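/- **Setting.** Let $L^2_c=L^2(\mathbb T,\mathbb C)^2$ with $\mathbb T=\mathbb R/\mathbb Z$. For $\varphi=(\varphi_1,\varphi_2)\in L^2_c$ let $$L(\varphi)=i\begin{pmatrix}1&0\\0&-1\end{pmatrix}\partial_x+\begin{pmatrix}0&\varphi_1\\ \varphi_2&0\end{pmatrix}.$$ Let $M(x,\lambda,\varphi)$ be the solution of $L(\varphi)M=\lambda M$, $M(0)=\mathrm{Id}$, and let $\Delta(\lambda,\varphi)=\operatorname{tr}M(1,\lambda,\varphi)$. Periodic eigenvalues and their algebraic multiplicities are those of $L(\varphi)$ on $[0,2]$ with periodic boundary conditions. $L^2_\bullet$ is the set of $\varphi\in L^2_c$ all of whose periodic eigenvalues have algebraic multiplicity at most $2$; $\varphi$ is a finite gap potential if only finitely many periodic eigenvalues are simple. Put $\pi_k=k\pi$ for $k\ne0$ and $\pi_0=1$. Products over infinite subsets of $\mathbb Z$ are limits, as $N\to\infty$, of the products over the indices with $|k|\le N$. Write $a\preccurlyeq b$ for the lexicographic order on $\mathbb C$ (real part first, then imaginary part). *Listings.* A listing of the periodic eigenvalues of $\varphi\in L^2_\bullet$ consists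 of an integer $N_0\ge1$ and numbers $\lambda_k^-\preccurlyeq\lambda_k^+$, $k\in\mathbb Z$, in which each periodic eigenvalue occurs exactly as often as its algebraic multiplicity and nothing else occurs, such that $|\lambda_k^\pm-k\pi|<\pi/4$ for $|k|>N_0$, $|\lambda_k^\pm|<(N_0+\frac14)\pi$ for $|k|\le N_0$, and for $k=-N_0,\dots,N_0$ successively: $\lambda_k^-$ is the smallest of the eigenvalues in the disk $|\lambda|<(N_0+\frac14)\pi$ not listed at a smaller index; $\lambda_k^+=\lambda_k^-$ if $\lambda_k^-$ is double; otherwise $\lambda_k^+$ is the smallest simple eigenvalue among the remaining ones in that disk. Put $\tau_k=(\lambda_k^-+\lambda_k^+)/2$ and $J=\{k\in\mathbb Z:\lambda_k^-,\lambda_k^+\text{ are simple}\}$. *Curves.* An admissible choice of curves for a listing consists of simple closed $C^1$-smooth counterclockwise curves $\Gamma_k$ and arcs $G_k$, $k\in\mathbb Z$, such that the closures of the domains bounded by the $\Gamma_k$ are pairwise disjoint and $G_k$ is a simple $C^1$ arc from $\lambda_k^-$ to $\lambda_k^+$ inside $\Gamma_k$ (constant if $\lambda_k^-=\lambda_k^+$).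 For $|k|>N_0$, $\Gamma_k$ is the circle $|\lambda-k\pi|=\pi/4$ and $G_k$ is a line segment; for $|k|\le N_0$, $\Gamma_k$ lies in $|\lambda|\le(N_0+\frac14)\pi$. *Canonical sheet.* The standard root $\sqrt[s]{(\lambda-\lambda_k^+)(\lambda-\lambda_k^-)}$ is the holomorphic square root on $\mathbb C\setminus G_k$ which near infinity equals $-\lambda\sqrt{(1-\lambda_k^+/\lambda)(1-\lambda_k^- /\lambda)}$ (principal branch). For $\lambda\notin\bigcup_kG_k$ the canonical root is $$\sqrt[c]{\Delta(\lambda,\varphi)^2-4}:=2i\prod_{k\in\mathbb Z}\frac{\sqrt[s]{(\lambda-\lambda_k^+)(\lambda-\lambda_k^-)}}{\pi_k}.$$ Its graph over $\mathbb C\setminus\bigcup_kG_k$ is the canonical sheet $\mathcal C^c_\varphi$, and $A_m$ is the lift of $\Gamma_m$ to $\mathcal C^c_\varphi$. On $A_m$, $\sqrt{\Delta^2-4}$ is the canonical root. **Theorem.** Let $\varphi\in L^2_\bullet$ be a finite gap potential. Then its periodic eigenvalues have a listing. For every listing and every admissible choice of curves: the product defining the canonical root converges at every $\lambda\notin\bigcup_kG_k$,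 the canonical sheet lies on the curve $\mathcal C_\varphi=\{(\lambda,w)\in\mathbb C^2: w^2=\Delta(\lambda,\varphi)^2-4\}$ and contains the cycles $A_m$, the set $J$ is finite, and for every $n\in\mathbb Z$ there is an entire function $\zeta_n$ such that for all $m\in\mathbb Z$ $$\frac1{2\pi}\oint_{A_m}\frac{\zeta_n(\lambda)}{\sqrt{\Delta(\lambda,\varphi)^2-4}}\,d\lambda=\delta_{mn},$$ and such that for all $\lambda\in\mathbb C$, with a convergent product, $$\zeta_n(\lambda)=-\frac2{\pi_n}\Big(\prod_{j\in J,\,j\ne n}\pi_j\Big)^{-1}P_n(\lambda)\prod_{j\notin J,\,j\ne n}\frac{\tau_j-\lambda}{\pi_j},$$ where $P_n(\lambda)=(-\lambda)^d+\dots$ is a polynomial of degree $d$, with $d=|J|$ if $n\notin J$ and $d=|J|-1$ if $n\in J$. -/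

import Mathlib

open MeasureTheory Filter Topology Set SummationFilter

noncomputable section

namespace ZS

/-! ### Potentials and the Zakharov-Shabat operator -/

/-- The space `L²_c = L²(𝕋, ℂ) × L²(𝕋, ℂ)` of potentials, `𝕋 = ℝ/ℤ`. -/
abbrev Potential : Type :=
  Lp ℂ 2 (volume : Measure UnitAddCircle) × Lp ℂ 2 (volume : Measure UnitAddCircle)

/-- `f ∈ H¹_loc(ℝ, ℂ)` with weak derivative `g`: `g` is locally square integrable and `f` is a
primitive of `g`. -/
def HasH1Deriv (f g : ℝ → ℂ) : Prop :=
  (∀ a b : ℝ, MemLp g 2 (volume.restrict (Icc a b))) ∧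
    ∀ x : ℝ, f x = f 0 + ∫ t in (0 : ℝ)..x, g t

/-- `F ∈ H¹_loc × H¹_loc` and `L(φ) F = K` almost everywhere, where
`L(φ) = i diag(1, -1) ∂ₓ + [[0, φ₁], [φ₂, 0]]`. -/
def IsZSImage (φ : Potential) (F K : ℝ → Fin 2 → ℂ) : Prop :=
  ∃ F' : ℝ → Fin 2 → ℂ,
    (∀ j, HasH1Deriv (fun x => F x j) (fun x => F' x j)) ∧
    ∀ᵐ x : ℝ,
      Complex.I * F' x 0 + φ.1 (x : UnitAddCircle) * F x 1 = K x 0 ∧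
      -Complex.I * F' x 1 + φ.2 (x : UnitAddCircle) * F x 0 = K x 1

/-- `M` is a fundamental matrix: each column `F` solves `L(φ) F = z F`, and `M(0) = Id`. -/
def IsFundamentalMatrix (φ : Potential) (z : ℂ) (M : ℝ → Matrix (Fin 2) (Fin 2) ℂ) : Prop :=
  M 0 = 1 ∧ ∀ j, IsZSImage φ (fun x i => M x i j) (fun x i => z * M x i j)

/-- The fundamental matrix `M(x, z, φ)` (it exists and is unique). -/
def fundamentalMatrix (φ : Potential) (z : ℂ) : ℝ → Matrix (Fin 2) (Fin 2) ℂ :=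
  Classical.epsilon (IsFundamentalMatrix φ z)

/-- The discriminant `Δ(z, φ) = tr M(1, z, φ)`. -/
def discriminant (φ : Potential) (z : ℂ) : ℂ := (fundamentalMatrix φ z 1).trace

/-! ### Periodic spectrum -/

/-- `F` is a root vector of order at most `n` for `z`: `F` lies in the kernel of `(L(φ) - z)ⁿ`,
where `L(φ)` is considered on `[0, 2]` with periodic boundary conditions, i.e. on `2`-periodic
functions in `H¹_loc × H¹_loc`. -/
def IsRootVector (φ : Potential) (z : ℂ) : ℕ → (ℝ → Fin 2 → ℂ) → Prop
  | 0, F => F = 0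
  | n + 1, F => Function.Periodic F 2 ∧
      ∃ K, IsRootVector φ z n K ∧ IsZSImage φ F (fun x => z • F x + K x)

/-- The root space (generalized eigenspace) of `z`. The root vectors already form a subspace, so
that taking the span adds nothing. -/
def rootSpace (φ : Potential) (z : ℂ) : Submodule ℂ (ℝ → Fin 2 → ℂ) :=
  Submodule.span ℂ {F | ∃ n, IsRootVector φ z n F}

/-- The algebraic multiplicity of `z` as a periodic eigenvalue of `L(φ)`
(zero if `z` is not a periodic eigenvalue). -/
def algMult (φ : Potential) (z : ℂ) : ℕ∞ :=
  Cardinal.toENat (Module.rank ℂ (rootSpace φ z))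

/-- `φ ∈ L²_•`: all periodic eigenvalues have algebraic multiplicity at most two. -/
def MultAtMostTwo (φ : Potential) : Prop := ∀ z : ℂ, algMult φ z ≤ 2

/-- `φ` is a finite gap potential: only finitely many periodic eigenvalues are simple. -/
def IsFiniteGap (φ : Potential) : Prop := {z : ℂ | algMult φ z = 1}.Finite

/-- The lexicographic order `a ≼ b` on `ℂ`. -/
def LexLE (a b : ℂ) : Prop := a.re < b.re ∨ (a.re = b.re ∧ a.im ≤ b.im)

/-- The normalizing constants: `π_k = kπ` for `k ≠ 0` and `π_0 = 1`. -/
def piK (k : ℤ) : ℂ := if k = 0 then 1 else (k : ℂ) * (Real.pi : ℂ)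

/-- An integer `N₀ ≥ 1` and the corresponding listing `(λ_k^-, λ_k^+)`, `k ∈ ℤ`, of the periodic
eigenvalues of `L(φ)`. -/
structure Listing (φ : Potential) where
  N₀ : ℕ
  one_le : 1 ≤ N₀
  /-- `λ_k^-` -/
  lm : ℤ → ℂ
  /-- `λ_k^+` -/
  lp : ℤ → ℂ
  /-- Each periodic eigenvalue is listed as often as its algebraic multiplicity says, and nothing
  else is listed. -/
  mult : ∀ z : ℂ, {k | lm k = z}.encard + {k | lp k = z}.encard = algMult φ z
  /-- For `|k| > N₀` the disk of radius `π/4` around `kπ` contains the pair with index `k`. -/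
  outer : ∀ k : ℤ, (N₀ : ℤ) < |k| →
    ‖lm k - k * (Real.pi : ℂ)‖ < Real.pi / 4 ∧ ‖lp k - k * (Real.pi : ℂ)‖ < Real.pi / 4
  /-- The other `4 N₀ + 2` eigenvalues lie in the disk of radius `(N₀ + 1/4)π` around `0`. -/
  inner : ∀ k : ℤ, |k| ≤ (N₀ : ℤ) →
    ‖lm k‖ < (N₀ + 1 / 4) * Real.pi ∧ ‖lp k‖ < (N₀ + 1 / 4) * Real.pi
  /-- Pairs are lexicographically ordered. -/
  pair_le : ∀ k : ℤ, LexLE (lm k) (lp k)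
  /-- For `|k| ≤ N₀`, `λ_k^-` is the smallest of the eigenvalues in the large disk that have not
  been listed at a smaller index. -/
  minus_least : ∀ k j : ℤ, -(N₀ : ℤ) ≤ k → k ≤ j → j ≤ N₀ →
    LexLE (lm k) (lm j) ∧ LexLE (lm k) (lp j)
  /-- For `|k| ≤ N₀`, if `λ_k^-` is double, then `λ_k^+ = λ_k^-`. -/
  double : ∀ k : ℤ, |k| ≤ (N₀ : ℤ) → algMult φ (lm k) = 2 → lp k = lm k
  /-- For `|k| ≤ N₀`, if `λ_k^-` is simple, then `λ_k^+` is simple ... -/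
  simple : ∀ k : ℤ, |k| ≤ (N₀ : ℤ) → algMult φ (lm k) = 1 → algMult φ (lp k) = 1
  /-- ... and it is the smallest of the remaining simple eigenvalues in the large disk. -/
  plus_least : ∀ k j : ℤ, -(N₀ : ℤ) ≤ k → k < j → j ≤ N₀ → algMult φ (lm k) = 1 →
    (algMult φ (lm j) = 1 → LexLE (lp k) (lm j)) ∧ (algMult φ (lp j) = 1 → LexLE (lp k) (lp j))

namespace Listing

variable {φ : Potential} (E : Listing φ)

/-- `τ_k = (λ_k^- + λ_k^+) / 2` -/
def tau (k : ℤ) : ℂ := (E.lm k + E.lp k) / 2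

/-- `J(φ)`: the indices `k` for which `λ_k^-` and `λ_k^+` are simple. -/
def J : Set ℤ := {k | algMult φ (E.lm k) = 1 ∧ algMult φ (E.lp k) = 1}

end Listing

/-! ### The curves `Γ_k` and `G_k` -/

/-- A simple closed `C¹`-smooth curve, parametrized with period `1`. -/
structure IsSimpleClosedC1 (γ : ℝ → ℂ) : Prop where
  contDiff : ContDiff ℝ 1 γ
  periodic : Function.Periodic γ 1
  injOn : InjOn γ (Ico 0 1)
  deriv_ne : ∀ t, deriv γ t ≠ 0

/-- The domain bounded by a closed curve: the points off the curve whose connected component in the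
complement of the curve is bounded. -/
def inside (γ : ℝ → ℂ) : Set ℂ :=
  {z | z ∉ range γ ∧ Bornology.IsBounded (connectedComponentIn (range γ)ᶜ z)}

/-- The closure of the domain bounded by a simple closed curve, i.e. the domain together with the
curve (the boundary of the domain, by Jordan's theorem). -/
def closedInside (γ : ℝ → ℂ) : Set ℂ := inside γ ∪ range γ

/-- Counterclockwise orientation: the curve winds once around each point of its domain. -/
def IsCounterclockwise (γ : ℝ → ℂ) : Prop :=
  ∀ z ∈ inside γ,
    (2 * Real.pi * Complex.I)⁻¹ * ∫ t in (0 : ℝ)..1, deriv γ t / (γ t - z) = 1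

/-- A choice of the curves `Γ_k` and `G_k` for a listing of the periodic eigenvalues. -/
structure CurveSystem {φ : Potential} (E : Listing φ) where
  /-- the closed curves `Γ_k` -/
  Γ : ℤ → ℝ → ℂ
  /-- the arcs `G_k`, parametrized over `[0, 1]` -/
  G : ℤ → ℝ → ℂ
  closed_curve : ∀ k, IsSimpleClosedC1 (Γ k)
  counterclockwise : ∀ k, IsCounterclockwise (Γ k)
  disjoint : ∀ j k, j ≠ k → Disjoint (closedInside (Γ j)) (closedInside (Γ k))
  /-- `G_k` connects `λ_k^-` with `λ_k^+` inside `Γ_k`. In particular, the domain bounded by `Γ_k`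
  contains `λ_k^-` and `λ_k^+`, and by disjointness no other periodic eigenvalue. -/
  arc_zero : ∀ k, G k 0 = E.lm k
  arc_one : ∀ k, G k 1 = E.lp k
  arc_inside : ∀ k, ∀ t ∈ Icc (0 : ℝ) 1, G k t ∈ inside (Γ k)
  arc_contDiff : ∀ k, ContDiffOn ℝ 1 (G k) (Icc 0 1)
  arc_simple : ∀ k, E.lm k ≠ E.lp k → InjOn (G k) (Icc 0 1)
  arc_const : ∀ k, E.lm k = E.lp k → ∀ t ∈ Icc (0 : ℝ) 1, G k t = E.lm k
  /-- For `|k| > N₀`, `Γ_k` is the circle of radius `π/4` around `kπ` ... -/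
  outer_curve : ∀ k : ℤ, (E.N₀ : ℤ) < |k| → ∀ t : ℝ,
    Γ k t = circleMap (k * (Real.pi : ℂ)) (Real.pi / 4) (2 * Real.pi * t)
  /-- ... and `G_k` is the line segment from `λ_k^-` to `λ_k^+`. -/
  outer_arc : ∀ k : ℤ, (E.N₀ : ℤ) < |k| → ∀ t ∈ Icc (0 : ℝ) 1,
    G k t = (1 - t) * E.lm k + t * E.lp k
  /-- For `|k| ≤ N₀`, `Γ_k` is contained in the disk of radius `(N₀ + 1/4)π`. -/
  inner_curve : ∀ k : ℤ, |k| ≤ (E.N₀ : ℤ) → ∀ t, ‖Γ k t‖ ≤ (E.N₀ + 1 / 4) * Real.pi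

/-! ### Standard and canonical roots, the spectral curve and its cycles -/

/-- `f` is the standard root of `(z - a)(z - b)` on the complement of the arc `S` from `a` to `b`:
the holomorphic branch of the square root given near infinity by `-z √((1 - a/z)(1 - b/z))`, with
the principal branch of `√`. -/
def IsStandardRoot (a b : ℂ) (S : Set ℂ) (f : ℂ → ℂ) : Prop :=
  DifferentiableOn ℂ f Sᶜ ∧
  (∀ z ∉ S, f z ^ 2 = (z - a) * (z - b)) ∧
  ∀ᶠ z in Bornology.cobounded ℂ, f z = -z * ((1 - a / z) * (1 - b / z)) ^ (1 / 2 : ℂ)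

/-- The standard root of `(z - a)(z - b)` (it exists, and is unique off `S`, if `S` is a
`C¹`-arc from `a` to `b`, or `S = {a}` and `a = b`). -/
def standardRoot (a b : ℂ) (S : Set ℂ) : ℂ → ℂ := Classical.epsilon (IsStandardRoot a b S)

/-- The spectral curve `w² = Δ(z, φ)² - 4`. -/
def spectralCurve (φ : Potential) : Set (ℂ × ℂ) :=
  {p | p.2 ^ 2 = discriminant φ p.1 ^ 2 - 4}

namespace CurveSystem

variable {φ : Potential} {E : Listing φ} (C : CurveSystem E)

/-- The arc `G_k` as a set. -/
def arc (k : ℤ) : Set ℂ := C.G k '' Icc 0 1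

/-- The factors of the canonical root. -/
def rootFactor (z : ℂ) (k : ℤ) : ℂ := standardRoot (E.lm k) (E.lp k) (C.arc k) z / piK k

/-- The canonical root of `Δ(z, φ)² - 4`, for `z` off the arcs: `2i ∏_k (standard root)_k / π_k`,
where the product over `ℤ` is the limit of the products over `|k| ≤ N`. -/
def canonicalRoot (z : ℂ) : ℂ := 2 * Complex.I * ∏'[symmetricIcc ℤ] k, C.rootFactor z k

/-- The canonical sheet of the spectral curve. -/
def canonicalSheet : Set (ℂ × ℂ) := {p | p.1 ∉ ⋃ k, C.arc k ∧ p.2 = C.canonicalRoot p.1}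

/-- The cycle `A_m`: the lift of `Γ_m` to the canonical sheet. -/
def cycle (m : ℤ) (t : ℝ) : ℂ × ℂ := (C.Γ m t, C.canonicalRoot (C.Γ m t))

/-- The integral of `f(z) / w dz` over the cycle `A_m`, where `w = √(Δ(z, φ)² - 4)` is the second
coordinate function on the spectral curve. -/
def cycleIntegral (m : ℤ) (f : ℂ → ℂ) : ℂ :=
  ∫ t in (0 : ℝ)..1, f (C.cycle m t).1 / (C.cycle m t).2 * deriv (fun s => (C.cycle m s).1) t

end CurveSystem

end ZS

end

/-!
The proof turns the statement about infinitely many curves `Γ_m` into one about a hyperelliptic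
curve of finite genus. Let `D = J ∪ {n}`. All factors of the canonical root with index outside `D`
belong to double eigenvalues, their standard roots are `τ_k - λ`, and their product, divided by the
`π_k`, is entire: `H`. Hence `ζ_n = c P H` divided by the canonical root is `i P / ∏_{k ∈ D} y_k`,
where `y_k` are the standard roots. What is needed is a polynomial `P` of degree `|D| - 1` whose
quotient by `∏_{k ∈ D} y_k` has a prescribed period around the cut `G_n` and none around the other
cuts, together with three facts on the spectrum: multiplicities are orders of zeros of `Δ² - 4`, the
eigenvalues have a listing, and `H` exists.

*Existence of the polynomial* (`ZS.IsCutSystem.exists_normalized_polynomial`). The periods around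
all cuts except one form a linear map from the polynomials of degree less than `|D| - 1` to a space
of the same dimension. It suffices that this map is injective (`ZS.IsCutSystem.eventually_eq_zero`).
If all periods of `f = Q / ∏ y` vanish, then `f` has a single-valued primitive `g` that vanishes at
infinity. Integration of `∂(ḡ f)/∂z̄ = |f|²` over the complement of the cuts, as in Riemann's
bilinear relations, expresses `∫ |f|²` by boundary terms at the cuts. Near a cut, up to an additive
constant, `g` is the square root of a holomorphic function `u` (`ZS.exists_sq_eq_of_primitive`), and
the boundary term is nonpositive because `|u|` is subharmonic
(`ZS.re_integral_conj_mul_deriv_mul_dbar_nonpos`). So `f = 0`.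

The cuts are arbitrary arcs and the curves are arbitrary simple closed curves. To avoid their
geometry, contour integrals around a cut are replaced by area integrals of `f ∂χ/∂z̄` for a cutoff
function `χ` that is `1` near the cut, and holomorphic functions are split by the Cauchy transforms
of these densities. The only property of a curve that enters is its winding number
(`ZS.integral_comp_mul_deriv_eq_sum`). A logarithm of `(z - G 1) / (z - G 0)` off the arc `G`,
namely `ZS.arcLog`, provides the standard root as well as the primitives `g`.

*Multiplicities* (`ZS.algMult_eq_analyticOrderAt`). The algebraic multiplicity of an eigenvalue `z`
is the order of the zero of `Δ² - 4` at `z`. A chain of root vectors is the coefficient at `w⁻¹` of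
`M(x, z + w)` times a principal part `∑ c_i w⁻¹⁻ⁱ` that is killed, up to holomorphic terms, by `M(2,
z + w) - 1`. The dimension of the space of such principal parts is the order of `det (M(2, z + w) -
1) = 4 - Δ(z + w)²` at `w = 0` (`ZS.rank_ker_principalPart`), by the argument of the Smith normal
form.

*Listings* (`ZS.nonempty_listing`). By the Riemann-Lebesgue lemma and Gronwall's inequality, `Δ` is
close to `2 cos` (`ZS.exists_norm_discriminant_sub_le`), also for potentials that are only square
integrable. Rouché's theorem `ZS.IsZeros.card_eq` then compares the zeros of `Δ² - 4` with those of
`-4 sin²`.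

*The product* (`ZS.Listing.exists_product`). On large circles the quotient of `Δ² - 4` and `-4 sin²`
is close to `1`, and so is, inside of them, the quotient of their zero-free parts
(`ZS.Listing.exists_ratio`). With the product formula of the sine this shows that the squares of the
symmetric partial products converge. Their successive quotients tend to `1`, so that the partial
products themselves converge off the zeros (`ZS.exists_tendsto_of_sq`), and everywhere by Cauchy's
formula (`ZS.exists_tendsto_ball`). The limit `H` is entire, with `Δ² - 4 = -4 ∏_{k ∈ D} ((λ - λ_k⁻)
(λ - λ_k⁺) / π_k²) H²`.
-/

noncomputable section

namespace ZS

/-! ### The Wirtinger derivative and the Cauchy transform -/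

/-- The Wirtinger derivative `∂F/∂z̄ = (∂ₓ F + i ∂_y F) / 2`. -/
def dbar (F : ℂ → ℂ) (z : ℂ) : ℂ := (fderiv ℝ F z 1 + Complex.I * fderiv ℝ F z Complex.I) / 2

lemma dbar_congr {F G : ℂ → ℂ} {z : ℂ} (h : F =ᶠ[𝓝 z] G) : dbar F z = dbar G z := by
  simp only [dbar, h.fderiv_eq]

lemma dbar_of_differentiableAt {F : ℂ → ℂ} {z : ℂ} (h : DifferentiableAt ℂ F z) :
    dbar F z = 0 := by
  have := (differentiableAt_complex_iff_differentiableAt_real.1 h).2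
  rw [dbar, this, smul_eq_mul, ← mul_assoc, Complex.I_mul_I]; ring

lemma differentiableAt_of_dbar_eq_zero {F : ℂ → ℂ} {z : ℂ} (h : DifferentiableAt ℝ F z)
    (h0 : dbar F z = 0) : DifferentiableAt ℂ F z := by
  refine differentiableAt_complex_iff_differentiableAt_real.2 ⟨h, ?_⟩
  have h1 : fderiv ℝ F z 1 + Complex.I * fderiv ℝ F z Complex.I = 0 := by
    simpa [dbar] using h0
  rw [smul_eq_mul, eq_neg_of_add_eq_zero_left h1, mul_neg, ← mul_assoc, Complex.I_mul_I]; ring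

lemma dbar_add {F G : ℂ → ℂ} {z : ℂ} (hF : DifferentiableAt ℝ F z) (hG : DifferentiableAt ℝ G z) :
    dbar (fun w => F w + G w) z = dbar F z + dbar G z := by
  simp only [dbar, fderiv_fun_add hF hG, add_apply]; ring

lemma dbar_sub {F G : ℂ → ℂ} {z : ℂ} (hF : DifferentiableAt ℝ F z) (hG : DifferentiableAt ℝ G z) :
    dbar (fun w => F w - G w) z = dbar F z - dbar G z := by
  simp only [dbar, fderiv_fun_sub hF hG, sub_apply]; ring

lemma dbar_mul {F G : ℂ → ℂ} {z : ℂ} (hF : DifferentiableAt ℝ F z) (hG : DifferentiableAt ℝ G z) :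
    dbar (fun w => F w * G w) z = F z * dbar G z + dbar F z * G z := by
  simp only [dbar, fderiv_fun_mul hF hG, add_apply,
    smul_apply, smul_eq_mul]; ring

lemma dbar_sum {ι : Type*} (s : Finset ι) {F : ι → ℂ → ℂ} {z : ℂ}
    (hF : ∀ i ∈ s, DifferentiableAt ℝ (F i) z) :
    dbar (fun w => ∑ i ∈ s, F i w) z = ∑ i ∈ s, dbar (F i) z := by
  simp only [dbar, fderiv_fun_sum hF, sum_apply, Finset.mul_sum,
    ← Finset.sum_add_distrib, Finset.sum_div]

lemma dbar_conj {F : ℂ → ℂ} {z : ℂ} (hF : DifferentiableAt ℂ F z) :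
    dbar (fun w => (starRingEnd ℂ) (F w)) z = (starRingEnd ℂ) (deriv F z) := by
  have h : HasFDerivAt (𝕜 := ℝ) (fun w => (starRingEnd ℂ) (F w))
      ((Complex.conjCLE : ℂ →L[ℝ] ℂ).comp ((fderiv ℂ F z).restrictScalars ℝ)) z :=
    (Complex.conjCLE : ℂ →L[ℝ] ℂ).hasFDerivAt.comp z (hF.hasFDerivAt.restrictScalars ℝ)
  have h2 : fderiv ℂ F z Complex.I = Complex.I * deriv F z := by
    rw [← fderiv_apply_one_eq_deriv, ← smul_eq_mul, ← map_smul]; simp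
  rw [dbar, h.fderiv]
  simp only [ContinuousLinearMap.comp_apply, ContinuousLinearMap.coe_restrictScalars']
  rw [h2, fderiv_apply_one_eq_deriv]
  simp only [ContinuousLinearEquiv.coe_coe, Complex.conjCLE_apply, map_mul, Complex.conj_I]
  linear_combination (-(starRingEnd ℂ) (deriv F z)/2) * Complex.I_mul_I

lemma continuous_dbar {F : ℂ → ℂ} (hF : ContDiff ℝ 1 F) : Continuous (dbar F) := by
  have h := hF.continuous_fderiv one_ne_zero
  exact ((h.clm_apply continuous_const).add
    (continuous_const.mul (h.clm_apply continuous_const))).div_const _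

lemma support_dbar_subset (F : ℂ → ℂ) : Function.support (dbar F) ⊆ tsupport F := by
  intro z hz
  by_contra h
  apply hz
  have : fderiv ℝ F z = 0 := by
    by_contra h2
    exact h (support_fderiv_subset ℝ h2)
  simp [dbar, this]

lemma tsupport_dbar_subset (F : ℂ → ℂ) : tsupport (dbar F) ⊆ tsupport F :=
  closure_minimal (support_dbar_subset F) (isClosed_tsupport F)

lemma hasCompactSupport_dbar {F : ℂ → ℂ} (hF : HasCompactSupport F) :
    HasCompactSupport (dbar F) :=
  hF.of_isClosed_subset (isClosed_tsupport _) (tsupport_dbar_subset F)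

lemma contDiff_dbar {F : ℂ → ℂ} {n : ℕ∞} (hF : ContDiff ℝ (n + 1) F) : ContDiff ℝ n (dbar F) := by
  have h := hF.fderiv_right (m := n) le_rfl
  exact ((h.clm_apply contDiff_const).add
    (contDiff_const.mul (h.clm_apply contDiff_const))).div_const _

/-- Gauss' theorem for the Wirtinger derivative of an integrable function. -/
lemma integral_dbar_eq_zero {F : ℂ → ℂ} (hF : Differentiable ℝ F) (hi : Integrable F)
    (h1 : ∀ v, Integrable (fun z => fderiv ℝ F z v)) : ∫ z, dbar F z = 0 := by
  have key : ∀ v : ℂ, ∫ z, fderiv ℝ F z v = 0 := by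
    intro v
    have := integral_mul_fderiv_eq_neg_fderiv_mul_of_integrable (μ := (volume : Measure ℂ))
      (f := F) (g := fun _ => (1 : ℂ)) (v := v) (by simpa using h1 v) (by simp) (by simpa using hi)
      (fun z _ => hF z) (fun z _ => differentiableAt_const _)
    simpa using this.symm
  simp only [dbar]
  rw [integral_div, integral_add (h1 _) ((h1 _).const_mul _), integral_const_mul, key, key]
  simp

lemma integral_dbar_eq_zero_of_compact {F : ℂ → ℂ} (hF : ContDiff ℝ 1 F)
    (hc : HasCompactSupport F) : ∫ z, dbar F z = 0 := by
  refine integral_dbar_eq_zero (hF.differentiable one_ne_zero)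
    (hF.continuous.integrable_of_hasCompactSupport hc) fun v => ?_
  exact ((hF.continuous_fderiv one_ne_zero).clm_apply
    continuous_const).integrable_of_hasCompactSupport (hc.fderiv_apply ℝ v)

/-- The kernel `1 / (π ζ)`, a fundamental solution of `∂/∂z̄`. -/
def cauchyKernel (ζ : ℂ) : ℂ := ((Real.pi : ℂ) * ζ)⁻¹

lemma locallyIntegrable_cauchyKernel : LocallyIntegrable cauchyKernel := by
  refine locallyIntegrable_of_norm_le_rpow (C := Real.pi⁻¹) (α := 1) (by simp)
    (by simp) (Eventually.of_forall fun z => ?_) ?_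
  · simp [cauchyKernel, abs_of_pos Real.pi_pos, Real.rpow_neg_one, mul_comm]
  · exact (by unfold cauchyKernel; fun_prop : Measurable cauchyKernel).aestronglyMeasurable

/-- The Cauchy transform `(1/π) ∫ h(ζ) / (z - ζ) dA(ζ)`, written as a convolution. -/
def cauchyTransform (h : ℂ → ℂ) : ℂ → ℂ :=
  MeasureTheory.convolution cauchyKernel h (ContinuousLinearMap.mul ℝ ℂ) volume

lemma cauchyTransform_apply (h : ℂ → ℂ) (z : ℂ) :
    cauchyTransform h z = ∫ ζ, cauchyKernel ζ * h (z - ζ) := rfl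

lemma cauchyTransform_apply' (h : ℂ → ℂ) (z : ℂ) :
    cauchyTransform h z = ∫ ζ, cauchyKernel (z - ζ) * h ζ := by
  rw [cauchyTransform_apply, ← integral_sub_left_eq_self _ volume z]
  simp

/-- Pompeiu's formula at the origin, by integration in polar coordinates. -/
lemma integral_cauchyKernel_mul_dbar {H : ℂ → ℂ} (hH : ContDiff ℝ 1 H)
    (hc : HasCompactSupport H) : ∫ ζ, cauchyKernel ζ * dbar H ζ = - H 0 := by
  obtain ⟨R, hR0, hR⟩ : ∃ R : ℝ, 0 < R ∧ ∀ z, R ≤ ‖z‖ → z ∉ tsupport H := by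
    obtain ⟨R, hR, h⟩ := hc.isCompact.isBounded.exists_pos_norm_lt
    exact ⟨R, hR, fun z hz hz' => absurd (h z hz') (not_lt.2 hz)⟩
  have hfd0 : ∀ z, R ≤ ‖z‖ → fderiv ℝ H z = 0 := fun z hz => by
    by_contra h2
    exact hR z hz (support_fderiv_subset ℝ h2)
  let e : ℝ → ℂ := fun θ => Complex.exp (θ * Complex.I)
  have he : Continuous e := by fun_prop
  have hen : ∀ θ, ‖e θ‖ = 1 := fun θ => Complex.norm_exp_ofReal_mul_I θ
  -- `A` is the radial derivative, and `B` is the angular derivative divided by the radius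
  let A : ℝ × ℝ → ℂ := fun p => fderiv ℝ H (p.1 * e p.2) (e p.2)
  let B : ℝ × ℝ → ℂ := fun p => fderiv ℝ H (p.1 * e p.2) (Complex.I * e p.2)
  have hcf := hH.continuous_fderiv one_ne_zero
  have hA : Continuous A := (hcf.comp (by fun_prop)).clm_apply (by fun_prop)
  have hB : Continuous B := (hcf.comp (by fun_prop)).clm_apply (by fun_prop)
  have hint : ∀ G : ℝ × ℝ → ℂ, Continuous G → (∀ p : ℝ × ℝ, R ≤ |p.1| → G p = 0) →
      IntegrableOn G (Ioi 0 ×ˢ Ioo (-Real.pi) Real.pi) := by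
    intro G hG h0
    have h1 : IntegrableOn G (Icc 0 R ×ˢ Icc (-Real.pi) Real.pi) :=
      hG.continuousOn.integrableOn_compact (isCompact_Icc.prod isCompact_Icc)
    have h2 : IntegrableOn G ((Ioi 0 ×ˢ Ioo (-Real.pi) Real.pi) ∩ {p | R ≤ p.1}) := by
      refine (integrableOn_zero (ε' := ℂ)).congr_fun (fun p hp => (h0 p ?_).symm) ?_
      · exact le_trans hp.2 (le_abs_self _)
      · exact (measurableSet_Ioi.prod measurableSet_Ioo).inter
          (measurableSet_le measurable_const measurable_fst)
    refine (h1.union h2).mono_set ?_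
    rintro ⟨r, θ⟩ ⟨hr, hθ⟩
    rcases le_total r R with h | h
    · exact Or.inl ⟨⟨le_of_lt hr, h⟩, ⟨hθ.1.le, hθ.2.le⟩⟩
    · exact Or.inr ⟨⟨hr, hθ⟩, h⟩
  have hnorm : ∀ p : ℝ × ℝ, ‖(p.1 : ℂ) * e p.2‖ = |p.1| := fun p => by simp [hen]
  have hAi := hint A hA fun p hp => by simp only [A, hfd0 _ (by rw [hnorm]; exact hp)]; rfl
  have hBi := hint B hB fun p hp => by simp only [B, hfd0 _ (by rw [hnorm]; exact hp)]; rfl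
  have hdK : ∀ r θ : ℝ, HasDerivAt (fun s : ℝ => H (s * e θ)) (A (r, θ)) r := by
    intro r θ
    have h1 : HasDerivAt (fun s : ℝ => (s : ℂ) * e θ) (1 * e θ) r :=
      (Complex.ofRealCLM.hasDerivAt (x := r)).mul_const _
    rw [one_mul] at h1
    exact ((hH.differentiable one_ne_zero _).hasFDerivAt).comp_hasDerivAt r h1
  have hdT : ∀ r θ : ℝ, HasDerivAt (fun s : ℝ => H (r * e s)) (r * B (r, θ)) θ := by
    intro r θ
    have h1 : HasDerivAt (fun s : ℝ => (r : ℂ) * e s) (r • (Complex.I * e θ)) θ := by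
      have h2 : HasDerivAt (fun s : ℝ => (s : ℂ) * Complex.I) (1 * Complex.I) θ :=
        (Complex.ofRealCLM.hasDerivAt (x := θ)).mul_const _
      rw [show r • (Complex.I * e θ) = (r : ℂ) * (e θ * (1 * Complex.I)) by
        rw [Complex.real_smul]; ring]
      exact (h2.cexp).const_mul (r : ℂ)
    have := ((hH.differentiable one_ne_zero _).hasFDerivAt).comp_hasDerivAt θ h1
    rw [map_smul] at this
    exact this
  have hIA : ∫ p in Ioi 0 ×ˢ Ioo (-Real.pi) Real.pi, A p = -(2 * Real.pi) * H 0 := by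
    rw [Measure.volume_eq_prod, ← setIntegral_prod_swap, setIntegral_prod _ (show IntegrableOn (fun z => A z.swap) _ _ from
      IntegrableOn.swap hAi)]
    have h1 : ∀ θ : ℝ, ∫ r in Ioi (0 : ℝ), A (r, θ) = - H 0 := by
      intro θ
      have hz : ∀ r : ℝ, R ≤ |r| → A (r, θ) = 0 := fun r hr => by
        simp only [A, hfd0 _ (by rw [hnorm (r, θ)]; exact hr)]; rfl
      have hcs : HasCompactSupport (fun r : ℝ => A (r, θ)) :=
        HasCompactSupport.intro (isCompact_Icc (a := -R) (b := R)) fun r hr => hz r (by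
          by_contra hlt
          exact hr (abs_le.1 (not_le.1 hlt).le))
      rw [integral_Ioi_of_hasDerivAt_of_tendsto' (m := 0) (fun r _ => hdK r θ)
        ((hA.comp (by fun_prop : Continuous fun r : ℝ => (r, θ))).integrable_of_hasCompactSupport
          hcs).integrableOn]
      · simp
      · refine tendsto_const_nhds.congr' ?_
        filter_upwards [eventually_ge_atTop R] with r hr
        refine (image_eq_zero_of_notMem_tsupport (hR _ ?_)).symm
        rw [hnorm (r, θ)]; exact hr.trans (le_abs_self r)
    simp only [Prod.swap_prod_mk, h1]
    rw [setIntegral_const, Real.volume_real_Ioo_of_le (by linarith [Real.pi_pos]),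
      Complex.real_smul]
    push_cast; ring
  have hIB : ∫ p in Ioi 0 ×ˢ Ioo (-Real.pi) Real.pi, B p = 0 := by
    rw [Measure.volume_eq_prod, setIntegral_prod _ hBi]
    refine integral_eq_zero_of_ae ((ae_restrict_iff' measurableSet_Ioi).2
      (Eventually.of_forall fun r hr => ?_))
    have h3 : (r : ℂ) ≠ 0 := by exact_mod_cast (ne_of_gt hr)
    have h1 : ∫ θ in (-Real.pi)..Real.pi, (r : ℂ) * B (r, θ) = 0 := by
      rw [intervalIntegral.integral_eq_sub_of_hasDerivAt (fun θ _ => hdT r θ)]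
      · have : e Real.pi = e (-Real.pi) := by simp [e, Complex.exp_neg, Complex.exp_pi_mul_I]
        rw [this, sub_self]
      · exact (continuous_const.mul (hB.comp (by fun_prop))).intervalIntegrable _ _
    rw [intervalIntegral.integral_const_mul, intervalIntegral.integral_of_le
      (by linarith [Real.pi_pos]), integral_Ioc_eq_integral_Ioo] at h1
    exact (mul_eq_zero.1 h1).resolve_left h3
  rw [← Complex.integral_comp_polarCoord_symm]
  rw [show polarCoord.target = Ioi (0 : ℝ) ×ˢ Ioo (-Real.pi) Real.pi from rfl]
  have hpt : ∀ p ∈ Ioi (0 : ℝ) ×ˢ Ioo (-Real.pi) Real.pi,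
      p.1 • (cauchyKernel (Complex.polarCoord.symm p) * dbar H (Complex.polarCoord.symm p)) =
        (2 * Real.pi : ℂ)⁻¹ * (A p + Complex.I * B p) := by
    rintro ⟨r, θ⟩ ⟨hr, -⟩
    have h3 : (r : ℂ) ≠ 0 := by exact_mod_cast (ne_of_gt hr)
    have h4 : Complex.polarCoord.symm (r, θ) = r * e θ := by
      simp [e, Complex.exp_mul_I]
    have hlin : ∀ w : ℂ, fderiv ℝ H (r * e θ) w =
        w.re * fderiv ℝ H (r * e θ) 1 + w.im * fderiv ℝ H (r * e θ) Complex.I := by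
      intro w
      conv_lhs => rw [show w = w.re • (1 : ℂ) + w.im • Complex.I by
        simp [Complex.re_add_im]]
      rw [map_add, map_smul, map_smul]; simp
    have hene : e θ ≠ 0 := Complex.exp_ne_zero _
    rw [h4]
    simp only [A, B, dbar, cauchyKernel]
    rw [hlin (e θ), hlin (Complex.I * e θ)]
    have hre : (e θ).re = Real.cos θ := Complex.exp_ofReal_mul_I_re θ
    have him : (e θ).im = Real.sin θ := Complex.exp_ofReal_mul_I_im θ
    have hinv : (e θ)⁻¹ = Real.cos θ - Real.sin θ * Complex.I := by
      simp only [e]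
      rw [← Complex.exp_neg, ← neg_mul, Complex.exp_mul_I]; simp; ring
    have hpi : (Real.pi : ℂ) ≠ 0 := by exact_mod_cast Real.pi_ne_zero
    simp only [Complex.mul_re, Complex.mul_im, Complex.I_re, Complex.I_im, hre, him]
    rw [mul_inv, mul_inv, hinv, Complex.real_smul]
    field_simp
    push_cast
    linear_combination (-(Complex.sin θ) * fderiv ℝ H (r * e θ) Complex.I) * Complex.I_mul_I
  rw [setIntegral_congr_fun (measurableSet_Ioi.prod measurableSet_Ioo) hpt, integral_const_mul,
    integral_add hAi (hBi.const_mul _), integral_const_mul, hIA, hIB]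
  have hpi : (Real.pi : ℂ) ≠ 0 := by exact_mod_cast Real.pi_ne_zero
  field_simp
  ring

section CauchyTransform

variable {h : ℂ → ℂ}

lemma hasFDerivAt_cauchyTransform (hh : ContDiff ℝ 1 h) (hc : HasCompactSupport h) (z : ℂ) :
    HasFDerivAt (cauchyTransform h)
      (MeasureTheory.convolution cauchyKernel (fderiv ℝ h)
        ((ContinuousLinearMap.mul ℝ ℂ).precompR ℂ) volume z) z :=
  hc.hasFDerivAt_convolution_right _ locallyIntegrable_cauchyKernel hh z

lemma contDiff_cauchyTransform {n : ℕ∞} (hh : ContDiff ℝ n h) (hc : HasCompactSupport h) :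
    ContDiff ℝ n (cauchyTransform h) :=
  hc.contDiff_convolution_right _ locallyIntegrable_cauchyKernel hh

/-- The Cauchy transform inverts `∂/∂z̄`. -/
lemma dbar_cauchyTransform (hh : ContDiff ℝ 1 h) (hc : HasCompactSupport h) (z : ℂ) :
    dbar (cauchyTransform h) z = h z := by
  have hd := hasFDerivAt_cauchyTransform hh hc z
  have happ : ∀ v : ℂ, fderiv ℝ (cauchyTransform h) z v =
      ∫ ζ, cauchyKernel ζ * fderiv ℝ h (z - ζ) v := by
    intro v
    rw [hd.fderiv, convolution_precompR_apply _ locallyIntegrable_cauchyKernel (hc.fderiv ℝ)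
      (hh.continuous_fderiv one_ne_zero)]
    rfl
  have hint : ∀ v : ℂ, Integrable (fun ζ => cauchyKernel ζ * fderiv ℝ h (z - ζ) v) := fun v =>
    (hc.fderiv_apply ℝ v).convolutionExists_right (ContinuousLinearMap.mul ℝ ℂ)
      locallyIntegrable_cauchyKernel
      ((hh.continuous_fderiv one_ne_zero).clm_apply continuous_const) z
  have hH : ContDiff ℝ 1 (fun ζ => h (z - ζ)) := hh.comp (contDiff_const.sub contDiff_id)
  have hHc : HasCompactSupport (fun ζ => h (z - ζ)) :=
    hc.comp_homeomorph (Homeomorph.subLeft z)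
  have hfd : ∀ ζ v, fderiv ℝ (fun ζ => h (z - ζ)) ζ v = - fderiv ℝ h (z - ζ) v := by
    intro ζ v
    have h1 : HasFDerivAt (fun ζ : ℂ => z - ζ) (-ContinuousLinearMap.id ℝ ℂ) ζ :=
      (hasFDerivAt_id ζ).const_sub z
    have := ((hh.differentiable one_ne_zero (z - ζ)).hasFDerivAt.comp ζ h1).fderiv
    rw [show (fun ζ => h (z - ζ)) = h ∘ fun ζ => z - ζ from rfl, this]
    simp
  have hP := integral_cauchyKernel_mul_dbar hH hHc
  simp only [sub_zero] at hP
  rw [dbar, happ, happ, ← integral_const_mul, ← integral_add (hint 1) ((hint _).const_mul _),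
    ← integral_div, ← neg_neg (h z), ← hP, ← integral_neg]
  congr 1
  ext ζ
  simp only [dbar, hfd]
  ring

lemma differentiableOn_cauchyTransform (hh : ContDiff ℝ 1 h) (hc : HasCompactSupport h) :
    DifferentiableOn ℂ (cauchyTransform h) (tsupport h)ᶜ := fun z hz =>
  (differentiableAt_of_dbar_eq_zero (hasFDerivAt_cauchyTransform hh hc z).differentiableAt
    (by rw [dbar_cauchyTransform hh hc, image_eq_zero_of_notMem_tsupport hz])).differentiableWithinAt

/-- The leading term at infinity is the total mass. -/
lemma tendsto_mul_cauchyTransform (hh : Continuous h) (hc : HasCompactSupport h) :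
    Tendsto (fun z => z * cauchyTransform h z) (Bornology.cobounded ℂ)
      (𝓝 ((Real.pi : ℂ)⁻¹ * ∫ ζ, h ζ)) := by
  obtain ⟨R, hR0, hR⟩ := hc.isCompact.isBounded.exists_pos_norm_lt
  have h1 : ∀ z, z * cauchyTransform h z = ∫ ζ, z * (cauchyKernel (z - ζ) * h ζ) := fun z => by
    rw [cauchyTransform_apply', integral_const_mul]
  simp only [h1]
  rw [← integral_const_mul]
  have hbig : ∀ᶠ z : ℂ in Bornology.cobounded ℂ, 2 * R ≤ ‖z‖ :=
    (tendsto_norm_cobounded_atTop (E := ℂ)).eventually_ge_atTop _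
  have hne : ∀ z : ℂ, 2 * R ≤ ‖z‖ → ∀ ζ, h ζ ≠ 0 → ‖z‖ / 2 ≤ ‖z - ζ‖ := fun z hz ζ hζ => by
    have := hR ζ (subset_tsupport _ hζ)
    have := norm_sub_norm_le z ζ
    linarith
  have : (Bornology.cobounded ℂ).IsCountablyGenerated := by
    rw [← comap_norm_atTop]; infer_instance
  refine tendsto_integral_filter_of_dominated_convergence (fun ζ => 2 * Real.pi⁻¹ * ‖h ζ‖) ?_ ?_ ?_
    (Eventually.of_forall fun ζ => ?_)
  · filter_upwards with z
    refine (AEStronglyMeasurable.mul ?_ hh.aestronglyMeasurable).const_mul _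
    exact (by unfold cauchyKernel; fun_prop :
      Measurable fun ζ => cauchyKernel (z - ζ)).aestronglyMeasurable
  · filter_upwards [hbig] with z hz
    refine Eventually.of_forall fun ζ => ?_
    by_cases hζ : h ζ = 0
    · simp [hζ]
    have h2 := hne z hz ζ hζ
    have hz0 : 0 < ‖z‖ := by linarith
    have h3 : 0 < ‖z - ζ‖ := by linarith
    rw [norm_mul, norm_mul, cauchyKernel, norm_inv, norm_mul, Complex.norm_real, Real.norm_eq_abs,
      abs_of_pos Real.pi_pos, ← mul_assoc]
    refine mul_le_mul_of_nonneg_right ?_ (norm_nonneg _)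
    rw [mul_inv, mul_left_comm, mul_comm 2]
    refine mul_le_mul_of_nonneg_left ?_ (by positivity)
    rw [← div_eq_mul_inv, div_le_iff₀ h3]; linarith
  · exact (hh.integrable_of_hasCompactSupport hc).norm.const_mul _
  · have h2 : Tendsto (fun z : ℂ => (1 - ζ * z⁻¹)⁻¹) (Bornology.cobounded ℂ) (𝓝 1) := by
      have : Tendsto (fun z : ℂ => 1 - ζ * z⁻¹) (Bornology.cobounded ℂ) (𝓝 (1 - ζ * 0)) :=
        tendsto_const_nhds.sub (tendsto_const_nhds.mul tendsto_inv₀_cobounded)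
      rw [mul_zero, sub_zero] at this
      simpa using this.inv₀ one_ne_zero
    have h3 := (h2.const_mul (Real.pi : ℂ)⁻¹).mul_const (h ζ)
    rw [mul_one] at h3
    refine h3.congr' ?_
    filter_upwards [hbig] with z hz
    have hz0 : z ≠ 0 := norm_pos_iff.1 (by linarith)
    rw [cauchyKernel, show 1 - ζ * z⁻¹ = (z - ζ) * z⁻¹ by field_simp, mul_inv, mul_inv, inv_inv]
    ring

end CauchyTransform

end ZS

namespace ZS

/-! ### Cutoff functions and splitting of holomorphic functions -/

/-- `χ` is a smooth cutoff function: it equals `1` near `K`, takes values in `[0, 1]` and is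
compactly supported in `U`. It is complex valued for the sake of the Wirtinger calculus. -/
structure IsCutoff (χ : ℂ → ℂ) (K U : Set ℂ) : Prop where
  contDiff : ContDiff ℝ ((⊤ : ℕ∞) : WithTop ℕ∞) χ
  compact : HasCompactSupport χ
  tsupport_subset : tsupport χ ⊆ U
  eq_one : ∀ᶠ z in 𝓝ˢ K, χ z = 1
  mem_Icc : ∀ z, ∃ t ∈ Icc (0 : ℝ) 1, χ z = t

lemma exists_isCutoff {K U : Set ℂ} (hK : IsCompact K) (hU : IsOpen U) (hKU : K ⊆ U) :
    ∃ χ, IsCutoff χ K U := by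
  obtain ⟨V, hV, hKV, hVU⟩ := exists_compact_between hK hU hKU
  obtain ⟨f, hf1, hf0, hf⟩ := exists_contMDiffMap_one_nhds_of_subset_interior
    (n := (⊤ : ℕ∞)) (modelWithCornersSelf ℝ ℂ) hK.isClosed hKV
  have hts : tsupport f ⊆ V := closure_minimal (fun z hz => by
    by_contra h; exact hz (hf0 z h)) hV.isClosed
  have hsup : tsupport (fun z => ((f z : ℝ) : ℂ)) ⊆ V := closure_minimal (fun z hz => by
    by_contra h; exact hz (by simp [hf0 z h])) hV.isClosed
  refine ⟨fun z => ((f z : ℝ) : ℂ), ?_, ?_, hsup.trans hVU, ?_, fun z => ⟨f z, hf z, rfl⟩⟩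
  · exact Complex.ofRealCLM.contDiff.comp f.contMDiff.contDiff
  · exact hV.of_isClosed_subset (isClosed_tsupport _) hsup
  · filter_upwards [hf1] with z hz
    simp [hz]

namespace IsCutoff

variable {χ : ℂ → ℂ} {K U : Set ℂ}

lemma differentiable (h : IsCutoff χ K U) : Differentiable ℝ χ :=
  h.contDiff.differentiable (by simp)

lemma eventually_one (h : IsCutoff χ K U) {z : ℂ} (hz : z ∈ K) : ∀ᶠ w in 𝓝 z, χ w = 1 :=
  h.eq_one.filter_mono (nhds_le_nhdsSet hz)

lemma eventually_zero {z : ℂ} (hz : z ∉ tsupport χ) : ∀ᶠ w in 𝓝 z, χ w = 0 :=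
  notMem_tsupport_iff_eventuallyEq.1 hz

lemma dbar_eventually_zero_of_mem (h : IsCutoff χ K U) {z : ℂ} (hz : z ∈ K) :
    ∀ᶠ w in 𝓝 z, dbar χ w = 0 := by
  filter_upwards [(h.eventually_one hz).eventually_nhds] with w hw
  rw [dbar_congr (G := fun _ => 1) hw, dbar_of_differentiableAt (differentiableAt_const _)]

lemma dbar_eventually_zero_of_notMem {z : ℂ} (hz : z ∉ tsupport χ) :
    ∀ᶠ w in 𝓝 z, dbar χ w = 0 := by
  filter_upwards [(eventually_zero hz).eventually_nhds] with w hw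
  rw [dbar_congr (G := fun _ => 0) hw, dbar_of_differentiableAt (differentiableAt_const _)]

lemma contDiff_dbar (h : IsCutoff χ K U) : ContDiff ℝ ((⊤ : ℕ∞) : WithTop ℕ∞) (dbar χ) :=
  ZS.contDiff_dbar (n := ⊤) (by simpa using h.contDiff)

/-- A real differentiable function on `U \ K`, multiplied by `∂χ/∂z̄`, is smooth on the whole
plane. -/
lemma contDiff_mul_dbar (h : IsCutoff χ K U) {n : ℕ∞} {N : ℂ → ℂ}
    (hN : ∀ z ∈ U \ K, ContDiffAt ℝ n N z) : ContDiff ℝ n (fun z => N z * dbar χ z) := by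
  refine contDiff_iff_contDiffAt.2 fun z => ?_
  by_cases hz : z ∈ K
  · refine (contDiffAt_const (c := (0 : ℂ))).congr_of_eventuallyEq ?_
    filter_upwards [h.dbar_eventually_zero_of_mem hz] with w hw
    simp [hw]
  by_cases hz2 : z ∈ tsupport χ
  · exact (hN z ⟨h.tsupport_subset hz2, hz⟩).mul
      (h.contDiff_dbar.of_le (by exact_mod_cast le_top)).contDiffAt
  · refine (contDiffAt_const (c := (0 : ℂ))).congr_of_eventuallyEq ?_
    filter_upwards [dbar_eventually_zero_of_notMem hz2] with w hw
    simp [hw]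

lemma hasCompactSupport_mul_dbar (h : IsCutoff χ K U) (N : ℂ → ℂ) :
    HasCompactSupport (fun z => N z * dbar χ z) :=
  (hasCompactSupport_dbar h.compact).mul_left

lemma tsupport_mul_dbar_subset (h : IsCutoff χ K U) (N : ℂ → ℂ) :
    tsupport (fun z => N z * dbar χ z) ⊆ tsupport χ \ K := by
  intro z hz
  refine ⟨?_, fun hzK => ?_⟩
  · exact tsupport_dbar_subset χ (tsupport_mul_subset_right hz)
  · refine notMem_tsupport_iff_eventuallyEq.2 ?_ hz
    filter_upwards [h.dbar_eventually_zero_of_mem hzK] with w hw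
    simp [hw]

end IsCutoff

lemma contDiffAt_real_of_differentiableOn {N : ℂ → ℂ} {V : Set ℂ} (hV : IsOpen V)
    (hN : DifferentiableOn ℂ N V) {z : ℂ} (hz : z ∈ V) {n : WithTop ℕ∞} : ContDiffAt ℝ n N z :=
  ((hN.analyticAt (hV.mem_nhds hz)).contDiffAt (n := n)).restrict_scalars ℝ

/-- The part of `N` that is holomorphic on `U`, for `N` holomorphic on `U \ K`. -/
def innerPart (χ N : ℂ → ℂ) (z : ℂ) : ℂ :=
  (1 - χ z) * N z + cauchyTransform (fun w => N w * dbar χ w) z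

/-- The part of `N` that is holomorphic off `K`, for `N` holomorphic on `U \ K`. -/
def outerPart (χ N : ℂ → ℂ) (z : ℂ) : ℂ :=
  χ z * N z - cauchyTransform (fun w => N w * dbar χ w) z

lemma innerPart_add_outerPart (χ N : ℂ → ℂ) (z : ℂ) : innerPart χ N z + outerPart χ N z = N z := by
  simp only [innerPart, outerPart]; ring

lemma outerPart_of_notMem {χ : ℂ → ℂ} (N : ℂ → ℂ) {z : ℂ} (hz : z ∉ tsupport χ) :
    outerPart χ N z = - cauchyTransform (fun w => N w * dbar χ w) z := by
  simp [outerPart, image_eq_zero_of_notMem_tsupport hz]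

section Split

variable {χ N : ℂ → ℂ} {K U : Set ℂ}

/-- Near a point of `K` the inner part is the Cauchy transform, since `χ = 1` there; on `U \ K` the
contributions `-N ∂χ/∂z̄` and `N ∂χ/∂z̄` to its derivative cancel. -/
lemma differentiableOn_innerPart (hχ : IsCutoff χ K U) (hK : IsCompact K) (hU : IsOpen U)
    (hN : DifferentiableOn ℂ N (U \ K)) : DifferentiableOn ℂ (innerPart χ N) U := by
  have hUK : IsOpen (U \ K) := hU.sdiff hK.isClosed
  have hh : ContDiff ℝ 1 (fun w => N w * dbar χ w) := hχ.contDiff_mul_dbar (n := 1) fun z hz =>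
    contDiffAt_real_of_differentiableOn hUK hN hz
  have hc := hχ.hasCompactSupport_mul_dbar N
  intro z hz
  refine (differentiableAt_of_dbar_eq_zero ?_ ?_).differentiableWithinAt
  all_goals by_cases hzK : z ∈ K
  · refine DifferentiableAt.congr_of_eventuallyEq
      (hasFDerivAt_cauchyTransform hh hc z).differentiableAt ?_
    filter_upwards [hχ.eventually_one hzK] with w hw
    simp [innerPart, hw]
  · exact (((differentiableAt_const _).sub (hχ.differentiable z)).mul
      ((hN.differentiableAt (hUK.mem_nhds ⟨hz, hzK⟩)).restrictScalars ℝ)).add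
      (hasFDerivAt_cauchyTransform hh hc z).differentiableAt
  · rw [dbar_congr (G := cauchyTransform (fun w => N w * dbar χ w)), dbar_cauchyTransform hh hc,
      (hχ.dbar_eventually_zero_of_mem hzK).self_of_nhds, mul_zero]
    filter_upwards [hχ.eventually_one hzK] with w hw
    simp [innerPart, hw]
  · have hNz := hN.differentiableAt (hUK.mem_nhds ⟨hz, hzK⟩)
    have h1 : DifferentiableAt ℝ (fun w => 1 - χ w) z :=
      (differentiableAt_const _).sub (hχ.differentiable z)
    have h2 : dbar (fun w => 1 - χ w) z = - dbar χ z := by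
      rw [dbar_sub (differentiableAt_const _) (hχ.differentiable z),
        dbar_of_differentiableAt (differentiableAt_const _), zero_sub]
    change dbar (fun w => (1 - χ w) * N w + cauchyTransform (fun w => N w * dbar χ w) w) z = 0
    rw [dbar_add (F := fun w => (1 - χ w) * N w) (h1.mul (hNz.restrictScalars ℝ))
      (hasFDerivAt_cauchyTransform hh hc z).differentiableAt,
      dbar_mul h1 (hNz.restrictScalars ℝ), dbar_of_differentiableAt hNz, h2,
      dbar_cauchyTransform hh hc]
    ring

lemma differentiableOn_outerPart (hχ : IsCutoff χ K U) (hK : IsCompact K) (hU : IsOpen U)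
    (hN : DifferentiableOn ℂ N (U \ K)) : DifferentiableOn ℂ (outerPart χ N) Kᶜ := by
  have hUK : IsOpen (U \ K) := hU.sdiff hK.isClosed
  have hh : ContDiff ℝ 1 (fun w => N w * dbar χ w) := hχ.contDiff_mul_dbar (n := 1) fun z hz =>
    contDiffAt_real_of_differentiableOn hUK hN hz
  have hc := hχ.hasCompactSupport_mul_dbar N
  intro z hz
  by_cases hzU : z ∈ tsupport χ
  · have hzm : U \ K ∈ 𝓝 z := hUK.mem_nhds ⟨hχ.tsupport_subset hzU, hz⟩
    refine DifferentiableAt.differentiableWithinAt ?_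
    refine ((hN.differentiableAt hzm).sub ((differentiableOn_innerPart hχ hK hU hN).differentiableAt
      (hU.mem_nhds (hχ.tsupport_subset hzU)))).congr_of_eventuallyEq
      (Eventually.of_forall fun w => ?_)
    simp only [Pi.sub_apply, ← innerPart_add_outerPart χ N w]; ring
  · have h2 := hχ.tsupport_mul_dbar_subset N
    have h3 : DifferentiableAt ℂ (cauchyTransform (fun w => N w * dbar χ w)) z :=
      (differentiableOn_cauchyTransform hh hc).differentiableAt
        ((isClosed_tsupport _).isOpen_compl.mem_nhds fun h => hzU (h2 h).1)
    refine (h3.neg.congr_of_eventuallyEq ?_).differentiableWithinAt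
    filter_upwards [(isClosed_tsupport χ).isOpen_compl.mem_nhds hzU] with w hw
    exact outerPart_of_notMem N hw

lemma tendsto_mul_outerPart (hχ : IsCutoff χ K U) (hK : IsCompact K) (hU : IsOpen U)
    (hN : DifferentiableOn ℂ N (U \ K)) :
    Tendsto (fun z => z * outerPart χ N z) (Bornology.cobounded ℂ)
      (𝓝 (-((Real.pi : ℂ)⁻¹ * ∫ w, N w * dbar χ w))) := by
  have hUK : IsOpen (U \ K) := hU.sdiff hK.isClosed
  have hh : ContDiff ℝ 1 (fun w => N w * dbar χ w) := hχ.contDiff_mul_dbar (n := 1) fun z hz =>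
    contDiffAt_real_of_differentiableOn hUK hN hz
  refine ((tendsto_mul_cauchyTransform hh.continuous
    (hχ.hasCompactSupport_mul_dbar N)).neg).congr' ?_
  filter_upwards [Bornology.isBounded_def.1 hχ.compact.isCompact.isBounded] with z hz
  rw [outerPart_of_notMem N hz]; ring

end Split

lemma tendsto_zero_of_tendsto_mul {F : ℂ → ℂ} {c : ℂ}
    (h : Tendsto (fun z => z * F z) (Bornology.cobounded ℂ) (𝓝 c)) :
    Tendsto F (Bornology.cobounded ℂ) (𝓝 0) := by
  have h2 := h.mul (tendsto_inv₀_cobounded (α := ℂ))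
  rw [mul_zero] at h2
  refine h2.congr' ?_
  filter_upwards [(tendsto_norm_cobounded_atTop (E := ℂ)).eventually_gt_atTop 0] with w hw
  have hw0 : w ≠ 0 := norm_pos_iff.1 hw
  field_simp

/-- The curve integral of a Cauchy transform: Fubini reduces it to the winding numbers of the curve
around the points of the support of `h`. -/
lemma integral_cauchyTransform_curve {γ : ℝ → ℂ} (hγ : ContDiff ℝ 1 γ) {h : ℂ → ℂ}
    (hh : Continuous h) (hc : HasCompactSupport h) (hd : Disjoint (range γ) (tsupport h)) {c : ℂ}
    (hind : ∀ ζ ∈ tsupport h,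
      (2 * Real.pi * Complex.I)⁻¹ * ∫ t in (0 : ℝ)..1, deriv γ t / (γ t - ζ) = c) :
    ∫ t in (0 : ℝ)..1, cauchyTransform h (γ t) * deriv γ t = 2 * Complex.I * c * ∫ ζ, h ζ := by
  have hπ : (Real.pi : ℂ) ≠ 0 := by exact_mod_cast Real.pi_ne_zero
  have hγ' : Continuous (deriv γ) := hγ.continuous_deriv_one
  let Φ : ℝ × ℂ → ℂ := fun p => cauchyKernel (γ p.1 - p.2) * h p.2 * deriv γ p.1
  have hne : ∀ t, ∀ ζ ∈ tsupport h, γ t - ζ ≠ 0 := fun t ζ hζ h0 =>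
    Set.disjoint_left.1 hd ⟨t, sub_eq_zero.1 h0⟩ hζ
  have hΦ : ContinuousOn Φ (Icc 0 1 ×ˢ tsupport h) := by
    refine ContinuousOn.mul (ContinuousOn.mul (ContinuousOn.inv₀ ?_ ?_) ?_) ?_
    · exact (continuous_const.mul
        ((hγ.continuous.comp continuous_fst).sub continuous_snd)).continuousOn
    · rintro ⟨t, ζ⟩ ⟨-, hζ⟩
      exact mul_ne_zero hπ (hne t ζ hζ)
    · exact (hh.comp continuous_snd).continuousOn
    · exact (hγ'.comp continuous_fst).continuousOn
  have hint : IntegrableOn Φ (Icc 0 1 ×ˢ tsupport h) :=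
    hΦ.integrableOn_compact (isCompact_Icc.prod hc.isCompact)
  have hint2 : Integrable (Function.uncurry fun t ζ => Φ (t, ζ))
      ((volume.restrict (uIoc (0 : ℝ) 1)).prod volume) := by
    have hsub : uIoc (0 : ℝ) 1 ×ˢ tsupport h ⊆ Icc 0 1 ×ˢ tsupport h :=
      prod_mono_left (by rw [uIoc_of_le zero_le_one]; exact Ioc_subset_Icc_self)
    have h1 : IntegrableOn Φ (uIoc (0 : ℝ) 1 ×ˢ univ) := by
      refine IntegrableOn.of_forall_sdiff_eq_zero (hint.mono_set hsub)
        (measurableSet_uIoc.prod MeasurableSet.univ) ?_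
      rintro ⟨t, ζ⟩ ⟨⟨h1, -⟩, h2⟩
      have : h ζ = 0 := image_eq_zero_of_notMem_tsupport fun hζ => h2 ⟨h1, hζ⟩
      simp [Φ, this]
    rw [IntegrableOn, Measure.volume_eq_prod, ← Measure.prod_restrict, Measure.restrict_univ] at h1
    exact h1
  have h1 : ∀ t, cauchyTransform h (γ t) * deriv γ t = ∫ ζ, Φ (t, ζ) := fun t => by
    rw [cauchyTransform_apply', ← integral_mul_const]
  simp only [h1]
  rw [intervalIntegral_integral_swap hint2, ← integral_const_mul]
  congr 1
  ext ζ
  by_cases hζ : ζ ∈ tsupport h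
  · rw [← hind ζ hζ]
    have h2 : ∀ t, Φ (t, ζ) = ((Real.pi : ℂ)⁻¹ * h ζ) * (deriv γ t / (γ t - ζ)) := fun t => by
      simp only [Φ, cauchyKernel, mul_inv]; ring
    simp only [h2]
    rw [intervalIntegral.integral_const_mul]
    have := Complex.I_ne_zero
    field_simp
  · simp [Φ, image_eq_zero_of_notMem_tsupport hζ]

end ZS

namespace ZS

/-! ### Curves, winding numbers and arcs -/

/-- An integral of Cauchy type over a parametrized curve may be differentiated under the integral
sign. -/
lemma hasDerivAt_integral_div_sub {a G : ℝ → ℂ} (ha : ContinuousOn a (Icc 0 1))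
    (hG : ContinuousOn G (Icc 0 1)) {z : ℂ} (hz : z ∉ G '' Icc 0 1) :
    HasDerivAt (fun w => ∫ t in (0 : ℝ)..1, a t / (G t - w))
      (∫ t in (0 : ℝ)..1, a t / (G t - z) ^ 2) z := by
  have hGc : IsCompact (G '' Icc 0 1) := isCompact_Icc.image_of_continuousOn hG
  obtain ⟨ε, hε, hb⟩ := Metric.isOpen_iff.1 hGc.isClosed.isOpen_compl z hz
  obtain ⟨C, hC⟩ := isCompact_Icc.exists_bound_of_continuousOn ha
  have hC0 : 0 ≤ C := (norm_nonneg _).trans (hC 0 ⟨le_rfl, zero_le_one⟩)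
  have hdist : ∀ w ∈ Metric.ball z (ε / 2), ∀ t ∈ Icc (0 : ℝ) 1, ε / 2 ≤ ‖G t - w‖ := by
    intro w hw t ht
    by_contra hlt
    rw [Metric.mem_ball, dist_eq_norm] at hw
    refine hb (?_ : G t ∈ Metric.ball z ε) ⟨t, ht, rfl⟩
    rw [Metric.mem_ball, dist_eq_norm]
    calc ‖G t - z‖ = ‖(G t - w) + (w - z)‖ := by ring_nf
      _ ≤ _ := norm_add_le _ _
      _ < ε := by linarith [not_le.1 hlt]
  have hI : uIcc (0 : ℝ) 1 = Icc 0 1 := uIcc_of_le zero_le_one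
  have hIo : uIoc (0 : ℝ) 1 ⊆ Icc 0 1 := by
    rw [uIoc_of_le zero_le_one]; exact Ioc_subset_Icc_self
  have hcont : ∀ w ∈ Metric.ball z (ε / 2), ∀ k : ℕ,
      ContinuousOn (fun t => a t / (G t - w) ^ k) (Icc 0 1) := fun w hw k =>
    ha.div ((hG.sub continuousOn_const).pow k) fun t ht =>
      pow_ne_zero _ (norm_pos_iff.1 (lt_of_lt_of_le (by positivity) (hdist w hw t ht)))
  have hm : ∀ w ∈ Metric.ball z (ε / 2), ∀ k : ℕ, AEStronglyMeasurable
      (fun t => a t / (G t - w) ^ k) (volume.restrict (uIoc 0 1)) := fun w hw k =>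
    ((hcont w hw k).mono hIo).aestronglyMeasurable measurableSet_uIoc
  have hz0 : z ∈ Metric.ball z (ε / 2) := Metric.mem_ball_self (by positivity)
  refine (intervalIntegral.hasDerivAt_integral_of_dominated_loc_of_deriv_le
    (F := fun w t => a t / (G t - w)) (F' := fun w t => a t / (G t - w) ^ 2)
    (s := Metric.ball z (ε / 2))
    (bound := fun _ => C / (ε / 2) ^ 2) (Metric.ball_mem_nhds z (by positivity)) ?_ ?_ ?_ ?_ ?_ ?_).2
  · filter_upwards [Metric.ball_mem_nhds z (half_pos hε)] with w hw
    simpa using hm w hw 1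
  · rw [intervalIntegrable_iff]
    have := (hcont z hz0 1).integrableOn_compact (μ := volume) isCompact_Icc
    simpa using this.mono_set hIo
  · exact hm z hz0 2
  · refine Eventually.of_forall fun t ht w hw => ?_
    rw [norm_div, norm_pow]
    have := hdist w hw t (hIo ht)
    gcongr
    exact hC t (hIo ht)
  · simp
  · refine Eventually.of_forall fun t ht w hw => ?_
    have h0 : G t - w ≠ 0 :=
      norm_pos_iff.1 (lt_of_lt_of_le (by positivity) (hdist w hw t (hIo ht)))
    have h1 : HasDerivAt (fun w => G t - w) (-1) w := (hasDerivAt_id w).const_sub _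
    refine ((h1.inv h0).const_mul (a t)).congr_deriv ?_
    simp [div_eq_mul_inv]

/-- A Cauchy type integral over a curve decays at infinity. -/
lemma isBigO_integral_div_sub {a G : ℝ → ℂ} (ha : ContinuousOn a (Icc 0 1))
    (hG : ContinuousOn G (Icc 0 1)) :
    (fun w => ∫ t in (0 : ℝ)..1, a t / (G t - w)) =O[Bornology.cobounded ℂ] fun z => z⁻¹ := by
  obtain ⟨C, hC⟩ := isCompact_Icc.exists_bound_of_continuousOn ha
  obtain ⟨R, hR⟩ := isCompact_Icc.exists_bound_of_continuousOn hG
  have hC0 : 0 ≤ C := (norm_nonneg _).trans (hC 0 ⟨le_rfl, zero_le_one⟩)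
  refine Asymptotics.IsBigO.of_bound (2 * C) ?_
  filter_upwards [(tendsto_norm_cobounded_atTop (E := ℂ)).eventually_ge_atTop (2 * R + 1),
    (tendsto_norm_cobounded_atTop (E := ℂ)).eventually_gt_atTop 0] with z hz hz0
  rw [norm_inv]
  have := intervalIntegral.norm_integral_le_of_norm_le_const (a := (0 : ℝ)) (b := 1)
    (f := fun t => a t / (G t - z)) (C := 2 * C * ‖z‖⁻¹) fun t ht => ?_
  · simpa using this
  have ht : t ∈ Icc (0 : ℝ) 1 := by
    rw [uIoc_of_le zero_le_one] at ht; exact Ioc_subset_Icc_self ht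
  have h1 : ‖z‖ / 2 ≤ ‖G t - z‖ := by
    have := norm_sub_norm_le z (G t)
    rw [norm_sub_rev z] at this
    linarith [hR t ht]
  rw [norm_div, div_le_iff₀ (by linarith)]
  calc ‖a t‖ ≤ C := hC t ht
    _ = 2 * C * ‖z‖⁻¹ * (‖z‖ / 2) := by field_simp
    _ ≤ _ := by gcongr

section Arc

variable {G : ℝ → ℂ}

/-- A holomorphic logarithm of `(z - G 1) / (z - G 0)` on the complement of the arc `G`. -/
def arcLog (G : ℝ → ℂ) (z : ℂ) : ℂ :=
  ∫ t in (0 : ℝ)..1, derivWithin G (Icc 0 1) t / (G t - z)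

lemma continuousOn_derivWithin_arc (hG : ContDiffOn ℝ 1 G (Icc 0 1)) :
    ContinuousOn (derivWithin G (Icc 0 1)) (Icc 0 1) :=
  hG.continuousOn_derivWithin (uniqueDiffOn_Icc zero_lt_one) le_rfl

lemma hasDerivAt_arc (hG : ContDiffOn ℝ 1 G (Icc 0 1)) {t : ℝ} (ht : t ∈ Ioo (0 : ℝ) 1) :
    HasDerivAt G (derivWithin G (Icc 0 1) t) t :=
  ((hG.differentiableOn one_ne_zero t (Ioo_subset_Icc_self ht)).hasDerivWithinAt).hasDerivAt
    (Icc_mem_nhds ht.1 ht.2)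

lemma hasDerivAt_arcLog (hG : ContDiffOn ℝ 1 G (Icc 0 1)) {z : ℂ} (hz : z ∉ G '' Icc 0 1) :
    HasDerivAt (arcLog G) (1 / (z - G 1) - 1 / (z - G 0)) z := by
  have h1 := hasDerivAt_integral_div_sub (continuousOn_derivWithin_arc hG) hG.continuousOn hz
  have h0 : ∀ t ∈ Icc (0 : ℝ) 1, G t - z ≠ 0 := fun t ht h => hz ⟨t, ht, sub_eq_zero.1 h⟩
  refine h1.congr_deriv ?_
  rw [intervalIntegral.integral_eq_sub_of_hasDerivAt_of_le zero_le_one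
    (f := fun t => - (G t - z)⁻¹)]
  · rw [one_div, one_div, ← neg_sub z (G 1), ← neg_sub z (G 0), inv_neg, inv_neg, neg_neg, neg_neg]
  · exact ((hG.continuousOn.sub continuousOn_const).inv₀ h0).neg
  · intro t ht
    have := ((hasDerivAt_arc hG ht).sub_const z).inv (h0 t (Ioo_subset_Icc_self ht))
    refine this.neg.congr_deriv ?_
    rw [neg_div, neg_neg]
  · rw [intervalIntegrable_iff_integrableOn_Icc_of_le zero_le_one]
    exact ((continuousOn_derivWithin_arc hG).div ((hG.continuousOn.sub continuousOn_const).pow 2)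
      fun t ht => pow_ne_zero _ (h0 t ht)).integrableOn_compact isCompact_Icc

lemma isBigO_arcLog (hG : ContDiffOn ℝ 1 G (Icc 0 1)) :
    arcLog G =O[Bornology.cobounded ℂ] fun z => z⁻¹ :=
  isBigO_integral_div_sub (continuousOn_derivWithin_arc hG) hG.continuousOn

/-- Along the arc, `(G x - z) exp (-∫₀ˣ G' / (G - z))` is constant. -/
lemma exp_arcLog (hG : ContDiffOn ℝ 1 G (Icc 0 1)) {z : ℂ} (hz : z ∉ G '' Icc 0 1) :
    Complex.exp (arcLog G z) = (G 1 - z) / (G 0 - z) := by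
  have h0 : ∀ t ∈ Icc (0 : ℝ) 1, G t - z ≠ 0 := fun t ht h => hz ⟨t, ht, sub_eq_zero.1 h⟩
  have hcont : ContinuousOn (fun t => derivWithin G (Icc 0 1) t / (G t - z)) (Icc 0 1) :=
    (continuousOn_derivWithin_arc hG).div (hG.continuousOn.sub continuousOn_const) h0
  let ℓ : ℝ → ℂ := fun x => ∫ t in (0 : ℝ)..x, derivWithin G (Icc 0 1) t / (G t - z)
  have hℓc : ContinuousOn ℓ (Icc 0 1) := by
    have := intervalIntegral.continuousOn_primitive_interval (μ := volume) (a := (0 : ℝ)) (b := 1)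
      (f := fun t => derivWithin G (Icc 0 1) t / (G t - z)) (by
        rw [uIcc_of_le zero_le_one]; exact hcont.integrableOn_compact isCompact_Icc)
    rwa [uIcc_of_le zero_le_one] at this
  have hℓd : ∀ x ∈ Ioo (0 : ℝ) 1,
      HasDerivAt ℓ (derivWithin G (Icc 0 1) x / (G x - z)) x := by
    intro x hx
    have hsub : Icc 0 x ⊆ Icc (0 : ℝ) 1 := Icc_subset_Icc_right hx.2.le
    refine intervalIntegral.integral_hasDerivAt_right ?_ ?_
      (hcont.continuousAt (Icc_mem_nhds hx.1 hx.2))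
    · rw [intervalIntegrable_iff_integrableOn_Icc_of_le hx.1.le]
      exact (hcont.mono hsub).integrableOn_compact isCompact_Icc
    · exact (hcont.mono Ioo_subset_Icc_self).stronglyMeasurableAtFilter isOpen_Ioo x hx
  have hk := intervalIntegral.integral_eq_sub_of_hasDerivAt_of_le zero_le_one
    (f := fun t => Complex.exp (-ℓ t) * (G t - z)) (f' := fun _ => 0)
    (hℓc.neg.cexp.mul (hG.continuousOn.sub continuousOn_const)) (fun t ht => by
      have h1 := ((hℓd t ht).neg.cexp).mul ((hasDerivAt_arc hG ht).sub_const z)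
      refine h1.congr_deriv ?_
      have := h0 t (Ioo_subset_Icc_self ht)
      field_simp
      ring) (by simp)
  have h00 := h0 0 ⟨le_rfl, zero_le_one⟩
  have hℓ0 : ℓ 0 = 0 := by simp [ℓ]
  have hℓ1 : ℓ 1 = arcLog G z := rfl
  simp only [hℓ0, hℓ1, intervalIntegral.integral_zero, neg_zero, Complex.exp_zero, one_mul] at hk
  rw [Complex.exp_neg] at hk
  rw [eq_div_iff h00]
  have := Complex.exp_ne_zero (arcLog G z)
  field_simp at hk
  linear_combination hk

end Arc

section Inside

variable {γ : ℝ → ℂ}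

lemma range_eq_image_Icc (hp : Function.Periodic γ 1) : range γ = γ '' Icc 0 1 := by
  have := hp.image_Icc zero_lt_one 0
  rw [zero_add] at this
  exact this.symm

lemma isCompact_range_of_periodic (hγ : Continuous γ) (hp : Function.Periodic γ 1) :
    IsCompact (range γ) := by
  rw [range_eq_image_Icc hp]; exact isCompact_Icc.image hγ

lemma isPreconnected_setOf_lt_norm {R : ℝ} (hR : 0 < R) : IsPreconnected {z : ℂ | R < ‖z‖} := by
  have h : {z : ℂ | R < ‖z‖} = Complex.exp '' {w : ℂ | Real.log R < w.re} := by
    ext z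
    constructor
    · intro hz
      have hz0 : z ≠ 0 := norm_pos_iff.1 (hR.trans hz)
      exact ⟨Complex.log z, by simpa [Complex.log_re] using Real.log_lt_log hR hz,
        Complex.exp_log hz0⟩
    · rintro ⟨w, hw, rfl⟩
      simpa [Complex.norm_exp, ← Real.log_lt_iff_lt_exp hR] using hw
  rw [h]
  exact ((convex_halfSpace_re_gt _).isPreconnected).image _ Complex.continuous_exp.continuousOn

/-- The points that lie neither on the curve nor inside form a connected set, the unbounded
component of the complement. -/
lemma exists_outer_component (hγ : Continuous γ) (hp : Function.Periodic γ 1) :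
    ∃ W : Set ℂ, IsOpen W ∧ IsPreconnected W ∧ W = (closedInside γ)ᶜ ∧
      (∃ R, ∀ z, R < ‖z‖ → z ∈ W) ∧ (closure W ∩ range γ).Nonempty := by
  have hc := isCompact_range_of_periodic hγ hp
  have hopen : IsOpen (range γ)ᶜ := hc.isClosed.isOpen_compl
  obtain ⟨R, hR0, hR⟩ := hc.isBounded.exists_pos_norm_lt
  have hsub : {z : ℂ | R < ‖z‖} ⊆ (range γ)ᶜ := fun z hz hz' => absurd (hR z hz') (not_lt.2 hz.le)
  let w₀ : ℂ := ((R + 1 : ℝ) : ℂ)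
  have hw₀ : w₀ ∈ {z : ℂ | R < ‖z‖} := by
    simp only [mem_ofPred_eq, w₀, Complex.norm_real, Real.norm_eq_abs]
    rw [abs_of_pos (by linarith)]; linarith
  let W := connectedComponentIn (range γ)ᶜ w₀
  have hfar : {z : ℂ | R < ‖z‖} ⊆ W :=
    (isPreconnected_setOf_lt_norm hR0).subset_connectedComponentIn hw₀ hsub
  have hWsub : W ⊆ (range γ)ᶜ := connectedComponentIn_subset _ _
  have hunb : ¬ Bornology.IsBounded W := by
    intro hb
    obtain ⟨R', hR'0, hR'⟩ := hb.exists_pos_norm_lt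
    have h1 : ((R + R' : ℝ) : ℂ) ∈ W := hfar (by
      simp only [mem_ofPred_eq, Complex.norm_real, Real.norm_eq_abs]
      rw [abs_of_pos (by linarith)]; linarith)
    have := hR' _ h1
    rw [Complex.norm_real, Real.norm_eq_abs, abs_of_pos (by linarith)] at this
    linarith
  have hWopen : IsOpen W := hopen.connectedComponentIn
  have hWpre : IsPreconnected W := isPreconnected_connectedComponentIn
  refine ⟨W, hWopen, hWpre, ?_, ⟨R, fun z hz => hfar hz⟩, ?_⟩
  · ext z
    simp only [closedInside, inside, mem_compl_iff, mem_union, mem_ofPred_eq, not_or, not_and]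
    constructor
    · intro hz
      refine ⟨fun _ hb => hunb ?_, hWsub hz⟩
      rwa [show W = connectedComponentIn (range γ)ᶜ z from connectedComponentIn_eq hz]
    · rintro ⟨h1, h2⟩
      have h3 := h1 h2
      obtain ⟨v, hv, hRv⟩ : ∃ v ∈ connectedComponentIn (range γ)ᶜ z, R < ‖v‖ := by
        by_contra hcon
        push Not at hcon
        exact h3 ((Metric.isBounded_closedBall (x := (0 : ℂ)) (r := R)).subset fun v hv => by
          simpa using hcon v hv)
      have h4 : connectedComponentIn (range γ)ᶜ z = W :=
        (connectedComponentIn_eq hv).trans (connectedComponentIn_eq (hfar hRv)).symm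
      rw [← h4]
      exact mem_connectedComponentIn h2
  · by_contra hcon
    rw [Set.not_nonempty_iff_eq_empty] at hcon
    have h1 : closure W ⊆ (range γ)ᶜ := fun z hz hz' => by
      have : z ∈ closure W ∩ range γ := ⟨hz, hz'⟩
      rw [hcon] at this; exact this
    have h2 : closure W ⊆ W :=
      hWpre.closure.subset_connectedComponentIn (subset_closure (hfar hw₀)) h1
    have h3 : IsClopen W := ⟨closure_subset_iff_isClosed.1 h2, hWopen⟩
    have h4 : W = univ := h3.eq_univ ⟨w₀, hfar hw₀⟩
    exact hWsub (h4 ▸ mem_univ (γ 0)) ⟨0, rfl⟩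

lemma isOpen_inside (hγ : Continuous γ) (hp : Function.Periodic γ 1) : IsOpen (inside γ) := by
  have hopen : IsOpen (range γ)ᶜ := (isCompact_range_of_periodic hγ hp).isClosed.isOpen_compl
  rw [isOpen_iff_mem_nhds]
  rintro z ⟨hz, hb⟩
  filter_upwards [hopen.connectedComponentIn.mem_nhds (mem_connectedComponentIn hz)] with w hw
  exact ⟨connectedComponentIn_subset _ _ hw, by rwa [← connectedComponentIn_eq hw]⟩

lemma isBounded_inside (hγ : Continuous γ) (hp : Function.Periodic γ 1) :
    Bornology.IsBounded (inside γ) := by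
  obtain ⟨W, -, -, hW, ⟨R, hR⟩, -⟩ := exists_outer_component hγ hp
  refine (Metric.isBounded_closedBall (x := (0 : ℂ)) (r := R)).subset fun z hz => ?_
  by_contra hcon
  have : z ∈ W := hR z (by simpa using hcon)
  rw [hW] at this
  exact this (Or.inl hz)

lemma isPreconnected_compl_inside (hγ : Continuous γ) (hp : Function.Periodic γ 1) :
    IsPreconnected (inside γ)ᶜ := by
  obtain ⟨W, -, hWc, hW, -, p, hp1, hp2⟩ := exists_outer_component hγ hp
  have h1 : IsPreconnected (insert p W) :=
    hWc.subset_closure (subset_insert _ _) (insert_subset hp1 subset_closure)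
  have h2 := h1.union p (mem_insert _ _) hp2 (isPreconnected_range hγ)
  have h3 : insert p W ∪ range γ = (inside γ)ᶜ := by
    ext z
    rw [hW]
    simp only [closedInside, mem_union, mem_insert_iff, mem_compl_iff, not_or]
    constructor
    · rintro ((rfl | h) | h)
      · exact fun h => h.1 hp2
      · exact h.1
      · exact fun h' => h'.1 h
    · intro h
      by_cases hz : z ∈ range γ
      · exact Or.inr hz
      · exact Or.inl (Or.inr ⟨h, hz⟩)
  rwa [h3] at h2

/-- A closed curve does not wind around the points of the unbounded component. -/
lemma integral_deriv_div_sub_eq_zero (hγ : ContDiff ℝ 1 γ) (hp : Function.Periodic γ 1) {z : ℂ}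
    (hz : z ∉ closedInside γ) : ∫ t in (0 : ℝ)..1, deriv γ t / (γ t - z) = 0 := by
  obtain ⟨W, hWo, hWc, hW, ⟨R, hR⟩, -⟩ := exists_outer_component hγ.continuous hp
  have hγ' : Continuous (deriv γ) := hγ.continuous_deriv_one
  have hzW : z ∈ W := by rw [hW]; exact hz
  have hnr : ∀ w ∈ W, w ∉ range γ := fun w hw h => by
    rw [hW] at hw; exact hw (Or.inr h)
  have hd : ∀ w ∈ W, HasDerivAt (fun w => ∫ t in (0 : ℝ)..1, deriv γ t / (γ t - w)) 0 w := by
    intro w hw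
    have h0 : ∀ t, γ t - w ≠ 0 := fun t h => hnr w hw ⟨t, sub_eq_zero.1 h⟩
    refine (hasDerivAt_integral_div_sub hγ'.continuousOn hγ.continuous.continuousOn
      (fun h => hnr w hw (image_subset_range _ _ h))).congr_deriv ?_
    rw [intervalIntegral.integral_eq_sub_of_hasDerivAt (f := fun t => - (γ t - w)⁻¹)]
    · have : γ 1 = γ 0 := by simpa using hp 0
      simp [this]
    · intro t _
      have h1 : HasDerivAt γ (deriv γ t) t := (hγ.differentiable one_ne_zero t).hasDerivAt
      refine ((h1.sub_const w).inv (h0 t)).neg.congr_deriv ?_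
      rw [neg_div, neg_neg]
    · exact (hγ'.div ((hγ.continuous.sub continuous_const).pow 2)
        fun t => pow_ne_zero _ (h0 t)).intervalIntegrable _ _
  obtain ⟨c, hc⟩ := hWo.exists_is_const_of_deriv_eq_zero hWc
    (fun w hw => (hd w hw).differentiableAt.differentiableWithinAt) (fun w hw => (hd w hw).deriv)
  have hlim : Tendsto (fun w => ∫ t in (0 : ℝ)..1, deriv γ t / (γ t - w)) (Bornology.cobounded ℂ)
      (𝓝 0) := (isBigO_integral_div_sub hγ'.continuousOn
        hγ.continuous.continuousOn).trans_tendsto tendsto_inv₀_cobounded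
  have hev : ∀ᶠ w in Bornology.cobounded ℂ,
      ∫ t in (0 : ℝ)..1, deriv γ t / (γ t - w) = c := by
    filter_upwards [(tendsto_norm_cobounded_atTop (E := ℂ)).eventually_gt_atTop R] with w hw
    exact hc w (hR w hw)
  rw [hc z hzW]
  exact tendsto_nhds_unique (tendsto_const_nhds.congr' (hev.mono fun _ h => h.symm)) hlim

end Inside

end ZS

namespace ZS

/-! ### Holomorphic functions near infinity and primitives -/

/-- Cauchy's estimate near infinity. -/
lemma eventually_norm_deriv_le {f : ℂ → ℂ} (hf : ∀ᶠ z in Bornology.cobounded ℂ, DifferentiableAt ℂ f z)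
    {n : ℕ} {ε : ℝ} (h : ∀ᶠ z in Bornology.cobounded ℂ, ‖f z‖ ≤ ε * ‖z⁻¹ ^ n‖) :
    ∀ᶠ z in Bornology.cobounded ℂ, ‖deriv f z‖ ≤ 2 ^ (n + 1) * ε * ‖z⁻¹ ^ (n + 1)‖ := by
  have hev := hf.and h
  rw [← comap_norm_atTop, eventually_comap] at hev
  obtain ⟨R, hR⟩ := eventually_atTop.1 hev
  filter_upwards [(tendsto_norm_cobounded_atTop (E := ℂ)).eventually_ge_atTop (2 * R),
    (tendsto_norm_cobounded_atTop (E := ℂ)).eventually_gt_atTop 0] with z hz hz0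
  have hball : ∀ w ∈ Metric.closedBall z (‖z‖ / 2), ‖z‖ / 2 ≤ ‖w‖ := fun w hw => by
    rw [Metric.mem_closedBall, dist_eq_norm, norm_sub_rev] at hw
    have := norm_sub_norm_le z w
    linarith
  have hε : 0 ≤ ε := by
    have := (norm_nonneg _).trans (hR ‖z‖ (by linarith) z rfl).2
    have h2 : 0 < ‖z⁻¹ ^ n‖ := by
      exact norm_pos_iff.2 (pow_ne_zero _ (inv_ne_zero (norm_pos_iff.1 hz0)))
    exact nonneg_of_mul_nonneg_left this h2
  have hd : DiffContOnCl ℂ f (Metric.ball z (‖z‖ / 2)) := by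
    refine DifferentiableOn.diffContOnCl ?_
    rw [closure_ball z (by positivity)]
    intro w hw
    exact (hR ‖w‖ (by linarith [hball w hw]) w rfl).1.differentiableWithinAt
  have hb : ∀ w ∈ Metric.sphere z (‖z‖ / 2), ‖f w‖ ≤ ε * (2 ^ n * ‖z⁻¹ ^ n‖) := by
    intro w hw
    have hw2 := hball w (Metric.sphere_subset_closedBall hw)
    refine (hR ‖w‖ (by linarith) w rfl).2.trans ?_
    refine mul_le_mul_of_nonneg_left ?_ hε
    rw [norm_pow, norm_pow, ← mul_pow, norm_inv, norm_inv]
    refine pow_le_pow_left₀ (by positivity) ?_ _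
    rw [inv_le_comm₀ (by linarith) (by positivity), mul_inv, inv_inv]
    linarith
  refine (Complex.norm_deriv_le_of_forall_mem_sphere_norm_le (by positivity) hd hb).trans
    (le_of_eq ?_)
  rw [pow_succ z⁻¹, norm_mul, norm_inv z, pow_succ (2 : ℝ)]
  field_simp

lemma isBigO_deriv_cobounded {f : ℂ → ℂ} (hf : ∀ᶠ z in Bornology.cobounded ℂ, DifferentiableAt ℂ f z)
    {n : ℕ} (h : f =O[Bornology.cobounded ℂ] fun z => z⁻¹ ^ n) :
    deriv f =O[Bornology.cobounded ℂ] fun z => z⁻¹ ^ (n + 1) := by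
  obtain ⟨C, hC⟩ := h.bound
  exact Asymptotics.IsBigO.of_bound _ (eventually_norm_deriv_le hf hC)

lemma tendsto_mul_deriv_cobounded {f : ℂ → ℂ} {c : ℂ}
    (hf : ∀ᶠ z in Bornology.cobounded ℂ, DifferentiableAt ℂ f z)
    (h : Tendsto f (Bornology.cobounded ℂ) (𝓝 c)) :
    Tendsto (fun z => z * deriv f z) (Bornology.cobounded ℂ) (𝓝 0) := by
  rw [Metric.tendsto_nhds]
  intro ε hε
  have h1 : ∀ᶠ z in Bornology.cobounded ℂ, ‖f z - c‖ ≤ ε / 4 * ‖z⁻¹ ^ 0‖ := by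
    filter_upwards [Metric.tendsto_nhds.1 h (ε / 4) (by positivity)] with z hz
    rw [dist_eq_norm] at hz
    simpa using hz.le
  have h2 := eventually_norm_deriv_le (f := fun z => f z - c) (n := 0)
    (hf.mono fun z hz => hz.sub_const c) h1
  filter_upwards [h2, (tendsto_norm_cobounded_atTop (E := ℂ)).eventually_gt_atTop 0] with z hz hz0
  rw [deriv_sub_const] at hz
  rw [dist_zero_right, norm_mul]
  calc ‖z‖ * ‖deriv f z‖ ≤ ‖z‖ * (2 ^ (0 + 1) * (ε / 4) * ‖z⁻¹ ^ (0 + 1)‖) := by gcongr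
    _ = ε / 2 := by rw [zero_add, pow_one, pow_one, norm_inv]; field_simp; ring
    _ < ε := by linarith

/-- A compact subset `S` of a bounded open set with connected complement has a compact neighbourhood
of the same kind. -/
lemma exists_full_compact {S U : Set ℂ} (hS : IsCompact S) (hU : IsOpen U)
    (hUb : Bornology.IsBounded U) (hUc : IsPreconnected Uᶜ) (hSU : S ⊆ U) :
    ∃ δ > 0, ∃ K, IsCompact K ∧ Metric.cthickening δ S ⊆ K ∧ K ⊆ U ∧ IsPreconnected Kᶜ := by
  obtain ⟨δ, hδ, hδU⟩ := hS.exists_cthickening_subset_open hU hSU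
  obtain ⟨w₀, hw₀⟩ : ∃ w₀, w₀ ∉ U := by
    by_contra h
    push Not at h
    exact NormedSpace.unbounded_univ ℂ ℂ (hUb.subset fun z _ => h z)
  have hT : IsCompact (Metric.cthickening δ S) := hS.cthickening
  let W := connectedComponentIn (Metric.cthickening δ S)ᶜ w₀
  have hWo : IsOpen W := hT.isClosed.isOpen_compl.connectedComponentIn
  have hUW : Uᶜ ⊆ W := hUc.subset_connectedComponentIn hw₀ (compl_subset_compl.2 hδU)
  refine ⟨δ, hδ, Wᶜ, ?_, ?_, ?_, ?_⟩
  · exact Metric.isCompact_of_isClosed_isBounded hWo.isClosed_compl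
      (hUb.subset (compl_subset_comm.1 hUW))
  · exact subset_compl_comm.1 (connectedComponentIn_subset _ _)
  · exact compl_subset_comm.1 hUW
  · rw [compl_compl]; exact isPreconnected_connectedComponentIn

lemma notMem_cthickening_imp {S : Set ℂ} {δ : ℝ} {z p : ℂ}
    (hz : z ∉ Metric.cthickening δ S) (hp : p ∈ S) : δ < ‖z - p‖ := by
  by_contra h
  refine hz (Metric.mem_cthickening_of_dist_le z p δ S hp ?_)
  rw [dist_eq_norm]; exact not_lt.1 h

/-- A density concentrated in a disk of radius `δ / 2`: up to the contribution of its total mass,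
its Cauchy transform has a primitive at distance more than `δ` from the centre. -/
lemma exists_primitive_of_ball {h : ℂ → ℂ} (hh : Integrable h) {p : ℂ} {δ : ℝ} (hδ : 0 < δ)
    (hsupp : ∀ ζ, h ζ ≠ 0 → ‖ζ - p‖ < δ / 2) :
    ∃ g : ℂ → ℂ, (∀ z, δ < ‖z - p‖ → HasDerivAt g
      ((∫ ζ, cauchyKernel (z - ζ) * h ζ) - (Real.pi : ℂ)⁻¹ * (∫ ζ, h ζ) / (z - p)) z) ∧
      g =O[Bornology.cobounded ℂ] fun z => z⁻¹ := by
  have hπ : (Real.pi : ℂ) ≠ 0 := by exact_mod_cast Real.pi_ne_zero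
  -- the integral of `F` is the logarithmic potential minus that of the total mass at `p`;
  -- `1 + (p - ζ) / (z - p) = (z - ζ) / (z - p)` stays in the slit plane
  let F : ℂ → ℂ → ℂ := fun z ζ => (Real.pi : ℂ)⁻¹ * (Complex.log (1 + (p - ζ) / (z - p)) * h ζ)
  let F' : ℂ → ℂ → ℂ := fun z ζ => cauchyKernel (z - ζ) * h ζ - (Real.pi : ℂ)⁻¹ * h ζ / (z - p)
  have hq : ∀ z, δ < ‖z - p‖ → ∀ ζ, ‖ζ - p‖ < δ / 2 → ‖(p - ζ) / (z - p)‖ ≤ 1 / 2 := by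
    intro z hz ζ hζ
    rw [norm_div, div_le_iff₀ (by linarith), norm_sub_rev]; linarith
  have hFb : ∀ z, δ < ‖z - p‖ → ∀ ζ, ‖F z ζ‖ ≤ Real.pi⁻¹ * (3 / 2 * (δ / 2)) * ‖z - p‖⁻¹ * ‖h ζ‖ := by
    intro z hz ζ
    by_cases hζ : h ζ = 0
    · simp [F, hζ]
    have h1 := hsupp ζ hζ
    have h2 := Complex.norm_log_one_add_half_le_self (hq z hz ζ h1)
    simp only [F]
    rw [norm_mul, norm_mul, norm_inv, Complex.norm_real, Real.norm_eq_abs, abs_of_pos Real.pi_pos]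
    rw [mul_assoc (Real.pi⁻¹), mul_assoc]
    have h3 : ‖(p - ζ) / (z - p)‖ ≤ δ / 2 * ‖z - p‖⁻¹ := by
      rw [norm_div, div_eq_mul_inv, norm_sub_rev]; gcongr
    have h4 : 0 < Real.pi := Real.pi_pos
    gcongr
    calc _ ≤ 3 / 2 * ‖(p - ζ) / (z - p)‖ := h2
      _ ≤ 3 / 2 * (δ / 2 * ‖z - p‖⁻¹) := by gcongr
      _ = _ := by ring
  have hFm : ∀ z, AEStronglyMeasurable (F z) volume := fun z => by
    refine AEStronglyMeasurable.const_mul (AEStronglyMeasurable.mul ?_ hh.aestronglyMeasurable) _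
    exact (by fun_prop : Measurable fun ζ =>
      Complex.log (1 + (p - ζ) / (z - p))).aestronglyMeasurable
  have hF'm : ∀ z, AEStronglyMeasurable (F' z) volume := fun z => by
    refine AEStronglyMeasurable.sub (AEStronglyMeasurable.mul ?_ hh.aestronglyMeasurable)
      ((hh.const_mul _).div_const _).aestronglyMeasurable
    exact (by unfold cauchyKernel; fun_prop :
      Measurable fun ζ => cauchyKernel (z - ζ)).aestronglyMeasurable
  have hki : ∀ z, δ < ‖z - p‖ → ∀ ζ, ‖cauchyKernel (z - ζ) * h ζ‖ ≤ (2 / (Real.pi * δ)) * ‖h ζ‖ := by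
    intro z hz ζ
    by_cases hζ : h ζ = 0
    · simp [hζ]
    have h1 := hsupp ζ hζ
    rw [norm_mul]
    gcongr
    have h2 : δ / 2 ≤ ‖z - ζ‖ := by
      have := norm_sub_norm_le (z - p) (ζ - p)
      rw [sub_sub_sub_cancel_right] at this
      linarith
    rw [cauchyKernel, norm_inv, norm_mul, Complex.norm_real, Real.norm_eq_abs,
      abs_of_pos Real.pi_pos, show 2 / (Real.pi * δ) = (Real.pi * (δ / 2))⁻¹ by
        rw [mul_inv, inv_div]; field_simp]
    gcongr
  refine ⟨fun z => ∫ ζ, F z ζ, fun z hz => ?_, ?_⟩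
  · have hopen : IsOpen {w : ℂ | δ < ‖w - p‖} :=
      isOpen_lt continuous_const (continuous_id.sub continuous_const).norm
    have hderiv := (hasDerivAt_integral_of_dominated_loc_of_deriv_le (μ := volume)
      (F := F) (F' := F') (s := {w : ℂ | δ < ‖w - p‖}) (x₀ := z)
      (bound := fun ζ => (2 / (Real.pi * δ)) * ‖h ζ‖ + Real.pi⁻¹ * ‖h ζ‖ / δ) (hopen.mem_nhds hz)
      (Eventually.of_forall hFm) ?_ (hF'm z) ?_ ?_ ?_).2
    · refine hderiv.congr_deriv ?_
      simp only [F']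
      rw [integral_sub, integral_div, integral_const_mul]
      · refine Integrable.mono' (hh.norm.const_mul (2 / (Real.pi * δ))) ?_
          (Eventually.of_forall (hki z hz))
        refine AEStronglyMeasurable.mul ?_ hh.aestronglyMeasurable
        exact (by unfold cauchyKernel; fun_prop :
          Measurable fun ζ => cauchyKernel (z - ζ)).aestronglyMeasurable
      · exact (hh.const_mul _).div_const _
    · exact Integrable.mono' (hh.norm.const_mul _) (hFm z) (Eventually.of_forall (hFb z hz))
    · refine Eventually.of_forall fun ζ w hw => ?_
      refine (norm_sub_le _ _).trans (add_le_add (hki w hw ζ) ?_)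
      rw [norm_div, norm_mul, norm_inv, Complex.norm_real, Real.norm_eq_abs,
        abs_of_pos Real.pi_pos]
      have : 0 < Real.pi := Real.pi_pos
      exact div_le_div_of_nonneg_left (by positivity) hδ (le_of_lt hw)
    · exact (hh.norm.const_mul _).add ((hh.norm.const_mul _).div_const _)
    · refine Eventually.of_forall fun ζ w hw => ?_
      by_cases hζ : h ζ = 0
      · simp only [F, F', hζ, mul_zero, zero_div, sub_zero]
        exact hasDerivAt_const _ _
      have h1 := hsupp ζ hζ
      have hwp : w - p ≠ 0 := norm_pos_iff.1 (hδ.trans hw)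
      have h2 := hq w hw ζ h1
      have hslit : 1 + (p - ζ) / (w - p) ∈ Complex.slitPlane := by
        refine Complex.mem_slitPlane_of_norm_lt_one (lt_of_le_of_lt h2 (by norm_num))
      have hval : 1 + (p - ζ) / (w - p) = (w - ζ) / (w - p) := by field_simp; ring
      have hwz : w - ζ ≠ 0 := fun h0 => by
        rw [hval, h0, zero_div] at hslit
        exact Complex.slitPlane_ne_zero hslit rfl
      have hdq : HasDerivAt (fun w => 1 + (p - ζ) / (w - p)) (-(p - ζ) / (w - p) ^ 2) w := by
        have h3 := (((hasDerivAt_id w).sub_const p).inv hwp).const_mul (p - ζ)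
        refine (h3.const_add 1).congr_deriv ?_
        simp only [id]; ring
      refine ((((hdq.clog hslit).mul_const (h ζ)).const_mul (Real.pi : ℂ)⁻¹)).congr_deriv ?_
      rw [hval]
      simp only [F', cauchyKernel]
      field_simp
      ring
  · refine Asymptotics.IsBigO.of_bound
      (Real.pi⁻¹ * (3 / 2 * (δ / 2)) * 2 * ∫ ζ, ‖h ζ‖) ?_
    filter_upwards [(tendsto_norm_cobounded_atTop (E := ℂ)).eventually_gt_atTop (2 * (‖p‖ + δ))]
      with z hz
    have h1 : ‖z‖ / 2 ≤ ‖z - p‖ := by linarith [norm_sub_norm_le z p, norm_nonneg p]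
    have hz0 : 0 < ‖z‖ := by linarith [norm_nonneg p]
    have h2 : δ < ‖z - p‖ := by linarith [norm_sub_norm_le z p, norm_nonneg p]
    have h3 : ‖z - p‖⁻¹ ≤ 2 * ‖z‖⁻¹ := by
      rw [show 2 * ‖z‖⁻¹ = (‖z‖ / 2)⁻¹ by rw [inv_div]; ring]
      gcongr
    have h4 : 0 < Real.pi := Real.pi_pos
    calc ‖∫ ζ, F z ζ‖ ≤ ∫ ζ, Real.pi⁻¹ * (3 / 2 * (δ / 2)) * ‖z - p‖⁻¹ * ‖h ζ‖ :=
          norm_integral_le_of_norm_le (hh.norm.const_mul _) (Eventually.of_forall (hFb z h2))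
      _ = Real.pi⁻¹ * (3 / 2 * (δ / 2)) * ‖z - p‖⁻¹ * ∫ ζ, ‖h ζ‖ := integral_const_mul _ _
      _ ≤ Real.pi⁻¹ * (3 / 2 * (δ / 2)) * (2 * ‖z‖⁻¹) * ∫ ζ, ‖h ζ‖ := by
          have : 0 ≤ ∫ ζ, ‖h ζ‖ := integral_nonneg fun _ => norm_nonneg _
          gcongr
      _ = _ := by rw [norm_inv]; ring

/-- A density of total mass zero, concentrated near an arc, has a Cauchy transform with a primitive
away from the arc. The masses are transported along the arc to its initial point by `arcLog`. -/
lemma exists_primitive_of_arc {G : ℝ → ℂ} (hG : ContDiffOn ℝ 1 G (Icc 0 1)) {δ : ℝ} (hδ : 0 < δ)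
    {h : ℂ → ℂ} (hc : Continuous h) (hcs : HasCompactSupport h)
    (hsupp : tsupport h ⊆ Metric.thickening (δ / 2) (G '' Icc 0 1)) (h0 : ∫ ζ, h ζ = 0) :
    ∃ g : ℂ → ℂ, (∀ z ∉ Metric.cthickening δ (G '' Icc 0 1),
      HasDerivAt g (cauchyTransform h z) z) ∧ g =O[Bornology.cobounded ℂ] fun z => z⁻¹ := by
  -- Induction over the number of disks that carry the density, without the hypothesis on its total
  -- mass: a nonzero mass is seen as a pole at the initial point of the arc.
  have key : ∀ t : Finset ℝ, (∀ s ∈ t, s ∈ Icc (0 : ℝ) 1) → ∀ h : ℂ → ℂ, Integrable h →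
      (∀ ζ, h ζ ≠ 0 → ∃ s ∈ t, ‖ζ - G s‖ < δ / 2) →
      ∃ g : ℂ → ℂ, (∀ z ∉ Metric.cthickening δ (G '' Icc 0 1), HasDerivAt g
        ((∫ ζ, cauchyKernel (z - ζ) * h ζ) - (Real.pi : ℂ)⁻¹ * (∫ ζ, h ζ) / (z - G 0)) z) ∧
        (∀ z ∉ Metric.cthickening δ (G '' Icc 0 1),
          Integrable fun ζ => cauchyKernel (z - ζ) * h ζ) ∧
        g =O[Bornology.cobounded ℂ] fun z => z⁻¹ := by
    intro t
    induction t using Finset.induction_on with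
    | empty =>
      intro _ h hh hs
      have hz : h = 0 := by
        ext ζ
        by_contra hne
        simpa using hs ζ hne
      refine ⟨0, fun z _ => ?_, fun z _ => by simp [hz], Asymptotics.isBigO_zero _ _⟩
      simp only [hz, Pi.zero_apply, mul_zero, integral_zero, zero_div, sub_zero]
      exact hasDerivAt_const _ _
    | insert s t hst ih =>
      intro ht h hh hs
      have hsI : s ∈ Icc (0 : ℝ) 1 := ht s (Finset.mem_insert_self _ _)
      let B : Set ℂ := Metric.ball (G s) (δ / 2)
      have hBm : MeasurableSet B := measurableSet_ball
      obtain ⟨g₁, hg₁, hi₁, hO₁⟩ := ih (fun s hs => ht s (Finset.mem_insert_of_mem hs))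
        (Bᶜ.indicator h) (hh.indicator hBm.compl) (fun ζ hζ => by
          have hζB : ζ ∈ Bᶜ := by
            by_contra hn; exact hζ (indicator_of_notMem hn _)
          rw [indicator_of_mem hζB] at hζ
          obtain ⟨s', hs', hlt⟩ := hs ζ hζ
          rcases Finset.mem_insert.1 hs' with rfl | h2
          · exact absurd (by rw [Metric.mem_ball, dist_eq_norm]; exact hlt) hζB
          · exact ⟨s', h2, hlt⟩)
      have hsB : ∀ ζ, B.indicator h ζ ≠ 0 → ‖ζ - G s‖ < δ / 2 := fun ζ hζ => by
        have hζB : ζ ∈ B := by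
          by_contra hn; exact hζ (indicator_of_notMem hn _)
        simpa [B, dist_eq_norm] using hζB
      obtain ⟨g₂, hg₂, hO₂⟩ := exists_primitive_of_ball (hh.indicator hBm) hδ hsB
      -- the subarc from `G 0` to `G s`
      let Gs : ℝ → ℂ := fun t => G (s * t)
      have hmaps : MapsTo (fun t : ℝ => s * t) (Icc 0 1) (Icc 0 1) := fun t ht =>
        ⟨mul_nonneg hsI.1 ht.1, mul_le_one₀ hsI.2 ht.1 ht.2⟩
      have hGs : ContDiffOn ℝ 1 Gs (Icc 0 1) :=
        hG.comp (contDiff_const.mul contDiff_id).contDiffOn hmaps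
      have hsubset : Gs '' Icc 0 1 ⊆ G '' Icc 0 1 := by
        rintro _ ⟨t, ht, rfl⟩
        exact ⟨s * t, hmaps ht, rfl⟩
      have hGS : G '' Icc 0 1 ⊆ Metric.cthickening δ (G '' Icc 0 1) :=
        Metric.self_subset_cthickening _
      set m : ℂ := (Real.pi : ℂ)⁻¹ * ∫ ζ, B.indicator h ζ with hm
      have hi₂ : ∀ z ∉ Metric.cthickening δ (G '' Icc 0 1),
          Integrable fun ζ => cauchyKernel (z - ζ) * B.indicator h ζ := by
        intro z hz
        have hz2 := notMem_cthickening_imp hz ⟨s, hsI, rfl⟩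
        refine Integrable.mono' ((hh.indicator hBm).norm.const_mul (Real.pi * (δ / 2))⁻¹) ?_
          (Eventually.of_forall fun ζ => ?_)
        · refine AEStronglyMeasurable.mul ?_ (hh.indicator hBm).aestronglyMeasurable
          exact (by unfold cauchyKernel; fun_prop :
            Measurable fun ζ => cauchyKernel (z - ζ)).aestronglyMeasurable
        · by_cases hζ : B.indicator h ζ = 0
          · simp [hζ]
          have h1 := hsB ζ hζ
          have h2 : δ / 2 ≤ ‖z - ζ‖ := by
            have := norm_sub_norm_le (z - G s) (ζ - G s)
            rw [sub_sub_sub_cancel_right] at this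
            linarith
          rw [norm_mul, cauchyKernel, norm_inv, norm_mul, Complex.norm_real, Real.norm_eq_abs,
            abs_of_pos Real.pi_pos]
          have : 0 < Real.pi := Real.pi_pos
          gcongr
      have hsplit : ∀ ζ, h ζ = Bᶜ.indicator h ζ + B.indicator h ζ := fun ζ => by
        rw [add_comm]; exact (congrFun (indicator_self_add_compl B h) ζ).symm
      have hsplit2 : ∀ z ζ, cauchyKernel (z - ζ) * h ζ = cauchyKernel (z - ζ) * Bᶜ.indicator h ζ +
          cauchyKernel (z - ζ) * B.indicator h ζ := fun z ζ => by
        rw [← mul_add, ← hsplit]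
      refine ⟨fun z => g₁ z + g₂ z + m * arcLog Gs z, fun z hz => ?_, fun z hz => ?_,
        (hO₁.add hO₂).add ((isBigO_arcLog hGs).const_mul_left m)⟩
      · have h3 := ((hg₁ z hz).add (hg₂ z (notMem_cthickening_imp hz ⟨s, hsI, rfl⟩))).add
          ((hasDerivAt_arcLog hGs (z := z) fun hm => hz (hGS (hsubset hm))).const_mul m)
        refine h3.congr_deriv ?_
        simp only [hsplit2 z]
        rw [integral_add (hi₁ z hz) (hi₂ z hz)]
        rw [show ∫ ζ, h ζ = (∫ ζ, Bᶜ.indicator h ζ) + ∫ ζ, B.indicator h ζ by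
          rw [← integral_add (hh.indicator hBm.compl) (hh.indicator hBm)]
          exact integral_congr_ae (Eventually.of_forall hsplit)]
        simp only [hm, Gs, mul_one, mul_zero]
        ring
      · simp only [hsplit2 z]
        exact (hi₁ z hz).add (hi₂ z hz)
  -- a finite cover of the support; now the total mass vanishes, and with it the pole
  have hcover : tsupport h ⊆ ⋃ s : Icc (0 : ℝ) 1, Metric.ball (G s) (δ / 2) := by
    intro ζ hζ
    obtain ⟨p, ⟨s, hs, rfl⟩, hlt⟩ := Metric.mem_thickening_iff.1 (hsupp hζ)
    exact mem_iUnion.2 ⟨⟨s, hs⟩, hlt⟩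
  obtain ⟨t, ht⟩ := hcs.isCompact.elim_finite_subcover _ (fun _ => Metric.isOpen_ball) hcover
  obtain ⟨g, hg, -, hO⟩ := key (t.image (Subtype.val : Icc (0 : ℝ) 1 → ℝ)) (fun s hs => by
    obtain ⟨s', -, rfl⟩ := Finset.mem_image.1 hs; exact s'.2) h
    (hc.integrable_of_hasCompactSupport hcs) (fun ζ hζ => by
      have := ht (subset_tsupport _ hζ)
      simp only [mem_iUnion] at this
      obtain ⟨s, hs, hb⟩ := this
      exact ⟨s, Finset.mem_image_of_mem _ hs, by simpa [dist_eq_norm] using hb⟩)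
  refine ⟨g, fun z hz => ?_, hO⟩
  rw [cauchyTransform_apply']
  simpa [h0] using hg z hz

end ZS

namespace ZS

/-! ### A positivity property of boundary integrals -/

lemma dbar_ofReal_comp {F : ℂ → ℝ} {φ : ℝ → ℝ} {φ' : ℝ} {z : ℂ} (hF : DifferentiableAt ℝ F z)
    (hφ : HasDerivAt φ φ' (F z)) :
    dbar (fun w => ((φ (F w) : ℝ) : ℂ)) z = φ' * dbar (fun w => ((F w : ℝ) : ℂ)) z := by
  have h1 : HasFDerivAt (fun w => ((F w : ℝ) : ℂ)) (Complex.ofRealCLM.comp (fderiv ℝ F z)) z :=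
    Complex.ofRealCLM.hasFDerivAt.comp z hF.hasFDerivAt
  have h2 : HasFDerivAt (fun w => ((φ (F w) : ℝ) : ℂ))
      (Complex.ofRealCLM.comp (φ' • fderiv ℝ F z)) z :=
    Complex.ofRealCLM.hasFDerivAt.comp z (hφ.comp_hasFDerivAt z hF.hasFDerivAt)
  simp only [dbar, h1.fderiv, h2.fderiv, ContinuousLinearMap.comp_apply, smul_apply,
    smul_eq_mul, Complex.ofRealCLM_apply, Complex.ofReal_mul]
  ring

/-- The regularization of `ū u' / (2 |u|)`. -/
def regForm (δ : ℝ) (u : ℂ → ℂ) (z : ℂ) : ℂ :=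
  (1 / 2 : ℂ) * (((√(Complex.normSq (u z) + δ ^ 2))⁻¹ : ℝ) : ℂ) *
    ((starRingEnd ℂ) (u z) * deriv u z)

lemma contDiffAt_normSq_comp {u : ℂ → ℂ} {z : ℂ} {n : WithTop ℕ∞} (hu : ContDiffAt ℝ n u z) :
    ContDiffAt ℝ n (fun w => Complex.normSq (u w)) z := by
  have h1 : ContDiffAt ℝ n (fun w => ‖u w‖ ^ 2) z := hu.norm_sq ℝ
  simpa only [← Complex.normSq_eq_norm_sq] using h1

lemma contDiffAt_regForm {δ : ℝ} (hδ : 0 < δ) {u : ℂ → ℂ} {U : Set ℂ} (hU : IsOpen U)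
    (hu : DifferentiableOn ℂ u U) {z : ℂ} (hz : z ∈ U) : ContDiffAt ℝ 1 (regForm δ u) z := by
  have h1 : ContDiffAt ℝ 1 u z := contDiffAt_real_of_differentiableOn hU hu hz
  have h2 : ContDiffAt ℝ 1 (deriv u) z := contDiffAt_real_of_differentiableOn hU (hu.deriv hU) hz
  have h3 : 0 < Complex.normSq (u z) + δ ^ 2 := by positivity [Complex.normSq_nonneg (u z)]
  have h4 : ContDiffAt ℝ 1 (fun w => (√(Complex.normSq (u w) + δ ^ 2))⁻¹) z :=
    (((contDiffAt_normSq_comp h1).add contDiffAt_const).sqrt h3.ne').inv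
      (Real.sqrt_pos.2 h3).ne'
  exact (contDiffAt_const.mul (Complex.ofRealCLM.contDiff.contDiffAt.comp z h4)).mul
    ((Complex.conjCLE.contDiff.contDiffAt.comp z h1).mul h2)

/-- The function `√(|u|² + δ²)` is subharmonic; here in divergence form. -/
lemma dbar_regForm_nonneg {δ : ℝ} (hδ : 0 < δ) {u : ℂ → ℂ} {U : Set ℂ} (hU : IsOpen U)
    (hu : DifferentiableOn ℂ u U) {z : ℂ} (hz : z ∈ U) :
    ∃ r : ℝ, 0 ≤ r ∧ dbar (regForm δ u) z = r := by
  have hd : DifferentiableAt ℂ u z := hu.differentiableAt (hU.mem_nhds hz)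
  have hd' : DifferentiableAt ℂ (deriv u) z := (hu.deriv hU).differentiableAt (hU.mem_nhds hz)
  have hdR : DifferentiableAt ℝ u z := hd.restrictScalars ℝ
  have h1 : ContDiffAt ℝ 1 u z := contDiffAt_real_of_differentiableOn hU hu hz
  have hN : DifferentiableAt ℝ (fun w => Complex.normSq (u w)) z :=
    (contDiffAt_normSq_comp h1).differentiableAt one_ne_zero
  have hconj : DifferentiableAt ℝ (fun w => (starRingEnd ℂ) (u w)) z :=
    Complex.conjCLE.differentiableAt.comp z hdR
  set N := Complex.normSq (u z) with hNdef
  have hN0 : 0 ≤ N := Complex.normSq_nonneg _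
  have h3 : 0 < N + δ ^ 2 := by positivity
  set v := (√(N + δ ^ 2))⁻¹ with hv
  have hs : 0 < √(N + δ ^ 2) := Real.sqrt_pos.2 h3
  have hφ : HasDerivAt (fun s => (√(s + δ ^ 2))⁻¹) (-(1 / 2) * v ^ 3) N := by
    have h5 := ((((hasDerivAt_id N).add_const (δ ^ 2)).sqrt h3.ne').inv hs.ne')
    refine h5.congr_deriv ?_
    simp only [id, hv]
    field_simp
  have hφN : DifferentiableAt ℝ (fun w => (√(Complex.normSq (u w) + δ ^ 2))⁻¹) z :=
    (HasDerivAt.comp_hasFDerivAt (f := fun w => Complex.normSq (u w)) z hφ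
      hN.hasFDerivAt).differentiableAt
  have hφC : DifferentiableAt ℝ (fun w => (((√(Complex.normSq (u w) + δ ^ 2))⁻¹ : ℝ) : ℂ)) z :=
    Complex.ofRealCLM.differentiableAt.comp z hφN
  have hdN : dbar (fun w => ((Complex.normSq (u w) : ℝ) : ℂ)) z =
      u z * (starRingEnd ℂ) (deriv u z) := by
    have h6 : (fun w => ((Complex.normSq (u w) : ℝ) : ℂ)) =
        fun w => u w * (starRingEnd ℂ) (u w) := by
      ext w; exact (Complex.mul_conj _).symm
    rw [h6, dbar_mul hdR hconj, dbar_conj hd, dbar_of_differentiableAt hd]; ring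
  refine ⟨1 / 2 * Complex.normSq (deriv u z) * v * (1 - 1 / 2 * (N * v ^ 2)), ?_, ?_⟩
  · have hv2 : N * v ^ 2 ≤ 1 := by
      rw [hv, inv_pow, Real.sq_sqrt h3.le, ← div_eq_mul_inv, div_le_one h3]
      linarith [sq_nonneg δ]
    have hv0 : 0 ≤ v := by positivity
    have := Complex.normSq_nonneg (deriv u z)
    have h7 : 0 ≤ 1 - 1 / 2 * (N * v ^ 2) := by linarith
    positivity
  · have hA : DifferentiableAt ℝ
        (fun w => (1 / 2 : ℂ) * (((√(Complex.normSq (u w) + δ ^ 2))⁻¹ : ℝ) : ℂ)) z :=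
      (differentiableAt_const _).mul hφC
    have hB : DifferentiableAt ℝ (fun w => (starRingEnd ℂ) (u w) * deriv u w) z :=
      hconj.mul (hd'.restrictScalars ℝ)
    have hdφ := dbar_ofReal_comp (F := fun w => Complex.normSq (u w)) hN hφ
    rw [hdN] at hdφ
    change dbar (fun w => ((1 / 2 : ℂ) * (((√(Complex.normSq (u w) + δ ^ 2))⁻¹ : ℝ) : ℂ)) *
      ((starRingEnd ℂ) (u w) * deriv u w)) z = _
    rw [dbar_mul hA hB, dbar_mul hconj (hd'.restrictScalars ℝ), dbar_conj hd,
      dbar_of_differentiableAt hd', dbar_mul (differentiableAt_const _) hφC, hdφ,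
      dbar_of_differentiableAt (differentiableAt_const _)]
    have e1 : ((Complex.normSq (deriv u z) : ℝ) : ℂ) = deriv u z * (starRingEnd ℂ) (deriv u z) :=
      (Complex.mul_conj _).symm
    have e2 : ((N : ℝ) : ℂ) = u z * (starRingEnd ℂ) (u z) := (Complex.mul_conj _).symm
    have e3 : (√(Complex.normSq (u z) + δ ^ 2))⁻¹ = v := rfl
    rw [e3]
    clear_value v
    push_cast
    rw [e1, e2]
    ring

/-- If `s² = u` off `K` for a function `u` holomorphic on `U ⊇ K`, then the flux of `|s|²` out of a
neighbourhood of `K` is nonnegative, because `|s|² = |u|` is subharmonic on `U`. -/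
lemma re_integral_conj_mul_deriv_mul_dbar_nonpos {χ s u : ℂ → ℂ} {K U : Set ℂ}
    (hK : IsCompact K) (hU : IsOpen U) (hχ : IsCutoff χ K U) (hs : DifferentiableOn ℂ s (U \ K))
    (hu : DifferentiableOn ℂ u U) (hsu : ∀ z ∈ U \ K, s z ^ 2 = u z) :
    (∫ z, (starRingEnd ℂ) (s z) * deriv s z * dbar χ z).re ≤ 0 := by
  have hUK : IsOpen (U \ K) := hU.sdiff hK.isClosed
  let δ : ℕ → ℝ := fun n => 1 / ((n : ℝ) + 1)
  have hδ : ∀ n, 0 < δ n := fun n => by positivity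
  have hδ0 : Tendsto δ atTop (𝓝 0) := tendsto_one_div_add_atTop_nhds_zero_nat
  have hcd : ∀ n, ContDiff ℝ 1 (fun z => χ z * regForm (δ n) u z) := fun n => by
    refine contDiff_iff_contDiffAt.2 fun z => ?_
    by_cases hz : z ∈ tsupport χ
    · exact (hχ.contDiff.of_le (by exact_mod_cast le_top)).contDiffAt.mul
        (contDiffAt_regForm (hδ n) hU hu (hχ.tsupport_subset hz))
    · refine (contDiffAt_const (c := (0 : ℂ))).congr_of_eventuallyEq ?_
      filter_upwards [IsCutoff.eventually_zero hz] with w hw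
      simp [hw]
  have hcs : ∀ n, HasCompactSupport (fun z => χ z * regForm (δ n) u z) := fun n =>
    hχ.compact.mul_right
  have hreg : ∀ n, ContDiff ℝ 1 (fun z => regForm (δ n) u z * dbar χ z) := fun n =>
    hχ.contDiff_mul_dbar (n := 1) fun z hz => contDiffAt_regForm (hδ n) hU hu hz.1
  have hdb : ∀ n z, dbar (fun z => χ z * regForm (δ n) u z) z =
      χ z * dbar (regForm (δ n) u) z + regForm (δ n) u z * dbar χ z := fun n z => by
    by_cases hz : z ∈ tsupport χ
    · rw [dbar_mul (hχ.differentiable z) ((contDiffAt_regForm (hδ n) hU hu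
        (hχ.tsupport_subset hz)).differentiableAt one_ne_zero)]
      ring
    · rw [dbar_congr (G := fun _ => 0), dbar_of_differentiableAt (differentiableAt_const _),
        image_eq_zero_of_notMem_tsupport hz,
        (IsCutoff.dbar_eventually_zero_of_notMem hz).self_of_nhds]
      · ring
      · filter_upwards [IsCutoff.eventually_zero hz] with w hw
        simp [hw]
  have hneg : ∀ n, (∫ z, regForm (δ n) u z * dbar χ z).re ≤ 0 := by
    intro n
    have h1 := integral_dbar_eq_zero_of_compact (hcd n) (hcs n)
    have hi1 : Integrable (fun z => dbar (fun z => χ z * regForm (δ n) u z) z) :=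
      (continuous_dbar (hcd n)).integrable_of_hasCompactSupport (hasCompactSupport_dbar (hcs n))
    have hi2 : Integrable (fun z => regForm (δ n) u z * dbar χ z) :=
      (hreg n).continuous.integrable_of_hasCompactSupport (hχ.hasCompactSupport_mul_dbar _)
    -- `F δ ∂χ/∂z̄` and `-χ ∂(F δ)/∂z̄` have the same integral, and the latter is nonpositive
    have h2 : ∫ z, regForm (δ n) u z * dbar χ z = - ∫ z, χ z * dbar (regForm (δ n) u) z := by
      have h3 : ∀ z, χ z * dbar (regForm (δ n) u) z =
          dbar (fun z => χ z * regForm (δ n) u z) z - regForm (δ n) u z * dbar χ z := fun z => by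
        rw [hdb]; ring
      simp only [h3]
      rw [integral_sub hi1 hi2, h1]; ring
    have h4 : ∀ z, ∃ r : ℝ, 0 ≤ r ∧ χ z * dbar (regForm (δ n) u) z = r := fun z => by
      obtain ⟨t, ht, hχt⟩ := hχ.mem_Icc z
      by_cases hz : z ∈ tsupport χ
      · obtain ⟨r, hr, hr2⟩ := dbar_regForm_nonneg (hδ n) hU hu (hχ.tsupport_subset hz)
        exact ⟨t * r, mul_nonneg ht.1 hr, by rw [hχt, hr2]; push_cast; ring⟩
      · exact ⟨0, le_rfl, by rw [image_eq_zero_of_notMem_tsupport hz]; simp⟩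
    choose r hr0 hr using h4
    rw [h2]
    simp only [hr]
    rw [show ∫ z, ((r z : ℝ) : ℂ) = ((∫ z, r z : ℝ) : ℂ) from integral_ofReal, Complex.neg_re,
      Complex.ofReal_re]
    exact neg_nonpos.2 (integral_nonneg hr0)
  have hlim : Tendsto (fun n => ∫ z, regForm (δ n) u z * dbar χ z) atTop
      (𝓝 (∫ z, (starRingEnd ℂ) (s z) * deriv s z * dbar χ z)) := by
    have hbd : ContDiff ℝ 1 (fun z => deriv u z * dbar χ z) := hχ.contDiff_mul_dbar (n := 1)
      fun z hz => contDiffAt_real_of_differentiableOn hU (hu.deriv hU) hz.1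
    -- dominated convergence as `δ → 0`; the limit of the regularized forms is the derivative of `s`
    -- times the conjugate of `s`, because `u = s ^ 2`
    refine tendsto_integral_of_dominated_convergence (fun z => ‖deriv u z * dbar χ z‖)
      (fun n => (hreg n).continuous.aestronglyMeasurable)
      (hbd.continuous.integrable_of_hasCompactSupport (hχ.hasCompactSupport_mul_dbar _)).norm
      (fun n => Eventually.of_forall fun z => ?_) (Eventually.of_forall fun z => ?_)
    · rw [norm_mul, norm_mul]
      refine mul_le_mul_of_nonneg_right ?_ (norm_nonneg _)
      rw [regForm, norm_mul, norm_mul, norm_mul, Complex.norm_real, RCLike.norm_conj, norm_inv,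
        Real.norm_eq_abs, abs_of_nonneg (Real.sqrt_nonneg _)]
      have h5 : ‖u z‖ ≤ √(Complex.normSq (u z) + δ n ^ 2) := by
        refine Real.le_sqrt_of_sq_le ?_
        rw [Complex.normSq_eq_norm_sq]
        linarith [sq_nonneg (δ n)]
      have h6 : (√(Complex.normSq (u z) + δ n ^ 2))⁻¹ * ‖u z‖ ≤ 1 := by
        rw [inv_mul_le_iff₀ (by positivity [hδ n, Complex.normSq_nonneg (u z)])]
        linarith
      have h7 : ‖(1 / 2 : ℂ)‖ = 1 / 2 := by norm_num
      rw [h7]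
      nlinarith [norm_nonneg (deriv u z), mul_le_mul_of_nonneg_right h6 (norm_nonneg (deriv u z))]
    · by_cases hzU : z ∈ tsupport χ
      swap
      · simp [(IsCutoff.dbar_eventually_zero_of_notMem hzU).self_of_nhds]
      by_cases hzK : z ∈ K
      · simp [(hχ.dbar_eventually_zero_of_mem hzK).self_of_nhds]
      have hz : z ∈ U \ K := ⟨hχ.tsupport_subset hzU, hzK⟩
      refine Tendsto.mul_const _ ?_
      have hsd : DifferentiableAt ℂ s z := hs.differentiableAt (hUK.mem_nhds hz)
      have hu' : deriv u z = 2 * s z * deriv s z := by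
        have h8 : u =ᶠ[𝓝 z] fun w => s w ^ 2 := by
          filter_upwards [hUK.mem_nhds hz] with w hw
          exact (hsu w hw).symm
        rw [h8.deriv_eq]
        have := (hsd.hasDerivAt.fun_pow 2).deriv
        simpa using this
      by_cases hs0 : s z = 0
      · have h9 : u z = 0 := by rw [← hsu z hz, hs0]; simp
        simp [regForm, h9, hs0]
      · have hns : 0 < Complex.normSq (s z) := Complex.normSq_pos.2 hs0
        have h10 : Complex.normSq (u z) = Complex.normSq (s z) ^ 2 := by
          rw [← hsu z hz, map_pow]
        have h11 : Tendsto (fun n => (√(Complex.normSq (u z) + δ n ^ 2))⁻¹) atTop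
            (𝓝 (Complex.normSq (s z))⁻¹) := by
          have h12 : Tendsto (fun n => Complex.normSq (u z) + δ n ^ 2) atTop
              (𝓝 (Complex.normSq (u z) + 0 ^ 2)) := tendsto_const_nhds.add (hδ0.pow 2)
          have h13 := ((Real.continuous_sqrt.tendsto _).comp h12)
          rw [h10, zero_pow two_ne_zero, add_zero, Real.sqrt_sq hns.le] at h13
          rw [h10]
          exact h13.inv₀ hns.ne'
        have h14 := (((Complex.continuous_ofReal.tendsto _).comp h11).const_mul (1 / 2 : ℂ)).mul_const
          ((starRingEnd ℂ) (u z) * deriv u z)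
        have h15 : (1 / 2 : ℂ) * (((Complex.normSq (s z))⁻¹ : ℝ) : ℂ) *
            ((starRingEnd ℂ) (u z) * deriv u z) = (starRingEnd ℂ) (s z) * deriv s z := by
          rw [hu', ← hsu z hz, map_pow, Complex.ofReal_inv, Complex.normSq_eq_conj_mul_self]
          have : (starRingEnd ℂ) (s z) ≠ 0 := by simpa using hs0
          field_simp
        rw [h15] at h14
        exact h14
  exact le_of_tendsto ((Complex.continuous_re.tendsto _).comp hlim) (Eventually.of_forall hneg)

end ZS

namespace ZS

/-! ### Functions holomorphic off finitely many compact sets -/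

lemma eventually_notMem_of_isCompact {K : Set ℂ} (hK : IsCompact K) :
    ∀ᶠ z in Bornology.cobounded ℂ, z ∉ K := by
  rw [Metric.cobounded_eq_cocompact]; exact hK.compl_mem_cocompact

section Localization

variable {ι : Type*} [Fintype ι] {K U : ι → Set ℂ} {χ : ι → ℂ → ℂ} {f : ℂ → ℂ}

lemma IsCutoff.eq_zero_of_notMem {χ : ℂ → ℂ} {K U : Set ℂ} (h : IsCutoff χ K U) {z : ℂ}
    (hz : z ∉ U) : χ z = 0 :=
  image_eq_zero_of_notMem_tsupport fun h' => hz (h.tsupport_subset h')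

lemma sum_cutoff_of_mem (hχ : ∀ k, IsCutoff (χ k) (K k) (U k)) (hd : Pairwise (Function.onFun Disjoint U))
    {k : ι} {z : ℂ} (hz : z ∈ U k) : ∑ j, χ j z = χ k z :=
  Finset.sum_eq_single k (fun j _ hj => (hχ j).eq_zero_of_notMem fun h =>
    (hd hj).le_bot ⟨h, hz⟩) (by simp)

lemma isClosed_iUnion_compact (hK : ∀ k, IsCompact (K k)) : IsClosed (⋃ k, K k) :=
  isClosed_iUnion_of_finite fun k => (hK k).isClosed

omit [Fintype ι] in
lemma sdiff_subset_compl_iUnion (hKU : ∀ k, K k ⊆ U k) (hd : Pairwise (Function.onFun Disjoint U)) (k : ι) :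
    U k \ K k ⊆ (⋃ k, K k)ᶜ := by
  intro z hz hz'
  obtain ⟨j, hj⟩ := mem_iUnion.1 hz'
  by_cases hjk : j = k
  · exact hz.2 (hjk ▸ hj)
  · exact (hd hjk).le_bot ⟨hKU j hj, hz.1⟩

lemma isOpen_compl_tsupport (χ : ι → ℂ → ℂ) : IsOpen (⋃ k, tsupport (χ k))ᶜ :=
  (isClosed_iUnion_of_finite fun _ => isClosed_tsupport _).isOpen_compl

variable (hK : ∀ k, IsCompact (K k)) (hU : ∀ k, IsOpen (U k)) (hKU : ∀ k, K k ⊆ U k)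
  (hd : Pairwise (Function.onFun Disjoint U)) (hχ : ∀ k, IsCutoff (χ k) (K k) (U k))
  (hf : DifferentiableOn ℂ f (⋃ k, K k)ᶜ)

include hK hU hKU hd hχ hf

omit [Fintype ι] in
lemma contDiff_mul_dbar_cutoff (k : ι) {n : ℕ∞} :
    ContDiff ℝ n (fun w => f w * dbar (χ k) w) :=
  (hχ k).contDiff_mul_dbar fun _ hz =>
    contDiffAt_real_of_differentiableOn ((hU k).sdiff (hK k).isClosed)
      (hf.mono (sdiff_subset_compl_iUnion hKU hd k)) hz

omit [Fintype ι] in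
lemma integrable_mul_dbar_cutoff (k : ι) : Integrable (fun w => f w * dbar (χ k) w) :=
  (contDiff_mul_dbar_cutoff hK hU hKU hd hχ hf k (n := 1)).continuous.integrable_of_hasCompactSupport
    ((hχ k).hasCompactSupport_mul_dbar f)

/-- A function that is holomorphic off finitely many compact sets and vanishes at infinity is a sum
of Cauchy transforms of densities near these sets. -/
lemma sub_sum_cutoff_mul_eq (hlim : Tendsto f (Bornology.cobounded ℂ) (𝓝 0)) (z : ℂ) :
    (1 - ∑ k, χ k z) * f z = - ∑ k, cauchyTransform (fun w => f w * dbar (χ k) w) z := by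
  classical
  have hh := fun k => contDiff_mul_dbar_cutoff hK hU hKU hd hχ hf k (n := 1)
  have hc := fun k => (hχ k).hasCompactSupport_mul_dbar f
  let F : ℂ → ℂ := fun z =>
    (1 - ∑ k, χ k z) * f z + ∑ k, cauchyTransform (fun w => f w * dbar (χ k) w) z
  have hC : ∀ k z, z ∉ tsupport (χ k) →
      DifferentiableAt ℂ (cauchyTransform (fun w => f w * dbar (χ k) w)) z := fun k z hz =>
    (differentiableOn_cauchyTransform (hh k) (hc k)).differentiableAt
      ((isClosed_tsupport _).isOpen_compl.mem_nhds fun h =>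
        hz ((hχ k).tsupport_mul_dbar_subset f h).1)
  have hF : Differentiable ℂ F := by
    intro z
    by_cases hz : ∃ k, z ∈ U k
    · obtain ⟨k, hk⟩ := hz
      have h1 : F =ᶠ[𝓝 z] fun z => innerPart (χ k) f z + ∑ j ∈ Finset.univ.erase k,
          cauchyTransform (fun w => f w * dbar (χ j) w) z := by
        filter_upwards [(hU k).mem_nhds hk] with w hw
        simp only [F, innerPart]
        rw [sum_cutoff_of_mem hχ hd hw, add_assoc, Finset.add_sum_erase Finset.univ
          (fun j => cauchyTransform (fun w => f w * dbar (χ j) w) w) (Finset.mem_univ k)]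
      refine DifferentiableAt.congr_of_eventuallyEq ?_ h1
      refine DifferentiableAt.add ((differentiableOn_innerPart (hχ k) (hK k) (hU k)
        (hf.mono (sdiff_subset_compl_iUnion hKU hd k))).differentiableAt ((hU k).mem_nhds hk))
        (DifferentiableAt.fun_sum fun j hj => hC j z fun h => ?_)
      exact (hd (Finset.ne_of_mem_erase hj)).le_bot ⟨(hχ j).tsupport_subset h, hk⟩
    · push Not at hz
      have hz' : z ∈ (⋃ k, tsupport (χ k))ᶜ := fun h => by
        obtain ⟨k, hk⟩ := mem_iUnion.1 h
        exact hz k ((hχ k).tsupport_subset hk)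
      have h1 : F =ᶠ[𝓝 z] fun z => f z + ∑ k, cauchyTransform (fun w => f w * dbar (χ k) w) z := by
        filter_upwards [(isOpen_compl_tsupport χ).mem_nhds hz'] with w hw
        have : ∑ k, χ k w = 0 := Finset.sum_eq_zero fun k _ =>
          image_eq_zero_of_notMem_tsupport fun h => hw (mem_iUnion.2 ⟨k, h⟩)
        simp [F, this]
      refine DifferentiableAt.congr_of_eventuallyEq ?_ h1
      refine DifferentiableAt.add (hf.differentiableAt
        ((isClosed_iUnion_compact hK).isOpen_compl.mem_nhds fun h => ?_))
        (DifferentiableAt.fun_sum fun j _ => hC j z fun h => hz j ((hχ j).tsupport_subset h))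
      obtain ⟨k, hk⟩ := mem_iUnion.1 h
      exact hz k (hKU k hk)
  have hFlim : Tendsto F (Bornology.cobounded ℂ) (𝓝 0) := by
    have h2 : Tendsto (fun z => f z + ∑ k, cauchyTransform (fun w => f w * dbar (χ k) w) z)
        (Bornology.cobounded ℂ) (𝓝 (0 + ∑ _k : ι, 0)) :=
      hlim.add (tendsto_finsetSum _ fun k _ => tendsto_zero_of_tendsto_mul
        (tendsto_mul_cauchyTransform (hh k).continuous (hc k)))
    rw [Finset.sum_const_zero, add_zero] at h2
    refine h2.congr' ?_
    have hb : IsCompact (⋃ k, tsupport (χ k)) := isCompact_iUnion fun k => (hχ k).compact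
    filter_upwards [eventually_notMem_of_isCompact hb] with w hw
    have : ∑ k, χ k w = 0 := Finset.sum_eq_zero fun k _ =>
      image_eq_zero_of_notMem_tsupport fun h => hw (mem_iUnion.2 ⟨k, h⟩)
    simp [F, this]
  rw [Metric.cobounded_eq_cocompact] at hFlim
  exact eq_neg_of_add_eq_zero_left (hF.apply_eq_of_tendsto_cocompact z hFlim)

lemma eq_neg_sum_cauchyTransform (hlim : Tendsto f (Bornology.cobounded ℂ) (𝓝 0)) {z : ℂ}
    (hz : ∀ k, z ∉ tsupport (χ k)) :
    f z = - ∑ k, cauchyTransform (fun w => f w * dbar (χ k) w) z := by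
  rw [← sub_sum_cutoff_mul_eq hK hU hKU hd hχ hf hlim z,
    Finset.sum_eq_zero fun k _ => image_eq_zero_of_notMem_tsupport (hz k)]
  simp

lemma tendsto_mul_of_tendsto_zero (hlim : Tendsto f (Bornology.cobounded ℂ) (𝓝 0)) :
    Tendsto (fun z => z * f z) (Bornology.cobounded ℂ)
      (𝓝 (-((Real.pi : ℂ)⁻¹ * ∑ k, ∫ w, f w * dbar (χ k) w))) := by
  have h1 : Tendsto (fun z => ∑ k, z * cauchyTransform (fun w => f w * dbar (χ k) w) z)
      (Bornology.cobounded ℂ) (𝓝 (∑ k, (Real.pi : ℂ)⁻¹ * ∫ w, f w * dbar (χ k) w)) :=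
    tendsto_finsetSum _ fun k _ => tendsto_mul_cauchyTransform
      (contDiff_mul_dbar_cutoff hK hU hKU hd hχ hf k (n := 1)).continuous
      ((hχ k).hasCompactSupport_mul_dbar f)
  rw [← Finset.mul_sum] at h1
  refine h1.neg.congr' ?_
  have hb : IsCompact (⋃ k, tsupport (χ k)) := isCompact_iUnion fun k => (hχ k).compact
  filter_upwards [eventually_notMem_of_isCompact hb] with w hw
  rw [eq_neg_sum_cauchyTransform hK hU hKU hd hχ hf hlim fun k h => hw (mem_iUnion.2 ⟨k, h⟩),
    ← Finset.mul_sum]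
  ring

/-- The residue theorem, with densities near the singular sets in place of residues. -/
lemma integral_comp_mul_deriv_eq_sum (hlim : Tendsto f (Bornology.cobounded ℂ) (𝓝 0)) {γ : ℝ → ℂ}
    (hγ : ContDiff ℝ 1 γ) (hγU : ∀ k, Disjoint (range γ) (U k)) {c : ι → ℂ}
    (hind : ∀ k, ∀ ζ ∈ U k,
      (2 * Real.pi * Complex.I)⁻¹ * ∫ t in (0 : ℝ)..1, deriv γ t / (γ t - ζ) = c k) :
    ∫ t in (0 : ℝ)..1, f (γ t) * deriv γ t =
      - ∑ k, 2 * Complex.I * c k * ∫ w, f w * dbar (χ k) w := by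
  have hh := fun k => contDiff_mul_dbar_cutoff hK hU hKU hd hχ hf k (n := 1)
  have hc := fun k => (hχ k).hasCompactSupport_mul_dbar f
  have hts : ∀ k, tsupport (fun w => f w * dbar (χ k) w) ⊆ U k := fun k z hz =>
    (hχ k).tsupport_subset ((hχ k).tsupport_mul_dbar_subset f hz).1
  have h1 : ∀ t, f (γ t) * deriv γ t =
      - ∑ k, cauchyTransform (fun w => f w * dbar (χ k) w) (γ t) * deriv γ t := fun t => by
    rw [eq_neg_sum_cauchyTransform hK hU hKU hd hχ hf hlim fun k h =>
      (hγU k).le_bot ⟨mem_range_self t, (hχ k).tsupport_subset h⟩, neg_mul, Finset.sum_mul]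
  simp only [h1]
  rw [intervalIntegral.integral_neg, intervalIntegral.integral_finsetSum]
  · congr 1
    refine Finset.sum_congr rfl fun k _ => ?_
    exact integral_cauchyTransform_curve hγ (hh k).continuous (hc k)
      ((hγU k).mono_right (hts k)) fun ζ hζ => hind k ζ (hts k hζ)
  · intro k _
    exact (((contDiff_cauchyTransform (n := 1) (hh k) (hc k)).continuous.comp
      hγ.continuous).mul hγ.continuous_deriv_one).intervalIntegrable _ _

end Localization

/-- If `f = q / y` with `q` holomorphic on `U` and `y² = (z - a)(z - b)`, then a primitive of `f`
on `U \ K` is, up to a constant, a square root of a function that is holomorphic on `U`. -/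
lemma exists_sq_eq_of_primitive {K U : Set ℂ} (hK : IsCompact K) (hU : IsOpen U) (hKU : K ⊆ U)
    (hKc : IsPreconnected Kᶜ) {a b : ℂ} (ha : a ∈ K) (hb : b ∈ K) {y q f g : ℂ → ℂ}
    (hy : DifferentiableOn ℂ y Kᶜ) (hy2 : ∀ z ∉ K, y z ^ 2 = (z - a) * (z - b))
    (hylim : Tendsto (fun z => y z / z) (Bornology.cobounded ℂ) (𝓝 (-1)))
    (hq : DifferentiableOn ℂ q U) (hfq : ∀ z ∈ U \ K, f z * y z = q z)
    (hg : ∀ z ∈ U \ K, HasDerivAt g (f z) z) :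
    ∃ (α : ℂ) (u : ℂ → ℂ), DifferentiableOn ℂ u U ∧ ∀ z ∈ U \ K, (g z - α) ^ 2 = u z := by
  have hUK : IsOpen (U \ K) := hU.sdiff hK.isClosed
  have hKo : IsOpen Kᶜ := hK.isClosed.isOpen_compl
  obtain ⟨χ, hχ⟩ := exists_isCutoff hK hU hKU
  have hy0 : ∀ z ∉ K, y z ≠ 0 := fun z hz h => by
    have := hy2 z hz
    rw [h, zero_pow two_ne_zero] at this
    rcases mul_eq_zero.1 this.symm with h | h
    · exact hz (sub_eq_zero.1 h ▸ ha)
    · exact hz (sub_eq_zero.1 h ▸ hb)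
  have hyd : ∀ z ∉ K, DifferentiableAt ℂ y z := fun z hz => hy.differentiableAt (hKo.mem_nhds hz)
  have hyy : ∀ z ∉ K, y z * deriv y z = (2 * z - a - b) / 2 := fun z hz => by
    have h1 : HasDerivAt (fun w => y w ^ 2) (2 * y z * deriv y z) z := by
      simpa using (hyd z hz).hasDerivAt.fun_pow 2
    have h2 : HasDerivAt (fun w => (w - a) * (w - b)) (1 * (z - b) + (z - a) * 1) z :=
      ((hasDerivAt_id z).sub_const a).mul ((hasDerivAt_id z).sub_const b)
    have h3 : (fun w => y w ^ 2) =ᶠ[𝓝 z] fun w => (w - a) * (w - b) := by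
      filter_upwards [hKo.mem_nhds hz] with w hw using hy2 w hw
    have := h1.unique (h2.congr_of_eventuallyEq h3)
    linear_combination this / 2
  let N : ℂ → ℂ := fun z => g z / y z
  have hN : DifferentiableOn ℂ N (U \ K) := fun z hz =>
    ((hg z hz).differentiableAt.div (hyd z hz.2) (hy0 z hz.2)).differentiableWithinAt
  -- `N = r₁ + r₂` with `r₁` holomorphic on `U` and `r₂` holomorphic off `K`, zero at infinity
  set r₁ := innerPart χ N with hr₁
  set r₂ := outerPart χ N with hr₂
  have h1 : DifferentiableOn ℂ r₁ U := differentiableOn_innerPart hχ hK hU hN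
  have h2 : DifferentiableOn ℂ r₂ Kᶜ := differentiableOn_outerPart hχ hK hU hN
  have hd1 : ∀ z ∈ U, DifferentiableAt ℂ r₁ z := fun z hz => h1.differentiableAt (hU.mem_nhds hz)
  have hd2 : ∀ z ∉ K, DifferentiableAt ℂ r₂ z := fun z hz => h2.differentiableAt (hKo.mem_nhds hz)
  -- off `K`, the operator is `D r = y (y r)'`; its coefficients are polynomials
  let D : (ℂ → ℂ) → ℂ → ℂ := fun r z =>
    (z - a) * (z - b) * deriv r z + (2 * z - a - b) / 2 * r z
  have hDp : ∀ r : ℂ → ℂ, ∀ z ∉ K, DifferentiableAt ℂ r z →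
      y z * deriv (fun w => y w * r w) z = D r z := fun r z hz hr => by
    have e : deriv (fun w => y w * r w) z = deriv y z * r z + y z * deriv r z :=
      ((hyd z hz).hasDerivAt.mul hr.hasDerivAt).deriv
    rw [e]
    simp only [D]
    rw [← hyy z hz, ← hy2 z hz]; ring
  -- `D N = q` on `U \ K`, so that `q - D r₁` and `D r₂` are two pieces of one entire function
  have hsum : ∀ z ∈ U \ K, D r₁ z + D r₂ z = q z := fun z hz => by
    have e1 : N =ᶠ[𝓝 z] fun w => r₁ w + r₂ w :=
      Eventually.of_forall fun w => (innerPart_add_outerPart χ N w).symm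
    have e2 : deriv N z = deriv r₁ z + deriv r₂ z := by
      rw [e1.deriv_eq]; exact ((hd1 z hz.1).hasDerivAt.add (hd2 z hz.2).hasDerivAt).deriv
    have e3 : D N z = q z := by
      rw [← hDp N z hz.2 (hN.differentiableAt (hUK.mem_nhds hz)), ← hfq z hz]
      have e4 : (fun w => y w * N w) =ᶠ[𝓝 z] g := by
        filter_upwards [hUK.mem_nhds hz] with w hw
        exact mul_div_cancel₀ _ (hy0 w hw.2)
      rw [e4.deriv_eq, (hg z hz).deriv]; ring
    rw [← e3]
    simp only [D]
    rw [e2, e1.self_of_nhds]; ring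
  have hDd : ∀ {r : ℂ → ℂ} {V : Set ℂ}, IsOpen V → DifferentiableOn ℂ r V →
      DifferentiableOn ℂ (D r) V := fun hV hr => by
    refine DifferentiableOn.add (DifferentiableOn.mul ?_ (hr.deriv hV)) (DifferentiableOn.mul ?_ hr)
    all_goals fun_prop
  classical
  let E : ℂ → ℂ := fun z => if z ∈ U then q z - D r₁ z else D r₂ z
  have hE2 : ∀ z ∉ K, E z = D r₂ z := fun z hz => by
    by_cases hzU : z ∈ U
    · simp only [E, if_pos hzU]; rw [← hsum z ⟨hzU, hz⟩]; ring
    · simp only [E, if_neg hzU]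
  have hE : Differentiable ℂ E := by
    intro z
    by_cases hz : z ∈ U
    · refine ((hq.sub (hDd hU h1)).differentiableAt (hU.mem_nhds hz)).congr_of_eventuallyEq ?_
      filter_upwards [hU.mem_nhds hz] with w hw
      simp only [E, if_pos hw]; rfl
    · have hzK : z ∈ Kᶜ := fun h => hz (hKU h)
      refine ((hDd hKo h2).differentiableAt (hKo.mem_nhds hzK)).congr_of_eventuallyEq ?_
      filter_upwards [hKo.mem_nhds hzK] with w hw using hE2 w hw
  have hKinf : ∀ᶠ z in Bornology.cobounded ℂ, z ∉ K := eventually_notMem_of_isCompact hK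
  have hne0 : ∀ᶠ z in Bornology.cobounded ℂ, z ≠ (0 : ℂ) := by
    filter_upwards [(tendsto_norm_cobounded_atTop (E := ℂ)).eventually_gt_atTop 0] with w hw
    exact norm_pos_iff.1 hw
  have hp : Tendsto (fun z => y z * r₂ z) (Bornology.cobounded ℂ)
      (𝓝 (-1 * -((Real.pi : ℂ)⁻¹ * ∫ w, N w * dbar χ w))) := by
    refine (hylim.mul (tendsto_mul_outerPart hχ hK hU hN)).congr' ?_
    filter_upwards [hne0] with z hz
    rw [← hr₂]
    field_simp
  have hpd : ∀ z ∉ K, DifferentiableAt ℂ (fun z => y z * r₂ z) z := fun z hz =>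
    (hyd z hz).mul (hd2 z hz)
  -- `y r₂` is bounded near infinity, so that `D r₂ = y (y r₂)'` vanishes there
  have hElim : Tendsto E (Bornology.cobounded ℂ) (𝓝 0) := by
    have h5 := hylim.mul (tendsto_mul_deriv_cobounded (hKinf.mono hpd) hp)
    rw [mul_zero] at h5
    refine h5.congr' ?_
    filter_upwards [hne0, hKinf] with z hz hzK
    rw [hE2 z hzK, ← hDp r₂ z hzK (hd2 z hzK)]
    field_simp
  have hE0 : ∀ z, E z = 0 := fun z => by
    rw [Metric.cobounded_eq_cocompact] at hElim
    exact hE.apply_eq_of_tendsto_cocompact z hElim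
  -- since `D r₂ = 0`, the function `y r₂` is constant on the connected complement of `K`
  have hconst : ∃ α, ∀ z ∉ K, y z * r₂ z = α := by
    by_cases hKe : Kᶜ.Nonempty
    · obtain ⟨w, hw⟩ := hKe
      refine ⟨y w * r₂ w, fun z hz => ?_⟩
      refine hKo.is_const_of_deriv_eq_zero hKc (f := fun z => y z * r₂ z)
        (fun z hz => (hpd z hz).differentiableWithinAt) (fun v hv => ?_) hz hw
      have h6 := hDp r₂ v hv (hd2 v hv)
      rw [← hE2 v hv, hE0] at h6
      exact (mul_eq_zero.1 h6).resolve_left (hy0 v hv)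
    · exact ⟨0, fun z hz => absurd ⟨z, hz⟩ hKe⟩
  obtain ⟨α, hα⟩ := hconst
  -- `g - α = y r₁`
  refine ⟨α, fun z => (z - a) * (z - b) * r₁ z ^ 2, ?_, fun z hz => ?_⟩
  · refine DifferentiableOn.mul ?_ (h1.pow 2)
    fun_prop
  · have e5 : y z * (r₁ z + r₂ z) = g z := by
      rw [innerPart_add_outerPart]; exact mul_div_cancel₀ _ (hy0 z hz.2)
    change _ = (z - a) * (z - b) * r₁ z ^ 2
    rw [← hα z hz.2, ← e5, ← hy2 z hz.2]; ring

end ZS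

namespace ZS

/-! ### Differentials with vanishing periods -/

/-- The flux of `f` through `U \ S` does not depend on the cutoff. -/
lemma integral_mul_dbar_eq_of_cutoff {S K U : Set ℂ} {χ ψ f : ℂ → ℂ} (hS : IsCompact S) (hU : IsOpen U)
    (hSK : S ⊆ K) (hχ : IsCutoff χ S U) (hψ : IsCutoff ψ K U)
    (hf : DifferentiableOn ℂ f (U \ S)) :
    ∫ z, f z * dbar ψ z = ∫ z, f z * dbar χ z := by
  have hUS : IsOpen (U \ S) := hU.sdiff hS.isClosed
  have hψ' : IsCutoff ψ S U := ⟨hψ.contDiff, hψ.compact, hψ.tsupport_subset,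
    hψ.eq_one.filter_mono (nhdsSet_mono hSK), hψ.mem_Icc⟩
  have hfr : ∀ z ∈ U \ S, ContDiffAt ℝ 1 f z := fun z hz =>
    contDiffAt_real_of_differentiableOn hUS hf hz
  let F : ℂ → ℂ := fun z => f z * (ψ z - χ z)
  have hz0 : ∀ z, z ∉ U \ S → F =ᶠ[𝓝 z] fun _ => 0 := fun z hz => by
    by_cases hzS : z ∈ S
    · filter_upwards [hχ.eventually_one hzS, hψ'.eventually_one hzS] with w h1 h2
      simp [F, h1, h2]
    · have hzU : z ∉ U := fun h => hz ⟨h, hzS⟩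
      filter_upwards [IsCutoff.eventually_zero fun h => hzU (hχ.tsupport_subset h),
        IsCutoff.eventually_zero fun h => hzU (hψ.tsupport_subset h)] with w h1 h2
      simp [F, h1, h2]
  have hcχ : ContDiff ℝ 1 χ := hχ.contDiff.of_le (by exact_mod_cast le_top)
  have hcψ : ContDiff ℝ 1 ψ := hψ.contDiff.of_le (by exact_mod_cast le_top)
  have hF : ContDiff ℝ 1 F := by
    refine contDiff_iff_contDiffAt.2 fun z => ?_
    by_cases hz : z ∈ U \ S
    · exact (hfr z hz).mul (hcψ.contDiffAt.sub hcχ.contDiffAt)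
    · exact (contDiffAt_const (c := (0 : ℂ))).congr_of_eventuallyEq (hz0 z hz)
  have hFc : HasCompactSupport F := (hψ.compact.sub hχ.compact).mul_left
  have hdF : ∀ z, dbar F z = f z * dbar ψ z - f z * dbar χ z := fun z => by
    by_cases hz : z ∈ U \ S
    · change dbar (fun w => f w * (ψ w - χ w)) z = _
      rw [dbar_mul (G := fun w => ψ w - χ w) ((hfr z hz).differentiableAt one_ne_zero)
        ((hψ.differentiable z).sub (hχ.differentiable z)),
        dbar_sub (hψ.differentiable z) (hχ.differentiable z),
        dbar_of_differentiableAt (hf.differentiableAt (hUS.mem_nhds hz))]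
      ring
    · rw [dbar_congr (hz0 z hz), dbar_of_differentiableAt (differentiableAt_const _)]
      by_cases hzS : z ∈ S
      · rw [(hχ.dbar_eventually_zero_of_mem hzS).self_of_nhds,
          (hψ'.dbar_eventually_zero_of_mem hzS).self_of_nhds]; ring
      · have hzU : z ∉ U := fun h => hz ⟨h, hzS⟩
        rw [(IsCutoff.dbar_eventually_zero_of_notMem fun h =>
          hzU (hχ.tsupport_subset h)).self_of_nhds,
          (IsCutoff.dbar_eventually_zero_of_notMem fun h =>
          hzU (hψ.tsupport_subset h)).self_of_nhds]; ring
  have hint : ∀ {φ : ℂ → ℂ}, IsCutoff φ S U → Integrable (fun z => f z * dbar φ z) := fun hφ =>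
    (hφ.contDiff_mul_dbar (n := 1) hfr).continuous.integrable_of_hasCompactSupport
      (hφ.hasCompactSupport_mul_dbar f)
  have h := integral_dbar_eq_zero_of_compact hF hFc
  simp only [hdF] at h
  rw [integral_sub (hint hψ') (hint hχ)] at h
  exact sub_eq_zero.1 h

/-- Arcs `G k` in pairwise disjoint bounded open sets `U k` without holes, together with square roots
`y k` of `(z - G k 0) (z - G k 1)` that are holomorphic off the arcs. -/
structure IsCutSystem {ι : Type*} (G : ι → ℝ → ℂ) (U : ι → Set ℂ) (y : ι → ℂ → ℂ) : Prop where
  contDiffOn : ∀ k, ContDiffOn ℝ 1 (G k) (Icc 0 1)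
  isOpen : ∀ k, IsOpen (U k)
  isBounded : ∀ k, Bornology.IsBounded (U k)
  isPreconnected : ∀ k, IsPreconnected (U k)ᶜ
  arc_subset : ∀ k, G k '' Icc 0 1 ⊆ U k
  disjoint : Pairwise (Function.onFun Disjoint U)
  differentiableOn : ∀ k, DifferentiableOn ℂ (y k) (G k '' Icc 0 1)ᶜ
  sq_eq : ∀ k, ∀ z ∉ G k '' Icc 0 1, y k z ^ 2 = (z - G k 0) * (z - G k 1)
  tendsto : ∀ k, Tendsto (fun z => y k z / z) (Bornology.cobounded ℂ) (𝓝 (-1))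

namespace IsCutSystem

variable {ι : Type*} [Fintype ι] {G : ι → ℝ → ℂ} {U : ι → Set ℂ} {y : ι → ℂ → ℂ} {f : ℂ → ℂ}

omit [Fintype ι] in
lemma isCompact_arc (h : IsCutSystem G U y) (k : ι) : IsCompact (G k '' Icc 0 1) :=
  isCompact_Icc.image_of_continuousOn (h.contDiffOn k).continuousOn

/-- A differential of the second kind on the curve all of whose periods vanish is zero:
Riemann's bilinear relation for a single-valued primitive. -/
lemma eventually_eq_zero (h : IsCutSystem G U y)
    (hf : DifferentiableOn ℂ f (⋃ k, G k '' Icc 0 1)ᶜ)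
    (hO : f =O[Bornology.cobounded ℂ] fun z => z⁻¹ ^ 2)
    (hq : ∀ k, ∃ q, DifferentiableOn ℂ q (U k) ∧ ∀ z ∈ U k \ G k '' Icc 0 1, f z * y k z = q z)
    (hper : ∀ k, ∃ χ, IsCutoff χ (G k '' Icc 0 1) (U k) ∧ ∫ z, f z * dbar χ z = 0) :
    ∀ᶠ z in Bornology.cobounded ℂ, f z = 0 := by
  classical
  have hS := h.isCompact_arc
  -- thickened cuts `K`; the supports of the cutoffs `χ` are close enough to the arcs for
  -- `exists_primitive_of_arc`, and the cutoffs `ψ` are `1` on the thickened cuts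
  choose δ hδ K hK hTK hKU hKc using fun k =>
    exists_full_compact (hS k) (h.isOpen k) (h.isBounded k) (h.isPreconnected k) (h.arc_subset k)
  have hSK : ∀ k, G k '' Icc 0 1 ⊆ K k := fun k =>
    (Metric.self_subset_cthickening _).trans (hTK k)
  have hfK : DifferentiableOn ℂ f (⋃ k, K k)ᶜ :=
    hf.mono (compl_subset_compl.2 (iUnion_mono hSK))
  have hfU : ∀ k, DifferentiableOn ℂ f (U k \ G k '' Icc 0 1) := fun k =>
    hf.mono (sdiff_subset_compl_iUnion h.arc_subset h.disjoint k)
  have hflim : Tendsto f (Bornology.cobounded ℂ) (𝓝 0) := by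
    refine hO.trans_tendsto ?_
    simpa using (tendsto_inv₀_cobounded (α := ℂ)).pow 2
  choose χ hχ' using fun k => exists_isCutoff (hS k)
    ((Metric.isOpen_thickening (δ := δ k / 2) (E := G k '' Icc 0 1)).inter (h.isOpen k))
    (subset_inter (Metric.self_subset_thickening (by have := hδ k; positivity) _) (h.arc_subset k))
  have hχ : ∀ k, IsCutoff (χ k) (G k '' Icc 0 1) (U k) := fun k =>
    ⟨(hχ' k).contDiff, (hχ' k).compact, (hχ' k).tsupport_subset.trans inter_subset_right,
      (hχ' k).eq_one, (hχ' k).mem_Icc⟩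
  choose ψ hψ using fun k => exists_isCutoff (hK k) (h.isOpen k) (hKU k)
  have hχ0 : ∀ k, ∫ z, f z * dbar (χ k) z = 0 := fun k => by
    obtain ⟨φ, hφ, hφ0⟩ := hper k
    rw [← hφ0, integral_mul_dbar_eq_of_cutoff (hS k) (h.isOpen k) Subset.rfl hφ (hχ k) (hfU k)]
  have hψ0 : ∀ k, ∫ z, f z * dbar (ψ k) z = 0 := fun k => by
    rw [← hχ0 k, integral_mul_dbar_eq_of_cutoff (hS k) (h.isOpen k) (hSK k) (hχ k) (hψ k) (hfU k)]
  have hcdχ := fun k => contDiff_mul_dbar_cutoff hS h.isOpen h.arc_subset h.disjoint hχ hf k (n := 1)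
  choose g' hg' hgO using fun k => exists_primitive_of_arc (h.contDiffOn k) (hδ k)
    (hcdχ k).continuous ((hχ k).hasCompactSupport_mul_dbar f)
    (((hχ k).tsupport_mul_dbar_subset f).trans (sdiff_subset.trans
      ((hχ' k).tsupport_subset.trans inter_subset_left))) (hχ0 k)
  let g : ℂ → ℂ := fun z => - ∑ k, g' k z
  have hg : ∀ z ∉ ⋃ k, K k, HasDerivAt g (f z) z := fun z hz => by
    have hzT : ∀ k, z ∉ Metric.cthickening (δ k) (G k '' Icc 0 1) := fun k hk =>
      hz (mem_iUnion.2 ⟨k, hTK k hk⟩)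
    rw [eq_neg_sum_cauchyTransform hS h.isOpen h.arc_subset h.disjoint hχ hf hflim
      fun k hk => hzT k (Metric.cthickening_mono (by have := hδ k; linarith) _
        (Metric.thickening_subset_cthickening _ _ ((hχ' k).tsupport_subset hk).1))]
    exact (HasDerivAt.fun_sum fun k _ => hg' k z (hzT k)).neg
  have hgO' : g =O[Bornology.cobounded ℂ] fun z => z⁻¹ ^ 1 := by
    simp only [pow_one]
    refine Asymptotics.IsBigO.congr_left (Asymptotics.IsBigO.sum (s := Finset.univ) fun k _ => hgO k).neg_left
      fun z => ?_
    simp [g]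
  have hUKc : ∀ k, U k \ K k ⊆ (⋃ k, K k)ᶜ := sdiff_subset_compl_iUnion hKU h.disjoint
  have hKo : IsOpen (⋃ k, K k)ᶜ := (isClosed_iUnion_compact hK).isOpen_compl
  have hgd : DifferentiableOn ℂ g (⋃ k, K k)ᶜ := fun z hz =>
    (hg z hz).differentiableAt.differentiableWithinAt
  -- the flux of `|g|²` out of each cut is nonnegative
  have hflux : ∀ k, (∫ z, (starRingEnd ℂ) (g z) * f z * dbar (ψ k) z).re ≤ 0 := fun k => by
    obtain ⟨q, hq1, hq2⟩ := hq k
    obtain ⟨α, u, hu, hsu⟩ := exists_sq_eq_of_primitive (hK k) (h.isOpen k) (hKU k) (hKc k)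
      (hSK k ⟨0, by simp, rfl⟩) (hSK k ⟨1, by simp, rfl⟩)
      ((h.differentiableOn k).mono (compl_subset_compl.2 (hSK k)))
      (fun z hz => h.sq_eq k z fun h' => hz (hSK k h')) (h.tendsto k) hq1
      (fun z hz => hq2 z ⟨hz.1, fun h' => hz.2 (hSK k h')⟩) (fun z hz => hg z (hUKc k hz))
    have h1 := re_integral_conj_mul_deriv_mul_dbar_nonpos (s := fun z => g z - α) (hK k)
      (h.isOpen k) (hψ k) ((hgd.mono (hUKc k)).sub_const α) hu hsu
    have hi : Integrable (fun z => f z * dbar (ψ k) z) :=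
      integrable_mul_dbar_cutoff hK h.isOpen hKU h.disjoint hψ hfK k
    have hi2 : Integrable (fun z => (starRingEnd ℂ) (g z) * f z * dbar (ψ k) z) := by
      refine ((hψ k).contDiff_mul_dbar (n := 1) (N := fun z => (starRingEnd ℂ) (g z) * f z)
        fun z hz => ?_).continuous.integrable_of_hasCompactSupport
        ((hψ k).hasCompactSupport_mul_dbar _)
      exact (Complex.conjCLE.contDiff.contDiffAt.comp z
        (contDiffAt_real_of_differentiableOn hKo hgd (hUKc k hz))).mul
        (contDiffAt_real_of_differentiableOn hKo hfK (hUKc k hz))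
    have h2 : ∀ z, (starRingEnd ℂ) (g z - α) * deriv (fun z => g z - α) z * dbar (ψ k) z =
        (starRingEnd ℂ) (g z) * f z * dbar (ψ k) z -
          (starRingEnd ℂ) α * (f z * dbar (ψ k) z) := fun z => by
      by_cases hzU : z ∈ tsupport (ψ k)
      · by_cases hzK : z ∈ K k
        · rw [((hψ k).dbar_eventually_zero_of_mem hzK).self_of_nhds]; ring
        · rw [((hg z (hUKc k ⟨(hψ k).tsupport_subset hzU, hzK⟩)).sub_const α).deriv, map_sub]; ring
      · rw [(IsCutoff.dbar_eventually_zero_of_notMem hzU).self_of_nhds]; ring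
    simp only [h2] at h1
    rwa [integral_sub hi2 (hi.const_mul _), integral_const_mul, hψ0, mul_zero, sub_zero] at h1
  -- `∂X/∂z̄` is `(1 - ∑ ψ) |f|²` minus the flux terms, and its integral is zero
  let X : ℂ → ℂ := fun z => (1 - ∑ k, ψ k z) * ((starRingEnd ℂ) (g z) * f z)
  have hη1 : ∀ k, ∀ z ∈ K k, ∀ᶠ w in 𝓝 z, ∑ j, ψ j w = 1 := fun k z hz => by
    filter_upwards [(h.isOpen k).mem_nhds (hKU k hz), (hψ k).eventually_one hz] with w h1 h2
    rw [sum_cutoff_of_mem hψ h.disjoint h1, h2]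
  have hηr : ∀ z, ∃ t : ℝ, 0 ≤ t ∧ 1 - ∑ k, ψ k z = t := fun z => by
    by_cases hz : ∃ k, z ∈ U k
    · obtain ⟨k, hk⟩ := hz
      obtain ⟨t, ht, hψt⟩ := (hψ k).mem_Icc z
      exact ⟨1 - t, by linarith [ht.2], by rw [sum_cutoff_of_mem hψ h.disjoint hk, hψt]; simp⟩
    · push Not at hz
      exact ⟨1, zero_le_one, by
        rw [Finset.sum_eq_zero fun k _ => (hψ k).eq_zero_of_notMem (hz k)]; simp⟩
  have hcη : ContDiff ℝ 1 (fun z => 1 - ∑ k, ψ k z) :=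
    contDiff_const.sub (ContDiff.sum fun k _ => (hψ k).contDiff.of_le (by exact_mod_cast le_top))
  have hgr : ∀ z ∉ ⋃ k, K k, ContDiffAt ℝ 1 g z := fun z hz =>
    contDiffAt_real_of_differentiableOn hKo hgd hz
  have hfr : ∀ z ∉ ⋃ k, K k, ContDiffAt ℝ 1 f z := fun z hz =>
    contDiffAt_real_of_differentiableOn hKo hfK hz
  have hgf : ∀ z ∉ ⋃ k, K k, ContDiffAt ℝ 1 (fun z => (starRingEnd ℂ) (g z) * f z) z :=
    fun z hz => (Complex.conjCLE.contDiff.contDiffAt.comp z (hgr z hz)).mul (hfr z hz)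
  have hloc : ∀ N : ℂ → ℂ, (∀ z ∉ ⋃ k, K k, ContDiffAt ℝ 1 N z) →
      ContDiff ℝ 1 fun z => (1 - ∑ k, ψ k z) * N z := fun N hN => by
    refine contDiff_iff_contDiffAt.2 fun z => ?_
    by_cases hz : z ∈ ⋃ k, K k
    · obtain ⟨k, hk⟩ := mem_iUnion.1 hz
      refine (contDiffAt_const (c := (0 : ℂ))).congr_of_eventuallyEq ?_
      filter_upwards [hη1 k z hk] with w hw
      rw [hw]; ring
    · exact hcη.contDiffAt.mul (hN z hz)
  have hX : ContDiff ℝ 1 X := hloc _ hgf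
  have hXeq : ∀ᶠ z in Bornology.cobounded ℂ, X =ᶠ[𝓝 z] fun z => (starRingEnd ℂ) (g z) * f z := by
    have hb : IsCompact (⋃ k, tsupport (ψ k)) := isCompact_iUnion fun k => (hψ k).compact
    filter_upwards [eventually_notMem_of_isCompact hb] with z hz
    filter_upwards [hb.isClosed.isOpen_compl.mem_nhds hz] with w hw
    have : ∑ k, ψ k w = 0 := Finset.sum_eq_zero fun k _ =>
      image_eq_zero_of_notMem_tsupport fun h => hw (mem_iUnion.2 ⟨k, h⟩)
    simp [X, this]
  have hnK : ∀ᶠ z in Bornology.cobounded ℂ, z ∉ ⋃ k, K k :=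
    eventually_notMem_of_isCompact (isCompact_iUnion hK)
  have hfd : ∀ z ∉ ⋃ k, K k, DifferentiableAt ℂ f z := fun z hz =>
    hfK.differentiableAt (hKo.mem_nhds hz)
  have hone : ∀ᶠ z in Bornology.cobounded ℂ, 1 ≤ ‖z‖ :=
    (tendsto_norm_cobounded_atTop (E := ℂ)).eventually_ge_atTop 1
  have hintO : ∀ {F : ℂ → ℂ}, Continuous F → F =O[Bornology.cobounded ℂ] (fun z => z⁻¹ ^ 3) →
      Integrable F := by
    intro F hFc hFO
    have hi : Integrable (fun z : ℂ => (1 + ‖z‖) ^ (-(3 : ℝ))) :=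
      integrable_one_add_norm (by rw [Complex.finrank_real_complex]; norm_num)
    refine hFc.locallyIntegrable.integrable_of_isBigO_cocompact ?_ (hi.integrableAtFilter _)
    rw [← Metric.cobounded_eq_cocompact]
    refine hFO.trans (Asymptotics.IsBigO.of_bound 8 ?_)
    filter_upwards [hone] with z hz
    rw [norm_pow, norm_inv, Real.norm_eq_abs, abs_of_nonneg (by positivity),
      Real.rpow_neg (by positivity), inv_pow, ← div_eq_mul_inv, inv_eq_one_div,
      div_le_div_iff₀ (by positivity) (by positivity)]
    have e : (1 + ‖z‖) ^ (3 : ℝ) = (1 + ‖z‖) ^ 3 := by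
      rw [show (3 : ℝ) = ((3 : ℕ) : ℝ) by norm_num, Real.rpow_natCast]
    rw [e, one_mul]
    calc (1 + ‖z‖) ^ 3 ≤ (2 * ‖z‖) ^ 3 := by gcongr; linarith
      _ = 8 * ‖z‖ ^ 3 := by ring
  have hconjO : (fun z => (starRingEnd ℂ) (g z)) =O[Bornology.cobounded ℂ] fun z => z⁻¹ ^ 1 :=
    Asymptotics.IsBigO.of_norm_left (by simpa using hgO'.norm_left)
  have hXO : X =O[Bornology.cobounded ℂ] fun z => z⁻¹ ^ 3 := by
    have := hconjO.mul hO
    refine this.congr' ?_ (Eventually.of_forall fun z => (pow_add z⁻¹ 1 2).symm)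
    filter_upwards [hXeq] with z hz using hz.self_of_nhds.symm
  have hX'O : ∀ v, (fun z => fderiv ℝ X z v) =O[Bornology.cobounded ℂ] fun z => z⁻¹ ^ 3 := fun v => by
    have hf' := isBigO_deriv_cobounded (hnK.mono hfd) hO
    have hfv : (fun z => f z * v) =O[Bornology.cobounded ℂ] fun z => z⁻¹ ^ 2 := by
      simpa [mul_comm] using hO.const_mul_left v
    have hfv' : (fun z => deriv f z * v) =O[Bornology.cobounded ℂ] fun z => z⁻¹ ^ 3 := by
      simpa [mul_comm] using hf'.const_mul_left v
    have hcfv : (fun z => (starRingEnd ℂ) (f z * v)) =O[Bornology.cobounded ℂ] fun z => z⁻¹ ^ 2 :=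
      Asymptotics.IsBigO.of_norm_left (by simpa using hfv.norm_left)
    have h4 : (fun z => (starRingEnd ℂ) (g z) * (deriv f z * v) + (starRingEnd ℂ) (f z * v) * f z)
        =O[Bornology.cobounded ℂ] fun z => z⁻¹ ^ 4 := by
      refine ((hconjO.mul hfv').congr_right fun z => by ring).add
        ((hcfv.mul hO).congr_right fun z => by ring)
    have h43 : (fun z : ℂ => z⁻¹ ^ 4) =O[Bornology.cobounded ℂ] fun z => z⁻¹ ^ 3 := by
      refine Asymptotics.IsBigO.of_bound 1 ?_
      filter_upwards [hone] with z hz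
      rw [norm_pow, norm_pow, norm_inv, one_mul]
      exact pow_le_pow_of_le_one (by positivity) (inv_le_one_of_one_le₀ hz) (by norm_num)
    refine (h4.trans h43).congr' ?_ EventuallyEq.rfl
    filter_upwards [hXeq, hnK] with z hz hzK
    have e1 : HasFDerivAt (fun w => (starRingEnd ℂ) (g w)) _ z :=
      (Complex.conjCLE : ℂ →L[ℝ] ℂ).hasFDerivAt.comp z ((hg z hzK).hasFDerivAt.restrictScalars ℝ)
    have e2 := (hfd z hzK).hasDerivAt.hasFDerivAt.restrictScalars ℝ
    rw [hz.fderiv_eq, show fderiv ℝ (fun z => (starRingEnd ℂ) (g z) * f z) z = _ from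
      (e1.mul e2).fderiv]
    simp
    ring
  have h0 := integral_dbar_eq_zero (hX.differentiable one_ne_zero) (hintO hX.continuous hXO)
    fun v => hintO ((hX.continuous_fderiv one_ne_zero).clm_apply continuous_const) (hX'O v)
  have hdX : ∀ z, dbar X z = (1 - ∑ k, ψ k z) * ((starRingEnd ℂ) (f z) * f z) -
      ∑ k, (starRingEnd ℂ) (g z) * f z * dbar (ψ k) z := fun z => by
    by_cases hz : z ∈ ⋃ k, K k
    · obtain ⟨k, hk⟩ := mem_iUnion.1 hz
      have e1 : X =ᶠ[𝓝 z] fun _ => 0 := by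
        filter_upwards [hη1 k z hk] with w hw
        simp [X, hw]
      rw [dbar_congr e1, dbar_of_differentiableAt (differentiableAt_const _),
        (hη1 k z hk).self_of_nhds, Finset.sum_eq_zero fun j _ => ?_]
      · ring
      · have e2 : dbar (ψ j) z = 0 := by
          by_cases hjk : j = k
          · exact ((hψ j).dbar_eventually_zero_of_mem (hjk ▸ hk)).self_of_nhds
          · exact (IsCutoff.dbar_eventually_zero_of_notMem fun h' => (h.disjoint hjk).le_bot
              ⟨(hψ j).tsupport_subset h', hKU k hk⟩).self_of_nhds
        rw [e2, mul_zero]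
    · have e1 : DifferentiableAt ℝ (fun w => (starRingEnd ℂ) (g w)) z :=
        Complex.conjCLE.differentiableAt.comp z ((hgr z hz).differentiableAt one_ne_zero)
      have e2 : dbar (fun z => 1 - ∑ k, ψ k z) z = - ∑ k, dbar (ψ k) z := by
        rw [dbar_sub (differentiableAt_const _)
          (DifferentiableAt.fun_sum fun k _ => (hψ k).differentiable z),
          dbar_of_differentiableAt (differentiableAt_const _),
          dbar_sum _ fun k _ => (hψ k).differentiable z, zero_sub]
      change dbar (fun z => (1 - ∑ k, ψ k z) * ((starRingEnd ℂ) (g z) * f z)) z = _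
      rw [dbar_mul (hcη.differentiable one_ne_zero z) ((hgf z hz).differentiableAt one_ne_zero),
        dbar_mul e1 ((hfr z hz).differentiableAt one_ne_zero), e2,
        dbar_conj (hg z hz).differentiableAt, dbar_of_differentiableAt (hfd z hz), (hg z hz).deriv,
        ← Finset.mul_sum]
      ring
  -- the nonnegative function `w` has an integral that is a sum of fluxes, hence nonpositive
  let w : ℂ → ℝ := fun z => ((1 - ∑ k, ψ k z) * ((starRingEnd ℂ) (f z) * f z)).re
  have hwt : ∀ z, ∃ t : ℝ, 0 ≤ t ∧ 1 - ∑ k, ψ k z = t ∧ w z = t * Complex.normSq (f z) :=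
    fun z => by
    obtain ⟨t, ht0, ht⟩ := hηr z
    refine ⟨t, ht0, ht, ?_⟩
    simp only [w]
    rw [ht, ← Complex.normSq_eq_conj_mul_self, ← Complex.ofReal_mul, Complex.ofReal_re]
  have hwc : Continuous w := Complex.continuous_re.comp
    (hloc (fun z => (starRingEnd ℂ) (f z) * f z) fun z hz =>
      (Complex.conjCLE.contDiff.contDiffAt.comp z (hfr z hz)).mul (hfr z hz)).continuous
  have hiX : Integrable (dbar X) := by
    have h5 := fun v => hintO ((hX.continuous_fderiv one_ne_zero).clm_apply
      (continuous_const (y := v))) (hX'O v)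
    exact ((h5 1).add ((h5 Complex.I).const_mul Complex.I)).div_const 2
  have hiψ : ∀ k, Integrable (fun z => (starRingEnd ℂ) (g z) * f z * dbar (ψ k) z) := fun k =>
    ((hψ k).contDiff_mul_dbar (n := 1) (N := fun z => (starRingEnd ℂ) (g z) * f z)
      fun z hz => hgf z (hUKc k hz)).continuous.integrable_of_hasCompactSupport
      ((hψ k).hasCompactSupport_mul_dbar _)
  have hW : ∀ z, (1 - ∑ k, ψ k z) * ((starRingEnd ℂ) (f z) * f z) =
      dbar X z + ∑ k, (starRingEnd ℂ) (g z) * f z * dbar (ψ k) z := fun z => by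
    rw [hdX]; ring
  have hiW : Integrable fun z => (1 - ∑ k, ψ k z) * ((starRingEnd ℂ) (f z) * f z) := by
    simp only [hW]
    exact hiX.add (integrable_finsetSum _ fun k _ => hiψ k)
  have hiw : Integrable w := hiW.re
  have hw0 : ∀ z, 0 ≤ w z := fun z => by
    obtain ⟨t, ht0, -, ht⟩ := hwt z
    rw [ht]; exact mul_nonneg ht0 (Complex.normSq_nonneg _)
  have hwint : ∫ z, w z = 0 := by
    refine le_antisymm ?_ (integral_nonneg hw0)
    have e3 : ∫ z, w z = (∫ z, (1 - ∑ k, ψ k z) * ((starRingEnd ℂ) (f z) * f z)).re :=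
      integral_re hiW
    rw [e3]
    simp only [hW]
    rw [integral_add hiX (integrable_finsetSum _ fun k _ => hiψ k), h0, zero_add,
      integral_finsetSum _ fun k _ => hiψ k, Complex.re_sum]
    exact Finset.sum_nonpos fun k _ => hflux k
  have hw1 : w = fun _ => 0 := by
    have := (integral_eq_zero_iff_of_nonneg hw0 hiw).1 hwint
    exact (Continuous.ae_eq_iff_eq volume hwc continuous_const).1 this
  have hb : IsCompact (⋃ k, tsupport (ψ k)) := isCompact_iUnion fun k => (hψ k).compact
  filter_upwards [eventually_notMem_of_isCompact hb] with z hz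
  obtain ⟨t, -, ht1, ht⟩ := hwt z
  rw [Finset.sum_eq_zero fun k _ => image_eq_zero_of_notMem_tsupport fun h' =>
    hz (mem_iUnion.2 ⟨k, h'⟩), sub_zero] at ht1
  rw [hw1, ← Complex.ofReal_injective ht1, one_mul] at ht
  exact Complex.normSq_eq_zero.1 ht.symm

end IsCutSystem

end ZS

namespace ZS

/-! ### Normalized differentials -/

lemma isBigO_eval_mul_inv_pow {m : ℕ} {Q : Polynomial ℂ} (hQ : Q ∈ Polynomial.degreeLT ℂ m) :
    (fun z => Q.eval z * z⁻¹ ^ (m + 1)) =O[Bornology.cobounded ℂ] fun z => z⁻¹ ^ 2 := by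
  rw [Polynomial.mem_degreeLT] at hQ
  by_cases hQ0 : Q = 0
  · simp only [hQ0, Polynomial.eval_zero, zero_mul]
    exact Asymptotics.isBigO_zero _ _
  have hQ' := (Polynomial.natDegree_lt_iff_degree_lt hQ0).2 hQ
  simp only [Polynomial.eval_eq_sum_range' hQ', Finset.sum_mul]
  refine Asymptotics.IsBigO.fun_sum fun i hi => ?_
  simp only [mul_assoc]
  refine Asymptotics.IsBigO.const_mul_left (Asymptotics.IsBigO.of_bound 1 ?_) _
  filter_upwards [(tendsto_norm_cobounded_atTop (E := ℂ)).eventually_ge_atTop 1] with z hz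
  have hz0 : z ≠ 0 := norm_pos_iff.1 (by linarith)
  obtain ⟨j, rfl⟩ := Nat.exists_eq_add_of_lt (Finset.mem_range.1 hi)
  have e : z ^ i * z⁻¹ ^ (i + j + 1 + 1) = z⁻¹ ^ 2 * z⁻¹ ^ j := by
    simp only [inv_pow]
    field_simp
    ring
  rw [e, norm_mul, one_mul, norm_pow z⁻¹ j, norm_inv]
  exact mul_le_of_le_one_right (norm_nonneg _)
    (pow_le_one₀ (by positivity) (inv_le_one_of_one_le₀ hz))

lemma eq_zero_of_eventually_eval_eq_zero {Q : Polynomial ℂ}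
    (h : ∀ᶠ z in Bornology.cobounded ℂ, Q.eval z = 0) : Q = 0 := by
  by_contra hQ
  have h1 := eventually_notMem_of_isCompact (Polynomial.finite_setOfPred_isRoot hQ).isCompact
  obtain ⟨z, hz1, hz2⟩ := (h.and h1).exists
  exact hz2 hz1

namespace IsCutSystem

variable {ι : Type*} [Fintype ι] {G : ι → ℝ → ℂ} {U : ι → Set ℂ} {y : ι → ℂ → ℂ} {f : ℂ → ℂ}

omit [Fintype ι] in
lemma ne_zero (h : IsCutSystem G U y) {k : ι} {z : ℂ} (hz : z ∉ G k '' Icc 0 1) : y k z ≠ 0 := by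
  intro h0
  have := h.sq_eq k z hz
  rw [h0, zero_pow two_ne_zero] at this
  rcases mul_eq_zero.1 this.symm with h | h
  · exact hz ⟨0, by simp, (sub_eq_zero.1 h).symm⟩
  · exact hz ⟨1, by simp, (sub_eq_zero.1 h).symm⟩

lemma differentiableOn_eval_div (h : IsCutSystem G U y) (P : Polynomial ℂ) :
    DifferentiableOn ℂ (fun z => P.eval z / ∏ k, y k z) (⋃ k, G k '' Icc 0 1)ᶜ := by
  refine P.differentiable.differentiableOn.div ?_ fun z hz => Finset.prod_ne_zero_iff.2
    fun k _ => h.ne_zero fun h' => hz (mem_iUnion.2 ⟨k, h'⟩)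
  exact DifferentiableOn.fun_finsetProd fun k _ => (h.differentiableOn k).mono
    (compl_subset_compl.2 (subset_iUnion (fun k => G k '' Icc 0 1) k))

lemma tendsto_pow_div_prod (h : IsCutSystem G U y) :
    Tendsto (fun z => z ^ Fintype.card ι / ∏ k, y k z) (Bornology.cobounded ℂ)
      (𝓝 ((-1) ^ Fintype.card ι)) := by
  have h1 := tendsto_finsetProd (Finset.univ : Finset ι) fun k _ => h.tendsto k
  simp only [Finset.prod_const, Finset.card_univ] at h1
  have h2 := h1.inv₀ (by simp)
  rw [← inv_pow, inv_neg, inv_one] at h2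
  refine h2.congr fun z => ?_
  rw [Finset.prod_div_distrib, Finset.prod_const, Finset.card_univ, inv_div]

/-- On the hyperelliptic curve with the cuts `G k` there is a normalized differential `P / ∏ y`: its
period over every closed curve that avoids the `U k` is determined by the winding number around
the distinguished cut. -/
theorem exists_normalized_polynomial (h : IsCutSystem G U y) (n : ι) :
    ∃ P : Polynomial ℂ, P.natDegree = Fintype.card ι - 1 ∧
      P.leadingCoeff = (-1) ^ P.natDegree ∧
      ∀ γ : ℝ → ℂ, ContDiff ℝ 1 γ → (∀ k, Disjoint (range γ) (U k)) → ∀ c : ι → ℂ,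
        (∀ k, ∀ ζ ∈ U k,
          (2 * Real.pi * Complex.I)⁻¹ * ∫ t in (0 : ℝ)..1, deriv γ t / (γ t - ζ) = c k) →
        ∫ t in (0 : ℝ)..1, P.eval (γ t) / (∏ k, y k (γ t)) * deriv γ t =
          -(2 * Real.pi * Complex.I) * c n := by
  classical
  obtain ⟨m, hm⟩ : ∃ m, Fintype.card ι = m + 1 :=
    Nat.exists_eq_add_one_of_ne_zero (Fintype.card_pos_iff.2 ⟨n⟩).ne'
  have hS := h.isCompact_arc
  choose χ hχ using fun k => exists_isCutoff (hS k) (h.isOpen k) (h.arc_subset k)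
  let F : Polynomial ℂ → ℂ → ℂ := fun P z => P.eval z / ∏ k, y k z
  have hF : ∀ P, DifferentiableOn ℂ (F P) (⋃ k, G k '' Icc 0 1)ᶜ := h.differentiableOn_eval_div
  have hint : ∀ P k, Integrable fun z => F P z * dbar (χ k) z := fun P k =>
    integrable_mul_dbar_cutoff hS h.isOpen h.arc_subset h.disjoint hχ (hF P) k
  have hp0 := h.tendsto_pow_div_prod
  have hne0 : ∀ᶠ z in Bornology.cobounded ℂ, z ≠ (0 : ℂ) := by
    filter_upwards [(tendsto_norm_cobounded_atTop (E := ℂ)).eventually_gt_atTop 0] with w hw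
    exact norm_pos_iff.1 hw
  have hFeq : ∀ P, ∀ᶠ z in Bornology.cobounded ℂ,
      P.eval z * z⁻¹ ^ (m + 1) * (z ^ Fintype.card ι / ∏ k, y k z) = F P z := fun P => by
    filter_upwards [hne0] with z hz
    rw [hm]
    simp only [F, inv_pow]
    field_simp
  have hFO : ∀ Q ∈ Polynomial.degreeLT ℂ m, F Q =O[Bornology.cobounded ℂ] fun z => z⁻¹ ^ 2 :=
    fun Q hQ => by
    have h1 := (isBigO_eval_mul_inv_pow hQ).mul (hp0.isBigO_one ℂ)
    simp only [mul_one] at h1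
    exact h1.congr' (hFeq Q) EventuallyEq.rfl
  have hF0 : ∀ Q ∈ Polynomial.degreeLT ℂ m, Tendsto (fun z => z * F Q z) (Bornology.cobounded ℂ)
      (𝓝 0) := fun Q hQ => by
    have h1 := (Asymptotics.isBigO_refl (fun z : ℂ => z) (Bornology.cobounded ℂ)).mul (hFO Q hQ)
    refine (h1.congr' EventuallyEq.rfl ?_).trans_tendsto (tendsto_inv₀_cobounded (α := ℂ))
    filter_upwards [hne0] with z hz
    field_simp
  -- the periods around all cuts except the `n`-th
  let Φ : Polynomial.degreeLT ℂ m →ₗ[ℂ] ({k // k ≠ n} → ℂ) :=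
    { toFun := fun Q k => ∫ z, F Q z * dbar (χ k) z
      map_add' := fun P Q => by
        ext k
        rw [Pi.add_apply, ← integral_add (hint _ _) (hint _ _)]
        refine integral_congr_ae (Eventually.of_forall fun z => ?_)
        simp only [F, Submodule.coe_add, Polynomial.eval_add]
        ring
      map_smul' := fun a Q => by
        ext k
        rw [Pi.smul_apply, RingHom.id_apply, smul_eq_mul, ← integral_const_mul]
        refine integral_congr_ae (Eventually.of_forall fun z => ?_)
        simp only [F, Submodule.coe_smul, Polynomial.eval_smul, smul_eq_mul]
        ring }
  -- the sum of all periods is seen at infinity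
  have hsum : ∀ P c, Tendsto (fun z => z * F P z) (Bornology.cobounded ℂ) (𝓝 c) →
      ∑ k, ∫ z, F P z * dbar (χ k) z = - (Real.pi : ℂ) * c := fun P c hc => by
    have hπ : (Real.pi : ℂ) ≠ 0 := by exact_mod_cast Real.pi_ne_zero
    have := tendsto_nhds_unique hc (tendsto_mul_of_tendsto_zero hS h.isOpen h.arc_subset h.disjoint
      hχ (hF P) (tendsto_zero_of_tendsto_mul hc))
    rw [this]
    field_simp
  -- in degree less than `m` the `n`-th period vanishes with the other ones
  have hinj : Function.Injective Φ := by
    rw [← LinearMap.ker_eq_bot, LinearMap.ker_eq_bot']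
    intro Q hQ
    have hk : ∀ k, k ≠ n → ∫ z, F Q z * dbar (χ k) z = 0 := fun k hk => congrFun hQ ⟨k, hk⟩
    have hkn : ∀ k, ∫ z, F Q z * dbar (χ k) z = 0 := fun k => by
      by_cases hkn : k = n
      · have h1 := hsum Q 0 (hF0 Q Q.2)
        rw [Finset.sum_eq_single n (fun k _ hk' => hk k hk') (by simp), mul_zero] at h1
        rw [hkn, h1]
      · exact hk k hkn
    have h0 := h.eventually_eq_zero (hF Q) (hFO Q Q.2) (fun k => ?_) fun k => ⟨χ k, hχ k, hkn k⟩
    · refine Subtype.ext (eq_zero_of_eventually_eval_eq_zero ?_)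
      filter_upwards [h0, eventually_notMem_of_isCompact (isCompact_iUnion hS)] with z hz hz2
      refine (div_eq_zero_iff.1 hz).resolve_right (Finset.prod_ne_zero_iff.2 fun k _ =>
        h.ne_zero fun h' => hz2 (mem_iUnion.2 ⟨k, h'⟩))
    · refine ⟨fun z => (Q : Polynomial ℂ).eval z / ∏ j ∈ Finset.univ.erase k, y j z, ?_,
        fun z hz => ?_⟩
      · have hUj : ∀ j ∈ Finset.univ.erase k, U k ⊆ (G j '' Icc 0 1)ᶜ := fun j hj z hz h' =>
          (h.disjoint (Finset.ne_of_mem_erase hj)).le_bot ⟨h.arc_subset j h', hz⟩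
        refine (Polynomial.differentiable _).differentiableOn.div
          (DifferentiableOn.fun_finsetProd fun j hj => (h.differentiableOn j).mono (hUj j hj))
          fun z hz => Finset.prod_ne_zero_iff.2 fun j hj => h.ne_zero (hUj j hj hz)
      · simp only [F]
        rw [← Finset.mul_prod_erase Finset.univ (fun j => y j z) (Finset.mem_univ k), mul_comm (y k z),
          ← div_div, div_mul_cancel₀ _ (h.ne_zero hz.2)]
  have hsurj : Function.Surjective Φ := by
    refine (LinearMap.injective_iff_surjective_of_finrank_eq_finrank ?_).1 hinj
    rw [(Polynomial.degreeLTEquiv ℂ m).finrank_eq, Module.finrank_fintype_fun_eq_card,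
      Module.finrank_fintype_fun_eq_card, Fintype.card_subtype_compl, hm]
    simp
  -- the leading monomial is corrected by terms of lower degree, to leave only the `n`-th period
  let M : Polynomial ℂ := Polynomial.C ((-1) ^ m) * Polynomial.X ^ m
  obtain ⟨Q, hQ⟩ := hsurj fun k => - ∫ z, F M z * dbar (χ k) z
  have hMd : M.degree = m := Polynomial.degree_C_mul_X_pow m (by simp)
  have hdeg : (Q : Polynomial ℂ).degree < M.degree := by
    rw [hMd]; exact Polynomial.mem_degreeLT.1 Q.2
  have hPd : (M + Q).natDegree = m :=
    Polynomial.natDegree_eq_of_degree_eq_some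
      ((Polynomial.degree_add_eq_left_of_degree_lt hdeg).trans hMd)
  have hFadd : ∀ z, F (M + Q) z = F M z + F Q z := fun z => by
    simp only [F, Polynomial.eval_add]; ring
  have hper : ∀ k, k ≠ n → ∫ z, F (M + Q) z * dbar (χ k) z = 0 := fun k hk => by
    have h1 : ∫ z, F Q z * dbar (χ k) z = - ∫ z, F M z * dbar (χ k) z := congrFun hQ ⟨k, hk⟩
    simp only [hFadd, add_mul]
    rw [integral_add (hint _ _) (hint _ _), h1]; ring
  have hlim : Tendsto (fun z => z * F (M + Q) z) (Bornology.cobounded ℂ) (𝓝 (-1)) := by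
    have h1 : Tendsto (fun z => z * F M z) (Bornology.cobounded ℂ) (𝓝 (-1)) := by
      have h2 := hp0.const_mul ((-1 : ℂ) ^ m)
      rw [hm, ← pow_add, show m + (m + 1) = 2 * m + 1 by ring, pow_succ, pow_mul] at h2
      norm_num at h2
      refine h2.congr' ?_
      filter_upwards [hFeq M, hne0] with z hz hz0
      rw [← hz, hm]
      simp only [M, Polynomial.eval_mul, Polynomial.eval_C, Polynomial.eval_pow, Polynomial.eval_X,
        inv_pow]
      field_simp
      ring
    have h3 := h1.add (hF0 Q Q.2)
    rw [add_zero] at h3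
    exact h3.congr fun z => by rw [hFadd]; ring
  have htot : ∫ z, F (M + Q) z * dbar (χ n) z = Real.pi := by
    have h1 := hsum _ _ hlim
    rw [Finset.sum_eq_single n (fun k _ hk' => hper k hk') (by simp)] at h1
    rw [h1]; ring
  refine ⟨M + Q, by rw [hPd, hm]; rfl, ?_, fun γ hγ hγU c hc => ?_⟩
  · rw [hPd, Polynomial.leadingCoeff_add_of_degree_lt' hdeg]
    simp [M]
  · have h1 := integral_comp_mul_deriv_eq_sum hS h.isOpen h.arc_subset h.disjoint hχ (hF (M + Q))
      (tendsto_zero_of_tendsto_mul hlim) hγ hγU hc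
    rw [Finset.sum_eq_single n (fun k _ hk' => by rw [hper k hk', mul_zero]) (by simp), htot] at h1
    change ∫ t in (0 : ℝ)..1, F (M + Q) (γ t) * deriv γ t = _
    rw [h1]; ring

end IsCutSystem

end ZS

namespace ZS

/-! ### Primitives of locally integrable functions -/

/-- `f` is a primitive of the locally integrable function `f'`. -/
structure IsPrimitive {E : Type*} [NormedAddCommGroup E] [NormedSpace ℝ E] (f f' : ℝ → E) : Prop where
  intervalIntegrable : ∀ a b, IntervalIntegrable f' volume a b
  eq : ∀ x, f x = f 0 + ∫ t in (0 : ℝ)..x, f' t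

namespace IsPrimitive

variable {E : Type*} [NormedAddCommGroup E] [NormedSpace ℝ E] {f f' g g' : ℝ → E}

lemma continuous (h : IsPrimitive f f') : Continuous f := by
  have : f = fun x => f 0 + ∫ t in (0 : ℝ)..x, f' t := funext h.eq
  rw [this]
  exact continuous_const.add (intervalIntegral.continuous_primitive h.intervalIntegrable 0)

lemma ae_hasDerivAt [CompleteSpace E] (h : IsPrimitive f f') : ∀ᵐ x, HasDerivAt f (f' x) x := by
  have hl : LocallyIntegrable f' volume := by
    intro x
    refine ⟨Ioc (x - 1) (x + 1), Ioc_mem_nhds (by linarith) (by linarith), ?_⟩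
    exact (intervalIntegrable_iff_integrableOn_Ioc_of_le (by linarith)).1
      (h.intervalIntegrable (x - 1) (x + 1))
  filter_upwards [LocallyIntegrable.ae_hasDerivAt_integral hl] with x hx
  have : f = fun x => f 0 + ∫ t in (0 : ℝ)..x, f' t := funext h.eq
  rw [this]
  exact (hx 0).const_add (f 0)

end IsPrimitive

/-- A primitive of a locally integrable function is absolutely continuous. This is the real case. -/
lemma absolutelyContinuousOnInterval_of_isPrimitive_real {f f' : ℝ → ℝ} (h : IsPrimitive f f')
    (a b : ℝ) : AbsolutelyContinuousOnInterval f a b := by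
  have h1 := (h.intervalIntegrable a b).absolutelyContinuousOnInterval_intervalIntegral
    (c := a) left_mem_uIcc
  have h2 : AbsolutelyContinuousOnInterval (fun _ : ℝ => f a) a b :=
    (LipschitzWith.const (f a)).lipschitzOnWith.absolutelyContinuousOnInterval
  convert! h2.add h1 using 1
  ext x
  rw [Pi.add_apply, h.eq x, h.eq a, add_assoc,
    intervalIntegral.integral_add_adjacent_intervals (h.intervalIntegrable _ _)
      (h.intervalIntegrable _ _)]

lemma absolutelyContinuousOnInterval_const {X : Type*} [PseudoMetricSpace X] (c : X) (a b : ℝ) :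
    AbsolutelyContinuousOnInterval (fun _ : ℝ => c) a b :=
  (LipschitzWith.const c).lipschitzOnWith.absolutelyContinuousOnInterval

lemma IsPrimitive.absolutelyContinuousOnInterval {f f' : ℝ → ℂ} (h : IsPrimitive f f') (a b : ℝ) :
    AbsolutelyContinuousOnInterval f a b := by
  have hre : IsPrimitive (fun x => (f x).re) (fun x => (f' x).re) :=
    ⟨fun a b => ⟨(h.intervalIntegrable a b).1.re, (h.intervalIntegrable a b).2.re⟩, fun x => by
      rw [h.eq x, Complex.add_re]
      congr 1
      exact (Complex.reCLM.intervalIntegral_comp_comm (h.intervalIntegrable 0 x)).symm⟩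
  have him : IsPrimitive (fun x => (f x).im) (fun x => (f' x).im) :=
    ⟨fun a b => ⟨(h.intervalIntegrable a b).1.im, (h.intervalIntegrable a b).2.im⟩, fun x => by
      rw [h.eq x, Complex.add_im]
      congr 1
      exact (Complex.imCLM.intervalIntegral_comp_comm (h.intervalIntegrable 0 x)).symm⟩
  have h1 := (absolutelyContinuousOnInterval_of_isPrimitive_real hre a b).smul
    (absolutelyContinuousOnInterval_const (1 : ℂ) a b)
  have h2 := (absolutelyContinuousOnInterval_of_isPrimitive_real him a b).smul
    (absolutelyContinuousOnInterval_const Complex.I a b)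
  convert! h1.add h2 using 1
  ext x
  simp [Complex.re_add_im]

lemma eq_of_ae_hasDerivAt_zero {F : ℝ → ℂ} (h : ∀ a b, AbsolutelyContinuousOnInterval F a b)
    (h0 : ∀ᵐ x, HasDerivAt F 0 x) (x : ℝ) : F x = F 0 := by
  obtain ⟨C, hC⟩ := (h 0 x).const_of_ae_hasDerivAt_zero (h0.mono fun y hy _ => hy)
  rw [hC x right_mem_uIcc, hC 0 left_mem_uIcc]

/-- The product rule for primitives of locally integrable functions. -/
lemma IsPrimitive.mul {f f' g g' : ℝ → ℂ} (hf : IsPrimitive f f') (hg : IsPrimitive g g') :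
    IsPrimitive (fun x => f x * g x) (fun x => f' x * g x + f x * g' x) := by
  have hi : ∀ a b, IntervalIntegrable (fun x => f' x * g x + f x * g' x) volume a b := fun a b =>
    ((hf.intervalIntegrable a b).mul_continuousOn hg.continuous.continuousOn).add
      ((hg.intervalIntegrable a b).continuousOn_mul hf.continuous.continuousOn)
  have hP : IsPrimitive (fun x => ∫ t in (0 : ℝ)..x, (f' t * g t + f t * g' t))
      (fun x => f' x * g x + f x * g' x) := ⟨hi, fun x => by simp⟩
  refine ⟨hi, fun x => ?_⟩
  have h1 := eq_of_ae_hasDerivAt_zero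
    (F := fun x => f x * g x - ∫ t in (0 : ℝ)..x, (f' t * g t + f t * g' t))
    (fun a b => ((hf.absolutelyContinuousOnInterval a b).smul
      (hg.absolutelyContinuousOnInterval a b)).sub (hP.absolutelyContinuousOnInterval a b)) (by
      filter_upwards [hf.ae_hasDerivAt, hg.ae_hasDerivAt, hP.ae_hasDerivAt] with x h1 h2 h3
      exact ((h1.mul h2).sub h3).congr_deriv (by ring)) x
  simp only [intervalIntegral.integral_same, sub_zero] at h1
  exact sub_eq_iff_eq_add.1 h1

lemma absolutelyContinuousOnInterval_lipschitzOnWith_comp {f g : ℝ → ℝ} {a b : ℝ} {K : NNReal}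
    (hf : AbsolutelyContinuousOnInterval f a b) (hg : LipschitzOnWith K g (f '' uIcc a b)) :
    AbsolutelyContinuousOnInterval (fun x => g (f x)) a b := by
  rw [absolutelyContinuousOnInterval_iff] at hf ⊢
  intro ε hε
  obtain ⟨δ, hδ, h⟩ := hf (ε / (K + 1)) (by positivity)
  refine ⟨δ, hδ, fun E hE1 hE2 => ?_⟩
  have h1 := h E hE1 hE2
  calc ∑ i ∈ Finset.range E.1, dist (g (f (E.2 i).1)) (g (f (E.2 i).2))
      ≤ ∑ i ∈ Finset.range E.1, K * dist (f (E.2 i).1) (f (E.2 i).2) :=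
        Finset.sum_le_sum fun i hi => hg.dist_le_mul _ ⟨_, (hE1.1 i hi).1, rfl⟩ _
          ⟨_, (hE1.1 i hi).2, rfl⟩
    _ = K * ∑ i ∈ Finset.range E.1, dist (f (E.2 i).1) (f (E.2 i).2) := by rw [Finset.mul_sum]
    _ ≤ K * (ε / (K + 1)) := by gcongr
    _ < ε := by
      rw [mul_div_assoc', div_lt_iff₀ (by positivity)]
      nlinarith

section Gronwall

variable {β : ℝ → ℝ} (hβ : ∀ a b, IntervalIntegrable β volume a b)

include hβ

/-- The fundamental theorem of calculus for `x ↦ exp (κ ∫₀ˣ β)`. -/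
lemma mul_integral_mul_exp (κ x : ℝ) :
    κ * ∫ t in (0 : ℝ)..x, β t * Real.exp (κ * ∫ s in (0 : ℝ)..t, β s) =
      Real.exp (κ * ∫ s in (0 : ℝ)..x, β s) - 1 := by
  have hθ : IsPrimitive (fun x => ∫ s in (0 : ℝ)..x, β s) β := ⟨hβ, fun x => by simp⟩
  have hθc := hθ.continuous
  have hi : ∀ a b, IntervalIntegrable
      (fun t => β t * Real.exp (κ * ∫ s in (0 : ℝ)..t, β s)) volume a b := fun a b =>
    (hβ a b).mul_continuousOn (by fun_prop)
  have hP : IsPrimitive (fun x => ∫ t in (0 : ℝ)..x, β t * Real.exp (κ * ∫ s in (0 : ℝ)..t, β s))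
      (fun t => β t * Real.exp (κ * ∫ s in (0 : ℝ)..t, β s)) := ⟨hi, fun x => by simp⟩
  have hexp : ∀ a b, AbsolutelyContinuousOnInterval
      (fun x => Real.exp (κ * ∫ s in (0 : ℝ)..x, β s)) a b := fun a b => by
    have hc : IsCompact ((fun x => ∫ s in (0 : ℝ)..x, β s) '' uIcc a b) :=
      isCompact_uIcc.image hθc
    obtain ⟨R, hR⟩ := hc.isBounded.subset_closedBall 0
    obtain ⟨K, hK⟩ := ContDiffOn.exists_lipschitzOnWith (n := 1) (f := fun s : ℝ => Real.exp (κ * s))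
      (s := Metric.closedBall 0 R) (by fun_prop) one_ne_zero (convex_closedBall _ _)
      (isCompact_closedBall _ _)
    exact absolutelyContinuousOnInterval_lipschitzOnWith_comp
      (g := fun s => Real.exp (κ * s)) (absolutelyContinuousOnInterval_of_isPrimitive_real hθ a b) (hK.mono hR)
  have hac : ∀ a b, AbsolutelyContinuousOnInterval (fun x => Real.exp (κ * ∫ s in (0 : ℝ)..x, β s) -
      κ * ∫ t in (0 : ℝ)..x, β t * Real.exp (κ * ∫ s in (0 : ℝ)..t, β s)) a b := fun a b =>
    (hexp a b).sub ((absolutelyContinuousOnInterval_of_isPrimitive_real hP a b).const_mul κ)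
  obtain ⟨C, hC⟩ := (hac 0 x).const_of_ae_hasDerivAt_zero (by
    filter_upwards [hθ.ae_hasDerivAt, hP.ae_hasDerivAt] with y h1 h2 _
    exact (((h1.const_mul κ).exp).sub (h2.const_mul κ)).congr_deriv (by ring))
  have h1 := hC x right_mem_uIcc
  have h0 := hC 0 left_mem_uIcc
  simp only [intervalIntegral.integral_same, mul_zero, Real.exp_zero, sub_zero] at h0
  linarith

variable (hβ0 : ∀ t, 0 ≤ β t)

include hβ0

omit hβ in
lemma integral_nonneg_of_le {x : ℝ} (hx : 0 ≤ x) : 0 ≤ ∫ s in (0 : ℝ)..x, β s :=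
  intervalIntegral.integral_nonneg hx fun t _ => hβ0 t

omit hβ in
lemma integral_nonpos_of_le {x : ℝ} (hx : x ≤ 0) : ∫ s in (0 : ℝ)..x, β s ≤ 0 := by
  rw [intervalIntegral.integral_symm, neg_nonpos]
  exact intervalIntegral.integral_nonneg hx fun t _ => hβ0 t

/-- The exponential weight `exp (κ |∫ β|)` absorbs integration against `β` with a gain `1 / κ`. -/
lemma abs_integral_mul_weight_le {κ : ℝ} (hκ : 0 < κ) (x : ℝ) :
    |∫ t in (0 : ℝ)..x, β t * Real.exp (κ * |∫ s in (0 : ℝ)..t, β s|)| ≤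
      Real.exp (κ * |∫ s in (0 : ℝ)..x, β s|) / κ := by
  rw [le_div_iff₀ hκ, mul_comm, ← abs_of_pos hκ, ← abs_mul, abs_of_pos hκ]
  rcases le_total 0 x with hx | hx
  · have h1 : ∫ t in (0 : ℝ)..x, β t * Real.exp (κ * |∫ s in (0 : ℝ)..t, β s|) =
        ∫ t in (0 : ℝ)..x, β t * Real.exp (κ * ∫ s in (0 : ℝ)..t, β s) := by
      refine intervalIntegral.integral_congr fun t ht => ?_
      rw [uIcc_of_le hx] at ht
      simp only [abs_of_nonneg (integral_nonneg_of_le hβ0 ht.1)]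
    have h3 := integral_nonneg_of_le hβ0 hx
    rw [h1, mul_integral_mul_exp hβ, abs_of_nonneg h3, abs_of_nonneg]
    · linarith
    · linarith [Real.one_le_exp (mul_nonneg hκ.le h3)]
  · have h1 : ∫ t in (0 : ℝ)..x, β t * Real.exp (κ * |∫ s in (0 : ℝ)..t, β s|) =
        ∫ t in (0 : ℝ)..x, β t * Real.exp (-κ * ∫ s in (0 : ℝ)..t, β s) := by
      refine intervalIntegral.integral_congr fun t ht => ?_
      rw [uIcc_of_ge hx] at ht
      simp only [abs_of_nonpos (integral_nonpos_of_le hβ0 ht.2)]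
      ring_nf
    have h3 := integral_nonpos_of_le hβ0 hx
    have h4 := mul_integral_mul_exp hβ (-κ) x
    rw [h1, abs_of_nonpos h3]
    have h5 : 1 ≤ Real.exp (-κ * ∫ s in (0 : ℝ)..x, β s) := Real.one_le_exp (by nlinarith)
    rw [show κ * -∫ s in (0 : ℝ)..x, β s = -κ * ∫ s in (0 : ℝ)..x, β s by ring, abs_le]
    constructor <;> linarith

omit hβ0 in
lemma continuous_weight (κ : ℝ) : Continuous fun x => Real.exp (κ * |∫ s in (0 : ℝ)..x, β s|) := by
  have := intervalIntegral.continuous_primitive hβ 0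
  fun_prop

omit hβ0 in
lemma intervalIntegrable_mul_weight (κ a b : ℝ) :
    IntervalIntegrable (fun t => β t * Real.exp (κ * |∫ s in (0 : ℝ)..t, β s|)) volume a b :=
  (hβ a b).mul_continuousOn (continuous_weight hβ κ).continuousOn

/-- Gronwall's inequality. -/
lemma le_of_le_add_abs_integral {f : ℝ → ℝ} (hf : Continuous f) (hf0 : ∀ x, 0 ≤ f x) {a : ℝ}
    (ha : 0 ≤ a) {R : ℝ} (h : ∀ x, |x| ≤ R → f x ≤ a + |∫ t in (0 : ℝ)..x, β t * f t|) {x : ℝ}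
    (hx : |x| ≤ R) : f x ≤ 2 * a * Real.exp (2 * |∫ s in (0 : ℝ)..x, β s|) := by
  set W : ℝ → ℝ := fun x => Real.exp (2 * |∫ s in (0 : ℝ)..x, β s|) with hW
  have hWc : Continuous W := continuous_weight hβ 2
  have hWp : ∀ x, 0 < W x := fun x => Real.exp_pos _
  have hW1 : ∀ x, 1 ≤ W x := fun x => Real.one_le_exp (by positivity)
  have hR : 0 ≤ R := (abs_nonneg x).trans hx
  -- the quotient of `f` by the weight is estimated at its maximum
  obtain ⟨x₀, hx₀, hmax⟩ := (isCompact_Icc (a := -R) (b := R)).exists_isMaxOn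
    ⟨0, by simpa using hR⟩ (hf.div hWc fun x => (hWp x).ne').continuousOn
  set m := f x₀ / W x₀ with hm
  have hm0 : 0 ≤ m := div_nonneg (hf0 _) (hWp _).le
  have hle : ∀ t, |t| ≤ R → f t ≤ m * W t := fun t ht => by
    have := hmax (abs_le.1 ht)
    exact (div_le_iff₀ (hWp t)).1 this
  have hint : |∫ t in (0 : ℝ)..x₀, β t * f t| ≤ m * (W x₀ / 2) := by
    have h1 : |∫ t in (0 : ℝ)..x₀, β t * f t| ≤ |∫ t in (0 : ℝ)..x₀, m * (β t * W t)| := by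
      rw [← Real.norm_eq_abs (∫ t in (0 : ℝ)..x₀, β t * f t)]
      refine intervalIntegral.norm_integral_le_abs_of_norm_le ?_
        ((intervalIntegrable_mul_weight hβ 2 0 x₀).const_mul m)
      refine ae_restrict_of_forall_mem measurableSet_uIoc fun t ht => ?_
      have ht' : |t| ≤ R := by
        have h1 := abs_sub_left_of_mem_uIcc (uIoc_subset_uIcc ht)
        rw [sub_zero, sub_zero] at h1
        exact h1.trans (abs_le.2 hx₀)
      rw [Real.norm_eq_abs, abs_mul, abs_of_nonneg (hβ0 t), abs_of_nonneg (hf0 t)]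
      nlinarith [mul_le_mul_of_nonneg_left (hle t ht') (hβ0 t)]
    rw [intervalIntegral.integral_const_mul, abs_mul, abs_of_nonneg hm0] at h1
    exact h1.trans (mul_le_mul_of_nonneg_left (abs_integral_mul_weight_le hβ hβ0 two_pos x₀) hm0)
  have h2 := h x₀ (abs_le.2 hx₀)
  have h3 : f x₀ = m * W x₀ := by rw [hm, div_mul_cancel₀ _ (hWp x₀).ne']
  have h4 : m ≤ 2 * a := by
    have : m * W x₀ ≤ a * W x₀ + m * (W x₀ / 2) := by
      nlinarith [mul_le_mul_of_nonneg_left (hW1 x₀) ha]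
    have h5 : m * W x₀ ≤ 2 * a * W x₀ := by linarith
    exact le_of_mul_le_mul_right h5 (hWp x₀)
  exact (hle x hx).trans (mul_le_mul_of_nonneg_right h4 (hWp x).le)

end Gronwall

end ZS

namespace ZS

/-! ### Linear differential equations with integrable coefficients -/

/-- The state space of a system of two equations. -/
abbrev V2 : Type := Fin 2 → ℂ

section Volterra

variable {β : ℝ → ℝ} {b : ℝ → V2 →L[ℂ] V2}

lemma aestronglyMeasurable_clm_apply {μ : Measure ℝ} (hb : AEStronglyMeasurable b μ) {f : ℝ → V2}
    (hf : Continuous f) : AEStronglyMeasurable (fun t => b t (f t)) μ :=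
  isBoundedBilinearMap_apply.continuous.comp_aestronglyMeasurable₂ hb hf.aestronglyMeasurable

lemma intervalIntegrable_clm_apply (hβ : ∀ x y, IntervalIntegrable β volume x y)
    (hb : AEStronglyMeasurable b volume) (hbβ : ∀ t, ‖b t‖ ≤ β t) {f : ℝ → V2} (hf : Continuous f)
    (x y : ℝ) : IntervalIntegrable (fun t => b t (f t)) volume x y := by
  have h1 : IntervalIntegrable (fun t => β t * ‖f t‖) volume x y :=
    (hβ x y).mul_continuousOn hf.norm.continuousOn
  refine h1.mono_fun (aestronglyMeasurable_clm_apply hb.restrict hf)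
    (Eventually.of_forall fun t => ?_)
  have h2 : 0 ≤ β t := (norm_nonneg _).trans (hbβ t)
  dsimp only
  rw [norm_mul, norm_norm, Real.norm_eq_abs, abs_of_nonneg h2]
  exact (b t).le_of_opNorm_le (hbβ t) _

/-- The Volterra operator `f ↦ ∫₀ˣ b f`, conjugated with the weight `exp (κ |∫ β|)`. -/
def volterraFun (β : ℝ → ℝ) (κ : ℝ) (b : ℝ → V2 →L[ℂ] V2) (f : ℝ → V2) (x : ℝ) : V2 :=
  (Real.exp (κ * |∫ s in (0 : ℝ)..x, β s|))⁻¹ •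
    ∫ t in (0 : ℝ)..x, b t (Real.exp (κ * |∫ s in (0 : ℝ)..t, β s|) • f t)

variable (hβ : ∀ x y, IntervalIntegrable β volume x y) (hb : AEStronglyMeasurable b volume)
  (hbβ : ∀ t, ‖b t‖ ≤ β t)

include hβ hb hbβ

lemma continuous_volterraFun (κ : ℝ) {f : ℝ → V2} (hf : Continuous f) :
    Continuous (volterraFun β κ b f) := by
  have hW := continuous_weight hβ κ
  refine (hW.inv₀ fun x => (Real.exp_pos _).ne').smul
    (intervalIntegral.continuous_primitive (fun x y => ?_) 0)
  exact intervalIntegrable_clm_apply hβ hb hbβ (hW.smul hf) x y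

omit hb in
lemma norm_volterraFun_le {κ : ℝ} (hκ : 0 < κ) {f : ℝ → V2} {C : ℝ}
    (hC : ∀ t, ‖f t‖ ≤ C) (x : ℝ) : ‖volterraFun β κ b f x‖ ≤ κ⁻¹ * C := by
  have hβ0 : ∀ t, 0 ≤ β t := fun t => (norm_nonneg _).trans (hbβ t)
  have hC0 : 0 ≤ C := (norm_nonneg _).trans (hC 0)
  set W : ℝ → ℝ := fun x => Real.exp (κ * |∫ s in (0 : ℝ)..x, β s|) with hW
  have hWp : ∀ x, 0 < W x := fun x => Real.exp_pos _
  have h1 : ‖∫ t in (0 : ℝ)..x, b t (W t • f t)‖ ≤ |∫ t in (0 : ℝ)..x, C * (β t * W t)| := by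
    refine intervalIntegral.norm_integral_le_abs_of_norm_le (Eventually.of_forall fun t => ?_)
      ((intervalIntegrable_mul_weight hβ κ 0 x).const_mul C)
    refine ((b t).le_of_opNorm_le (hbβ t) _).trans ?_
    rw [norm_smul, Real.norm_eq_abs, abs_of_pos (hWp t)]
    have := mul_le_mul_of_nonneg_left (hC t) (mul_nonneg (hβ0 t) (hWp t).le)
    nlinarith
  rw [intervalIntegral.integral_const_mul, abs_mul, abs_of_nonneg hC0] at h1
  have h2 := mul_le_mul_of_nonneg_left (abs_integral_mul_weight_le hβ hβ0 hκ x) hC0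
  change ‖(W x)⁻¹ • ∫ t in (0 : ℝ)..x, b t (W t • f t)‖ ≤ _
  rw [norm_smul, norm_inv, Real.norm_eq_abs, abs_of_pos (hWp x), inv_mul_le_iff₀ (hWp x)]
  refine (h1.trans h2).trans (le_of_eq ?_)
  simp only [hW]
  field_simp

/-- The conjugated Volterra operator on bounded continuous functions. -/
lemma exists_volterra {κ : ℝ} (hκ : 0 < κ) :
    ∃ A : BoundedContinuousFunction ℝ V2 →L[ℂ] BoundedContinuousFunction ℝ V2,
      ‖A‖ ≤ κ⁻¹ ∧ ∀ f x, A f x = volterraFun β κ b f x := by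
  have hint : ∀ f : ℝ → V2, Continuous f → ∀ x y, IntervalIntegrable
      (fun t => b t (Real.exp (κ * |∫ s in (0 : ℝ)..t, β s|) • f t)) volume x y := fun f hf x y =>
    intervalIntegrable_clm_apply hβ hb hbβ ((continuous_weight hβ κ).smul hf) x y
  let T : BoundedContinuousFunction ℝ V2 →ₗ[ℂ] BoundedContinuousFunction ℝ V2 :=
    { toFun := fun f => BoundedContinuousFunction.ofNormedAddCommGroup (volterraFun β κ b f)
        (continuous_volterraFun hβ hb hbβ κ f.continuous) (κ⁻¹ * ‖f‖)
        (norm_volterraFun_le hβ hbβ hκ f.norm_coe_le_norm)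
      map_add' := fun f g => by
        ext1 x
        change volterraFun β κ b (f + g) x = volterraFun β κ b f x + volterraFun β κ b g x
        simp only [volterraFun]
        rw [← smul_add, ← intervalIntegral.integral_add (hint f f.continuous _ _)
          (hint g g.continuous _ _)]
        simp only [Pi.add_apply, smul_add, map_add]
      map_smul' := fun c f => by
        ext1 x
        change volterraFun β κ b (c • f) x = c • volterraFun β κ b f x
        simp only [volterraFun]
        have e : ∀ t, b t (Real.exp (κ * |∫ s in (0 : ℝ)..t, β s|) • (c • ⇑f) t) =
            c • b t (Real.exp (κ * |∫ s in (0 : ℝ)..t, β s|) • f t) := fun t => by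
          rw [Pi.smul_apply, smul_comm _ c, map_smul]
        simp only [e]
        rw [intervalIntegral.integral_smul, smul_comm] }
  refine ⟨T.mkContinuous κ⁻¹ fun f => ?_, ?_, fun f x => rfl⟩
  · exact BoundedContinuousFunction.norm_ofNormedAddCommGroup_le _ (by positivity)
      (norm_volterraFun_le hβ hbβ hκ f.norm_coe_le_norm)
  · exact T.mkContinuous_norm_le (inv_pos.2 hκ).le _

end Volterra

/-- `F` solves `F' = b F + k`, `F(0) = v`, in integrated form. -/
def SolvesODE (b : ℝ → V2 →L[ℂ] V2) (k : ℝ → V2) (v : V2) (F : ℝ → V2) : Prop :=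
  Continuous F ∧ ∀ x, F x = v + ∫ t in (0 : ℝ)..x, (b t (F t) + k t)

section Uniqueness

variable {β : ℝ → ℝ} {b : ℝ → V2 →L[ℂ] V2} (hβ : ∀ x y, IntervalIntegrable β volume x y)
  (hb : AEStronglyMeasurable b volume) (hbβ : ∀ t, ‖b t‖ ≤ β t)

include hβ hb hbβ

lemma SolvesODE.unique {k : ℝ → V2} (hk : ∀ x y, IntervalIntegrable k volume x y) {v : V2}
    {F G : ℝ → V2} (hF : SolvesODE b k v F) (hG : SolvesODE b k v G) : F = G := by
  have hβ0 : ∀ t, 0 ≤ β t := fun t => (norm_nonneg _).trans (hbβ t)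
  ext1 x
  have h1 : ∀ x, F x - G x = ∫ t in (0 : ℝ)..x, b t (F t - G t) := fun x => by
    rw [hF.2, hG.2, add_sub_add_left_eq_sub, ← intervalIntegral.integral_sub
      ((intervalIntegrable_clm_apply hβ hb hbβ hF.1 _ _).add (hk _ _))
      ((intervalIntegrable_clm_apply hβ hb hbβ hG.1 _ _).add (hk _ _))]
    refine intervalIntegral.integral_congr fun t _ => ?_
    simp only [map_sub]
    abel
  have h2 := le_of_le_add_abs_integral hβ hβ0 (f := fun x => ‖F x - G x‖) (hF.1.sub hG.1).norm
    (fun x => norm_nonneg _) le_rfl (R := |x|) (fun y _ => ?_) le_rfl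
  · simp only [mul_zero, zero_mul] at h2
    exact sub_eq_zero.1 (norm_le_zero_iff.1 h2)
  · rw [zero_add, h1]
    exact intervalIntegral.norm_integral_le_abs_of_norm_le
      (Eventually.of_forall fun t => (b t).le_of_opNorm_le (hbβ t) _)
      ((hβ _ _).mul_continuousOn (hF.1.sub hG.1).norm.continuousOn)

end Uniqueness

/-- The Neumann series: the solution `F` of `F = g + A F + z S F` depends analytically on `z`. -/
lemma exists_neumann_chain {X : Type*} [NormedAddCommGroup X] [NormedSpace ℂ X] [CompleteSpace X]
    (A S : X →L[ℂ] X) (z : ℂ) (hA : ‖A‖ ≤ (2 * (‖z‖ + 1))⁻¹) (hS : ‖S‖ ≤ (2 * (‖z‖ + 1))⁻¹)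
    (g : X) :
    ∃ f : ℕ → X, f 0 = g + (A (f 0) + z • S (f 0)) ∧
      (∀ k, f (k + 1) = S (f k) + (A (f (k + 1)) + z • S (f (k + 1)))) ∧
      ∃ ε > 0, ∀ w : ℂ, ‖w‖ < ε →
        ∃ F, F = g + (A F + (z + w) • S F) ∧ HasSum (fun k => w ^ k • f k) F := by
  have hAS : ‖A + z • S‖ < 1 := by
    have h1 : ‖z • S‖ ≤ ‖z‖ * (2 * (‖z‖ + 1))⁻¹ := by
      rw [norm_smul]
      exact mul_le_mul_of_nonneg_left hS (norm_nonneg _)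
    have h2 : (2 * (‖z‖ + 1))⁻¹ + ‖z‖ * (2 * (‖z‖ + 1))⁻¹ = 1 / 2 := by field_simp; ring
    linarith [norm_add_le A (z • S)]
  -- `R` is the resolvent `(1 - A - z S)⁻¹`, and the Taylor coefficients are `(R S)^k R g`
  let u := Units.oneSub (A + z • S) hAS
  let R : X →L[ℂ] X := ↑u⁻¹
  have hR : ∀ f, R f = f + (A (R f) + z • S (R f)) := fun f => by
    have h1 : (1 - (A + z • S)) * R = 1 := u.mul_inv
    have h2 := congrArg (fun T => T f) h1
    have h3 : R f - (A (R f) + z • S (R f)) = f := by simpa using h2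
    rwa [sub_eq_iff_eq_add] at h3
  let f : ℕ → X := fun k => ((R * S) ^ k) (R g)
  have hf0 : f 0 = R g := by simp [f]
  have hfs : ∀ k, f (k + 1) = R (S (f k)) := fun k => by
    simp only [f, pow_succ' (R * S) k]; rfl
  clear_value f R
  refine ⟨f, by rw [hf0]; exact hR g, fun k => by rw [hfs]; exact hR _, (‖R * S‖ + 1)⁻¹,
    by positivity, fun w hw => ?_⟩
  have hr : ‖w‖ * ‖R * S‖ < 1 := by
    have h3 : ‖w‖ * (‖R * S‖ + 1) < 1 := by
      rwa [← lt_div_iff₀ (by positivity), one_div]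
    nlinarith [norm_nonneg w, norm_nonneg (R * S)]
  have hsum : Summable fun k => w ^ k • f k := by
    have h4 : ∀ k, ‖f k‖ ≤ ‖R * S‖ ^ k * ‖f 0‖ := fun k => by
      induction k with
      | zero => simp
      | succ k ih =>
        rw [hfs, pow_succ', mul_assoc]
        exact (R * S).le_opNorm_of_le ih
    refine Summable.of_norm_bounded
      ((summable_geometric_of_lt_one (by positivity) hr).mul_right ‖f 0‖) fun k => ?_
    rw [norm_smul, norm_pow, mul_pow, mul_assoc]
    exact mul_le_mul_of_nonneg_left (h4 k) (by positivity)
  set F := ∑' k, w ^ k • f k with hF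
  have hFs : HasSum (fun k => w ^ k • f k) F := hsum.hasSum
  refine ⟨F, ?_, hFs⟩
  have h6 : HasSum (fun k => w ^ (k + 1) • f (k + 1)) (w • R (S F)) := by
    have h7 := (R.hasSum (S.hasSum hFs)).const_smul w
    have h8 : (fun k => w • R (S (w ^ k • f k))) = fun k => w ^ (k + 1) • f (k + 1) := by
      ext1 k
      rw [S.map_smul, R.map_smul, smul_smul, hfs, pow_succ']
    rwa [h8] at h7
  have h8 : F = R (g + w • S F) := by
    have h10 := hFs.unique h6.zero_add
    rw [pow_zero, one_smul, hf0] at h10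
    rw [R.map_add, R.map_smul]
    exact h10
  have h9 := hR (g + w • S F)
  rw [← h8] at h9
  conv_lhs => rw [h9]
  rw [add_smul]
  abel

/-- The solution of `F' = (b₁ + z b₂) F`, `F(0) = v`, is an analytic function of `z`. Its Taylor
coefficients at `z` solve a chain of inhomogeneous equations. -/
theorem exists_solvesODE_chain {β : ℝ → ℝ} {b₁ b₂ : ℝ → V2 →L[ℂ] V2}
    (hβ : ∀ x y, IntervalIntegrable β volume x y)
    (hb₁ : AEStronglyMeasurable b₁ volume) (hbβ₁ : ∀ t, ‖b₁ t‖ ≤ β t)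
    (hb₂ : AEStronglyMeasurable b₂ volume) (hbβ₂ : ∀ t, ‖b₂ t‖ ≤ β t) (z : ℂ) (v : V2) :
    ∃ Y : ℕ → ℝ → V2, SolvesODE (fun t => b₁ t + z • b₂ t) 0 v (Y 0) ∧
      (∀ k, SolvesODE (fun t => b₁ t + z • b₂ t) (fun t => b₂ t (Y k t)) 0 (Y (k + 1))) ∧
      ∃ ε > 0, ∀ w : ℂ, ‖w‖ < ε → ∃ F, SolvesODE (fun t => b₁ t + (z + w) • b₂ t) 0 v F ∧
        ∀ x, HasSum (fun k => w ^ k • Y k x) (F x) := by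
  set κ : ℝ := 2 * (‖z‖ + 1) with hκ
  have hκ0 : 0 < κ := by positivity
  obtain ⟨A, hA, hA'⟩ := exists_volterra hβ hb₁ hbβ₁ hκ0
  obtain ⟨S, hS, hS'⟩ := exists_volterra hβ hb₂ hbβ₂ hκ0
  set W : ℝ → ℝ := fun x => Real.exp (κ * |∫ s in (0 : ℝ)..x, β s|) with hW
  have hWc : Continuous W := continuous_weight hβ κ
  have hWp : ∀ x, 0 < W x := fun x => Real.exp_pos _
  have hW1 : ∀ x, 1 ≤ W x := fun x => Real.one_le_exp (by positivity)
  let g : BoundedContinuousFunction ℝ V2 :=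
    BoundedContinuousFunction.ofNormedAddCommGroup (fun x => (W x)⁻¹ • v)
      ((hWc.inv₀ fun x => (hWp x).ne').smul continuous_const) ‖v‖ fun x => by
        rw [norm_smul, norm_inv, Real.norm_eq_abs, abs_of_pos (hWp x)]
        exact mul_le_of_le_one_left (norm_nonneg _) (inv_le_one_of_one_le₀ (hW1 x))
  obtain ⟨f, hf0, hfs, ε, hε, hF⟩ := exists_neumann_chain A S z hA hS g
  -- undoing the conjugation turns Volterra operators into integrals
  have hun : ∀ (ζ : ℂ) (h : BoundedContinuousFunction ℝ V2) (x : ℝ),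
      W x • (A h + ζ • S h) x = ∫ t in (0 : ℝ)..x, (b₁ t + ζ • b₂ t) (W t • h t) := fun ζ h x => by
    have hi₁ := intervalIntegrable_clm_apply hβ hb₁ hbβ₁ (hWc.smul h.continuous) 0 x
    have hi₂ := intervalIntegrable_clm_apply hβ hb₂ hbβ₂ (hWc.smul h.continuous) 0 x
    rw [BoundedContinuousFunction.add_apply, BoundedContinuousFunction.smul_apply, hA', hS',
      smul_add, smul_comm _ ζ]
    simp only [volterraFun, add_apply, smul_apply]
    rw [smul_inv_smul₀ (hWp x).ne', smul_inv_smul₀ (hWp x).ne', ← intervalIntegral.integral_smul]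
    exact (intervalIntegral.integral_add hi₁ (hi₂.smul ζ)).symm
  have hunS : ∀ (h : BoundedContinuousFunction ℝ V2) (x : ℝ),
      W x • (S h) x = ∫ t in (0 : ℝ)..x, b₂ t (W t • h t) := fun h x => by
    rw [hS', volterraFun, smul_inv_smul₀ (hWp x).ne']
  have hWg : ∀ x, W x • g x = v := fun x => smul_inv_smul₀ (hWp x).ne' v
  have hadd : ∀ (p q : BoundedContinuousFunction ℝ V2) (x : ℝ),
      W x • (p + q) x = W x • p x + W x • q x := fun p q x => smul_add _ _ _
  refine ⟨fun k x => W x • f k x, ⟨hWc.smul (f 0).continuous, fun x => ?_⟩,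
    fun k => ⟨hWc.smul (f (k + 1)).continuous, fun x => ?_⟩, ε, hε, fun w hw => ?_⟩
  · simp only [Pi.zero_apply, add_zero]
    conv_lhs => rw [hf0]
    rw [hadd, hun, hWg]
  · change W x • f (k + 1) x = _
    conv_lhs => rw [hfs k]
    rw [hadd, hun, hunS, zero_add, add_comm, ← intervalIntegral.integral_add]
    · exact ((intervalIntegrable_clm_apply hβ hb₁ hbβ₁ (hWc.smul (f (k + 1)).continuous) 0 x).add
        ((intervalIntegrable_clm_apply hβ hb₂ hbβ₂ (hWc.smul (f (k + 1)).continuous) 0 x).smul z))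
    · exact intervalIntegrable_clm_apply hβ hb₂ hbβ₂ (hWc.smul (f k).continuous) 0 x
  · obtain ⟨F, hFeq, hFs⟩ := hF w hw
    refine ⟨fun x => W x • F x, ⟨hWc.smul F.continuous, fun x => ?_⟩, fun x => ?_⟩
    · simp only [Pi.zero_apply, add_zero]
      conv_lhs => rw [hFeq]
      rw [hadd, hun, hWg]
    · have h8 := ((BoundedContinuousFunction.evalCLM ℂ x).hasSum hFs).const_smul (W x)
      convert! h8 using 1
      ext1 k
      change w ^ k • (W x • f k x) = W x • (w ^ k • f k x)
      rw [smul_comm]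

end ZS

namespace ZS

/-! ### The Zakharov-Shabat system -/

/-- The coefficient `φ₁` as a function on the line. -/
def pot₁ (φ : Potential) (t : ℝ) : ℂ := φ.1 (t : UnitAddCircle)

/-- The coefficient `φ₂` as a function on the line. -/
def pot₂ (φ : Potential) (t : ℝ) : ℂ := φ.2 (t : UnitAddCircle)

section Lp

variable (f : Lp ℂ 2 (volume : Measure UnitAddCircle))

lemma periodic_coe_addCircle : Function.Periodic (fun t : ℝ => f (t : UnitAddCircle)) 1 := fun t => by
  simp

lemma stronglyMeasurable_coe_addCircle :
    StronglyMeasurable (fun t : ℝ => f (t : UnitAddCircle)) :=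
  (Lp.stronglyMeasurable f).comp_measurable AddCircle.measurable_mk'

lemma intervalIntegrable_norm_sq_coe_addCircle (a b : ℝ) :
    IntervalIntegrable (fun t : ℝ => ‖f (t : UnitAddCircle)‖ ^ 2) volume a b := by
  have h1 : Integrable (fun x : UnitAddCircle => ‖f x‖ ^ 2) := by
    have := (Lp.memLp f).integrable_norm_pow two_ne_zero
    simpa using this
  have h2 := (UnitAddCircle.measurePreserving_mk 0).integrable_comp_of_integrable h1
  refine Function.Periodic.intervalIntegrable (t := 0) (T := 1) (fun t => ?_) one_ne_zero ?_ a b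
  · rw [show f ((t + 1 : ℝ) : UnitAddCircle) = f (t : UnitAddCircle) from periodic_coe_addCircle f t]
  · exact (intervalIntegrable_iff_integrableOn_Ioc_of_le (by norm_num)).2 h2

lemma memLp_coe_addCircle (a b : ℝ) :
    MemLp (fun t : ℝ => f (t : UnitAddCircle)) 2 (volume.restrict (Icc a b)) := by
  rw [memLp_two_iff_integrable_sq_norm (stronglyMeasurable_coe_addCircle f).aestronglyMeasurable]
  rcases le_total a b with hab | hab
  · exact (integrableOn_Icc_iff_integrableOn_Ioc (by simp)).2
      ((intervalIntegrable_iff_integrableOn_Ioc_of_le hab).1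
        (intervalIntegrable_norm_sq_coe_addCircle f a b))
  · refine IntegrableOn.of_measure_zero ?_
    rw [Real.volume_Icc]; simpa using hab

lemma intervalIntegrable_coe_addCircle (a b : ℝ) :
    IntervalIntegrable (fun t : ℝ => f (t : UnitAddCircle)) volume a b := by
  have h1 : IntervalIntegrable (fun t : ℝ => 1 + ‖f (t : UnitAddCircle)‖ ^ 2) volume a b :=
    intervalIntegrable_const.add (intervalIntegrable_norm_sq_coe_addCircle f a b)
  refine h1.mono_fun (stronglyMeasurable_coe_addCircle f).aestronglyMeasurable
    (Eventually.of_forall fun t => ?_)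
  dsimp only
  rw [Real.norm_eq_abs, abs_of_nonneg (by positivity)]
  nlinarith [sq_nonneg (‖f (t : UnitAddCircle)‖ - 1)]

end Lp

/-- The operator `v ↦ (v₁, 0)`. -/
def upperCLM : V2 →L[ℂ] V2 := ContinuousLinearMap.pi ![ContinuousLinearMap.proj 1, 0]

/-- The operator `v ↦ (0, v₀)`. -/
def lowerCLM : V2 →L[ℂ] V2 := ContinuousLinearMap.pi ![0, ContinuousLinearMap.proj 0]

/-- The operator `v ↦ (-i v₀, i v₁)`. -/
def diagCLM : V2 →L[ℂ] V2 :=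
  ContinuousLinearMap.pi ![(-Complex.I) • ContinuousLinearMap.proj 0, Complex.I • ContinuousLinearMap.proj 1]

@[simp] lemma upperCLM_apply (v : V2) : upperCLM v = ![v 1, 0] := by
  ext i; fin_cases i <;> rfl

@[simp] lemma lowerCLM_apply (v : V2) : lowerCLM v = ![0, v 0] := by
  ext i; fin_cases i <;> rfl

@[simp] lemma diagCLM_apply (v : V2) : diagCLM v = ![-Complex.I * v 0, Complex.I * v 1] := by
  ext i; fin_cases i <;> rfl

lemma norm_upperCLM_le : ‖upperCLM‖ ≤ 1 := by
  refine ContinuousLinearMap.opNorm_le_bound _ zero_le_one fun v => ?_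
  rw [one_mul, pi_norm_le_iff_of_nonneg (norm_nonneg _), Fin.forall_fin_two]
  simpa using norm_le_pi_norm v 1

lemma norm_lowerCLM_le : ‖lowerCLM‖ ≤ 1 := by
  refine ContinuousLinearMap.opNorm_le_bound _ zero_le_one fun v => ?_
  rw [one_mul, pi_norm_le_iff_of_nonneg (norm_nonneg _), Fin.forall_fin_two]
  simpa using norm_le_pi_norm v 0

lemma norm_diagCLM_le : ‖diagCLM‖ ≤ 1 := by
  refine ContinuousLinearMap.opNorm_le_bound _ zero_le_one fun v => ?_
  rw [one_mul, pi_norm_le_iff_of_nonneg (norm_nonneg _), Fin.forall_fin_two]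
  simpa using ⟨norm_le_pi_norm v 0, norm_le_pi_norm v 1⟩

/-- The part of the coefficient matrix that contains the potential. -/
def potCLM (φ : Potential) (t : ℝ) : V2 →L[ℂ] V2 :=
  (Complex.I * pot₁ φ t) • upperCLM + (-(Complex.I * pot₂ φ t)) • lowerCLM

/-- The coefficient matrix of the system `L(φ) F = z F`, solved for `F'`. -/
def coeffCLM (φ : Potential) (z : ℂ) (t : ℝ) : V2 →L[ℂ] V2 := potCLM φ t + z • diagCLM

lemma coeffCLM_apply (φ : Potential) (z : ℂ) (t : ℝ) (v : V2) :
    coeffCLM φ z t v = ![-Complex.I * (z * v 0 - pot₁ φ t * v 1),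
      Complex.I * (z * v 1 - pot₂ φ t * v 0)] := by
  ext i
  fin_cases i
  · simp [coeffCLM, potCLM]; ring
  · simp [coeffCLM, potCLM]; ring

/-- An integrable bound for the coefficients. -/
def potBound (φ : Potential) (t : ℝ) : ℝ := 1 + ‖pot₁ φ t‖ + ‖pot₂ φ t‖

lemma intervalIntegrable_pot₁ (φ : Potential) (a b : ℝ) : IntervalIntegrable (pot₁ φ) volume a b :=
  intervalIntegrable_coe_addCircle φ.1 a b

lemma intervalIntegrable_pot₂ (φ : Potential) (a b : ℝ) : IntervalIntegrable (pot₂ φ) volume a b :=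
  intervalIntegrable_coe_addCircle φ.2 a b

lemma intervalIntegrable_potBound (φ : Potential) (a b : ℝ) :
    IntervalIntegrable (potBound φ) volume a b :=
  (intervalIntegrable_const.add (intervalIntegrable_pot₁ φ a b).norm).add
    (intervalIntegrable_pot₂ φ a b).norm

lemma aestronglyMeasurable_potCLM (φ : Potential) : AEStronglyMeasurable (potCLM φ) volume := by
  have h1 : StronglyMeasurable (pot₁ φ) := stronglyMeasurable_coe_addCircle φ.1
  have h2 : StronglyMeasurable (pot₂ φ) := stronglyMeasurable_coe_addCircle φ.2
  exact (((h1.const_mul Complex.I).smul_const upperCLM).add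
    ((h2.const_mul Complex.I).neg.smul_const lowerCLM)).aestronglyMeasurable

lemma norm_potCLM_le (φ : Potential) (t : ℝ) : ‖potCLM φ t‖ ≤ potBound φ t := by
  refine (norm_add_le _ _).trans ?_
  have h1 : ‖(Complex.I * pot₁ φ t) • upperCLM‖ ≤ ‖pot₁ φ t‖ := by
    refine (ContinuousLinearMap.opNorm_smul_le _ _).trans ?_
    rw [norm_mul, Complex.norm_I, one_mul]
    exact mul_le_of_le_one_right (norm_nonneg _) norm_upperCLM_le
  have h2 : ‖(-(Complex.I * pot₂ φ t)) • lowerCLM‖ ≤ ‖pot₂ φ t‖ := by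
    refine (ContinuousLinearMap.opNorm_smul_le _ _).trans ?_
    rw [norm_neg, norm_mul, Complex.norm_I, one_mul]
    exact mul_le_of_le_one_right (norm_nonneg _) norm_lowerCLM_le
  unfold potBound
  linarith

lemma norm_diagCLM_le_potBound (φ : Potential) (t : ℝ) : ‖diagCLM‖ ≤ potBound φ t := by
  unfold potBound
  linarith [norm_diagCLM_le, norm_nonneg (pot₁ φ t), norm_nonneg (pot₂ φ t)]

lemma aestronglyMeasurable_coeffCLM (φ : Potential) (z : ℂ) :
    AEStronglyMeasurable (coeffCLM φ z) volume :=
  (aestronglyMeasurable_potCLM φ).add aestronglyMeasurable_const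

lemma norm_coeffCLM_le (φ : Potential) (z : ℂ) (t : ℝ) :
    ‖coeffCLM φ z t‖ ≤ (1 + ‖z‖) * potBound φ t := by
  refine (norm_add_le _ _).trans ?_
  have h1 := (ContinuousLinearMap.opNorm_smul_le z diagCLM).trans
    (mul_le_mul_of_nonneg_left (norm_diagCLM_le_potBound φ t) (norm_nonneg z))
  linarith [norm_potCLM_le φ t]

lemma periodic_coeffCLM (φ : Potential) (z : ℂ) : Function.Periodic (coeffCLM φ z) 1 := fun t => by
  have h1 : pot₁ φ (t + 1) = pot₁ φ t := periodic_coe_addCircle φ.1 t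
  have h2 : pot₂ φ (t + 1) = pot₂ φ t := periodic_coe_addCircle φ.2 t
  simp only [coeffCLM, potCLM, h1, h2]

lemma intervalIntegrable_coeffCLM_apply (φ : Potential) (z : ℂ) {F : ℝ → V2} (hF : Continuous F)
    (x y : ℝ) : IntervalIntegrable (fun t => coeffCLM φ z t (F t)) volume x y :=
  intervalIntegrable_clm_apply (fun a b => (intervalIntegrable_potBound φ a b).const_mul (1 + ‖z‖))
    (aestronglyMeasurable_coeffCLM φ z) (norm_coeffCLM_le φ z) hF x y

lemma SolvesODE.unique_coeff {φ : Potential} {z : ℂ} {k : ℝ → V2} (hk : Continuous k) {v : V2}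
    {F G : ℝ → V2} (hF : SolvesODE (coeffCLM φ z) k v F) (hG : SolvesODE (coeffCLM φ z) k v G) :
    F = G :=
  SolvesODE.unique (fun a b => (intervalIntegrable_potBound φ a b).const_mul (1 + ‖z‖))
    (aestronglyMeasurable_coeffCLM φ z) (norm_coeffCLM_le φ z)
    (fun x y => hk.intervalIntegrable x y) hF hG

lemma intervalIntegral_apply {g : ℝ → V2} {x y : ℝ} (hg : IntervalIntegrable g volume x y)
    (i : Fin 2) : (∫ t in x..y, g t) i = ∫ t in x..y, g t i :=
  ((ContinuousLinearMap.proj (R := ℂ) (φ := fun _ : Fin 2 => ℂ) i).intervalIntegral_comp_comm hg).symm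

/-- The equation `L(φ) F = z F + K` in integrated form. -/
lemma isZSImage_iff {φ : Potential} {z : ℂ} {F K : ℝ → V2} (hK : Continuous K) :
    IsZSImage φ F (fun x => z • F x + K x) ↔
      SolvesODE (coeffCLM φ z) (fun t => diagCLM (K t)) (F 0) F := by
  constructor
  · rintro ⟨F', hF', hae⟩
    have hi : ∀ j x y, IntervalIntegrable (fun t => F' t j) volume x y := fun j x y => by
      have h1 : IntegrableOn (fun t => F' t j) (uIcc x y) volume :=
        ((hF' j).1 (min x y) (max x y)).integrable one_le_two
      exact intervalIntegrable_iff.2 (h1.mono_set uIoc_subset_uIcc)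
    have hcF : Continuous F := continuous_pi fun j =>
      IsPrimitive.continuous (f' := fun t => F' t j) ⟨hi j, (hF' j).2⟩
    refine ⟨hcF, fun x => ?_⟩
    have hint : IntervalIntegrable (fun t => coeffCLM φ z t (F t) + diagCLM (K t)) volume 0 x :=
      (intervalIntegrable_coeffCLM_apply φ z hcF 0 x).add ((diagCLM.continuous.comp hK).intervalIntegrable 0 x)
    have heq : ∀ᵐ t, ∀ j, F' t j = (coeffCLM φ z t (F t) + diagCLM (K t)) j := by
      filter_upwards [hae] with t ht
      have h1 : Complex.I * F' t 0 + pot₁ φ t * F t 1 = z * F t 0 + K t 0 := ht.1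
      have h2 : -Complex.I * F' t 1 + pot₂ φ t * F t 0 = z * F t 1 + K t 1 := ht.2
      have hI := Complex.I_mul_I
      rw [Fin.forall_fin_two, coeffCLM_apply, diagCLM_apply]
      simp only [Pi.add_apply, Matrix.cons_val_zero, Matrix.cons_val_one]
      constructor
      · linear_combination (-Complex.I) * h1 + F' t 0 * hI
      · linear_combination Complex.I * h2 + F' t 1 * hI
    ext j
    rw [Pi.add_apply, intervalIntegral_apply hint j]
    refine ((hF' j).2 x).trans (congrArg (F 0 j + ·) ?_)
    refine intervalIntegral.integral_congr_ae ?_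
    filter_upwards [heq] with t ht _
    exact ht j
  · rintro ⟨hcF, hF⟩
    refine ⟨fun t => coeffCLM φ z t (F t) + diagCLM (K t), fun j => ⟨fun a b => ?_, fun x => ?_⟩, ?_⟩
    · have hq : ∀ (q : Lp ℂ 2 (volume : Measure UnitAddCircle)) {c d : ℝ → ℂ}, Continuous c →
          Continuous d → MemLp (fun t : ℝ => q (t : UnitAddCircle) * c t + d t) 2
            (volume.restrict (Icc a b)) := fun q c d hc hd => by
        obtain ⟨C, hC⟩ := isCompact_Icc.exists_bound_of_continuousOn (s := Icc a b) hc.continuousOn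
        obtain ⟨D, hD⟩ := isCompact_Icc.exists_bound_of_continuousOn (s := Icc a b) hd.continuousOn
        refine MemLp.add ?_ ?_
        · refine (memLp_coe_addCircle q a b).of_le_mul (c := C)
            ((stronglyMeasurable_coe_addCircle q).aestronglyMeasurable.mul
              hc.aestronglyMeasurable) ?_
          refine ae_restrict_of_forall_mem measurableSet_Icc fun t ht => ?_
          rw [norm_mul, mul_comm]
          exact mul_le_mul_of_nonneg_right (hC t ht) (norm_nonneg _)
        · exact MemLp.of_bound hd.aestronglyMeasurable D
            (ae_restrict_of_forall_mem measurableSet_Icc hD)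
      have hF0 := (continuous_apply (0 : Fin 2)).comp hcF
      have hF1 := (continuous_apply (1 : Fin 2)).comp hcF
      have hK0 := (continuous_apply (0 : Fin 2)).comp hK
      have hK1 := (continuous_apply (1 : Fin 2)).comp hK
      fin_cases j
      · refine (hq φ.1 (c := fun t => Complex.I * F t 1)
          (d := fun t => -Complex.I * (z * F t 0 + K t 0)) (by fun_prop) (by fun_prop)).ae_eq ?_
        refine Eventually.of_forall fun t => ?_
        simp [coeffCLM_apply, pot₁]; ring
      · refine (hq φ.2 (c := fun t => -Complex.I * F t 0)
          (d := fun t => Complex.I * (z * F t 1 + K t 1)) (by fun_prop) (by fun_prop)).ae_eq ?_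
        refine Eventually.of_forall fun t => ?_
        simp [coeffCLM_apply, pot₂]; ring
    · have hint : IntervalIntegrable (fun t => coeffCLM φ z t (F t) + diagCLM (K t)) volume 0 x :=
        (intervalIntegrable_coeffCLM_apply φ z hcF 0 x).add ((diagCLM.continuous.comp hK).intervalIntegrable 0 x)
      have := congrFun (hF x) j
      rw [Pi.add_apply, show (∫ t in (0 : ℝ)..x, (coeffCLM φ z t (F t) + (fun t => diagCLM (K t)) t)) j = _ from
        intervalIntegral_apply hint j] at this
      exact this
    · refine Eventually.of_forall fun t => ?_
      have hI := Complex.I_mul_I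
      have h1 : φ.1 (t : UnitAddCircle) = pot₁ φ t := rfl
      have h2 : φ.2 (t : UnitAddCircle) = pot₂ φ t := rfl
      simp only [coeffCLM_apply, diagCLM_apply, Pi.add_apply, Matrix.cons_val_zero,
        Matrix.cons_val_one, Pi.smul_apply, smul_eq_mul, h1, h2]
      constructor
      · linear_combination (-(z * F t 0 - pot₁ φ t * F t 1) - K t 0) * hI
      · linear_combination (-(z * F t 1 - pot₂ φ t * F t 0) - K t 1) * hI

end ZS

namespace ZS

/-! ### The fundamental matrix -/

section General

variable {φ : Potential} {z : ℂ}

lemma SolvesODE.apply_zero {b : ℝ → V2 →L[ℂ] V2} {k : ℝ → V2} {v : V2} {F : ℝ → V2}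
    (h : SolvesODE b k v F) : F 0 = v := by
  rw [h.2]; simp

lemma SolvesODE.add {k l : ℝ → V2} {v w : V2} {F G : ℝ → V2} (hk : Continuous k) (hl : Continuous l)
    (hF : SolvesODE (coeffCLM φ z) k v F) (hG : SolvesODE (coeffCLM φ z) l w G) :
    SolvesODE (coeffCLM φ z) (k + l) (v + w) (F + G) := by
  refine ⟨hF.1.add hG.1, fun x => ?_⟩
  rw [Pi.add_apply, hF.2, hG.2, add_add_add_comm, ← intervalIntegral.integral_add]
  · congr 1
    refine intervalIntegral.integral_congr fun t _ => ?_
    simp only [Pi.add_apply, map_add]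
    abel
  · exact (intervalIntegrable_coeffCLM_apply φ z hF.1 _ _).add (hk.intervalIntegrable _ _)
  · exact (intervalIntegrable_coeffCLM_apply φ z hG.1 _ _).add (hl.intervalIntegrable _ _)

lemma SolvesODE.smul {k : ℝ → V2} {v : V2} {F : ℝ → V2} (c : ℂ)
    (hF : SolvesODE (coeffCLM φ z) k v F) :
    SolvesODE (coeffCLM φ z) (c • k) (c • v) (c • F) := by
  refine ⟨hF.1.const_smul c, fun x => ?_⟩
  rw [Pi.smul_apply, hF.2, smul_add, ← intervalIntegral.integral_smul]
  congr 1
  refine intervalIntegral.integral_congr fun t _ => ?_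
  simp only [Pi.smul_apply, map_smul, smul_add]

/-- Translation by a period. -/
lemma SolvesODE.comp_add {k : ℝ → V2} {v : V2} {F : ℝ → V2} (hk : Continuous k)
    (hF : SolvesODE (coeffCLM φ z) k v F) {T : ℝ} (hT : Function.Periodic (coeffCLM φ z) T) :
    SolvesODE (coeffCLM φ z) (fun x => k (x + T)) (F T) (fun x => F (x + T)) := by
  refine ⟨hF.1.comp (continuous_id.add continuous_const), fun x => ?_⟩
  have hi : ∀ x y, IntervalIntegrable (fun t => coeffCLM φ z t (F t) + k t) volume x y := fun x y =>
    (intervalIntegrable_coeffCLM_apply φ z hF.1 _ _).add (hk.intervalIntegrable _ _)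
  have h1 := intervalIntegral.integral_comp_add_right
    (fun t => coeffCLM φ z t (F t) + k t) T (a := 0) (b := x)
  simp only [hT _, zero_add] at h1
  rw [h1]
  change F (x + T) = _
  rw [hF.2 (x + T), hF.2 T, add_assoc,
    intervalIntegral.integral_add_adjacent_intervals (hi _ _) (hi _ _)]

end General

lemma isFundamentalMatrix_iff {φ : Potential} {z : ℂ} {M : ℝ → Matrix (Fin 2) (Fin 2) ℂ} :
    IsFundamentalMatrix φ z M ↔
      ∀ j, SolvesODE (coeffCLM φ z) 0 (fun i => (1 : Matrix (Fin 2) (Fin 2) ℂ) i j)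
        (fun x i => M x i j) := by
  have key : ∀ j, IsZSImage φ (fun x i => M x i j) (fun x i => z * M x i j) ↔
      SolvesODE (coeffCLM φ z) 0 (fun i => M 0 i j) (fun x i => M x i j) := fun j => by
    have h := isZSImage_iff (φ := φ) (z := z) (F := fun x i => M x i j) (K := fun _ => 0)
      continuous_const
    simp only [add_zero, map_zero] at h
    exact h
  constructor
  · rintro ⟨h0, h⟩ j
    have := (key j).1 (h j)
    rwa [h0] at this
  · intro h
    have h0 : M 0 = 1 := by
      ext i j
      exact congrFun (h j).apply_zero i
    refine ⟨h0, fun j => (key j).2 ?_⟩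
    rw [h0]
    exact h j

/-- The Taylor coefficients of `w ↦ M(x, z + w)`. -/
structure IsTaylor (φ : Potential) (z : ℂ) (V : ℕ → ℝ → Matrix (Fin 2) (Fin 2) ℂ) : Prop where
  zero : V 0 = fundamentalMatrix φ z
  succ : ∀ k j, SolvesODE (coeffCLM φ z) (fun t => diagCLM (fun i => V k t i j)) 0
    (fun x i => V (k + 1) x i j)
  hasSum : ∃ ε > 0, ∀ w : ℂ, ‖w‖ < ε → ∀ x i j,
    HasSum (fun k => w ^ k * V k x i j) (fundamentalMatrix φ (z + w) x i j)

/-- The Taylor expansion in the spectral parameter of the solution with initial value `v`. -/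
lemma exists_chain (φ : Potential) (z : ℂ) (v : V2) :
    ∃ Y : ℕ → ℝ → V2, SolvesODE (coeffCLM φ z) 0 v (Y 0) ∧
      (∀ k, SolvesODE (coeffCLM φ z) (fun t => diagCLM (Y k t)) 0 (Y (k + 1))) ∧
      ∃ ε > 0, ∀ w : ℂ, ‖w‖ < ε → ∃ F, SolvesODE (coeffCLM φ (z + w)) 0 v F ∧
        ∀ x, HasSum (fun k => w ^ k • Y k x) (F x) :=
  exists_solvesODE_chain (b₂ := fun _ => diagCLM) (intervalIntegrable_potBound φ)
    (aestronglyMeasurable_potCLM φ) (norm_potCLM_le φ) aestronglyMeasurable_const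
    (norm_diagCLM_le_potBound φ) z v

lemma solvesODE_fundamentalMatrix (φ : Potential) (z : ℂ) (j : Fin 2) :
    SolvesODE (coeffCLM φ z) 0 (fun i => (1 : Matrix (Fin 2) (Fin 2) ℂ) i j)
      (fun x i => fundamentalMatrix φ z x i j) := by
  have hex : ∃ M, IsFundamentalMatrix φ z M := by
    choose Y hY _ using fun j => exists_chain φ z (fun i => (1 : Matrix (Fin 2) (Fin 2) ℂ) i j)
    exact ⟨fun x => Matrix.of fun i j => Y j 0 x i, isFundamentalMatrix_iff.2 hY⟩
  exact isFundamentalMatrix_iff.1 (Classical.epsilon_spec hex) j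

lemma exists_isTaylor (φ : Potential) (z : ℂ) : ∃ V, IsTaylor φ z V := by
  choose Y hY0 hYs ε hε hYw using
    fun j => exists_chain φ z (fun i => (1 : Matrix (Fin 2) (Fin 2) ℂ) i j)
  have hY : ∀ j, Y j 0 = fun x i => fundamentalMatrix φ z x i j := fun j =>
    (hY0 j).unique_coeff continuous_const (solvesODE_fundamentalMatrix φ z j)
  refine ⟨fun k x => Matrix.of fun i j => Y j k x i, ?_, fun k j => hYs j k,
    min (ε 0) (ε 1), lt_min (hε 0) (hε 1), fun w hw x i j => ?_⟩
  · ext x i j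
    exact congrFun (congrFun (hY j) x) i
  · have hwj : ‖w‖ < ε j := by
      fin_cases j
      · exact hw.trans_le (min_le_left _ _)
      · exact hw.trans_le (min_le_right _ _)
    obtain ⟨F, hF, hFs⟩ := hYw j w hwj
    rw [hF.unique_coeff continuous_const (solvesODE_fundamentalMatrix φ (z + w) j)] at hFs
    exact (ContinuousLinearMap.proj (R := ℂ) (φ := fun _ : Fin 2 => ℂ) i).hasSum (hFs x)

lemma analyticAt_fundamentalMatrix (φ : Potential) (x : ℝ) (i j : Fin 2) (z : ℂ) :
    AnalyticAt ℂ (fun z => fundamentalMatrix φ z x i j) z := by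
  obtain ⟨V, hV⟩ := exists_isTaylor φ z
  obtain ⟨ε, hε, h⟩ := hV.hasSum
  refine ⟨FormalMultilinearSeries.ofScalars ℂ (fun k => V k x i j), ?_⟩
  rw [hasFPowerSeriesAt_iff]
  filter_upwards [Metric.ball_mem_nhds (0 : ℂ) hε] with w hw
  simpa using h w (by simpa using hw) x i j

lemma differentiable_fundamentalMatrix (φ : Potential) (x : ℝ) (i j : Fin 2) :
    Differentiable ℂ (fun z => fundamentalMatrix φ z x i j) := fun z =>
  (analyticAt_fundamentalMatrix φ x i j z).differentiableAt

lemma differentiable_discriminant (φ : Potential) : Differentiable ℂ (discriminant φ) := by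
  have h : discriminant φ = fun z => fundamentalMatrix φ z 1 0 0 + fundamentalMatrix φ z 1 1 1 := by
    ext z; exact Matrix.trace_fin_two _
  rw [h]
  exact (differentiable_fundamentalMatrix φ 1 0 0).add (differentiable_fundamentalMatrix φ 1 1 1)

/-- The Wronskian is constant, because the coefficient matrix has trace zero. -/
lemma det_fundamentalMatrix (φ : Potential) (z : ℂ) (x : ℝ) : (fundamentalMatrix φ z x).det = 1 := by
  set M := fundamentalMatrix φ z with hM
  have hsol := solvesODE_fundamentalMatrix φ z
  rw [← hM] at hsol
  have hp : ∀ i j, IsPrimitive (fun x => M x i j) (fun x => coeffCLM φ z x (fun i => M x i j) i) :=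
    fun i j => by
    have hint := fun x y => intervalIntegrable_coeffCLM_apply φ z (hsol j).1 x y
    refine ⟨fun a b => ?_, fun x => ?_⟩
    · have := hint a b
      exact ⟨(ContinuousLinearMap.proj (R := ℂ) (φ := fun _ : Fin 2 => ℂ) i).integrable_comp this.1,
        (ContinuousLinearMap.proj (R := ℂ) (φ := fun _ : Fin 2 => ℂ) i).integrable_comp this.2⟩
    · have h1 := congrFun ((hsol j).2 x) i
      simp only [Pi.zero_apply, add_zero] at h1
      rw [Pi.add_apply, intervalIntegral_apply (hint 0 x), ← congrFun (hsol j).apply_zero i] at h1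
      exact h1
  -- the product rule for the two terms of the determinant; the integrands cancel
  have h1 := ((hp 0 0).mul (hp 1 1)).eq x
  have h2 := ((hp 0 1).mul (hp 1 0)).eq x
  have h0 : M 0 = 1 := by
    ext i j; exact congrFun (hsol j).apply_zero i
  rw [Matrix.det_fin_two, h1, h2, h0]
  have h3 : ∫ t in (0 : ℝ)..x, (coeffCLM φ z t (fun i => M t i 0) 0 * M t 1 1 +
      M t 0 0 * coeffCLM φ z t (fun i => M t i 1) 1) =
      ∫ t in (0 : ℝ)..x, (coeffCLM φ z t (fun i => M t i 1) 0 * M t 1 0 +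
      M t 0 1 * coeffCLM φ z t (fun i => M t i 0) 1) := by
    refine intervalIntegral.integral_congr fun t _ => ?_
    simp only [coeffCLM_apply, Matrix.cons_val_zero, Matrix.cons_val_one]
    ring
  rw [h3]
  simp

lemma SolvesODE.eq_mulVec {φ : Potential} {z : ℂ} {v : V2} {F : ℝ → V2}
    (h : SolvesODE (coeffCLM φ z) 0 v F) (x : ℝ) : F x = (fundamentalMatrix φ z x).mulVec v := by
  have h0 : Continuous (0 : ℝ → V2) := continuous_const
  have h1 : SolvesODE (coeffCLM φ z) (v 0 • (0 : ℝ → V2) + v 1 • (0 : ℝ → V2)) _ _ :=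
    ((solvesODE_fundamentalMatrix φ z 0).smul (v 0)).add (h0.const_smul _) (h0.const_smul _)
      ((solvesODE_fundamentalMatrix φ z 1).smul (v 1))
  have hv : (v 0 • fun i => (1 : Matrix (Fin 2) (Fin 2) ℂ) i 0) +
      (v 1 • fun i => (1 : Matrix (Fin 2) (Fin 2) ℂ) i 1) = v := by
    ext i; fin_cases i <;> simp
  rw [hv, smul_zero, smul_zero, add_zero] at h1
  rw [h.unique_coeff continuous_const h1]
  ext i
  simp [Matrix.mulVec, dotProduct, Fin.sum_univ_two, mul_comm]

/-- The potential has period one, so the monodromy over the period two is a square. -/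
lemma fundamentalMatrix_two (φ : Potential) (z : ℂ) :
    fundamentalMatrix φ z 2 = fundamentalMatrix φ z 1 * fundamentalMatrix φ z 1 := by
  ext i j
  have h1 := (solvesODE_fundamentalMatrix φ z j).comp_add continuous_const
    (periodic_coeffCLM φ z)
  have h2 := congrFun (SolvesODE.eq_mulVec h1 1) i
  simp only [one_add_one_eq_two] at h2
  rw [h2]
  rfl

lemma det_fundamentalMatrix_two_sub_one (φ : Potential) (z : ℂ) :
    (fundamentalMatrix φ z 2 - 1).det = 4 - discriminant φ z ^ 2 := by
  have h := det_fundamentalMatrix φ z 1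
  rw [fundamentalMatrix_two, discriminant]
  generalize fundamentalMatrix φ z 1 = N at h ⊢
  rw [Matrix.det_fin_two] at h
  rw [Matrix.det_fin_two, Matrix.trace_fin_two]
  simp only [Matrix.sub_apply, Matrix.mul_apply, Fin.sum_univ_two, Matrix.one_apply_eq,
    Matrix.one_apply_ne (show (0 : Fin 2) ≠ 1 by decide),
    Matrix.one_apply_ne (show (1 : Fin 2) ≠ 0 by decide)]
  linear_combination (N 0 0 * N 1 1 - N 0 1 * N 1 0 + 3) * h

end ZS

namespace ZS

/-! ### Kernels of matrices of power series -/

open PowerSeries in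
/-- A matrix `T` of power series acts on polynomial principal parts: identifying the finitely
supported sequence `c` with `∑ i, c i X⁻¹⁻ⁱ`, this is the principal part of `T c`. -/
def principalPart (T : Matrix (Fin 2) (Fin 2) (PowerSeries ℂ)) : (ℕ →₀ V2) →ₗ[ℂ] (ℕ → V2) :=
  Finsupp.lsum ℂ fun i => LinearMap.pi fun m =>
    if m ≤ i then Matrix.mulVecLin (T.map (coeff (i - m))) else 0

lemma principalPart_single (T : Matrix (Fin 2) (Fin 2) (PowerSeries ℂ)) (i : ℕ) (v : V2) (m : ℕ) :
    principalPart T (Finsupp.single i v) m =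
      if m ≤ i then (T.map (PowerSeries.coeff (i - m))).mulVec v else 0 := by
  rw [principalPart, Finsupp.lsum_single, LinearMap.pi_apply]
  split_ifs <;> simp

lemma principalPart_apply (T : Matrix (Fin 2) (Fin 2) (PowerSeries ℂ)) (c : ℕ →₀ V2) (m : ℕ) :
    principalPart T c m = c.sum fun i v =>
      if m ≤ i then (T.map (PowerSeries.coeff (i - m))).mulVec v else 0 := by
  rw [principalPart, Finsupp.lsum_apply, Finsupp.sum, Finset.sum_apply, Finsupp.sum]
  refine Finset.sum_congr rfl fun i _ => ?_
  rw [LinearMap.pi_apply]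
  split_ifs <;> simp

/-- A matrix that is invertible at `0` kills no principal part. -/
lemma ker_principalPart_eq_bot {T : Matrix (Fin 2) (Fin 2) (PowerSeries ℂ)}
    (hT : (T.map (PowerSeries.coeff 0)).det ≠ 0) : LinearMap.ker (principalPart T) = ⊥ := by
  rw [LinearMap.ker_eq_bot']
  intro c hc
  by_contra hne
  have hs : c.support.Nonempty := Finsupp.support_nonempty_iff.2 hne
  set i := c.support.max' hs
  have hi : i ∈ c.support := Finset.max'_mem _ _
  have h1 := congrFun hc i
  rw [principalPart_apply, Finsupp.sum, Finset.sum_eq_single_of_mem i hi] at h1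
  · simp only [le_refl, if_true, Nat.sub_self, Pi.zero_apply] at h1
    exact Finsupp.mem_support_iff.1 hi (Matrix.eq_zero_of_mulVec_eq_zero hT h1)
  · intro j hj hji
    rw [if_neg]
    have := Finset.le_max' _ j hj
    omega

/-- The dimension of the kernel of a composition with a surjective map. -/
lemma rank_ker_comp {M N Q : Type} [AddCommGroup M] [Module ℂ M] [AddCommGroup N] [Module ℂ N]
    [AddCommGroup Q] [Module ℂ Q] (f : N →ₗ[ℂ] Q) (g : M →ₗ[ℂ] N) (hg : Function.Surjective g) :
    Module.rank ℂ (LinearMap.ker (f ∘ₗ g)) =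
      Module.rank ℂ (LinearMap.ker f) + Module.rank ℂ (LinearMap.ker g) := by
  let r : LinearMap.ker (f ∘ₗ g) →ₗ[ℂ] LinearMap.ker f :=
    g.restrict (fun x hx => by simpa using hx)
  have hr : Function.Surjective r := by
    rintro ⟨y, hy⟩
    obtain ⟨x, rfl⟩ := hg y
    exact ⟨⟨x, by simpa using hy⟩, rfl⟩
  have e : LinearMap.ker r ≃ₗ[ℂ] LinearMap.ker g :=
    { toFun := fun x => ⟨x.1.1, congrArg Subtype.val x.2⟩
      invFun := fun x => ⟨⟨x.1, by have := x.2; simp only [LinearMap.mem_ker] at this; simp [this]⟩,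
        by have := x.2; simp only [LinearMap.mem_ker] at this; simp [r, Subtype.ext_iff, this]⟩
      map_add' := fun _ _ => rfl
      map_smul' := fun _ _ => rfl
      left_inv := fun _ => rfl
      right_inv := fun _ => rfl }
  rw [LinearMap.rank_eq_of_surjective hr, e.rank_eq]

/-- The action of `diag(X, 1)` on principal parts. -/
def shiftFirst : (ℕ →₀ V2) →ₗ[ℂ] (ℕ →₀ V2) :=
  Finsupp.mapRange.linearMap (Matrix.mulVecLin !![1, 0; 0, 0]) ∘ₗ
      Finsupp.lcomapDomain Nat.succ Nat.succ_injective +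
    Finsupp.mapRange.linearMap (Matrix.mulVecLin !![0, 0; 0, 1])

lemma shiftFirst_apply (c : ℕ →₀ V2) (m : ℕ) : shiftFirst c m = ![c (m + 1) 0, c m 1] := by
  ext i
  fin_cases i <;> simp [shiftFirst, Finsupp.lcomapDomain] <;> rfl

lemma shiftFirst_surjective : Function.Surjective shiftFirst := by
  intro c
  refine ⟨Finsupp.mapRange.linearMap (Matrix.mulVecLin !![1, 0; 0, 0])
    (c.mapDomain Nat.succ) + Finsupp.mapRange.linearMap (Matrix.mulVecLin !![0, 0; 0, 1]) c, ?_⟩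
  ext m i
  rw [shiftFirst_apply]
  fin_cases i
  · simp [← Nat.succ_eq_add_one, Finsupp.mapDomain_apply Nat.succ_injective]
    rfl
  · simp
    rfl

lemma rank_ker_shiftFirst : Module.rank ℂ (LinearMap.ker shiftFirst) = 1 := by
  have e : LinearMap.ker shiftFirst ≃ₗ[ℂ] ℂ :=
    { toFun := fun c => c.1 0 0
      invFun := fun a => ⟨Finsupp.single 0 ![a, 0], by
        rw [LinearMap.mem_ker]
        ext m i
        rw [shiftFirst_apply]
        fin_cases i
        · simp
        · rcases m with _ | m <;> simp⟩
      map_add' := fun _ _ => rfl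
      map_smul' := fun _ _ => rfl
      left_inv := fun c => by
        have hc := LinearMap.mem_ker.1 c.2
        have h : ∀ m, ![c.1 (m + 1) 0, c.1 m 1] = 0 := fun m => by
          rw [← shiftFirst_apply, hc]; rfl
        ext m i
        fin_cases i
        · cases m with
          | zero => simp
          | succ m =>
            have := congrFun (h m) 0
            simpa using this.symm
        · have := congrFun (h m) 1
          rcases m with _ | m <;> simpa using this.symm
      right_inv := fun a => by simp }
  rw [e.rank_eq, Module.rank_self]

lemma principalPart_comp_mapRange (T : Matrix (Fin 2) (Fin 2) (PowerSeries ℂ))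
    (A : Matrix (Fin 2) (Fin 2) ℂ) :
    principalPart T ∘ₗ Finsupp.mapRange.linearMap A.mulVecLin =
      principalPart (T * A.map PowerSeries.C) := by
  refine Finsupp.lhom_ext fun i v => ?_
  ext m j
  simp only [LinearMap.comp_apply, Finsupp.mapRange.linearMap_apply, Finsupp.mapRange_single,
    principalPart_single]
  split_ifs
  · simp [Matrix.mulVec, dotProduct, Fin.sum_univ_two, Matrix.mul_apply]
    ring
  · rfl

/-- The map `shiftFirst` is the multiplication by `diag(X, 1)`: what it drops from a principal part
is holomorphic and does not contribute after multiplication by `T`. -/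
lemma principalPart_comp_shiftFirst (T : Matrix (Fin 2) (Fin 2) (PowerSeries ℂ)) :
    principalPart T ∘ₗ shiftFirst =
      principalPart (T * Matrix.diagonal ![PowerSeries.X, 1]) := by
  refine Finsupp.lhom_ext fun i v => ?_
  have h1 : shiftFirst (Finsupp.single i v) = (if i = 0 then 0 else
      Finsupp.single (i - 1) ![v 0, 0]) + Finsupp.single i ![0, v 1] := by
    ext m j
    rw [shiftFirst_apply]
    fin_cases j
    · rcases i with _ | i
      · simp [Finsupp.single_apply]; split_ifs <;> simp
      · simp [Finsupp.single_apply]; split_ifs <;> simp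
    · rcases i with _ | i
      · simp [Finsupp.single_apply]; split_ifs <;> simp
      · simp [Finsupp.single_apply]; split_ifs <;> simp
  ext m j
  rw [LinearMap.comp_apply, h1, map_add, Pi.add_apply, principalPart_single, principalPart_single]
  rcases i with _ | i
  · rcases m with _ | m
    · fin_cases j <;>
        simp [Matrix.mulVec, dotProduct, Fin.sum_univ_two, Matrix.mul_apply, Matrix.diagonal]
    · simp
  · rw [if_neg (Nat.succ_ne_zero i), principalPart_single]
    simp only [Nat.add_sub_cancel]
    rcases lt_trichotomy m (i + 1) with h | h | h
    · have e : i + 1 - m = (i - m) + 1 := by omega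
      rw [if_pos (by omega), if_pos (by omega), if_pos (by omega), e]
      fin_cases j <;>
      simp [Matrix.mulVec, dotProduct, Fin.sum_univ_two, Matrix.mul_apply, Matrix.diagonal,
        PowerSeries.coeff_succ_mul_X]
    · subst h
      fin_cases j <;>
        simp [Matrix.mulVec, dotProduct, Fin.sum_univ_two, Matrix.mul_apply, Matrix.diagonal]
    · rw [if_neg (by omega), if_neg (by omega), if_neg (by omega)]
      simp

/-- The local multiplicity formula: the kernel has the dimension `ord det T`. As in the Smith normal
form, one splits off a factor `diag(X, 1)` as long as `T` is singular at `0`. -/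
lemma rank_ker_principalPart (n : ℕ) :
    ∀ T : Matrix (Fin 2) (Fin 2) (PowerSeries ℂ), T.det.order = n →
      Module.rank ℂ (LinearMap.ker (principalPart T)) = n := by
  have hdet0 : ∀ T : Matrix (Fin 2) (Fin 2) (PowerSeries ℂ),
      (T.map (PowerSeries.coeff 0)).det = PowerSeries.coeff 0 T.det := fun T => by
    simp [Matrix.det_fin_two]
  induction n with
  | zero =>
    intro T hT
    rw [ker_principalPart_eq_bot]
    · simp
    · rw [hdet0]
      exact (PowerSeries.order_eq_nat.1 hT).1
  | succ n ih =>
    intro T hT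
    have h0 : (T.map (PowerSeries.coeff 0)).det = 0 := by
      rw [hdet0]
      exact PowerSeries.coeff_of_lt_order _ (by rw [hT]; exact_mod_cast Nat.succ_pos n)
    -- `v` is in the kernel of `T` at `0`; with `v` as the first column of `A`, the first column of
    -- `T A` is divisible by `X`
    obtain ⟨v, hv, hTv⟩ := Matrix.exists_mulVec_eq_zero_iff.2 h0
    obtain ⟨A, hA, hAv⟩ : ∃ A : Matrix (Fin 2) (Fin 2) ℂ, A.det ≠ 0 ∧ ∀ i, A i 0 = v i := by
      by_cases h : v 0 = 0
      · refine ⟨!![0, 1; v 1, 0], ?_, ?_⟩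
        · have : v 1 ≠ 0 := fun h' => hv (by ext i; fin_cases i <;> simp [h, h'])
          simpa [Matrix.det_fin_two]
        · intro i; fin_cases i <;> simp [h]
      · refine ⟨!![v 0, 0; v 1, 1], ?_, ?_⟩
        · simpa [Matrix.det_fin_two]
        · intro i; fin_cases i <;> simp
    have hdvd : ∀ i, ∃ q, (T * A.map PowerSeries.C) i 0 = PowerSeries.X * q := fun i => by
      have : PowerSeries.X ∣ (T * A.map PowerSeries.C) i 0 := ?_
      · exact this
      rw [PowerSeries.X_dvd_iff]
      have := congrFun hTv i
      simpa [Matrix.mulVec, dotProduct, Fin.sum_univ_two, Matrix.mul_apply, hAv] using this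
    choose q hq using hdvd
    -- `T A = T' diag(X, 1)`, and the order of the determinant drops by one
    set T' : Matrix (Fin 2) (Fin 2) (PowerSeries ℂ) :=
      Matrix.of fun i => ![q i, (T * A.map PowerSeries.C) i 1] with hT'
    have hfac : T * A.map PowerSeries.C = T' * Matrix.diagonal ![PowerSeries.X, 1] := by
      ext1 i j
      rw [Matrix.mul_diagonal]
      fin_cases j
      · simp [hT', hq i, mul_comm]
      · simp [hT']
    have hdet : T'.det.order = n := by
      have h1 := congrArg (fun B => B.det.order) hfac
      have h2 : (A.map PowerSeries.C).det = PowerSeries.C (R := ℂ) A.det := by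
        simp [Matrix.det_fin_two]
      simp only [Matrix.det_mul, h2, PowerSeries.order_mul, Matrix.det_diagonal, Fin.prod_univ_two,
        Matrix.cons_val_zero, Matrix.cons_val_one, PowerSeries.order_X, PowerSeries.order_one,
        add_zero, hT] at h1
      have h3 : (PowerSeries.C (R := ℂ) A.det).order = 0 := by
        rw [← Nat.cast_zero, PowerSeries.order_eq_nat]
        simp [hA]
      rw [h3, add_zero, Nat.cast_succ] at h1
      exact (ENat.addLECancellable_of_ne_top ENat.one_ne_top).inj_left.1 h1.symm
    have hinv : A * A⁻¹ = 1 := Matrix.mul_nonsing_inv _ (isUnit_iff_ne_zero.2 hA)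
    have hr1 := rank_ker_comp (principalPart T) (Finsupp.mapRange.linearMap A.mulVecLin)
      (fun c => ⟨Finsupp.mapRange.linearMap (A⁻¹).mulVecLin c, by
        ext1 m
        rw [Finsupp.mapRange.linearMap_apply, Finsupp.mapRange.linearMap_apply,
          Finsupp.mapRange_apply, Finsupp.mapRange_apply, Matrix.mulVecLin_apply,
          Matrix.mulVecLin_apply, Matrix.mulVec_mulVec, hinv, Matrix.one_mulVec]⟩)
    have hk : LinearMap.ker (Finsupp.mapRange.linearMap (α := ℕ) A.mulVecLin) = ⊥ := by
      rw [LinearMap.ker_eq_bot']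
      intro c hc
      ext1 m
      have := DFunLike.congr_fun hc m
      exact Matrix.eq_zero_of_mulVec_eq_zero hA (by simpa using this)
    have hr2 := rank_ker_comp (principalPart T') shiftFirst shiftFirst_surjective
    rw [principalPart_comp_mapRange, hfac, ← principalPart_comp_shiftFirst, hr2, hk,
      rank_ker_shiftFirst, ih T' hdet] at hr1
    simp only [rank_bot, add_zero] at hr1
    rw [← hr1]
    push_cast
    rfl

end ZS

namespace ZS

/-! ### Algebraic multiplicities as orders of zeros -/

/-- `f (z + w)` is the sum of the power series `p` for small `w`. -/
def HasTaylorAt (f : ℂ → ℂ) (p : PowerSeries ℂ) (z : ℂ) : Prop :=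
  ∃ ε > 0, ∀ w : ℂ, ‖w‖ < ε → HasSum (fun k => w ^ k * PowerSeries.coeff k p) (f (z + w))

lemma HasTaylorAt.mul {f g : ℂ → ℂ} {p q : PowerSeries ℂ} {z : ℂ} (hf : HasTaylorAt f p z)
    (hg : HasTaylorAt g q z) : HasTaylorAt (fun z => f z * g z) (p * q) z := by
  obtain ⟨ε, hε, hf⟩ := hf
  obtain ⟨δ, hδ, hg⟩ := hg
  refine ⟨min ε δ, lt_min hε hδ, fun w hw => ?_⟩
  have h1 := hf w (hw.trans_le (min_le_left _ _))
  have h2 := hg w (hw.trans_le (min_le_right _ _))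
  have h3 : (fun k => w ^ k * PowerSeries.coeff k (p * q)) = fun k =>
      ∑ kl ∈ Finset.HasAntidiagonal.antidiagonal k,
        (w ^ kl.1 * PowerSeries.coeff kl.1 p) * (w ^ kl.2 * PowerSeries.coeff kl.2 q) := by
    ext k
    rw [PowerSeries.coeff_mul, Finset.mul_sum]
    refine Finset.sum_congr rfl fun kl hkl => ?_
    rw [← Finset.HasAntidiagonal.mem_antidiagonal.1 hkl, pow_add]
    ring
  change HasSum _ (f (z + w) * g (z + w))
  rw [h3, ← h1.tsum_eq, ← h2.tsum_eq,
    tsum_mul_tsum_eq_tsum_sum_antidiagonal_of_summable_norm h1.summable.norm h2.summable.norm]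
  exact (summable_norm_sum_mul_antidiagonal_of_summable_norm h1.summable.norm
    h2.summable.norm).of_norm.hasSum

lemma HasTaylorAt.sub {f g : ℂ → ℂ} {p q : PowerSeries ℂ} {z : ℂ} (hf : HasTaylorAt f p z)
    (hg : HasTaylorAt g q z) : HasTaylorAt (fun z => f z - g z) (p - q) z := by
  obtain ⟨ε, hε, hf⟩ := hf
  obtain ⟨δ, hδ, hg⟩ := hg
  refine ⟨min ε δ, lt_min hε hδ, fun w hw => ?_⟩
  simp only [map_sub, mul_sub]
  exact (hf w (hw.trans_le (min_le_left _ _))).sub (hg w (hw.trans_le (min_le_right _ _)))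

lemma hasTaylorAt_const (c z : ℂ) : HasTaylorAt (fun _ => c) (PowerSeries.C c) z := by
  refine ⟨1, one_pos, fun w _ => ?_⟩
  have h := hasSum_single (f := fun k => w ^ k * PowerSeries.coeff k (PowerSeries.C c)) 0
    (fun k hk => by simp [PowerSeries.coeff_C, hk])
  simpa using h

lemma HasTaylorAt.order_eq {f : ℂ → ℂ} {p : PowerSeries ℂ} {z : ℂ} (hf : HasTaylorAt f p z)
    (hz : AnalyticAt ℂ f z) {n : ℕ} (hn : analyticOrderAt f z = n) : p.order = n := by
  obtain ⟨ε, hε, h⟩ := hf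
  have h1 : HasFPowerSeriesAt f
      (FormalMultilinearSeries.ofScalars ℂ fun k => PowerSeries.coeff k p) z := by
    rw [hasFPowerSeriesAt_iff]
    filter_upwards [Metric.ball_mem_nhds (0 : ℂ) hε] with w hw
    simpa using h w (by simpa using hw)
  have h2 := h1.eq_formalMultilinearSeries hz.hasFPowerSeriesAt
  have h3 : ∀ k, PowerSeries.coeff k p = iteratedDeriv k f z / (k.factorial : ℂ) := fun k => by
    have := congrArg (fun q => FormalMultilinearSeries.coeff q k) h2
    simpa using this
  obtain ⟨h4, h5⟩ := (analyticOrderAt_eq_nat_iff_iteratedDeriv_eq_zero hz).1 hn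
  rw [PowerSeries.order_eq_nat]
  refine ⟨?_, fun i hi => ?_⟩
  · rw [h3]
    exact div_ne_zero h5 (Nat.cast_ne_zero.2 (Nat.factorial_ne_zero _))
  · rw [h3, h4 i hi, zero_div]

section Chains

variable {φ : Potential} {z : ℂ} {V : ℕ → ℝ → Matrix (Fin 2) (Fin 2) ℂ}

/-- The function `∑ i, V i c i`. For Taylor coefficients `V` of the fundamental matrix, it is the
coefficient at `w⁻¹` of the product of `M(x, z + w)` with `∑ i, c i w⁻¹⁻ⁱ`. -/
def chainSum (V : ℕ → ℝ → Matrix (Fin 2) (Fin 2) ℂ) : (ℕ →₀ V2) →ₗ[ℂ] (ℝ → V2) :=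
  Finsupp.lsum ℂ fun i => LinearMap.pi fun x => Matrix.mulVecLin (V i x)

lemma chainSum_single (i : ℕ) (v : V2) (x : ℝ) :
    chainSum V (Finsupp.single i v) x = (V i x).mulVec v := by
  rw [chainSum, Finsupp.lsum_single, LinearMap.pi_apply, Matrix.mulVecLin_apply]

/-- The shift `c ↦ (c 1, c 2, …)`. -/
def shift : (ℕ →₀ V2) →ₗ[ℂ] (ℕ →₀ V2) := Finsupp.lcomapDomain Nat.succ Nat.succ_injective

lemma shift_apply (c : ℕ →₀ V2) (m : ℕ) : shift c m = c (m + 1) := by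
  simp [shift, Finsupp.lcomapDomain]

lemma mulVec_fin_two (A : Matrix (Fin 2) (Fin 2) ℂ) (v : V2) :
    A.mulVec v = (v 0 • fun i => A i 0) + v 1 • fun i => A i 1 := by
  ext i
  simp [Matrix.mulVec, dotProduct, Fin.sum_univ_two, mul_comm]

/-- The operator maps `chainSum V c` to `z` times it plus `chainSum V (shift c)`: principal parts
are multiplied by `w`. -/
lemma IsTaylor.solvesODE_chainSum (hV : IsTaylor φ z V) (c : ℕ →₀ V2) :
    Continuous (chainSum V c) ∧ SolvesODE (coeffCLM φ z)
      (fun t => diagCLM (chainSum V (shift c) t)) (c 0) (chainSum V c) := by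
  suffices h : ∀ c, Continuous (chainSum V (shift c)) ∧ SolvesODE (coeffCLM φ z)
      (fun t => diagCLM (chainSum V (shift c) t)) (c 0) (chainSum V c) from ⟨(h c).2.1, (h c).2⟩
  have hsol0 : ∀ j, SolvesODE (coeffCLM φ z) 0 (fun i => (1 : Matrix (Fin 2) (Fin 2) ℂ) i j)
      (fun x i => V 0 x i j) := fun j => by
    rw [hV.zero]; exact solvesODE_fundamentalMatrix φ z j
  have hcont : ∀ k j, Continuous fun x i => V k x i j := fun k j => by
    cases k with
    | zero => exact (hsol0 j).1
    | succ k => exact (hV.succ k j).1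
  intro c
  induction c using Finsupp.induction_linear with
  | zero =>
    refine ⟨by rw [map_zero, map_zero]; exact continuous_const, ?_⟩
    rw [map_zero, map_zero]
    refine ⟨continuous_const, fun x => ?_⟩
    simp only [map_zero, Pi.zero_apply, add_zero, Finsupp.coe_zero,
      intervalIntegral.integral_zero]
  | add c d hc hd =>
    refine ⟨by rw [map_add, map_add]; exact hc.1.add hd.1, ?_⟩
    have := hc.2.add (diagCLM.continuous.comp hc.1) (diagCLM.continuous.comp hd.1) hd.2
    convert! this using 1
    · ext1 t
      simp only [map_add, Pi.add_apply, Function.comp_apply]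
    · simp
  | single i v =>
    have hv : chainSum V (Finsupp.single i v) =
        (v 0 • fun x j => V i x j 0) + v 1 • fun x j => V i x j 1 := by
      ext1 x
      rw [chainSum_single, mulVec_fin_two]
      rfl
    cases i with
    | zero =>
      have h0 : shift (Finsupp.single 0 v) = 0 := by
        ext1 m; rw [shift_apply]; simp
      rw [h0, map_zero]
      refine ⟨continuous_const, ?_⟩
      rw [hv]
      have h0' : Continuous (0 : ℝ → V2) := continuous_const
      have := ((hsol0 0).smul (v 0)).add (h0'.const_smul _) (h0'.const_smul _)
        ((hsol0 1).smul (v 1))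
      convert! this using 1
      · ext1 t; simp
      · rw [← mulVec_fin_two, Matrix.one_mulVec]
        simp
    | succ i =>
      have h0 : shift (Finsupp.single (i + 1) v) = Finsupp.single i v := by
        ext1 m; rw [shift_apply]; simp [Finsupp.single_apply]
      have hv' : chainSum V (Finsupp.single i v) =
          (v 0 • fun x j => V i x j 0) + v 1 • fun x j => V i x j 1 := by
        ext1 x
        rw [chainSum_single, mulVec_fin_two]
        rfl
      have hc : ∀ j, Continuous fun t => diagCLM (fun l => V i t l j) := fun j =>
        diagCLM.continuous.comp (hcont i j)
      rw [h0, hv, hv']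
      refine ⟨((hcont i 0).const_smul _).add ((hcont i 1).const_smul _), ?_⟩
      have := ((hV.succ i 0).smul (v 0)).add ((hc 0).const_smul _) ((hc 1).const_smul _)
        ((hV.succ i 1).smul (v 1))
      convert! this using 1
      · ext1 t
        simp only [Pi.add_apply, Pi.smul_apply, map_add, map_smul]
      · simp

/-- If the sum vanishes, then so does its shift, by the differential equation, and all coefficients
are initial values of iterated shifts. -/
lemma IsTaylor.chainSum_injective (hV : IsTaylor φ z V) : Function.Injective (chainSum V) := by
  rw [← LinearMap.ker_eq_bot, LinearMap.ker_eq_bot']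
  have hstep : ∀ c, chainSum V c = 0 → chainSum V (shift c) = 0 := by
    intro c hc
    have h1 := (hV.solvesODE_chainSum c).2
    have h2 := (hV.solvesODE_chainSum (shift c)).1
    have h3 : Continuous fun t => diagCLM (chainSum V (shift c) t) := diagCLM.continuous.comp h2
    have h4 : ∀ x : ℝ, ∫ t in (0 : ℝ)..x, diagCLM (chainSum V (shift c) t) = 0 := fun x => by
      have h5 := h1.2 x
      rw [← h1.apply_zero, hc] at h5
      simpa using h5.symm
    have h5 : ∀ x, diagCLM (chainSum V (shift c) x) = 0 := fun x => by
      have h6 := intervalIntegral.integral_hasDerivAt_right (h3.intervalIntegrable 0 x)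
        h3.stronglyMeasurable.stronglyMeasurableAtFilter h3.continuousAt
      simp only [h4] at h6
      exact h6.unique (hasDerivAt_const _ _)
    ext x i
    have h6 := congrFun (h5 x) i
    fin_cases i <;> simpa using h6
  have key : ∀ m c, chainSum V c = 0 → c m = 0 := by
    intro m
    induction m with
    | zero =>
      intro c hc
      rw [← (hV.solvesODE_chainSum c).2.apply_zero, hc]
      rfl
    | succ m ih =>
      intro c hc
      rw [← shift_apply]
      exact ih _ (hstep c hc)
  intro c hc
  ext1 m
  exact key m c hc

/-- The power series of `w ↦ M(2, z + w) - 1`. -/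
def monodromySeries (V : ℕ → ℝ → Matrix (Fin 2) (Fin 2) ℂ) :
    Matrix (Fin 2) (Fin 2) (PowerSeries ℂ) :=
  Matrix.of (fun i j => PowerSeries.mk fun k => V k 2 i j) - 1

/-- Multiplication of principal parts by `T` commutes with multiplication by `w`. -/
lemma principalPart_shift (T : Matrix (Fin 2) (Fin 2) (PowerSeries ℂ)) (c : ℕ →₀ V2) (m : ℕ) :
    principalPart T (shift c) m = principalPart T c (m + 1) := by
  induction c using Finsupp.induction_linear with
  | zero => simp
  | add c d hc hd => simp only [map_add, Pi.add_apply, hc, hd]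
  | single i v =>
    cases i with
    | zero =>
      have h0 : shift (Finsupp.single 0 v) = 0 := by
        ext1 m; rw [shift_apply]; simp
      rw [h0, principalPart_single]
      simp
    | succ i =>
      have h0 : shift (Finsupp.single (i + 1) v) = Finsupp.single i v := by
        ext1 m; rw [shift_apply]; simp [Finsupp.single_apply]
      rw [h0, principalPart_single, principalPart_single]
      simp

/-- The residue of `(M(2, z + w) - 1) ∑ c i w⁻¹⁻ⁱ` is the periodicity defect of `chainSum V c`. -/
lemma principalPart_monodromySeries_zero (c : ℕ →₀ V2) :
    principalPart (monodromySeries V) c 0 = chainSum V c 2 - c 0 := by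
  induction c using Finsupp.induction_linear with
  | zero => simp
  | add c d hc hd =>
    simp only [map_add, Pi.add_apply, hc, hd, Finsupp.add_apply]
    abel
  | single i v =>
    rw [principalPart_single, chainSum_single, if_pos (Nat.zero_le _), Nat.sub_zero]
    have h : (monodromySeries V).map (PowerSeries.coeff i) = V i 2 - if i = 0 then 1 else 0 := by
      ext a b
      by_cases hi : i = 0
      · subst hi
        fin_cases a <;> fin_cases b <;> simp [monodromySeries]
      · fin_cases a <;> fin_cases b <;>
          simp [monodromySeries, PowerSeries.coeff_one, hi]
    rw [h, Matrix.sub_mulVec]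
    congr 1
    by_cases hi : i = 0
    · subst hi; simp
    · simp [hi]

/-- A principal part killed by the monodromy series gives a periodic root vector: the periodicity of
the iterated images under the operator minus `z` is read off from the single coefficients. -/
lemma IsTaylor.isRootVector_chainSum (hV : IsTaylor φ z V) (n : ℕ) :
    ∀ c : ℕ →₀ V2, (∀ m, n ≤ m → c m = 0) → principalPart (monodromySeries V) c = 0 →
      IsRootVector φ z n (chainSum V c) := by
  induction n with
  | zero =>
    intro c hc _
    have : c = 0 := by ext1 m; exact hc m (Nat.zero_le m)
    rw [this, map_zero]
    rfl
  | succ n ih =>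
    intro c hc hker
    have hK := ih (shift c) (fun m hm => by rw [shift_apply]; exact hc _ (by omega)) (by
      ext1 m; rw [principalPart_shift, hker]; rfl)
    have hsol := (hV.solvesODE_chainSum c).2
    have hKc := (hV.solvesODE_chainSum (shift c)).1
    refine ⟨?_, chainSum V (shift c), hK, ?_⟩
    · have hper : Function.Periodic (chainSum V (shift c)) 2 := by
        cases n with
        | zero => rw [show chainSum V (shift c) = 0 from hK]; intro x; rfl
        | succ n => exact hK.1
      have h2 : chainSum V c 2 = c 0 := by
        rw [← sub_eq_zero, ← principalPart_monodromySeries_zero, hker]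
        rfl
      have hp2 : Function.Periodic (coeffCLM φ z) 2 := by
        have := (periodic_coeffCLM φ z).nat_mul 2
        simpa using this
      have h3 := hsol.comp_add (diagCLM.continuous.comp hKc) hp2
      simp only [Function.comp_apply, hper _, h2] at h3
      intro x
      exact congrFun (h3.unique_coeff (diagCLM.continuous.comp hKc) hsol) x
    · rw [isZSImage_iff hKc, hsol.apply_zero]
      exact hsol

/-- Every root vector arises in this way. Its principal part is that of its image under the operator
minus `z`, shifted back, with the initial value as new coefficient. -/
lemma IsTaylor.exists_chainSum_eq (hV : IsTaylor φ z V) (n : ℕ) :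
    ∀ F, IsRootVector φ z n F →
      ∃ c, principalPart (monodromySeries V) c = 0 ∧ chainSum V c = F := by
  induction n with
  | zero =>
    intro F hF
    exact ⟨0, map_zero _, by rw [map_zero]; exact hF.symm⟩
  | succ n ih =>
    rintro F ⟨hper, K, hK, hF⟩
    obtain ⟨c', hc', rfl⟩ := ih K hK
    have hKc := (hV.solvesODE_chainSum c').1
    rw [isZSImage_iff hKc] at hF
    set c : ℕ →₀ V2 := c'.mapDomain Nat.succ + Finsupp.single 0 (F 0) with hc
    have hsc : shift c = c' := by
      ext1 m
      rw [shift_apply, hc, Finsupp.add_apply, ← Nat.succ_eq_add_one,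
        Finsupp.mapDomain_apply Nat.succ_injective]
      simp
    have hc0 : c 0 = F 0 := by
      rw [hc, Finsupp.add_apply, Finsupp.mapDomain_of_notMem_range]
      · simp
      · simp
    have hFc : chainSum V c = F := by
      have := (hV.solvesODE_chainSum c).2
      rw [hsc, hc0] at this
      exact this.unique_coeff (diagCLM.continuous.comp hKc) hF
    refine ⟨c, ?_, hFc⟩
    ext1 m
    cases m with
    | zero =>
      rw [principalPart_monodromySeries_zero, hFc, hc0]
      have := hper 0
      rw [zero_add] at this
      rw [this, sub_self]
      rfl
    | succ m => rw [← principalPart_shift, hsc, hc']; rfl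

end Chains

/-- The algebraic multiplicity of a periodic eigenvalue is its order as a zero of `Δ² - 4`. -/
theorem algMult_eq_analyticOrderAt (φ : Potential) (z : ℂ)
    (h : analyticOrderAt (fun z => discriminant φ z ^ 2 - 4) z ≠ ⊤) :
    algMult φ z = analyticOrderAt (fun z => discriminant φ z ^ 2 - 4) z := by
  obtain ⟨V, hV⟩ := exists_isTaylor φ z
  obtain ⟨n, hn⟩ := ENat.ne_top_iff_exists.1 h
  have hker : rootSpace φ z =
      (LinearMap.ker (principalPart (monodromySeries V))).map (chainSum V) := by
    rw [rootSpace, ← Submodule.span_eq (Submodule.map _ _)]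
    congr 1
    ext F
    constructor
    · rintro ⟨n, hF⟩
      obtain ⟨c, hc, rfl⟩ := hV.exists_chainSum_eq n F hF
      exact ⟨c, hc, rfl⟩
    · rintro ⟨c, hc, rfl⟩
      refine ⟨c.support.sup id + 1, hV.isRootVector_chainSum _ c (fun m hm => ?_) hc⟩
      by_contra hne
      have : m ≤ c.support.sup id := Finset.le_sup (f := id) (Finsupp.mem_support_iff.2 hne)
      omega
  have hT : ∀ i j, HasTaylorAt (fun z => fundamentalMatrix φ z 2 i j -
      (1 : Matrix (Fin 2) (Fin 2) ℂ) i j) (monodromySeries V i j) z := fun i j => by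
    have h1 : HasTaylorAt (fun z => fundamentalMatrix φ z 2 i j)
        (PowerSeries.mk fun k => V k 2 i j) z := by
      obtain ⟨ε, hε, hs⟩ := hV.hasSum
      refine ⟨ε, hε, fun w hw => ?_⟩
      simpa using hs w hw 2 i j
    have h2 := h1.sub (hasTaylorAt_const ((1 : Matrix (Fin 2) (Fin 2) ℂ) i j) z)
    convert! h2 using 1
    fin_cases i <;> fin_cases j <;> simp [monodromySeries]
  have hdet := ((hT 0 0).mul (hT 1 1)).sub ((hT 0 1).mul (hT 1 0))
  rw [← Matrix.det_fin_two] at hdet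
  have hf : (fun z => (fundamentalMatrix φ z 2 0 0 - (1 : Matrix (Fin 2) (Fin 2) ℂ) 0 0) *
        (fundamentalMatrix φ z 2 1 1 - (1 : Matrix (Fin 2) (Fin 2) ℂ) 1 1) -
      (fundamentalMatrix φ z 2 0 1 - (1 : Matrix (Fin 2) (Fin 2) ℂ) 0 1) *
        (fundamentalMatrix φ z 2 1 0 - (1 : Matrix (Fin 2) (Fin 2) ℂ) 1 0)) =
      -fun z => discriminant φ z ^ 2 - 4 := by
    ext z
    have := det_fundamentalMatrix_two_sub_one φ z
    rw [Matrix.det_fin_two] at this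
    simp only [Matrix.sub_apply] at this
    rw [this, Pi.neg_apply, neg_sub]
  rw [hf] at hdet
  have han : AnalyticAt ℂ (-fun z => discriminant φ z ^ 2 - 4) z :=
    (((differentiable_discriminant φ).pow 2).sub_const 4).neg.analyticAt z
  have hord := hdet.order_eq han (n := n) (by rw [analyticOrderAt_neg, hn])
  rw [algMult, hker, ← hn]
  have e := Submodule.equivMapOfInjective (chainSum V) hV.chainSum_injective
    (LinearMap.ker (principalPart (monodromySeries V)))
  rw [← e.rank_eq, rank_ker_principalPart n _ hord]
  simp

end ZS

namespace ZS

/-! ### Asymptotics of the discriminant -/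

lemma norm_exp_neg_mul_le (z : ℂ) {x t : ℝ} (ht : t ∈ Icc 0 x) :
    ‖Complex.exp (-(z * (x - 2 * t)))‖ ≤ Real.exp (|z.re| * x) := by
  rw [Complex.norm_exp, Real.exp_le_exp]
  have h1 : (-(z * (x - 2 * t))).re = z.re * (2 * t - x) := by
    simp
    ring
  rw [h1]
  have h2 : |2 * t - x| ≤ x := by rw [abs_le]; constructor <;> linarith [ht.1, ht.2]
  calc z.re * (2 * t - x) ≤ |z.re * (2 * t - x)| := le_abs_self _
    _ = |z.re| * |2 * t - x| := abs_mul _ _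
    _ ≤ |z.re| * x := mul_le_mul_of_nonneg_left h2 (abs_nonneg _)

/-- The case of smooth functions, by integration by parts. -/
lemma norm_integral_exp_mul_le_of_contDiff {h : ℝ → ℂ} (hh : ContDiff ℝ 1 h) :
    ∃ C, ∀ z : ℂ, z ≠ 0 → ∀ x ∈ Icc (0 : ℝ) 1,
      ‖∫ t in (0 : ℝ)..x, Complex.exp (-(z * (x - 2 * t))) * h t‖ ≤
        C / ‖z‖ * Real.exp (|z.re| * x) := by
  obtain ⟨B, hB⟩ := (isCompact_Icc (a := (0 : ℝ)) (b := 1)).exists_bound_of_continuousOn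
    hh.continuous.continuousOn
  obtain ⟨B', hB'⟩ := (isCompact_Icc (a := (0 : ℝ)) (b := 1)).exists_bound_of_continuousOn
    (hh.continuous_deriv le_rfl).continuousOn
  have hB0 : 0 ≤ B := (norm_nonneg _).trans (hB 0 (by simp))
  have hB0' : 0 ≤ B' := (norm_nonneg _).trans (hB' 0 (by simp))
  refine ⟨B + B + B', fun z hz x hx => ?_⟩
  have hz0 : 0 < ‖z‖ := norm_pos_iff.2 hz
  set E : ℝ → ℂ := fun t => Complex.exp (-(z * (x - 2 * t))) with hE
  have hEd : ∀ t : ℝ, HasDerivAt (fun t => E t / (2 * z)) (E t) t := fun t => by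
    have h1 : HasDerivAt (fun t : ℝ => -(z * ((x : ℂ) - 2 * t))) (2 * z) t := by
      have := ((((hasDerivAt_id t).ofReal_comp.const_mul (2 : ℂ)).const_sub (x : ℂ)).const_mul
        z).neg
      convert! this using 1
      push_cast
      ring
    convert! (h1.cexp.div_const (2 * z)) using 1
    field_simp
    rfl
  have hEc : Continuous E := by fun_prop
  have hparts := intervalIntegral.integral_mul_deriv_eq_deriv_mul (a := 0) (b := x)
    (u := h) (v := fun t => E t / (2 * z)) (u' := deriv h) (v' := E)
    (fun t _ => (hh.differentiable one_ne_zero t).hasDerivAt) (fun t _ => hEd t)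
    ((hh.continuous_deriv le_rfl).intervalIntegrable _ _) (hEc.intervalIntegrable _ _)
  have hcomm : ∫ t in (0 : ℝ)..x, E t * h t = ∫ t in (0 : ℝ)..x, h t * E t :=
    intervalIntegral.integral_congr fun t _ => mul_comm _ _
  have hEb : ∀ t ∈ Icc 0 x, ‖E t / (2 * z)‖ ≤ Real.exp (|z.re| * x) / ‖z‖ := fun t ht => by
    rw [norm_div, norm_mul, Complex.norm_ofNat]
    have := norm_exp_neg_mul_le z ht
    rw [div_le_div_iff₀ (by positivity) hz0]
    nlinarith [Real.exp_pos (|z.re| * x), norm_nonneg (E t)]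
  set K := Real.exp (|z.re| * x) / ‖z‖ with hK
  have hK0 : 0 ≤ K := by positivity
  rw [hcomm, hparts]
  have hxI : ∀ t ∈ Icc 0 x, t ∈ Icc (0 : ℝ) 1 := fun t ht => ⟨ht.1, ht.2.trans hx.2⟩
  have h1 : ‖h x * (E x / (2 * z))‖ ≤ B * K := by
    rw [norm_mul]
    exact mul_le_mul (hB x hx) (hEb x ⟨hx.1, le_rfl⟩) (norm_nonneg _) hB0
  have h2 : ‖h 0 * (E 0 / (2 * z))‖ ≤ B * K := by
    rw [norm_mul]
    exact mul_le_mul (hB 0 (by simp)) (hEb 0 ⟨le_rfl, hx.1⟩) (norm_nonneg _) hB0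
  have h3 : ‖∫ t in (0 : ℝ)..x, deriv h t * (E t / (2 * z))‖ ≤ B' * K := by
    refine (intervalIntegral.norm_integral_le_of_norm_le_const (C := B' * K)
      fun t ht => ?_).trans ?_
    · rw [uIoc_of_le hx.1] at ht
      rw [norm_mul]
      exact mul_le_mul (hB' t (hxI t ⟨ht.1.le, ht.2⟩)) (hEb t ⟨ht.1.le, ht.2⟩) (norm_nonneg _) hB0'
    · rw [sub_zero, abs_of_nonneg hx.1]
      exact mul_le_of_le_one_right (by positivity) hx.2
  calc _ ≤ ‖h x * (E x / (2 * z))‖ + ‖h 0 * (E 0 / (2 * z))‖ +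
        ‖∫ t in (0 : ℝ)..x, deriv h t * (E t / (2 * z))‖ :=
        (norm_sub_le _ _).trans (add_le_add_left (norm_sub_le _ _) _)
    _ ≤ B * K + B * K + B' * K := add_le_add (add_le_add h1 h2) h3
    _ = (B + B + B') / ‖z‖ * Real.exp (|z.re| * x) := by rw [hK]; ring

/-- Smooth functions are dense in `L¹(0, 1)`. -/
lemma exists_contDiff_integral_norm_sub_le {q : ℝ → ℂ} (hq : IntervalIntegrable q volume 0 1)
    {ε : ℝ} (hε : 0 < ε) :
    ∃ h : ℝ → ℂ, ContDiff ℝ 1 h ∧ ∫ t in (0 : ℝ)..1, ‖q t - h t‖ ≤ ε := by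
  have hq' : IntegrableOn q (Ioc 0 1) :=
    (intervalIntegrable_iff_integrableOn_Ioc_of_le zero_le_one).1 hq
  obtain ⟨g, -, hg, hgc, hgi⟩ := hq'.exists_hasCompactSupport_integral_sub_le
    (half_pos (half_pos hε))
  obtain ⟨p₁, hp₁⟩ := exists_polynomial_near_of_continuousOn 0 1 (fun t => (g t).re)
    (Complex.continuous_re.comp hgc).continuousOn (ε / 4) (by positivity)
  obtain ⟨p₂, hp₂⟩ := exists_polynomial_near_of_continuousOn 0 1 (fun t => (g t).im)
    (Complex.continuous_im.comp hgc).continuousOn (ε / 4) (by positivity)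
  have hcd : ContDiff ℝ 1 fun t : ℝ => ((p₁.eval t : ℝ) : ℂ) + ((p₂.eval t : ℝ) : ℂ) * Complex.I := by
    have h1 : ∀ p : Polynomial ℝ, ContDiff ℝ 1 fun t : ℝ => ((p.eval t : ℝ) : ℂ) := fun p =>
      Complex.ofRealCLM.contDiff.comp (by simpa using p.contDiff_aeval (𝕜 := ℝ) 1)
    exact (h1 p₁).add ((h1 p₂).mul contDiff_const)
  refine ⟨_, hcd, ?_⟩
  set h : ℝ → ℂ := fun t : ℝ => ((p₁.eval t : ℝ) : ℂ) + ((p₂.eval t : ℝ) : ℂ) * Complex.I with hh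
  have hgh : ∀ t ∈ Icc (0 : ℝ) 1, ‖g t - h t‖ ≤ ε / 2 := fun t ht => by
    refine (Complex.norm_le_abs_re_add_abs_im _).trans ?_
    have e1 : (g t - h t).re = -(p₁.eval t - (g t).re) := by simp [hh]
    have e2 : (g t - h t).im = -(p₂.eval t - (g t).im) := by simp [hh]
    rw [e1, e2, abs_neg, abs_neg]
    linarith [hp₁ t ht, hp₂ t ht]
  have hgI : IntervalIntegrable g volume 0 1 := hgc.intervalIntegrable _ _
  have hhI : IntervalIntegrable h volume 0 1 := hcd.continuous.intervalIntegrable _ _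
  calc ∫ t in (0 : ℝ)..1, ‖q t - h t‖ ≤ ∫ t in (0 : ℝ)..1, (‖q t - g t‖ + ε / 2) := by
        refine intervalIntegral.integral_mono_on zero_le_one (hq.sub hhI).norm
          ((hq.sub hgI).norm.add intervalIntegrable_const) fun t ht => ?_
        have := norm_sub_le_norm_sub_add_norm_sub (q t) (g t) (h t)
        linarith [hgh t ht]
    _ = (∫ t in (0 : ℝ)..1, ‖q t - g t‖) + ε / 2 := by
        rw [intervalIntegral.integral_add (hq.sub hgI).norm intervalIntegrable_const]
        simp
    _ ≤ ε := by
        rw [intervalIntegral.integral_of_le zero_le_one]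
        linarith

/-- A version of the Riemann-Lebesgue lemma, uniform in all complex directions. -/
lemma exists_norm_integral_exp_mul_le {q : ℝ → ℂ} (hq : ∀ a b, IntervalIntegrable q volume a b)
    {ε : ℝ} (hε : 0 < ε) :
    ∃ R, ∀ z : ℂ, R ≤ ‖z‖ → ∀ x ∈ Icc (0 : ℝ) 1,
      ‖∫ t in (0 : ℝ)..x, Complex.exp (-(z * (x - 2 * t))) * q t‖ ≤
        ε * Real.exp (|z.re| * x) := by
  obtain ⟨h, hh, hqh⟩ := exists_contDiff_integral_norm_sub_le (hq 0 1) (half_pos hε)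
  obtain ⟨C, hC⟩ := norm_integral_exp_mul_le_of_contDiff hh
  refine ⟨max 1 (2 * C / ε), fun z hz x hx => ?_⟩
  have hz0 : 0 < ‖z‖ := one_pos.trans_le ((le_max_left _ _).trans hz)
  have hCz : C / ‖z‖ ≤ ε / 2 := by
    have := (le_max_right _ _).trans hz
    rw [div_le_iff₀ hε] at this
    rw [div_le_iff₀ hz0]
    linarith
  have hhi : ∀ a b, IntervalIntegrable h volume a b := fun a b => hh.continuous.intervalIntegrable _ _
  have hEc : Continuous fun t : ℝ => Complex.exp (-(z * (x - 2 * t))) := by fun_prop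
  have hsplit : ∫ t in (0 : ℝ)..x, Complex.exp (-(z * (x - 2 * t))) * q t =
      (∫ t in (0 : ℝ)..x, Complex.exp (-(z * (x - 2 * t))) * (q t - h t)) +
        ∫ t in (0 : ℝ)..x, Complex.exp (-(z * (x - 2 * t))) * h t := by
    rw [← intervalIntegral.integral_add]
    · exact intervalIntegral.integral_congr fun t _ => by ring
    · exact ((hq _ _).sub (hhi _ _)).continuousOn_mul hEc.continuousOn
    · exact (hhi _ _).continuousOn_mul hEc.continuousOn
  have h1 : ‖∫ t in (0 : ℝ)..x, Complex.exp (-(z * (x - 2 * t))) * (q t - h t)‖ ≤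
      ε / 2 * Real.exp (|z.re| * x) := by
    calc _ ≤ ∫ t in (0 : ℝ)..x, Real.exp (|z.re| * x) * ‖q t - h t‖ := by
          refine intervalIntegral.norm_integral_le_of_norm_le hx.1
            (Eventually.of_forall fun t ht => ?_)
            (((hq _ _).sub (hhi _ _)).norm.const_mul _)
          rw [norm_mul]
          exact mul_le_mul_of_nonneg_right (norm_exp_neg_mul_le z ⟨ht.1.le, ht.2⟩) (norm_nonneg _)
      _ = Real.exp (|z.re| * x) * ∫ t in (0 : ℝ)..x, ‖q t - h t‖ :=
          intervalIntegral.integral_const_mul _ _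
      _ ≤ Real.exp (|z.re| * x) * (ε / 2) := by
          refine mul_le_mul_of_nonneg_left (le_trans ?_ hqh) (Real.exp_pos _).le
          exact intervalIntegral.integral_mono_interval le_rfl hx.1 hx.2
            (Eventually.of_forall fun t => norm_nonneg _) ((hq _ _).sub (hhi _ _)).norm
      _ = _ := mul_comm _ _
  rw [hsplit]
  refine (norm_add_le _ _).trans ?_
  have h2 := hC z (norm_pos_iff.1 hz0) x hx
  have h3 := mul_le_mul_of_nonneg_right hCz (Real.exp_pos (|z.re| * x)).le
  linarith

/-- The diagonal entries of the fundamental matrix are close to exponentials: `b` is small by the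
Riemann-Lebesgue lemma and Gronwall's inequality, hence so is `a x - exp (z x)`. -/
lemma norm_sub_exp_le {p q a b : ℝ → ℂ} (hp : ∀ x y, IntervalIntegrable p volume x y)
    (hq : ∀ x y, IntervalIntegrable q volume x y) (ha : Continuous a) (hb : Continuous b) {z : ℂ}
    (hab : ∀ x, a x = Complex.exp (z * x) +
      ∫ t in (0 : ℝ)..x, Complex.exp (z * (x - t)) * (p t * b t))
    (hba : ∀ x, b x = ∫ t in (0 : ℝ)..x, Complex.exp (-(z * (x - t))) * (q t * a t))
    {ε : ℝ} (hε : 0 ≤ ε) (hqe : ∀ x ∈ Icc (0 : ℝ) 1,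
      ‖∫ t in (0 : ℝ)..x, Complex.exp (-(z * (x - 2 * t))) * q t‖ ≤ ε * Real.exp (|z.re| * x)) :
    ‖a 1 - Complex.exp z‖ ≤ ε * (2 * (∫ t in (0 : ℝ)..1, ‖p t‖) *
      Real.exp (2 * ((∫ t in (0 : ℝ)..1, ‖q t‖) * ∫ t in (0 : ℝ)..1, ‖p t‖))) *
        Real.exp |z.re| := by
  -- `f` is `|b|`, rescaled by the expected growth `exp (y x)`
  set y := |z.re| with hy
  have hy0 : 0 ≤ y := abs_nonneg _
  set P := ∫ t in (0 : ℝ)..1, ‖p t‖ with hP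
  set Q := ∫ t in (0 : ℝ)..1, ‖q t‖ with hQ
  have hQ0 : 0 ≤ Q := intervalIntegral.integral_nonneg zero_le_one fun t _ => norm_nonneg _
  have hP0 : 0 ≤ P := intervalIntegral.integral_nonneg zero_le_one fun t _ => norm_nonneg _
  set f : ℝ → ℝ := fun x => Real.exp (-(y * x)) * ‖b x‖ with hf
  have hfc : Continuous f := by fun_prop
  have hf0 : ∀ x, 0 ≤ f x := fun x => by positivity
  have hbf : ∀ x, ‖b x‖ = Real.exp (y * x) * f x := fun x => by
    rw [hf]; simp only; rw [← mul_assoc, ← Real.exp_add, add_neg_cancel, Real.exp_zero, one_mul]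
  have hexp : ∀ s : ℝ, 0 ≤ s → ‖Complex.exp (z * s)‖ ≤ Real.exp (y * s) := fun s hs => by
    rw [Complex.norm_exp, Real.exp_le_exp, Complex.re_mul_ofReal]
    exact mul_le_mul_of_nonneg_right (le_abs_self _) hs
  have hexp' : ∀ s : ℝ, 0 ≤ s → ‖Complex.exp (-(z * s))‖ ≤ Real.exp (y * s) := fun s hs => by
    rw [Complex.norm_exp, Real.exp_le_exp, Complex.neg_re, Complex.re_mul_ofReal, ← neg_mul]
    exact mul_le_mul_of_nonneg_right (neg_le_abs _) hs
  have hpf : ∀ x y, IntervalIntegrable (fun t => ‖p t‖ * f t) volume x y := fun x y =>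
    (hp x y).norm.mul_continuousOn hfc.continuousOn
  -- the deviation of `a` from the exponential
  have hD : ∀ x, 0 ≤ x → ‖a x - Complex.exp (z * x)‖ ≤
      Real.exp (y * x) * ∫ t in (0 : ℝ)..x, ‖p t‖ * f t := fun x hx => by
    rw [hab, add_sub_cancel_left, ← intervalIntegral.integral_const_mul]
    refine intervalIntegral.norm_integral_le_of_norm_le hx (Eventually.of_forall fun t ht => ?_)
      ((hpf _ _).const_mul _)
    rw [norm_mul, norm_mul, hbf]
    have h1 := hexp (x - t) (by linarith [ht.2])
    rw [Complex.ofReal_sub] at h1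
    calc _ ≤ Real.exp (y * (x - t)) * (‖p t‖ * (Real.exp (y * t) * f t)) :=
          mul_le_mul_of_nonneg_right h1 (by have := hf0 t; positivity)
      _ = (Real.exp (y * (x - t)) * Real.exp (y * t)) * (‖p t‖ * f t) := by ring
      _ = _ := by rw [← Real.exp_add]; congr 2; ring
  -- `b` is an oscillating integral, small by hypothesis, plus a term with the deviation of `a`
  have hg : ∀ x ∈ Icc (0 : ℝ) 1, f x ≤ ε + ∫ t in (0 : ℝ)..x, Q * ‖p t‖ * f t := fun x hx => by
    have hsplit : b x = (∫ t in (0 : ℝ)..x, Complex.exp (-(z * (x - 2 * t))) * q t) +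
        ∫ t in (0 : ℝ)..x, Complex.exp (-(z * (x - t))) * (q t * (a t - Complex.exp (z * t))) := by
      rw [hba, ← intervalIntegral.integral_add]
      · refine intervalIntegral.integral_congr fun t _ => ?_
        have : Complex.exp (-(z * (x - 2 * t))) =
            Complex.exp (-(z * (x - t))) * Complex.exp (z * t) := by
          rw [← Complex.exp_add]; congr 1; ring
        simp only [this]
        ring
      · exact (hq _ _).continuousOn_mul (by fun_prop)
      · refine IntervalIntegrable.continuousOn_mul ?_ (by fun_prop)
        exact (hq _ _).mul_continuousOn (by fun_prop)
    set g := ∫ t in (0 : ℝ)..x, ‖p t‖ * f t with hgdef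
    have hg0 : 0 ≤ g := intervalIntegral.integral_nonneg hx.1 fun t _ =>
      mul_nonneg (norm_nonneg _) (hf0 t)
    have h2 : ‖∫ t in (0 : ℝ)..x, Complex.exp (-(z * (x - t))) *
        (q t * (a t - Complex.exp (z * t)))‖ ≤ Real.exp (y * x) * (Q * g) := by
      calc _ ≤ ∫ t in (0 : ℝ)..x, Real.exp (y * x) * g * ‖q t‖ := by
            refine intervalIntegral.norm_integral_le_of_norm_le hx.1
              (Eventually.of_forall fun t ht => ?_) ((hq _ _).norm.const_mul _)
            rw [norm_mul, norm_mul]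
            have h1 := hexp' (x - t) (by linarith [ht.2])
            rw [Complex.ofReal_sub] at h1
            have h3 : ∫ s in (0 : ℝ)..t, ‖p s‖ * f s ≤ g :=
              intervalIntegral.integral_mono_interval le_rfl ht.1.le ht.2
                (Eventually.of_forall fun s => mul_nonneg (norm_nonneg _) (hf0 s)) (hpf _ _)
            have h4 : ‖a t - Complex.exp (z * t)‖ ≤ Real.exp (y * t) * g :=
              (hD t ht.1.le).trans (mul_le_mul_of_nonneg_left h3 (Real.exp_pos _).le)
            calc _ ≤ Real.exp (y * (x - t)) * (‖q t‖ * (Real.exp (y * t) * g)) :=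
                  mul_le_mul h1 (mul_le_mul_of_nonneg_left h4 (norm_nonneg _)) (by positivity)
                    (Real.exp_pos _).le
              _ = (Real.exp (y * (x - t)) * Real.exp (y * t)) * (g * ‖q t‖) := by ring
              _ = _ := by rw [← Real.exp_add, ← mul_assoc]; congr 3; ring
        _ = Real.exp (y * x) * g * ∫ t in (0 : ℝ)..x, ‖q t‖ :=
            intervalIntegral.integral_const_mul _ _
        _ ≤ Real.exp (y * x) * g * Q := by
            refine mul_le_mul_of_nonneg_left ?_ (by positivity)
            exact intervalIntegral.integral_mono_interval le_rfl hx.1 hx.2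
              (Eventually.of_forall fun t => norm_nonneg _) (hq _ _).norm
        _ = _ := by ring
    have h3 : ‖b x‖ ≤ Real.exp (y * x) * (ε + Q * g) := by
      rw [hsplit]
      refine (norm_add_le _ _).trans ?_
      have := hqe x hx
      nlinarith
    have h4 : f x ≤ ε + Q * g := by
      rw [hbf] at h3
      exact le_of_mul_le_mul_left h3 (Real.exp_pos _)
    have h5 : ∫ t in (0 : ℝ)..x, Q * ‖p t‖ * f t = Q * g := by
      rw [hgdef, ← intervalIntegral.integral_const_mul]
      exact intervalIntegral.integral_congr fun t _ => mul_assoc _ _ _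
    rw [h5]
    exact h4
  have hb0 : b 0 = 0 := by rw [hba]; simp
  have hβ : ∀ x y, IntervalIntegrable (fun t => Q * ‖p t‖) volume x y := fun x y =>
    (hp x y).norm.const_mul _
  -- Gronwall's inequality is applied to `f (max x 0)`, which vanishes on the negative axis
  have hgron : ∀ x ∈ Icc (0 : ℝ) 1, f x ≤ 2 * ε * Real.exp (2 * (Q * P)) := fun x hx => by
    have h := le_of_le_add_abs_integral hβ (fun t => by positivity) (f := fun x => f (max x 0))
      (hfc.comp (continuous_id.max continuous_const)) (fun x => hf0 _) hε (R := 1)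
      (fun x hx => ?_) (x := x) (by rw [abs_of_nonneg hx.1]; exact hx.2)
    · simp only [max_eq_left hx.1] at h
      refine h.trans (mul_le_mul_of_nonneg_left (Real.exp_le_exp.2 ?_) (by positivity))
      rw [intervalIntegral.integral_const_mul, abs_of_nonneg]
      · have : ∫ t in (0 : ℝ)..x, ‖p t‖ ≤ P :=
          intervalIntegral.integral_mono_interval le_rfl hx.1 hx.2
            (Eventually.of_forall fun t => norm_nonneg _) (hp _ _).norm
        have := mul_le_mul_of_nonneg_left this hQ0
        linarith
      · exact mul_nonneg hQ0 (intervalIntegral.integral_nonneg hx.1 fun t _ => norm_nonneg _)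
    · rcases le_total x 0 with h0 | h0
      · have : f (max x 0) = 0 := by rw [max_eq_right h0, hf]; simp [hb0]
        rw [this]
        positivity
      · have h1 := hg x ⟨h0, (le_abs_self x).trans hx⟩
        have h2 : ∫ t in (0 : ℝ)..x, Q * ‖p t‖ * f (max t 0) =
            ∫ t in (0 : ℝ)..x, Q * ‖p t‖ * f t := by
          refine intervalIntegral.integral_congr fun t ht => ?_
          rw [uIcc_of_le h0] at ht
          simp only [max_eq_left ht.1]
        simp only [max_eq_left h0, h2]
        exact h1.trans (add_le_add_right (le_abs_self _) _)
  have h1 := hD 1 zero_le_one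
  simp only [Complex.ofReal_one, mul_one] at h1
  refine h1.trans ?_
  have h2 : ∫ t in (0 : ℝ)..1, ‖p t‖ * f t ≤ P * (2 * ε * Real.exp (2 * (Q * P))) := by
    rw [hP, ← intervalIntegral.integral_mul_const]
    exact intervalIntegral.integral_mono_on zero_le_one (hpf _ _) ((hp _ _).norm.mul_const _)
      fun t ht => mul_le_mul_of_nonneg_left (hgron t ht) (norm_nonneg _)
  calc Real.exp y * ∫ t in (0 : ℝ)..1, ‖p t‖ * f t
      ≤ Real.exp y * (P * (2 * ε * Real.exp (2 * (Q * P)))) :=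
        mul_le_mul_of_nonneg_left h2 (Real.exp_pos _).le
    _ = _ := by ring

end ZS

namespace ZS

/-- Variation of constants. -/
lemma IsPrimitive.eq_exp_mul_add_integral {u g : ℝ → ℂ} {κ : ℂ} (h : IsPrimitive u fun t => κ * u t + g t) (x : ℝ) :
    u x = Complex.exp (κ * x) * u 0 +
      ∫ t in (0 : ℝ)..x, Complex.exp (κ * (x - t)) * g t := by
  have hd : ∀ t : ℝ, HasDerivAt (fun t : ℝ => Complex.exp (-(κ * t)))
      (Complex.exp (-(κ * t)) * -κ) t := fun t => by
    have := (((hasDerivAt_id t).ofReal_comp.const_mul κ).neg).cexp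
    convert! this using 1
    simp
  have he : IsPrimitive (fun t : ℝ => Complex.exp (-(κ * t)))
      (fun t : ℝ => Complex.exp (-(κ * t)) * -κ) := by
    have hc : Continuous fun t : ℝ => Complex.exp (-(κ * t)) * -κ := by fun_prop
    refine ⟨fun a b => hc.intervalIntegrable _ _, fun x => ?_⟩
    rw [intervalIntegral.integral_eq_sub_of_hasDerivAt (fun t _ => hd t) (hc.intervalIntegrable _ _)]
    ring
  have h1 := (he.mul h).eq x
  have h2 : ∫ t in (0 : ℝ)..x, (Complex.exp (-(κ * t)) * -κ * u t +
      Complex.exp (-(κ * t)) * (κ * u t + g t)) =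
      ∫ t in (0 : ℝ)..x, Complex.exp (-(κ * t)) * g t :=
    intervalIntegral.integral_congr fun t _ => by ring
  rw [h2] at h1
  have h3 : ∫ t in (0 : ℝ)..x, Complex.exp (κ * (x - t)) * g t =
      Complex.exp (κ * x) * ∫ t in (0 : ℝ)..x, Complex.exp (-(κ * t)) * g t := by
    rw [← intervalIntegral.integral_const_mul]
    refine intervalIntegral.integral_congr fun t _ => ?_
    have : κ * ((x : ℂ) - t) = κ * x + -(κ * t) := by ring
    simp only [this, Complex.exp_add]
    ring
  rw [h3]
  have h4 : Complex.exp (κ * x) * Complex.exp (-(κ * x)) = 1 := by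
    rw [← Complex.exp_add, add_neg_cancel, Complex.exp_zero]
  simp only [Complex.ofReal_zero, mul_zero, neg_zero, Complex.exp_zero, one_mul] at h1
  rw [← mul_add, ← h1, ← mul_assoc, h4, one_mul]

/-- The asymptotics of the discriminant: `Δ - 2 cos` is small in comparison with `exp |im z|`. -/
theorem exists_norm_discriminant_sub_le (φ : Potential) {ε : ℝ} (hε : 0 < ε) :
    ∃ R, ∀ z : ℂ, R ≤ ‖z‖ →
      ‖discriminant φ z - 2 * Complex.cos z‖ ≤ ε * Real.exp |z.im| := by
  have hq₁ := fun x y => (intervalIntegrable_pot₁ φ x y).const_mul Complex.I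
  have hq₂ := fun x y => (intervalIntegrable_pot₂ φ x y).const_mul (-Complex.I)
  set K₁ : ℝ := 2 * (∫ t in (0 : ℝ)..1, ‖Complex.I * pot₁ φ t‖) *
      Real.exp (2 * ((∫ t in (0 : ℝ)..1, ‖-Complex.I * pot₂ φ t‖) *
        ∫ t in (0 : ℝ)..1, ‖Complex.I * pot₁ φ t‖)) with hK₁
  set K₂ : ℝ := 2 * (∫ t in (0 : ℝ)..1, ‖-Complex.I * pot₂ φ t‖) *
      Real.exp (2 * ((∫ t in (0 : ℝ)..1, ‖Complex.I * pot₁ φ t‖) *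
        ∫ t in (0 : ℝ)..1, ‖-Complex.I * pot₂ φ t‖)) with hK₂
  have hK₁0 : 0 ≤ K₁ := by
    have := intervalIntegral.integral_nonneg (μ := volume) (f := fun t => ‖Complex.I * pot₁ φ t‖)
      zero_le_one fun t _ => norm_nonneg _
    positivity
  have hK₂0 : 0 ≤ K₂ := by
    have := intervalIntegral.integral_nonneg (μ := volume) (f := fun t => ‖-Complex.I * pot₂ φ t‖)
      zero_le_one fun t _ => norm_nonneg _
    positivity
  set δ := ε / (K₁ + K₂ + 1) with hδ
  have hδ0 : 0 < δ := by positivity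
  obtain ⟨R₁, hR₁⟩ := exists_norm_integral_exp_mul_le hq₁ hδ0
  obtain ⟨R₂, hR₂⟩ := exists_norm_integral_exp_mul_le hq₂ hδ0
  refine ⟨max R₁ R₂, fun z hz => ?_⟩
  set M := fundamentalMatrix φ z with hM
  have hsol := solvesODE_fundamentalMatrix φ z
  rw [← hM] at hsol
  have hc : ∀ i j, Continuous fun x => M x i j := fun i j => (continuous_apply i).comp (hsol j).1
  have h0 : M 0 = 1 := by
    ext i j; exact congrFun (hsol j).apply_zero i
  have hp : ∀ i j, IsPrimitive (fun x => M x i j) (fun x => coeffCLM φ z x (fun i => M x i j) i) :=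
    fun i j => by
    have hint := fun x y => intervalIntegrable_coeffCLM_apply φ z (hsol j).1 x y
    refine ⟨fun a b => ?_, fun x => ?_⟩
    · have := hint a b
      exact ⟨(ContinuousLinearMap.proj (R := ℂ) (φ := fun _ : Fin 2 => ℂ) i).integrable_comp this.1,
        (ContinuousLinearMap.proj (R := ℂ) (φ := fun _ : Fin 2 => ℂ) i).integrable_comp this.2⟩
    · have h1 := congrFun ((hsol j).2 x) i
      simp only [Pi.zero_apply, add_zero] at h1
      rw [Pi.add_apply, intervalIntegral_apply (hint 0 x), ← congrFun (hsol j).apply_zero i] at h1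
      exact h1
  have hp0 : ∀ j, IsPrimitive (fun x => M x 0 j)
      (fun x => (-Complex.I * z) * M x 0 j + Complex.I * pot₁ φ x * M x 1 j) := fun j => by
    convert! hp 0 j using 1
    ext x
    simp only [coeffCLM_apply, Matrix.cons_val_zero]
    ring
  have hp1 : ∀ j, IsPrimitive (fun x => M x 1 j)
      (fun x => (Complex.I * z) * M x 1 j + -Complex.I * pot₂ φ x * M x 0 j) := fun j => by
    convert! hp 1 j using 1
    ext x
    simp only [coeffCLM_apply, Matrix.cons_val_one, Matrix.cons_val_fin_one]
    ring
  -- variation of constants for the entries; the columns satisfy coupled equations with `q₁`, `q₂`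
  have hv0 := fun j => (hp0 j).eq_exp_mul_add_integral
  have hv1 := fun j => (hp1 j).eq_exp_mul_add_integral
  have e1 : -(-Complex.I * z) = Complex.I * z := by ring
  have hA := norm_sub_exp_le hq₁ hq₂ (hc 0 0) (hc 1 0) (z := -Complex.I * z)
    (fun x => by rw [hv0 0 x, h0]; simp) (fun x => by
      rw [hv1 0 x, h0]
      simp only [← neg_mul, e1]
      simp) hδ0.le (hR₂ _ (by simpa using (le_max_right _ _).trans hz))
  have hB := norm_sub_exp_le hq₂ hq₁ (hc 1 1) (hc 0 1) (z := Complex.I * z)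
    (fun x => by rw [hv1 1 x, h0]; simp) (fun x => by
      rw [hv0 1 x, h0]
      simp) hδ0.le (hR₁ _ (by simpa using (le_max_left _ _).trans hz))
  have er : |(-Complex.I * z).re| = |z.im| := by simp
  have er' : |(Complex.I * z).re| = |z.im| := by simp
  rw [er, ← hK₁] at hA
  rw [er', ← hK₂] at hB
  have hcos : discriminant φ z - 2 * Complex.cos z =
      (M 1 0 0 - Complex.exp (-Complex.I * z)) + (M 1 1 1 - Complex.exp (Complex.I * z)) := by
    rw [discriminant, Matrix.trace_fin_two, ← hM, Complex.cos,
      show z * Complex.I = Complex.I * z by ring, show -z * Complex.I = -Complex.I * z by ring]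
    ring
  rw [hcos]
  refine (norm_add_le _ _).trans ((add_le_add hA hB).trans ?_)
  rw [← add_mul, ← mul_add]
  refine mul_le_mul_of_nonneg_right ?_ (Real.exp_pos _).le
  rw [hδ, div_mul_eq_mul_div, div_le_iff₀ (by positivity)]
  nlinarith

lemma norm_sin_sq (z : ℂ) : ‖Complex.sin z‖ ^ 2 = Real.sin z.re ^ 2 + Real.sinh z.im ^ 2 := by
  have h1 : Complex.sin z = ((Real.sin z.re * Real.cosh z.im : ℝ) : ℂ) +
      ((Real.cos z.re * Real.sinh z.im : ℝ) : ℂ) * Complex.I := by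
    rw [Complex.sin_eq]; push_cast; ring
  rw [h1, Complex.sq_norm, Complex.normSq_add_mul_I]
  have h2 := Real.cosh_sq z.im
  have h3 := Real.sin_sq_add_cos_sq z.re
  linear_combination Real.sin z.re ^ 2 * h2 + Real.sinh z.im ^ 2 * h3

/-- Off the disks of radius `π / 4` around its zeros, `sin` has the size of `exp |im z|`. -/
lemma exists_le_norm_sin : ∃ c > 0, ∀ z : ℂ,
    (∀ k : ℤ, Real.pi / 4 ≤ ‖z - k * (Real.pi : ℂ)‖) → c * Real.exp |z.im| ≤ ‖Complex.sin z‖ := by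
  have hπ := Real.pi_pos
  have he : 0 < 1 - Real.exp (-(Real.pi / 4)) := by
    rw [sub_pos, Real.exp_lt_one_iff]; linarith
  refine ⟨min ((1 - Real.exp (-(Real.pi / 4))) / 2) (Real.exp (-(Real.pi / 8)) / 4),
    lt_min (by positivity) (by positivity), fun z hz => ?_⟩
  have hsq := norm_sin_sq z
  rcases le_total (Real.pi / 8) |z.im| with hy | hy
  · have h1 : |Real.sinh z.im| ≤ ‖Complex.sin z‖ :=
      abs_le_of_sq_le_sq (by nlinarith [sq_nonneg (Real.sin z.re)]) (norm_nonneg _)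
    have h2 : |Real.sinh z.im| = Real.sinh |z.im| := by rw [Real.abs_sinh]
    refine le_trans ?_ h1
    rw [h2, Real.sinh_eq]
    have h3 : Real.exp (-|z.im|) ≤ Real.exp (-(Real.pi / 4)) * Real.exp |z.im| := by
      rw [← Real.exp_add, Real.exp_le_exp]; linarith
    have h4 := mul_le_mul_of_nonneg_right (min_le_left ((1 - Real.exp (-(Real.pi / 4))) / 2)
      (Real.exp (-(Real.pi / 8)) / 4)) (Real.exp_pos |z.im|).le
    linarith
  · set k : ℤ := round (z.re / Real.pi) with hk
    set x := z.re - k * Real.pi with hx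
    have hx1 : |x| ≤ Real.pi / 2 := by
      have h1 := abs_sub_round (z.re / Real.pi)
      have h2 : x = (z.re / Real.pi - k) * Real.pi := by
        rw [hx]; field_simp
      rw [h2, abs_mul, abs_of_pos hπ]
      nlinarith
    have hx2 : Real.pi / 8 ≤ |x| := by
      have h1 := hz k
      have h2 : ‖z - k * (Real.pi : ℂ)‖ ≤ |x| + |z.im| := by
        refine (Complex.norm_le_abs_re_add_abs_im _).trans (le_of_eq ?_)
        simp [hx]
      linarith
    have hs : |Real.sin z.re| = |Real.sin x| := by
      rw [hx, Real.sin_sub_int_mul_pi, abs_mul, abs_zpow]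
      simp
    have h3 : 1 / 4 ≤ |Real.sin x| := by
      have h4 : |Real.sin x| = |Real.sin (|x|)| := by
        rcases abs_choice x with h | h <;> rw [h]
        rw [Real.sin_neg, abs_neg]
      rw [h4]
      refine le_trans ?_ (le_abs_self _)
      refine le_trans ?_ (Real.mul_le_sin (abs_nonneg x) hx1)
      rw [div_mul_eq_mul_div, le_div_iff₀ hπ]
      linarith
    have h1 : |Real.sin z.re| ≤ ‖Complex.sin z‖ :=
      abs_le_of_sq_le_sq (by nlinarith [sq_nonneg (Real.sinh z.im)]) (norm_nonneg _)
    refine le_trans ?_ (h3.trans (hs ▸ h1))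
    have h4 := mul_le_mul_of_nonneg_right (min_le_right ((1 - Real.exp (-(Real.pi / 4))) / 2)
      (Real.exp (-(Real.pi / 8)) / 4)) (Real.exp_pos |z.im|).le
    refine h4.trans ?_
    have h5 : Real.exp (-(Real.pi / 8)) * Real.exp |z.im| ≤ 1 := by
      rw [← Real.exp_add, Real.exp_le_one_iff]; linarith
    linarith

lemma norm_cos_le (z : ℂ) : ‖Complex.cos z‖ ≤ Real.exp |z.im| := by
  rw [Complex.cos, norm_div, Complex.norm_ofNat, div_le_iff₀ two_pos]
  have h1 : ‖Complex.exp (z * Complex.I)‖ ≤ Real.exp |z.im| := by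
    rw [Complex.norm_exp, Real.exp_le_exp]; simpa using neg_le_abs z.im
  have h2 : ‖Complex.exp (-z * Complex.I)‖ ≤ Real.exp |z.im| := by
    rw [Complex.norm_exp, Real.exp_le_exp]; simpa using le_abs_self z.im
  linarith [norm_add_le (Complex.exp (z * Complex.I)) (Complex.exp (-z * Complex.I))]

/-- Off the disks of radius `π / 4` around the zeros of `sin`, the function `Δ² - 4` is
asymptotic to `-4 sin²`. -/
theorem exists_norm_ratio_sub_one_le (φ : Potential) {ε : ℝ} (hε : 0 < ε) :
    ∃ R, ∀ z : ℂ, R ≤ ‖z‖ → (∀ k : ℤ, Real.pi / 4 ≤ ‖z - k * (Real.pi : ℂ)‖) →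
      ‖(discriminant φ z ^ 2 - 4) / (-4 * Complex.sin z ^ 2) - 1‖ ≤ ε := by
  obtain ⟨c, hc, hsin⟩ := exists_le_norm_sin
  set δ := min 1 (ε * c ^ 2) with hδ
  have hδ0 : 0 < δ := lt_min one_pos (by positivity)
  have hδ1 : δ ≤ 1 := min_le_left _ _
  have hδ2 : δ ≤ ε * c ^ 2 := min_le_right _ _
  obtain ⟨R, hR⟩ := exists_norm_discriminant_sub_le φ (half_pos hδ0)
  refine ⟨R, fun z hz hk => ?_⟩
  have h1 := hR z hz
  have h2 := hsin z hk
  set e := Real.exp |z.im| with he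
  have he0 : 0 < e := Real.exp_pos _
  have hs0 : 0 < ‖Complex.sin z‖ := (mul_pos hc he0).trans_le h2
  have hs : Complex.sin z ≠ 0 := norm_pos_iff.1 hs0
  have hid : (discriminant φ z ^ 2 - 4) / (-4 * Complex.sin z ^ 2) - 1 =
      (discriminant φ z - 2 * Complex.cos z) *
        (discriminant φ z - 2 * Complex.cos z + 4 * Complex.cos z) / (-4 * Complex.sin z ^ 2) := by
    rw [div_sub_one (by simpa using hs)]
    congr 1
    linear_combination 4 * Complex.sin_sq_add_cos_sq z
  rw [hid, norm_div, norm_mul, norm_mul, norm_pow, norm_neg, Complex.norm_ofNat,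
    div_le_iff₀ (by positivity)]
  have h3 : ‖discriminant φ z - 2 * Complex.cos z + 4 * Complex.cos z‖ ≤ 5 * e := by
    refine (norm_add_le _ _).trans ?_
    rw [norm_mul, Complex.norm_ofNat]
    have := norm_cos_le z
    nlinarith
  calc _ ≤ (δ / 2 * e) * (5 * e) := mul_le_mul h1 h3 (norm_nonneg _) (by positivity)
    _ ≤ ε * (4 * (c * e) ^ 2) := by nlinarith [sq_nonneg e]
    _ ≤ ε * (4 * ‖Complex.sin z‖ ^ 2) := by gcongr

end ZS

namespace ZS

/-! ### Counting zeros -/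

/-- The monic polynomial function with the roots `A`. -/
def rootProd (A : Multiset ℂ) (z : ℂ) : ℂ := (A.map fun a => z - a).prod

lemma rootProd_zero : rootProd 0 = fun _ => 1 := by
  ext z; simp [rootProd]

lemma rootProd_cons (a : ℂ) (A : Multiset ℂ) (z : ℂ) :
    rootProd (a ::ₘ A) z = (z - a) * rootProd A z := by
  simp [rootProd]

lemma rootProd_ne_zero {A : Multiset ℂ} {z : ℂ} (h : z ∉ A) : rootProd A z ≠ 0 := by
  rw [rootProd, Ne, Multiset.prod_eq_zero_iff, Multiset.mem_map]
  rintro ⟨a, ha, haz⟩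
  rw [sub_eq_zero] at haz
  exact h (haz ▸ ha)

lemma differentiable_rootProd (A : Multiset ℂ) : Differentiable ℂ (rootProd A) := by
  induction A using Multiset.induction with
  | empty => rw [rootProd_zero]; exact differentiable_const _
  | cons a A ih =>
    have : rootProd (a ::ₘ A) = fun z => (z - a) * rootProd A z := funext (rootProd_cons a A)
    rw [this]
    exact (differentiable_id.sub_const a).mul ih

lemma analyticOrderAt_sub_mul {f : ℂ → ℂ} {a z : ℂ} (hf : AnalyticAt ℂ f z) :
    analyticOrderAt (fun z => (z - a) * f z) z = (if z = a then 1 else 0) + analyticOrderAt f z := by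
  have h1 : AnalyticAt ℂ (fun z => z - a) z := by fun_prop
  have h2 := analyticOrderAt_mul h1 hf
  have h3 : analyticOrderAt (fun z => z - a) z = if z = a then 1 else 0 := by
    split_ifs with h
    · subst h; exact analyticOrderAt_id_sub_const_self
    · rw [analyticOrderAt_eq_zero]
      exact Or.inr (sub_ne_zero.2 h)
  rw [← h3]
  exact h2

/-- Each linear factor contributes to the order at its root. -/
lemma analyticOrderAt_rootProd_mul {g : ℂ → ℂ} (hg : Differentiable ℂ g) (A : Multiset ℂ) (z : ℂ) :
    analyticOrderAt (fun z => rootProd A z * g z) z = A.count z + analyticOrderAt g z := by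
  induction A using Multiset.induction with
  | empty => simp [rootProd_zero]
  | cons a A ih =>
    have h1 : (fun z => rootProd (a ::ₘ A) z * g z) =
        fun z => (z - a) * (rootProd A z * g z) := by
      ext z; rw [rootProd_cons, mul_assoc]
    rw [h1, analyticOrderAt_sub_mul (f := fun z => rootProd A z * g z)
      (((differentiable_rootProd A).mul hg).analyticAt z), ih, Multiset.count_cons]
    push_cast
    split_ifs <;> ring

/-- Zeros can be divided out. -/
lemma exists_eq_rootProd_mul (A : Multiset ℂ) :
    ∀ {f : ℂ → ℂ}, Differentiable ℂ f → (∀ z, (A.count z : ℕ∞) ≤ analyticOrderAt f z) →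
      ∃ g : ℂ → ℂ, Differentiable ℂ g ∧ f = fun z => rootProd A z * g z := by
  induction A using Multiset.induction with
  | empty => exact fun {f} hf _ => ⟨f, hf, by simp [rootProd_zero]⟩
  | cons a A ih =>
    intro f hf hA
    have hfa : f a = 0 := by
      refine apply_eq_zero_of_analyticOrderAt_ne_zero fun h => ?_
      have := hA a
      rw [h] at this
      simp at this
    have hd : Differentiable ℂ (dslope f a) := by
      rw [← differentiableOn_univ] at hf ⊢
      exact (Complex.differentiableOn_dslope Filter.univ_mem).2 hf
    have hfd : f = fun z => (z - a) * dslope f a z := by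
      ext z
      have := sub_smul_dslope f a z
      rw [smul_eq_mul, hfa, sub_zero] at this
      exact this.symm
    obtain ⟨g, hg, hfg⟩ := ih hd fun z => by
      have h1 := hA z
      rw [hfd, analyticOrderAt_sub_mul (hd.analyticAt z), Multiset.count_cons] at h1
      push_cast at h1
      split_ifs at h1
      · rw [add_comm] at h1
        exact (ENat.addLECancellable_of_ne_top ENat.one_ne_top).add_le_add_iff_left.1 h1
      · simpa using h1
    refine ⟨g, hg, ?_⟩
    ext z
    rw [hfd, rootProd_cons, mul_assoc]
    simp only
    rw [hfg]

/-- `A` consists of the zeros of `f` in `K` with multiplicities. -/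
def IsZeros (f : ℂ → ℂ) (K : Set ℂ) (A : Multiset ℂ) : Prop :=
  (∀ z ∈ K, (A.count z : ℕ∞) = analyticOrderAt f z) ∧ ∀ a ∈ A, a ∈ K

lemma IsZeros.exists_eq {f : ℂ → ℂ} {K : Set ℂ} {A : Multiset ℂ} (h : IsZeros f K A)
    (hf : Differentiable ℂ f) :
    ∃ g : ℂ → ℂ, Differentiable ℂ g ∧ (f = fun z => rootProd A z * g z) ∧ ∀ z ∈ K, g z ≠ 0 := by
  obtain ⟨g, hg, hfg⟩ := exists_eq_rootProd_mul A hf fun z => by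
    by_cases hz : z ∈ K
    · exact (h.1 z hz).le
    · rw [Multiset.count_eq_zero_of_notMem fun hA => hz (h.2 z hA)]
      exact zero_le
  refine ⟨g, hg, hfg, fun z hz => ?_⟩
  have h1 := h.1 z hz
  rw [hfg, analyticOrderAt_rootProd_mul hg] at h1
  have h2 : analyticOrderAt g z = 0 := by
    have h3 : ((A.count z : ℕ) : ℕ∞) + 0 = (A.count z : ℕ) + analyticOrderAt g z := by
      rw [add_zero]; exact h1
    exact ((ENat.addLECancellable_of_ne_top (ENat.natCast_ne_top _)).inj.1 h3).symm
  exact ((hg.analyticAt z).analyticOrderAt_eq_zero).1 h2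

lemma analyticOrderAt_ne_top_of_differentiable {f : ℂ → ℂ} (hf : Differentiable ℂ f) {w : ℂ}
    (hw : f w ≠ 0) (z : ℂ) : analyticOrderAt f z ≠ ⊤ := by
  have han : AnalyticOnNhd ℂ f univ := fun z _ => hf.analyticAt z
  refine han.analyticOrderAt_ne_top_of_isPreconnected (x := w) isPreconnected_univ (mem_univ _)
    (mem_univ _) ?_
  rw [(hf.analyticAt w).analyticOrderAt_eq_zero.2 hw]
  exact ENat.zero_ne_top

/-- An entire function that is not zero identically has finitely many zeros in a compact set. -/
lemma exists_isZeros {f : ℂ → ℂ} (hf : Differentiable ℂ f) {w : ℂ} (hw : f w ≠ 0) {K : Set ℂ}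
    (hK : IsCompact K) : ∃ A, IsZeros f K A := by
  have hfin : {z ∈ K | f z = 0}.Finite := by
    by_contra hinf
    obtain ⟨x, -, hx⟩ := Set.Infinite.exists_accPt_of_subset_isCompact hinf hK fun z hz => hz.1
    have h1 : ∃ᶠ z in 𝓝[≠] x, f z = 0 :=
      (accPt_iff_frequently_nhdsNE.1 hx).mono fun z hz => hz.2
    have han : AnalyticOnNhd ℂ f univ := fun z _ => hf.analyticAt z
    exact hw (han.eqOn_zero_of_preconnected_of_frequently_eq_zero isPreconnected_univ
      (mem_univ x) h1 (mem_univ w))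
  refine ⟨∑ z ∈ hfin.toFinset, Multiset.replicate (analyticOrderNatAt f z) z, fun z hz => ?_,
    fun a ha => ?_⟩
  · rw [Multiset.count_sum']
    simp only [Multiset.count_replicate, Finset.sum_ite_eq']
    split_ifs with h
    · exact Nat.cast_analyticOrderNatAt (analyticOrderAt_ne_top_of_differentiable hf hw z)
    · have hfz : f z ≠ 0 := fun h0 => h (by simpa using ⟨hz, h0⟩)
      rw [(hf.analyticAt z).analyticOrderAt_eq_zero.2 hfz]
      rfl
  · rw [Multiset.mem_sum] at ha
    obtain ⟨b, hb, hab⟩ := ha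
    rw [Multiset.eq_of_mem_replicate hab]
    exact ((Set.Finite.mem_toFinset hfin).1 hb).1

/-- The argument principle for an explicitly factored function. -/
lemma circleIntegral_logDeriv {c : ℂ} {R : ℝ} (hR : 0 < R) {g : ℂ → ℂ} (hg : Differentiable ℂ g)
    (hg0 : ∀ z ∈ Metric.closedBall c R, g z ≠ 0) (A : Multiset ℂ) (hA : ∀ a ∈ A, a ∈ Metric.ball c R) :
    (∮ z in C(c, R), logDeriv (fun z => rootProd A z * g z) z) =
      Multiset.card A * (2 * Real.pi * Complex.I) := by
  have hcont : ∀ {f : ℂ → ℂ}, Differentiable ℂ f → (∀ z ∈ Metric.sphere c R, f z ≠ 0) →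
      CircleIntegrable (logDeriv f) c R := fun {f} hf h0 =>
    ContinuousOn.circleIntegrable hR.le
      (((hf.deriv).continuous.continuousOn).div hf.continuous.continuousOn h0)
  induction A using Multiset.induction with
  | empty =>
    simp only [rootProd_zero, one_mul, Multiset.card_zero, Nat.cast_zero, zero_mul]
    refine Complex.circleIntegral_eq_zero_of_differentiable_on_off_countable hR.le
      countable_empty ?_ ?_
    · exact ((hg.deriv).continuous.continuousOn).div hg.continuous.continuousOn hg0
    · intro z hz
      exact ((hg.deriv) z).div (hg z) (hg0 z (Metric.ball_subset_closedBall hz.1))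
  | cons a A ih =>
    have ha : a ∈ Metric.ball c R := hA a (Multiset.mem_cons_self a A)
    have hA' : ∀ b ∈ A, b ∈ Metric.ball c R := fun b hb => hA b (Multiset.mem_cons_of_mem hb)
    have hs : ∀ z ∈ Metric.sphere c R, ∀ b ∈ Metric.ball c R, z ≠ b := fun z hz b hb h => by
      rw [← h, Metric.mem_ball, Metric.mem_sphere.1 hz] at hb
      exact lt_irrefl _ hb
    have hne : ∀ z ∈ Metric.sphere c R, rootProd A z * g z ≠ 0 := fun z hz =>
      mul_ne_zero (rootProd_ne_zero fun h => hs z hz z (hA' z h) rfl)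
        (hg0 z (Metric.sphere_subset_closedBall hz))
    have hd : Differentiable ℂ fun z => rootProd A z * g z := (differentiable_rootProd A).mul hg
    have h1 : ∀ z ∈ Metric.sphere c R, logDeriv (fun z => rootProd (a ::ₘ A) z * g z) z =
        (z - a)⁻¹ + logDeriv (fun z => rootProd A z * g z) z := fun z hz => by
      have e : (fun z => rootProd (a ::ₘ A) z * g z) =
          fun z => (z - a) * (rootProd A z * g z) := by
        ext z; rw [rootProd_cons, mul_assoc]
      rw [e, logDeriv_mul (f := fun z => z - a) z (sub_ne_zero.2 (hs z hz a ha)) (hne z hz)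
        (by fun_prop) (hd z)]
      congr 1
      rw [logDeriv_apply, deriv_sub_const, deriv_id'', one_div]
    rw [circleIntegral.integral_congr hR.le h1, circleIntegral.integral_add,
      circleIntegral.integral_sub_inv_of_mem_ball ha, ih hA', Multiset.card_cons]
    · push_cast
      ring
    · refine ContinuousOn.circleIntegrable hR.le (ContinuousOn.inv₀ (by fun_prop) fun z hz => ?_)
      exact sub_ne_zero.2 (hs z hz a ha)
    · exact hcont hd hne

/-- Rouché's theorem. -/
lemma IsZeros.card_eq {c : ℂ} {R : ℝ} (hR : 0 < R) {f h : ℂ → ℂ} (hf : Differentiable ℂ f)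
    (hh : Differentiable ℂ h) (h0 : ∀ z ∈ Metric.sphere c R, h z ≠ 0)
    (hfh : ∀ z ∈ Metric.sphere c R, ‖f z / h z - 1‖ < 1) {A B : Multiset ℂ}
    (hA : IsZeros f (Metric.closedBall c R) A) (hB : IsZeros h (Metric.closedBall c R) B) :
    Multiset.card A = Multiset.card B := by
  have hf0 : ∀ z ∈ Metric.sphere c R, f z ≠ 0 := fun z hz hfz => by
    have := hfh z hz
    rw [hfz, zero_div, zero_sub, norm_neg, norm_one] at this
    exact lt_irrefl _ this
  have hball : ∀ {u : ℂ → ℂ} {D : Multiset ℂ}, IsZeros u (Metric.closedBall c R) D →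
      (∀ z ∈ Metric.sphere c R, u z ≠ 0) → ∀ a ∈ D, a ∈ Metric.ball c R := by
    intro u D hD hu a ha
    have h1 := Metric.mem_closedBall.1 (hD.2 a ha)
    refine Metric.mem_ball.2 (lt_of_le_of_ne h1 fun h2 => hu a h2 ?_)
    refine apply_eq_zero_of_analyticOrderAt_ne_zero ?_
    rw [← hD.1 a (hD.2 a ha)]
    exact_mod_cast (Multiset.count_pos.2 ha).ne'
  obtain ⟨g, hg, hfg, hg0⟩ := hA.exists_eq hf
  obtain ⟨k, hk, hhk, hk0⟩ := hB.exists_eq hh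
  have h1 := circleIntegral_logDeriv hR hg hg0 A (hball hA hf0)
  have h2 := circleIntegral_logDeriv hR hk hk0 B (hball hB h0)
  rw [← hfg] at h1
  rw [← hhk] at h2
  have hi : ∀ {f : ℂ → ℂ}, Differentiable ℂ f → (∀ z ∈ Metric.sphere c R, f z ≠ 0) →
      CircleIntegrable (logDeriv f) c R := fun {f} hf h0 =>
    ContinuousOn.circleIntegrable hR.le
      (((hf.deriv).continuous.continuousOn).div hf.continuous.continuousOn h0)
  -- the logarithm of `f / h`, which stays in the disk of radius one around `1`, is a primitive of
  -- the difference of the logarithmic derivatives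
  have h3 : (∮ z in C(c, R), (logDeriv f z - logDeriv h z)) = 0 := by
    refine circleIntegral.integral_eq_zero_of_hasDerivWithinAt
      (f := fun z => Complex.log (f z / h z)) hR.le fun z hz => ?_
    have hsl : f z / h z ∈ Complex.slitPlane := by
      refine Complex.mem_slitPlane_of_norm_lt_one (z := f z / h z - 1) (hfh z hz) |> fun h => ?_
      simpa using h
    have hd : HasDerivAt (fun z => f z / h z) _ z :=
      (hf z).hasDerivAt.div (hh z).hasDerivAt (h0 z hz)
    convert! (hd.clog hsl).hasDerivWithinAt using 1
    have := h0 z hz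
    have := hf0 z hz
    rw [logDeriv_apply, logDeriv_apply]
    field_simp
  rw [circleIntegral.integral_sub (hi hf hf0) (hi hh h0), h1, h2, ← sub_mul] at h3
  have h4 : (2 * Real.pi * Complex.I : ℂ) ≠ 0 := Complex.two_pi_I_ne_zero
  have h5 := (mul_eq_zero.1 h3).resolve_right h4
  rw [sub_eq_zero] at h5
  exact_mod_cast h5

end ZS

namespace ZS

/-! ### The number of periodic eigenvalues in disks -/

/-- The function `Δ² - 4`, whose zeros are the periodic eigenvalues. -/
def charFun (φ : Potential) (z : ℂ) : ℂ := discriminant φ z ^ 2 - 4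

lemma differentiable_charFun (φ : Potential) : Differentiable ℂ (charFun φ) :=
  ((differentiable_discriminant φ).pow 2).sub_const 4

lemma pi_div_four_le_norm_sub {z : ℂ} {N : ℕ} {r : ℝ} (hr : Real.pi / 4 ≤ r)
    (hr' : r ≤ 3 * Real.pi / 4) (hz : ‖z‖ = N * Real.pi + r) (k : ℤ) :
    Real.pi / 4 ≤ ‖z - k * (Real.pi : ℂ)‖ := by
  have hπ := Real.pi_pos
  have hk : ‖(k : ℂ) * (Real.pi : ℂ)‖ = |(k : ℝ)| * Real.pi := by
    rw [norm_mul, Complex.norm_intCast, Complex.norm_real, Real.norm_of_nonneg hπ.le]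
  rcases le_or_gt |k| (N : ℤ) with h | h
  · have h1 : |(k : ℝ)| ≤ N := by exact_mod_cast h
    have h2 := norm_sub_norm_le z (k * (Real.pi : ℂ))
    rw [hk, hz] at h2
    nlinarith
  · have h1 : (N : ℝ) + 1 ≤ |(k : ℝ)| := by exact_mod_cast h
    have h2 := norm_sub_norm_le (k * (Real.pi : ℂ)) z
    rw [hk, hz, norm_sub_rev] at h2
    nlinarith

/-- The centers `kπ` have mutual distance at least `π`. -/
lemma pi_le_norm_sub {j k : ℤ} (h : j ≠ k) :
    Real.pi ≤ ‖(j : ℂ) * (Real.pi : ℂ) - k * (Real.pi : ℂ)‖ := by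
  have hπ := Real.pi_pos
  rw [← sub_mul, norm_mul, Complex.norm_real, Real.norm_of_nonneg hπ.le, ← Int.cast_sub,
    Complex.norm_intCast]
  have : (1 : ℝ) ≤ |((j - k : ℤ) : ℝ)| := by
    exact_mod_cast Int.one_le_abs (sub_ne_zero.2 h)
  nlinarith

lemma norm_sub_of_mem_disk {k : ℤ} {z : ℂ} {r : ℝ} (hr : r ≤ Real.pi / 4)
    (hz : ‖z - k * (Real.pi : ℂ)‖ = r) {j : ℤ} (hj : j ≠ k) :
    Real.pi / 4 ≤ ‖z - j * (Real.pi : ℂ)‖ := by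
  have hπ := Real.pi_pos
  have h1 := pi_le_norm_sub hj
  have h2 := norm_sub_le_norm_sub_add_norm_sub ((j : ℂ) * (Real.pi : ℂ)) z (k * (Real.pi : ℂ))
  rw [norm_sub_rev _ z] at h2
  linarith

lemma exists_charFun_ne_zero (φ : Potential) : ∃ z, charFun φ z ≠ 0 := by
  obtain ⟨R, hR⟩ := exists_norm_ratio_sub_one_le φ (ε := 1 / 2) (by norm_num)
  have hπ := Real.pi_pos
  obtain ⟨N, hN⟩ := exists_nat_gt (R / Real.pi)
  rw [div_lt_iff₀ hπ] at hN
  have hn : ‖((N * Real.pi + Real.pi / 4 : ℝ) : ℂ)‖ = N * Real.pi + Real.pi / 4 := by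
    rw [Complex.norm_real, Real.norm_of_nonneg (by positivity)]
  refine ⟨((N * Real.pi + Real.pi / 4 : ℝ) : ℂ), fun h0 => ?_⟩
  have h := hR _ (by rw [hn]; linarith)
    (pi_div_four_le_norm_sub le_rfl (by linarith) hn)
  rw [charFun] at h0
  rw [h0, zero_div, zero_sub, norm_neg, norm_one] at h
  norm_num at h

lemma analyticOrderAt_charFun_ne_top (φ : Potential) (z : ℂ) :
    analyticOrderAt (charFun φ) z ≠ ⊤ := by
  obtain ⟨w, hw⟩ := exists_charFun_ne_zero φ
  exact analyticOrderAt_ne_top_of_differentiable (differentiable_charFun φ) hw z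

lemma algMult_eq (φ : Potential) (z : ℂ) : algMult φ z = analyticOrderAt (charFun φ) z :=
  algMult_eq_analyticOrderAt φ z (analyticOrderAt_charFun_ne_top φ z)

lemma algMult_eq_zero_iff (φ : Potential) (z : ℂ) : algMult φ z = 0 ↔ charFun φ z ≠ 0 := by
  rw [algMult_eq, ((differentiable_charFun φ).analyticAt z).analyticOrderAt_eq_zero]

lemma differentiable_neg_four_mul_sin_sq :
    Differentiable ℂ fun z : ℂ => -4 * Complex.sin z ^ 2 := by fun_prop

lemma analyticOrderAt_neg_four_mul_sin_sq (z : ℂ) [Decidable (Complex.sin z = 0)] :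
    analyticOrderAt (fun z : ℂ => -4 * Complex.sin z ^ 2) z =
      if Complex.sin z = 0 then 2 else 0 := by
  have hd := differentiable_neg_four_mul_sin_sq.analyticAt z
  split_ifs with h
  · have hs : AnalyticAt ℂ Complex.sin z := Complex.differentiable_sin.analyticAt z
    have hc : Complex.cos z ≠ 0 := fun hc => by
      have := Complex.sin_sq_add_cos_sq z
      rw [h, hc] at this
      norm_num at this
    have h1 : analyticOrderAt Complex.sin z = 1 :=
      hs.analyticOrderAt_eq_one_of_zero_deriv_ne_zero h (by rwa [Complex.deriv_sin])
    have h2 := analyticOrderAt_mul (analyticAt_const (x := z) (v := (-4 : ℂ))) (hs.pow 2)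
    rw [analyticOrderAt_pow hs, h1] at h2
    have h3 : analyticOrderAt (fun _ : ℂ => (-4 : ℂ)) z = 0 := by
      rw [analyticOrderAt_eq_zero]; right; norm_num
    rw [h3] at h2
    exact h2.trans (by norm_num)
  · rw [hd.analyticOrderAt_eq_zero]
    simpa using h

/-- The zeros of `sin²` are the multiples of `π`, all of them double. -/
lemma isZeros_sin_sq {K : Set ℂ} {s : Finset ℤ} (hs : ∀ k : ℤ, k ∈ s ↔ (k : ℂ) * Real.pi ∈ K) :
    IsZeros (fun z : ℂ => -4 * Complex.sin z ^ 2) K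
      (∑ k ∈ s, Multiset.replicate 2 ((k : ℂ) * Real.pi)) := by
  classical
  have hπ : (Real.pi : ℂ) ≠ 0 := by exact_mod_cast Real.pi_ne_zero
  refine ⟨fun z hz => ?_, fun a ha => ?_⟩
  · rw [analyticOrderAt_neg_four_mul_sin_sq, Multiset.count_sum']
    simp only [Multiset.count_replicate]
    split_ifs with h
    · obtain ⟨k, hk⟩ := Complex.sin_eq_zero_iff.1 h
      have hks : k ∈ s := (hs k).2 (hk ▸ hz)
      rw [Finset.sum_eq_single_of_mem k hks, if_pos hk.symm]
      · rfl
      · intro j _ hjk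
        rw [if_neg]
        rw [hk]
        intro h
        exact hjk (by exact_mod_cast mul_right_cancel₀ hπ h)
    · rw [Finset.sum_eq_zero]
      · rfl
      · intro k _
        rw [if_neg]
        rintro rfl
        exact h (Complex.sin_int_mul_pi k)
  · rw [Multiset.mem_sum] at ha
    obtain ⟨k, hk, hak⟩ := ha
    rw [Multiset.eq_of_mem_replicate hak]
    exact (hs k).1 hk

lemma card_sum_replicate (s : Finset ℤ) :
    Multiset.card (∑ k ∈ s, Multiset.replicate 2 ((k : ℂ) * (Real.pi : ℂ))) = 2 * s.card := by
  rw [Multiset.card_sum]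
  simp [mul_comm]

/-- The zeros of `Δ² - 4` in a large disk about a common center and radius are as many as the zeros of
`sin²`, provided that the boundary keeps the distance `π / 4` from the latter. -/
lemma card_eq_of_isZeros {φ : Potential} {R : ℝ} (hR : ∀ z : ℂ, R ≤ ‖z‖ →
    (∀ k : ℤ, Real.pi / 4 ≤ ‖z - k * (Real.pi : ℂ)‖) →
      ‖charFun φ z / (-4 * Complex.sin z ^ 2) - 1‖ ≤ 1 / 2) {c : ℂ} {r : ℝ} (hr : 0 < r)
    (hcr : ∀ z ∈ Metric.sphere c r, R ≤ ‖z‖ ∧ ∀ k : ℤ, Real.pi / 4 ≤ ‖z - k * (Real.pi : ℂ)‖)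
    {A : Multiset ℂ} (hA : IsZeros (charFun φ) (Metric.closedBall c r) A) {s : Finset ℤ}
    (hs : ∀ k : ℤ, k ∈ s ↔ (k : ℂ) * Real.pi ∈ Metric.closedBall c r) :
    Multiset.card A = 2 * s.card := by
  rw [← card_sum_replicate]
  have hπ := Real.pi_pos
  refine hA.card_eq hr (differentiable_charFun φ) differentiable_neg_four_mul_sin_sq
    (fun z hz h0 => ?_) (fun z hz => ?_) (isZeros_sin_sq hs)
  · have h1 : Complex.sin z = 0 := by simpa using h0
    obtain ⟨k, hk⟩ := Complex.sin_eq_zero_iff.1 h1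
    have := (hcr z hz).2 k
    rw [hk, sub_self, norm_zero] at this
    linarith
  · exact (hR z (hcr z hz).1 (hcr z hz).2).trans_lt (by norm_num)

end ZS

namespace ZS

/-! ### Existence of a listing -/

lemma lexLE_iff_toLex {a b : ℂ} : LexLE a b ↔ toLex (a.re, a.im) ≤ toLex (b.re, b.im) := by
  rw [Prod.Lex.toLex_le_toLex]
  rfl

lemma exists_lexLE_minimal {s : Finset ℂ} (hs : s.Nonempty) : ∃ a ∈ s, ∀ b ∈ s, LexLE a b := by
  obtain ⟨a, ha, h⟩ := s.exists_min_image (fun z => toLex (z.re, z.im)) hs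
  exact ⟨a, ha, fun b hb => lexLE_iff_toLex.2 (h b hb)⟩

lemma LexLE.refl (a : ℂ) : LexLE a a := Or.inr ⟨rfl, le_rfl⟩

/-- If all multiplicities are at most two, then the number of simple elements has the parity of the
cardinality. In particular a simple element is not the only one. -/
lemma exists_ne_count_eq_one {A : Multiset ℂ} {n : ℕ} (hA : Multiset.card A = 2 * n)
    (h2 : ∀ z, A.count z ≤ 2) {a : ℂ} (ha : A.count a = 1) : ∃ b, b ≠ a ∧ A.count b = 1 := by
  by_contra! hcon
  have hmem : a ∈ A := Multiset.count_pos.1 (by omega)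
  have hcount : ∀ z ∈ (A.erase a).toFinset, 2 ∣ (A.erase a).count z := fun z hz => by
    have hz' : 0 < (A.erase a).count z := Multiset.count_pos.2 (Multiset.mem_toFinset.1 hz)
    have hza : z ≠ a := by
      rintro rfl
      rw [Multiset.count_erase_self] at hz'
      omega
    rw [Multiset.count_erase_of_ne hza] at hz' ⊢
    have := hcon z hza
    have := h2 z
    have h : A.count z = 2 := by omega
    rw [h]
  have h3 := Finset.dvd_sum hcount
  rw [Multiset.toFinset_sum_count_eq, Multiset.card_erase_of_mem hmem, hA, Nat.pred_eq_sub_one] at h3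
  have : 0 < 2 * n := by rw [← hA]; exact Multiset.card_pos_iff_exists_mem.2 ⟨a, hmem⟩
  omega

/-- The pairing of eigenvalues in the inner disk. -/
lemma exists_pairing (n : ℕ) : ∀ A : Multiset ℂ, Multiset.card A = 2 * n → (∀ z, A.count z ≤ 2) →
    ∃ a b : ℕ → ℂ, A = ∑ i ∈ Finset.range n, {a i, b i} ∧ (∀ i < n, LexLE (a i) (b i)) ∧
      (∀ i j, i ≤ j → j < n → LexLE (a i) (a j) ∧ LexLE (a i) (b j)) ∧
      (∀ i < n, A.count (a i) = 2 → b i = a i) ∧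
      (∀ i < n, A.count (a i) = 1 → A.count (b i) = 1) ∧
      ∀ i j, i < j → j < n → A.count (a i) = 1 →
        (A.count (a j) = 1 → LexLE (b i) (a j)) ∧ (A.count (b j) = 1 → LexLE (b i) (b j)) := by
  induction n with
  | zero =>
    intro A hA _
    have : A = 0 := Multiset.card_eq_zero.1 (by simpa using hA)
    exact ⟨0, 0, by simpa using this, by simp, by simp, by simp, by simp, by simp⟩
  | succ n ih =>
    intro A hA h2
    have hne : A.toFinset.Nonempty := by
      rw [Multiset.toFinset_nonempty]
      rintro rfl
      simp at hA
    obtain ⟨a₀, ha₀, hmin⟩ := exists_lexLE_minimal hne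
    rw [Multiset.mem_toFinset] at ha₀
    have hpos : 0 < A.count a₀ := Multiset.count_pos.2 ha₀
    -- `a₀` is the smallest element; its partner `b₀` is `a₀` itself if it is double, and else the
    -- smallest of the other simple elements, which exist by parity
    obtain ⟨b₀, A', hAA', hb2, hb1, hcount⟩ : ∃ b₀ A', A = a₀ ::ₘ b₀ ::ₘ A' ∧
        (A.count a₀ = 2 → b₀ = a₀) ∧
        (A.count a₀ = 1 → A.count b₀ = 1 ∧ ∀ z, A.count z = 1 → z ≠ a₀ → LexLE b₀ z) ∧
        ∀ z ∈ A', A'.count z = A.count z ∧ z ≠ a₀ := by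
      have hcase : A.count a₀ = 2 ∨ A.count a₀ = 1 := by have := h2 a₀; omega
      have hcons : A = a₀ ::ₘ A.erase a₀ := (Multiset.cons_erase ha₀).symm
      rcases hcase with h | h
      · have hmem : a₀ ∈ A.erase a₀ := by
          rw [← Multiset.count_pos, Multiset.count_erase_self]; omega
        refine ⟨a₀, (A.erase a₀).erase a₀, ?_, fun _ => rfl, fun h' => by omega, fun z hz => ?_⟩
        · rw [Multiset.cons_erase hmem]; exact hcons
        · have hza : z ≠ a₀ := by
            rintro rfl
            rw [← Multiset.count_pos, Multiset.count_erase_self, Multiset.count_erase_self] at hz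
            omega
          rw [Multiset.count_erase_of_ne hza, Multiset.count_erase_of_ne hza]
          exact ⟨rfl, hza⟩
      · obtain ⟨c, hca, hc⟩ := exists_ne_count_eq_one hA h2 h
        have hs : (A.toFinset.filter fun z => A.count z = 1 ∧ z ≠ a₀).Nonempty :=
          ⟨c, by
            rw [Finset.mem_filter, Multiset.mem_toFinset, ← Multiset.count_pos]
            exact ⟨by omega, hc, hca⟩⟩
        obtain ⟨b₀, hb₀, hbmin⟩ := exists_lexLE_minimal hs
        simp only [Finset.mem_filter, Multiset.mem_toFinset] at hb₀ hbmin
        have hmem : b₀ ∈ A.erase a₀ := (Multiset.mem_erase_of_ne hb₀.2.2).2 hb₀.1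
        refine ⟨b₀, (A.erase a₀).erase b₀, ?_, fun h' => by omega, fun _ => ⟨hb₀.2.1, fun z hz hza =>
          hbmin z ⟨Multiset.count_pos.1 (by omega), hz, hza⟩⟩, fun z hz => ?_⟩
        · rw [Multiset.cons_erase hmem]; exact hcons
        · have hza : z ≠ a₀ := by
            rintro rfl
            rw [← Multiset.count_pos, Multiset.count_erase_of_ne (Ne.symm hb₀.2.2),
              Multiset.count_erase_self] at hz
            omega
          have hzb : z ≠ b₀ := by
            rintro rfl
            rw [← Multiset.count_pos, Multiset.count_erase_self, Multiset.count_erase_of_ne hza] at hz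
            omega
          rw [Multiset.count_erase_of_ne hzb, Multiset.count_erase_of_ne hza]
          exact ⟨rfl, hza⟩
    have hcard : Multiset.card A' = 2 * n := by
      rw [hAA', Multiset.card_cons, Multiset.card_cons] at hA
      omega
    have hsub : ∀ z ∈ A', z ∈ A := fun z hz => by
      rw [hAA']
      exact Multiset.mem_cons_of_mem (Multiset.mem_cons_of_mem hz)
    -- the remaining elements are paired by the induction hypothesis
    obtain ⟨a, b, hab, h3, h4, h5, h6, h7⟩ := ih A' hcard fun z => by
      by_cases hz : z ∈ A'
      · rw [(hcount z hz).1]; exact h2 z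
      · rw [Multiset.count_eq_zero_of_notMem hz]; exact Nat.zero_le _
    have hmemab : ∀ i < n, a i ∈ A' ∧ b i ∈ A' := fun i hi => by
      rw [hab]
      simp only [Multiset.mem_sum]
      exact ⟨⟨i, Finset.mem_range.2 hi, by simp⟩, ⟨i, Finset.mem_range.2 hi, by simp⟩⟩
    have hmin' : ∀ z ∈ A, LexLE a₀ z := fun z hz => hmin z (Multiset.mem_toFinset.2 hz)
    have hb₀A : b₀ ∈ A := by rw [hAA']; simp
    have hca : ∀ i < n, A.count (a i) = A'.count (a i) := fun i hi =>
      (hcount _ (hmemab i hi).1).1.symm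
    have hcb : ∀ i < n, A.count (b i) = A'.count (b i) := fun i hi =>
      (hcount _ (hmemab i hi).2).1.symm
    refine ⟨fun i => Nat.casesOn i a₀ a, fun i => Nat.casesOn i b₀ b, ?_, ?_, ?_, ?_, ?_, ?_⟩
    · rw [Finset.sum_range_succ', ← hab, hAA', add_comm]
      change a₀ ::ₘ b₀ ::ₘ A' = {a₀, b₀} + A'
      simp [Multiset.insert_eq_cons]
    · rintro (_ | i) hi
      · exact hmin' b₀ hb₀A
      · exact h3 i (by omega)
    · rintro (_ | i) (_ | j) hij hj
      · exact ⟨LexLE.refl _, hmin' b₀ hb₀A⟩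
      · exact ⟨hmin' _ (hsub _ (hmemab j (by omega)).1), hmin' _ (hsub _ (hmemab j (by omega)).2)⟩
      · omega
      · exact h4 i j (by omega) (by omega)
    · rintro (_ | i) hi h
      · exact hb2 h
      · exact h5 i (by omega) (by rw [← hca i (by omega)]; exact h)
    · rintro (_ | i) hi h
      · exact (hb1 h).1
      · have := h6 i (by omega) (by rw [← hca i (by omega)]; exact h)
        rw [← hcb i (by omega)] at this
        exact this
    · rintro (_ | i) (_ | j) hij hj h
      · omega
      · exact ⟨fun h' => (hb1 h).2 _ h' (hcount _ (hmemab j (by omega)).1).2,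
          fun h' => (hb1 h).2 _ h' (hcount _ (hmemab j (by omega)).2).2⟩
      · omega
      · have := h7 i j (by omega) (by omega) (by rw [← hca i (by omega)]; exact h)
        rw [← hca j (by omega), ← hcb j (by omega)] at this
        exact this

/-- The location of the periodic eigenvalues. -/
lemma exists_localization (φ : Potential) : ∃ N₁ : ℕ, 1 ≤ N₁ ∧
    (∀ N : ℕ, N₁ ≤ N → ∀ A, IsZeros (charFun φ) (Metric.closedBall 0 (N * Real.pi + Real.pi / 4)) A →
      Multiset.card A = 2 * (2 * N + 1)) ∧
    (∀ k : ℤ, (N₁ : ℤ) < |k| → ∀ A,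
      IsZeros (charFun φ) (Metric.closedBall (k * (Real.pi : ℂ)) (Real.pi / 4)) A →
      Multiset.card A = 2) ∧
    ∀ z, (N₁ * Real.pi ≤ ‖z‖) → (∀ k : ℤ, Real.pi / 4 ≤ ‖z - k * (Real.pi : ℂ)‖) →
      ‖charFun φ z / (-4 * Complex.sin z ^ 2) - 1‖ ≤ 1 / 2 := by
  have hπ := Real.pi_pos
  obtain ⟨R, hR⟩ := exists_norm_ratio_sub_one_le φ (ε := 1 / 2) (by norm_num)
  obtain ⟨N₁, hN₁⟩ := exists_nat_gt (max 1 (R / Real.pi))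
  have hN1 : 1 ≤ N₁ := by
    have := (le_max_left _ _).trans_lt hN₁
    exact_mod_cast this.le
  have hN2 : R ≤ N₁ * Real.pi := by
    have := (le_max_right _ _).trans_lt hN₁
    rw [div_lt_iff₀ hπ] at this
    exact this.le
  have hnk : ∀ k : ℤ, ‖(k : ℂ) * (Real.pi : ℂ)‖ = |(k : ℝ)| * Real.pi := fun k => by
    rw [norm_mul, Complex.norm_intCast, Complex.norm_real, Real.norm_of_nonneg hπ.le]
  refine ⟨N₁, hN1, fun N hN A hA => ?_, fun k hk A hA => ?_, fun z hz hk => hR z (hN2.trans hz) hk⟩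
  · have hNN : (N₁ : ℝ) ≤ N := by exact_mod_cast hN
    rw [card_eq_of_isZeros hR (by positivity) (fun z hz => ?_) hA
      (s := Finset.Icc (-(N : ℤ)) N) (fun k => ?_)]
    · rw [Int.card_Icc]
      congr 1
      omega
    · rw [mem_sphere_zero_iff_norm] at hz
      exact ⟨by nlinarith, pi_div_four_le_norm_sub le_rfl (by linarith) hz⟩
    · rw [Finset.mem_Icc, ← abs_le, mem_closedBall_zero_iff, hnk]
      constructor
      · intro h
        have : |(k : ℝ)| ≤ N := by exact_mod_cast h
        nlinarith
      · intro h
        by_contra! h'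
        have : (N : ℝ) + 1 ≤ |(k : ℝ)| := by exact_mod_cast h'
        nlinarith
  · have hk' : (N₁ : ℝ) + 1 ≤ |(k : ℝ)| := by exact_mod_cast hk
    rw [card_eq_of_isZeros hR (by positivity) (fun z hz => ?_) hA (s := {k}) (fun j => ?_)]
    · simp
    · rw [mem_sphere_iff_norm] at hz
      refine ⟨?_, fun j => ?_⟩
      · have h1 := norm_sub_norm_le ((k : ℂ) * (Real.pi : ℂ)) z
        rw [hnk, norm_sub_rev, hz] at h1
        nlinarith
      · rcases eq_or_ne j k with rfl | h
        · exact hz.ge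
        · exact norm_sub_of_mem_disk le_rfl hz h
    · rw [Finset.mem_singleton, mem_closedBall_iff_norm]
      constructor
      · rintro rfl
        rw [sub_self, norm_zero]; positivity
      · intro h
        by_contra hjk
        linarith [pi_le_norm_sub hjk]

lemma count_sum_pair {ι : Type*} (s : Finset ι) (a b : ι → ℂ) (z : ℂ) :
    (∑ i ∈ s, ({a i, b i} : Multiset ℂ)).count z =
      (s.filter fun i => a i = z).card + (s.filter fun i => b i = z).card := by
  rw [Multiset.count_sum', Finset.card_filter, Finset.card_filter, ← Finset.sum_add_distrib]
  refine Finset.sum_congr rfl fun i _ => ?_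
  rw [Multiset.insert_eq_cons, Multiset.count_cons, Multiset.count_singleton, add_comm]
  simp only [eq_comm]

/-- The inner disk and the outer disks contain as many eigenvalues as for the zero potential, and
these are paired. No eigenvalue lies elsewhere or on the boundary of these disks. -/
theorem nonempty_listing (φ : Potential) (hφ : MultAtMostTwo φ) : Nonempty (Listing φ) := by
  have hπ := Real.pi_pos
  obtain ⟨N, hN1, hinner, houter, hratio⟩ := exists_localization φ
  obtain ⟨w, hw⟩ := exists_charFun_ne_zero φ
  have hd := differentiable_charFun φ
  have hne : ∀ z : ℂ, (N * Real.pi ≤ ‖z‖) → (∀ k : ℤ, Real.pi / 4 ≤ ‖z - k * (Real.pi : ℂ)‖) →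
      charFun φ z ≠ 0 := fun z hz hk h0 => by
    have := hratio z hz hk
    rw [h0, zero_div, zero_sub, norm_neg, norm_one] at this
    norm_num at this
  have hmem0 : ∀ {K : Set ℂ} {A : Multiset ℂ}, IsZeros (charFun φ) K A → ∀ a ∈ A, charFun φ a = 0 := by
    intro K A hA a ha
    refine apply_eq_zero_of_analyticOrderAt_ne_zero ?_
    rw [← hA.1 a (hA.2 a ha)]
    exact_mod_cast (Multiset.count_pos.2 ha).ne'
  have hcount2 : ∀ {K : Set ℂ} {A : Multiset ℂ}, IsZeros (charFun φ) K A → ∀ z, A.count z ≤ 2 := by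
    intro K A hA z
    by_cases hz : z ∈ A
    · have h1 := hA.1 z (hA.2 z hz)
      have h2 := hφ z
      rw [algMult_eq, ← h1] at h2
      exact_mod_cast h2
    · rw [Multiset.count_eq_zero_of_notMem hz]; exact Nat.zero_le _
  -- `a i`, `b i` for `i ≤ 2 N` are the pairs in the inner disk, `p k` is the pair in an outer disk
  obtain ⟨A, hA⟩ := exists_isZeros hd hw
    (isCompact_closedBall (0 : ℂ) (N * Real.pi + Real.pi / 4))
  obtain ⟨a, b, hab, hp1, hp2, hp3, hp4, hp5⟩ := exists_pairing _ A (hinner N le_rfl A hA) (hcount2 hA)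
  have hO : ∀ k : ℤ, ∃ p : ℂ × ℂ, (N : ℤ) < |k| →
      IsZeros (charFun φ) (Metric.closedBall (k * (Real.pi : ℂ)) (Real.pi / 4)) {p.1, p.2} ∧
      LexLE p.1 p.2 := fun k => by
    by_cases hk : (N : ℤ) < |k|
    · obtain ⟨B, hB⟩ := exists_isZeros hd hw
        (isCompact_closedBall ((k : ℂ) * (Real.pi : ℂ)) (Real.pi / 4))
      obtain ⟨p, q, hpq, h1, -⟩ := exists_pairing 1 B (houter k hk B hB) (hcount2 hB)
      refine ⟨(p 0, q 0), fun _ => ⟨?_, h1 0 one_pos⟩⟩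
      rw [Finset.sum_range_one] at hpq
      rw [← hpq]
      exact hB
    · exact ⟨(0, 0), fun h => absurd h hk⟩
  choose p hp using hO
  have hAmem : ∀ i < 2 * N + 1, a i ∈ A ∧ b i ∈ A := fun i hi => by
    rw [hab]
    simp only [Multiset.mem_sum]
    exact ⟨⟨i, Finset.mem_range.2 hi, by simp⟩, ⟨i, Finset.mem_range.2 hi, by simp⟩⟩
  have hAlt : ∀ z ∈ A, ‖z‖ < N * Real.pi + Real.pi / 4 := fun z hz => by
    have h1 := mem_closedBall_zero_iff.1 (hA.2 z hz)
    refine lt_of_le_of_ne h1 fun h2 => ?_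
    exact hne z (by rw [h2]; linarith) (pi_div_four_le_norm_sub le_rfl (by linarith) h2)
      (hmem0 hA z hz)
  have hOlt : ∀ k : ℤ, (N : ℤ) < |k| → ∀ z ∈ ({(p k).1, (p k).2} : Multiset ℂ),
      ‖z - k * (Real.pi : ℂ)‖ < Real.pi / 4 := fun k hk z hz => by
    have hB := (hp k hk).1
    have h1 := mem_closedBall_iff_norm.1 (hB.2 z hz)
    refine lt_of_le_of_ne h1 fun h2 => ?_
    refine hne z ?_ (fun j => ?_) (hmem0 hB z hz)
    · have h3 := norm_sub_norm_le ((k : ℂ) * (Real.pi : ℂ)) z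
      have hk' : (N : ℝ) + 1 ≤ |(k : ℝ)| := by exact_mod_cast hk
      rw [norm_mul, Complex.norm_intCast, Complex.norm_real, Real.norm_of_nonneg hπ.le,
        norm_sub_rev, h2] at h3
      nlinarith
    · rcases eq_or_ne j k with rfl | h
      · exact h2.ge
      · exact norm_sub_of_mem_disk le_rfl h2 h
  -- the disks are disjoint
  have hfar : ∀ k : ℤ, (N : ℤ) < |k| → ∀ z : ℂ, ‖z - k * (Real.pi : ℂ)‖ < Real.pi / 4 →
      N * Real.pi + Real.pi / 4 < ‖z‖ := fun k hk z hz => by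
    have h3 := norm_sub_norm_le ((k : ℂ) * (Real.pi : ℂ)) z
    have hk' : (N : ℝ) + 1 ≤ |(k : ℝ)| := by exact_mod_cast hk
    rw [norm_mul, Complex.norm_intCast, Complex.norm_real, Real.norm_of_nonneg hπ.le,
      norm_sub_rev] at h3
    nlinarith
  have hdisk : ∀ j k : ℤ, ∀ z : ℂ, ‖z - j * (Real.pi : ℂ)‖ < Real.pi / 4 →
      ‖z - k * (Real.pi : ℂ)‖ < Real.pi / 4 → j = k := fun j k z hj hk => by
    by_contra hjk
    have h1 := pi_le_norm_sub hjk
    have h2 := norm_sub_le_norm_sub_add_norm_sub ((j : ℂ) * (Real.pi : ℂ)) z (k * (Real.pi : ℂ))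
    rw [norm_sub_rev _ z] at h2
    linarith
  -- the inner indices `-N, …, N` are numbered by `0, …, 2 N`
  set ix : ℤ → ℕ := fun k => (k + N).toNat with hix
  set lm : ℤ → ℂ := fun k => if |k| ≤ (N : ℤ) then a (ix k) else (p k).1 with hlm
  set lp : ℤ → ℂ := fun k => if |k| ≤ (N : ℤ) then b (ix k) else (p k).2 with hlp
  have hixlt : ∀ k : ℤ, |k| ≤ (N : ℤ) → ix k < 2 * N + 1 := fun k hk => by
    rw [abs_le] at hk; simp only [hix]; omega
  have hlmi : ∀ k : ℤ, |k| ≤ (N : ℤ) → lm k = a (ix k) := fun k hk => if_pos hk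
  have hlpi : ∀ k : ℤ, |k| ≤ (N : ℤ) → lp k = b (ix k) := fun k hk => if_pos hk
  have hlmo : ∀ k : ℤ, (N : ℤ) < |k| → lm k = (p k).1 := fun k hk => if_neg (by omega)
  have hlpo : ∀ k : ℤ, (N : ℤ) < |k| → lp k = (p k).2 := fun k hk => if_neg (by omega)
  have hmultA : ∀ z ∈ A, algMult φ z = A.count z := fun z hz => by
    rw [algMult_eq, hA.1 z (hA.2 z hz)]
  have hin : ∀ k : ℤ, |k| ≤ (N : ℤ) → lm k ∈ A ∧ lp k ∈ A := fun k hk => by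
    rw [hlmi k hk, hlpi k hk]; exact hAmem _ (hixlt k hk)
  have hout : ∀ k : ℤ, (N : ℤ) < |k| → ‖lm k - k * (Real.pi : ℂ)‖ < Real.pi / 4 ∧
      ‖lp k - k * (Real.pi : ℂ)‖ < Real.pi / 4 := fun k hk => by
    rw [hlmo k hk, hlpo k hk]
    exact ⟨hOlt k hk _ (by simp), hOlt k hk _ (by simp)⟩
  have hNe : (N + 1 / 4 : ℝ) * Real.pi = N * Real.pi + Real.pi / 4 := by ring
  have habs : ∀ k : ℤ, -(N : ℤ) ≤ k → k ≤ N → |k| ≤ (N : ℤ) := fun k h1 h2 => abs_le.2 ⟨h1, h2⟩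
  have hmultn : ∀ {z : ℂ} {m : ℕ}, z ∈ A → algMult φ z = m → A.count z = m := fun {z m} hz h => by
    rw [hmultA z hz] at h; exact_mod_cast h
  refine ⟨{ N₀ := N, one_le := hN1, lm := lm, lp := lp, mult := fun z => ?_, outer := hout,
            inner := fun k hk => ?_, pair_le := fun k => ?_, minus_least := fun k j hk hkj hj => ?_,
            double := fun k hk h => ?_, simple := fun k hk h => ?_,
            plus_least := fun k j hk hkj hj h => ?_ }⟩
  · -- a preimage consists of inner indices for `z` in the inner disk, and of at most one index else
    by_cases hz : ‖z‖ ≤ N * Real.pi + Real.pi / 4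
    · have hset : ∀ (l : ℤ → ℂ) (u : ℕ → ℂ), (∀ k : ℤ, |k| ≤ (N : ℤ) → l k = u (ix k)) →
          (∀ k : ℤ, (N : ℤ) < |k| → ‖l k - k * (Real.pi : ℂ)‖ < Real.pi / 4) →
          {k | l k = z}.encard = (((Finset.range (2 * N + 1)).filter fun i => u i = z).card : ℕ∞) := by
        intro l u h1 h2
        have himg : {k | l k = z} = (fun i : ℕ => (i : ℤ) - N) ''
            (((Finset.range (2 * N + 1)).filter fun i => u i = z : Finset ℕ) : Set ℕ) := by
          ext k
          simp only [mem_ofPred_eq, Finset.coe_filter, Finset.mem_range, mem_image]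
          constructor
          · intro hk
            have hkN : |k| ≤ (N : ℤ) := by
              by_contra! hkN
              have := hfar k hkN (l k) (h2 k hkN)
              rw [hk] at this
              linarith
            refine ⟨ix k, ⟨hixlt k hkN, by rw [← h1 k hkN, hk]⟩, ?_⟩
            rw [abs_le] at hkN
            simp only [hix]
            omega
          · rintro ⟨i, ⟨hi, hiz⟩, rfl⟩
            rw [h1 _ (by rw [abs_le]; omega), ← hiz]
            congr 1
            simp only [hix]
            omega
        rw [himg, Function.Injective.encard_image, Set.encard_coe_eq_coe_finsetCard]
        intro i j hij
        simpa using hij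
      rw [hset lm a hlmi fun k hk => (hout k hk).1, hset lp b hlpi fun k hk => (hout k hk).2,
        algMult_eq, ← hA.1 z (mem_closedBall_zero_iff.2 hz), hab, count_sum_pair]
      push_cast
      rfl
    · push Not at hz
      by_cases hk : ∃ k : ℤ, (N : ℤ) < |k| ∧ ‖z - k * (Real.pi : ℂ)‖ < Real.pi / 4
      · obtain ⟨k, hkN, hkz⟩ := hk
        have hset : ∀ l : ℤ → ℂ, (∀ k : ℤ, |k| ≤ (N : ℤ) → l k ∈ A) →
            (∀ k : ℤ, (N : ℤ) < |k| → ‖l k - k * (Real.pi : ℂ)‖ < Real.pi / 4) →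
            {j | l j = z}.encard = ((if z = l k then 1 else 0 : ℕ) : ℕ∞) := by
          intro l h1 h2
          have hsub : ∀ j, l j = z → j = k := fun j hj => by
            rcases le_or_gt |j| (N : ℤ) with hjN | hjN
            · have := hAlt _ (h1 j hjN)
              rw [hj] at this
              linarith
            · exact hdisk j k z (hj ▸ h2 j hjN) hkz
          split_ifs with h
          · have : {j | l j = z} = {k} := by
              ext j
              exact ⟨hsub j, fun hj => by rw [mem_singleton_iff.1 hj]; exact h.symm⟩
            rw [this, encard_singleton]; rfl
          · have : {j | l j = z} = ∅ := by
              ext j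
              simp only [mem_ofPred_eq, mem_empty_iff_false, iff_false]
              intro hj
              exact h (by rw [← hsub j hj, hj])
            rw [this, encard_empty]; rfl
        rw [hset lm (fun k hk => (hin k hk).1) fun k hk => (hout k hk).1,
          hset lp (fun k hk => (hin k hk).2) fun k hk => (hout k hk).2,
          algMult_eq, ← (hp k hkN).1.1 z (mem_closedBall_iff_norm.2 hkz.le), hlmo k hkN, hlpo k hkN,
          Multiset.insert_eq_cons, Multiset.count_cons, Multiset.count_singleton, add_comm]
        push_cast
        rfl
      · push Not at hk
        have h0 : charFun φ z ≠ 0 := by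
          refine hne z (by linarith) fun k => ?_
          rcases le_or_gt |k| (N : ℤ) with hkN | hkN
          · have hk' : |(k : ℝ)| ≤ N := by exact_mod_cast hkN
            have h3 := norm_sub_norm_le z ((k : ℂ) * (Real.pi : ℂ))
            rw [norm_mul, Complex.norm_intCast, Complex.norm_real, Real.norm_of_nonneg hπ.le] at h3
            nlinarith
          · exact hk k hkN
        have hset : ∀ l : ℤ → ℂ, (∀ k : ℤ, |k| ≤ (N : ℤ) → l k ∈ A) →
            (∀ k : ℤ, (N : ℤ) < |k| → ‖l k - k * (Real.pi : ℂ)‖ < Real.pi / 4) →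
            {j | l j = z} = ∅ := by
          intro l h1 h2
          ext j
          simp only [mem_ofPred_eq, mem_empty_iff_false, iff_false]
          intro hj
          rcases le_or_gt |j| (N : ℤ) with hjN | hjN
          · have := hAlt _ (h1 j hjN)
            rw [hj] at this
            linarith
          · have h4 := h2 j hjN
            rw [hj] at h4
            linarith [hk j hjN]
        rw [hset lm (fun k hk => (hin k hk).1) fun k hk => (hout k hk).1,
          hset lp (fun k hk => (hin k hk).2) fun k hk => (hout k hk).2,
          (algMult_eq_zero_iff φ z).2 h0]
        simp
  · rw [hNe]
    exact ⟨hAlt _ (hin k hk).1, hAlt _ (hin k hk).2⟩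
  · rcases le_or_gt |k| (N : ℤ) with hk | hk
    · rw [hlmi k hk, hlpi k hk]; exact hp1 _ (hixlt k hk)
    · rw [hlmo k hk, hlpo k hk]; exact (hp k hk).2
  · have hk' := habs k hk (hkj.trans hj)
    have hj' := habs j (hk.trans hkj) hj
    rw [hlmi k hk', hlmi j hj', hlpi j hj']
    exact hp2 _ _ (by simp only [hix]; omega) (hixlt j hj')
  · have h1 := hmultn (m := 2) (hin k hk).1 h
    rw [hlmi k hk] at h1 ⊢
    rw [hlpi k hk]
    exact hp3 _ (hixlt k hk) h1
  · have h1 := hmultn (m := 1) (hin k hk).1 (by rw [h]; rfl)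
    rw [hmultA _ (hin k hk).2]
    rw [hlmi k hk] at h1
    rw [hlpi k hk, hp4 _ (hixlt k hk) h1]
    rfl
  · have hk' := habs k hk (hkj.le.trans hj)
    have hj' := habs j (hk.trans hkj.le) hj
    have h1 := hmultn (m := 1) (hin k hk').1 (by rw [h]; rfl)
    rw [hlmi k hk'] at h1
    have h2 := hp5 _ _ (by simp only [hix]; omega : ix k < ix j) (hixlt j hj') h1
    rw [hlpi k hk']
    refine ⟨fun h3 => ?_, fun h3 => ?_⟩
    · have h4 := hmultn (m := 1) (hin j hj').1 (by rw [h3]; rfl)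
      rw [hlmi j hj'] at h4 ⊢
      exact h2.1 h4
    · have h4 := hmultn (m := 1) (hin j hj').2 (by rw [h3]; rfl)
      rw [hlpi j hj'] at h4 ⊢
      exact h2.2 h4

end ZS

namespace ZS

/-! ### Comparison of holomorphic functions inside and outside a circle -/

/-- Cauchy's formula of a function holomorphic outside the circle and zero at infinity, evaluated at
a point inside: the circle is moved to infinity. -/
lemma circleIntegral_exterior_eq_zero {v : ℂ → ℂ} {R₀ R : ℝ} (hR₀ : 0 < R) (hR : R₀ < R)
    (hv : ∀ z, R₀ < ‖z‖ → DifferentiableAt ℂ v z)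
    (hvO : v =O[Bornology.cobounded ℂ] fun z => z⁻¹) {w : ℂ} (hw : ‖w‖ < R) :
    (∮ z in C(0, R), (z - w)⁻¹ • v z) = 0 := by
  obtain ⟨C, hC⟩ := hvO.bound
  obtain ⟨r, hr⟩ : ∃ r, ∀ z : ℂ, r ≤ ‖z‖ → ‖v z‖ ≤ C * ‖z⁻¹‖ := by
    obtain ⟨r, -, hr⟩ := (hasBasis_cobounded_norm (E := ℂ)).eventually_iff.1 hC
    exact ⟨r, fun z hz => hr hz⟩
  have hne : ∀ z : ℂ, R ≤ ‖z‖ → z - w ≠ 0 := fun z hz h => by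
    rw [sub_eq_zero] at h; rw [← h] at hw; linarith
  have hd : ∀ z : ℂ, R ≤ ‖z‖ → DifferentiableAt ℂ (fun z => (z - w)⁻¹ • v z) z := fun z hz =>
    ((differentiableAt_id.sub_const w).inv (hne z hz)).smul (hv z (hR.trans_le hz))
  have hlim : Tendsto (fun ρ : ℝ => 2 * Real.pi * C * (ρ - ‖w‖)⁻¹) atTop (𝓝 0) := by
    have h1 : Tendsto (fun ρ : ℝ => ρ - ‖w‖) atTop atTop := tendsto_atTop_add_const_right _ _ tendsto_id
    simpa using (tendsto_inv_atTop_zero.comp h1).const_mul (2 * Real.pi * C)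
  refine norm_le_zero_iff.1 (ge_of_tendsto hlim ?_)
  filter_upwards [eventually_ge_atTop (max R r)] with ρ hρ
  have hρR : R ≤ ρ := (le_max_left _ _).trans hρ
  have hρ0 : 0 < ρ := hR₀.trans_le hρR
  have heq := Complex.circleIntegral_eq_of_differentiable_on_annulus_off_countable (c := (0 : ℂ))
    hR₀ hρR countable_empty (f := fun z => (z - w)⁻¹ • v z) (fun z hz => ?_) (fun z hz => ?_)
  · rw [← heq]
    have hle := circleIntegral.norm_integral_le_of_norm_le_const (c := (0 : ℂ)) hρ0.le
      (f := fun z => (z - w)⁻¹ • v z) (C := (ρ - ‖w‖)⁻¹ * (C * ρ⁻¹)) fun z hz => ?_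
    · refine hle.trans (le_of_eq ?_)
      field_simp
    · rw [mem_sphere_zero_iff_norm] at hz
      rw [norm_smul, norm_inv]
      have h1 : ρ - ‖w‖ ≤ ‖z - w‖ := by rw [← hz]; exact norm_sub_norm_le z w
      have h2 := hr z (by rw [hz]; exact (le_max_right _ _).trans hρ)
      rw [norm_inv, hz] at h2
      exact mul_le_mul (inv_anti₀ (by linarith) h1) h2 (norm_nonneg _)
        (inv_nonneg.2 (by linarith))
  · have hz' : R ≤ ‖z‖ := by
      have := hz.2
      rw [mem_ball_zero_iff, not_lt] at this
      exact this
    exact (hd z hz').continuousAt.continuousWithinAt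
  · have hz' : R < ‖z‖ := by
      have := hz.1.2
      rw [mem_closedBall_zero_iff, not_le] at this
      exact this
    exact hd z hz'.le

/-- A holomorphic function without zeros on a disk has a logarithm. -/
lemma exists_exp_eq_of_ball {T : ℂ → ℂ} {c : ℂ} {R : ℝ} (hT : DifferentiableOn ℂ T (Metric.ball c R))
    (hT0 : ∀ z ∈ Metric.ball c R, T z ≠ 0) :
    ∃ u : ℂ → ℂ, DifferentiableOn ℂ u (Metric.ball c R) ∧
      ∀ z ∈ Metric.ball c R, T z = Complex.exp (u z) := by
  rcases le_or_gt R 0 with hR | hR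
  · rw [Metric.ball_eq_empty.2 hR]
    exact ⟨0, differentiableOn_empty, fun z hz => hz.elim⟩
  have hc : c ∈ Metric.ball c R := Metric.mem_ball_self hR
  have hTd : ∀ z ∈ Metric.ball c R, HasDerivAt T (deriv T z) z := fun z hz =>
    (hT.differentiableAt (Metric.isOpen_ball.mem_nhds hz)).hasDerivAt
  obtain ⟨g, hgc, hg⟩ := ((hT.deriv Metric.isOpen_ball).div hT hT0).isExactOn_ball.with_val_at c
    (Complex.log (T c))
  refine ⟨g, fun z hz => (hg z hz).differentiableAt.differentiableWithinAt, fun z hz => ?_⟩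
  have hF : ∀ z ∈ Metric.ball c R, HasDerivAt (fun z => T z * Complex.exp (-g z)) 0 z :=
    fun z hz => by
      convert! (hTd z hz).mul (hg z hz).neg.cexp using 1
      have := hT0 z hz
      simp only [Pi.div_apply]
      field_simp
      ring
  have hconst := (convex_ball c R).is_const_of_fderivWithin_eq_zero (𝕜 := ℂ)
    (f := fun z => T z * Complex.exp (-g z))
    (fun z hz => (hF z hz).differentiableAt.differentiableWithinAt)
    (fun z hz => by
      rw [fderivWithin_of_isOpen Metric.isOpen_ball hz]
      have := (hF z hz).hasFDerivAt.fderiv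
      rw [this]
      ext
      simp) hz hc
  have h1 : T c * Complex.exp (-g c) = 1 := by
    rw [hgc, Complex.exp_neg, Complex.exp_log (hT0 c hc), mul_inv_cancel₀ (hT0 c hc)]
  simp only [h1] at hconst
  rw [Complex.exp_neg] at hconst
  field_simp at hconst
  exact hconst

/-- Let `T = exp u` be holomorphic in a disk and `exp v` outside a smaller disk, with `v = 0` at infinity. If
both are close to each other on a circle, then `T` is close to `1` inside. Indeed, Cauchy's formula for
`u` over this circle does not see `v`. -/
lemma norm_sub_one_le_of_circle {T v : ℂ → ℂ} {R₀ R R₁ ε : ℝ} (hR : 0 < R) (hR₀ : R₀ < R)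
    (hR₁ : R < R₁) (hT : DifferentiableOn ℂ T (Metric.ball 0 R₁))
    (hT0 : ∀ z ∈ Metric.ball (0 : ℂ) R₁, T z ≠ 0)
    (hv : ∀ z, R₀ < ‖z‖ → DifferentiableAt ℂ v z)
    (hvO : v =O[Bornology.cobounded ℂ] fun z => z⁻¹) (hε : ε ≤ 1 / 3)
    (hTv : ∀ z ∈ Metric.sphere (0 : ℂ) R, ‖T z * Complex.exp (-v z) - 1‖ ≤ ε) {w : ℂ}
    (hw : ‖w‖ ≤ R / 2) : ‖T w - 1‖ ≤ 6 * ε := by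
  obtain ⟨u, hu, hTu⟩ := exists_exp_eq_of_ball hT hT0
  have hsub : Metric.closedBall (0 : ℂ) R ⊆ Metric.ball 0 R₁ := Metric.closedBall_subset_ball hR₁
  have hss : Metric.sphere (0 : ℂ) R ⊆ Metric.closedBall 0 R := Metric.sphere_subset_closedBall
  have hvc : ContinuousOn v (Metric.sphere 0 R) := fun z hz =>
    (hv z (by rw [mem_sphere_zero_iff_norm.1 hz]; exact hR₀)).continuousAt.continuousWithinAt
  have huc : ContinuousOn u (Metric.sphere 0 R) := hu.continuousOn.mono (hss.trans hsub)
  set h : ℂ → ℂ := fun z => Complex.exp (u z - v z) with hh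
  have hhe : ∀ z ∈ Metric.sphere (0 : ℂ) R, ‖h z - 1‖ ≤ ε := fun z hz => by
    have := hTv z hz
    rw [hTu z (hsub (hss hz)), ← Complex.exp_add, ← sub_eq_add_neg] at this
    exact this
  have hslit : ∀ z ∈ Metric.sphere (0 : ℂ) R, h z ∈ Complex.slitPlane := fun z hz => by
    have := Complex.mem_slitPlane_of_norm_lt_one ((hhe z hz).trans_lt (by linarith : ε < 1))
    simpa using this
  have hlog : ∀ z ∈ Metric.sphere (0 : ℂ) R, ‖Complex.log (h z)‖ ≤ 3 / 2 * ε := fun z hz => by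
    have h1 := Complex.norm_log_one_add_half_le_self ((hhe z hz).trans (by linarith : ε ≤ 1 / 2))
    rw [add_sub_cancel] at h1
    exact h1.trans (mul_le_mul_of_nonneg_left (hhe z hz) (by norm_num))
  have hlogc : ContinuousOn (fun z => Complex.log (h z)) (Metric.sphere 0 R) :=
    ContinuousOn.clog (huc.sub hvc).cexp hslit
  -- the logarithm of `h` differs from `u - v` by a constant
  obtain ⟨n, hn⟩ : ∃ n : ℤ, ∀ z ∈ Metric.sphere (0 : ℂ) R,
      u z - v z = Complex.log (h z) + n * (2 * Real.pi * Complex.I) := by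
    have h1 : ∀ z ∈ Metric.sphere (0 : ℂ) R, ∃ n : ℤ,
        u z - v z = Complex.log (h z) + n * (2 * Real.pi * Complex.I) := fun z _ =>
      Complex.exp_eq_exp_iff_exists_int.1 (by rw [Complex.exp_log (Complex.exp_ne_zero _)])
    choose! k hk using h1
    have hkc : ContinuousOn (fun z => (k z : ℂ)) (Metric.sphere 0 R) := by
      have h2 : ContinuousOn (fun z => (u z - v z - Complex.log (h z)) / (2 * Real.pi * Complex.I))
        (Metric.sphere 0 R) := ((huc.sub hvc).sub hlogc).div_const _
      refine h2.congr fun z hz => ?_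
      simp only
      rw [hk z hz, add_sub_cancel_left, mul_div_cancel_right₀ _ Complex.two_pi_I_ne_zero]
    have hkc' : ContinuousOn k (Metric.sphere 0 R) := by
      have h3 := Int.isClosedEmbedding_coe_real.isEmbedding.isInducing
      rw [h3.continuousOn_iff]
      exact (Complex.continuous_re.comp_continuousOn hkc).congr fun z _ => by simp
    have hpre : IsPreconnected (Metric.sphere (0 : ℂ) R) :=
      isPreconnected_sphere (by rw [Complex.rank_real_complex]; exact Cardinal.one_lt_two) 0 R
    have h0 : (R : ℂ) ∈ Metric.sphere (0 : ℂ) R := by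
      rw [mem_sphere_zero_iff_norm, Complex.norm_real, Real.norm_of_nonneg hR.le]
    refine ⟨k R, fun z hz => ?_⟩
    rw [hk z hz, hpre.constant hkc' hz h0]
  set κ : ℂ := n * (2 * Real.pi * Complex.I) with hκ
  have hwb : w ∈ Metric.ball (0 : ℂ) R := by rw [mem_ball_zero_iff]; linarith
  have hcau := Complex.two_pi_I_inv_smul_circleIntegral_sub_inv_smul_of_differentiable_on_off_countable
    countable_empty hwb (f := fun z => u z - κ) ((hu.continuousOn.mono hsub).sub continuousOn_const)
    (fun z hz => (hu.differentiableAt (Metric.isOpen_ball.mem_nhds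
      (hsub (Metric.ball_subset_closedBall hz.1)))).sub_const κ)
  have hext := circleIntegral_exterior_eq_zero hR hR₀ hv hvO (mem_ball_zero_iff.1 hwb)
  have hne : ∀ z ∈ Metric.sphere (0 : ℂ) R, z - w ≠ 0 := fun z hz h0 => by
    rw [sub_eq_zero] at h0
    rw [mem_sphere_zero_iff_norm, h0] at hz
    linarith
  have hinv : ContinuousOn (fun z : ℂ => (z - w)⁻¹) (Metric.sphere 0 R) :=
    ContinuousOn.inv₀ (by fun_prop) hne
  -- Cauchy's formula for `u - κ`: on the circle it is `log h + v`, and `v` does not contribute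
  have hint : (∮ z in C(0, R), (z - w)⁻¹ • (u z - κ)) =
      ∮ z in C(0, R), (z - w)⁻¹ • Complex.log (h z) := by
    have i1 : CircleIntegrable (fun z => (z - w)⁻¹ • (u z - κ)) 0 R :=
      (hinv.smul (huc.sub continuousOn_const)).circleIntegrable hR.le
    have i2 : CircleIntegrable (fun z => (z - w)⁻¹ • v z) 0 R :=
      (hinv.smul hvc).circleIntegrable hR.le
    have hs := circleIntegral.integral_sub i1 i2
    rw [hext, sub_zero] at hs
    rw [← hs]
    refine circleIntegral.integral_congr hR.le fun z hz => ?_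
    rw [← smul_sub]
    congr 1
    linear_combination hn z hz
  have hε0 : 0 ≤ ε := by
    have h0 : (R : ℂ) ∈ Metric.sphere (0 : ℂ) R := by
      rw [mem_sphere_zero_iff_norm, Complex.norm_real, Real.norm_of_nonneg hR.le]
    exact (norm_nonneg _).trans (hhe _ h0)
  have hbound : ‖u w - κ‖ ≤ 3 * ε := by
    rw [← hcau, hint]
    refine (circleIntegral.norm_two_pi_i_inv_smul_integral_le_of_norm_le_const hR.le
      (C := (R / 2)⁻¹ * (3 / 2 * ε)) fun z hz => ?_).trans (le_of_eq (by field_simp))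
    rw [norm_smul, norm_inv]
    have h1 : R / 2 ≤ ‖z - w‖ := by
      have h2 := norm_sub_norm_le z w
      rw [mem_sphere_zero_iff_norm.1 hz] at h2
      linarith
    exact mul_le_mul (inv_anti₀ (by linarith) h1) (hlog z hz) (norm_nonneg _) (by positivity)
  have hexp : Complex.exp (u w - κ) = T w := by
    rw [hκ, Complex.exp_sub, Complex.exp_int_mul_two_pi_mul_I, div_one,
      ← hTu w (hsub (Metric.ball_subset_closedBall hwb))]
  rw [← hexp]
  have := Complex.norm_exp_sub_one_le (hbound.trans (by linarith))
  linarith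

end ZS

namespace ZS

/-! ### Comparison of the listed eigenvalues with the zeros of the sine -/

namespace Listing

variable {φ : Potential} (E : Listing φ)

lemma norm_le {N : ℕ} (hN : E.N₀ ≤ N) {k : ℤ} (hk : |k| ≤ (N : ℤ)) :
    ‖E.lm k‖ ≤ N * Real.pi + Real.pi / 4 ∧ ‖E.lp k‖ ≤ N * Real.pi + Real.pi / 4 := by
  have hπ := Real.pi_pos
  have hNN : (E.N₀ : ℝ) ≤ N := by exact_mod_cast hN
  rcases le_or_gt |k| (E.N₀ : ℤ) with h | h
  · have h1 := E.inner k h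
    constructor <;> nlinarith [h1.1, h1.2]
  · have h1 := E.outer k h
    have hk' : |(k : ℝ)| ≤ N := by exact_mod_cast hk
    have h2 : ∀ w : ℂ, ‖w - k * (Real.pi : ℂ)‖ < Real.pi / 4 → ‖w‖ ≤ N * Real.pi + Real.pi / 4 :=
      fun w hw => by
        have h3 := norm_sub_norm_le w ((k : ℂ) * (Real.pi : ℂ))
        rw [norm_mul, Complex.norm_intCast, Complex.norm_real, Real.norm_of_nonneg hπ.le] at h3
        nlinarith
    exact ⟨h2 _ h1.1, h2 _ h1.2⟩

lemma lt_norm {N : ℕ} (hN : E.N₀ ≤ N) {k : ℤ} (hk : (N : ℤ) < |k|) :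
    N * Real.pi + 3 * Real.pi / 4 < ‖E.lm k‖ ∧ N * Real.pi + 3 * Real.pi / 4 < ‖E.lp k‖ := by
  have hπ := Real.pi_pos
  have h1 := E.outer k (lt_of_le_of_lt (by exact_mod_cast hN) hk)
  have hk' : (N : ℝ) + 1 ≤ |(k : ℝ)| := by exact_mod_cast hk
  have h2 : ∀ w : ℂ, ‖w - k * (Real.pi : ℂ)‖ < Real.pi / 4 → N * Real.pi + 3 * Real.pi / 4 < ‖w‖ :=
    fun w hw => by
      have h3 := norm_sub_norm_le ((k : ℂ) * (Real.pi : ℂ)) w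
      rw [norm_mul, Complex.norm_intCast, Complex.norm_real, Real.norm_of_nonneg hπ.le,
        norm_sub_rev] at h3
      nlinarith
  exact ⟨h2 _ h1.1, h2 _ h1.2⟩

lemma isZeros {N : ℕ} (hN : E.N₀ ≤ N) {r : ℝ} (hr : Real.pi / 4 ≤ r) (hr' : r ≤ 3 * Real.pi / 4) :
    IsZeros (charFun φ) (Metric.closedBall 0 (N * Real.pi + r))
      (∑ k ∈ Finset.Icc (-(N : ℤ)) N, {E.lm k, E.lp k}) := by
  refine ⟨fun z hz => ?_, fun a ha => ?_⟩
  · rw [mem_closedBall_zero_iff] at hz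
    have hset : ∀ l : ℤ → ℂ, (∀ k : ℤ, (N : ℤ) < |k| → N * Real.pi + 3 * Real.pi / 4 < ‖l k‖) →
        {k | l k = z}.encard =
          (((Finset.Icc (-(N : ℤ)) N).filter fun k => l k = z).card : ℕ∞) := by
      intro l hl
      rw [← Set.encard_coe_eq_coe_finsetCard]
      congr 1
      ext k
      simp only [mem_ofPred_eq, Finset.coe_filter, Finset.mem_Icc, ← abs_le]
      refine ⟨fun hk => ⟨?_, hk⟩, fun hk => hk.2⟩
      by_contra! hkN
      have := hl k hkN
      rw [hk] at this
      linarith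
    rw [count_sum_pair, ← algMult_eq, ← E.mult z, hset _ fun k hk => (E.lt_norm hN hk).1,
      hset _ fun k hk => (E.lt_norm hN hk).2]
    push_cast
    rfl
  · rw [Multiset.mem_sum] at ha
    obtain ⟨k, hk, ha⟩ := ha
    rw [Finset.mem_Icc, ← abs_le] at hk
    have h1 := E.norm_le hN hk
    rw [mem_closedBall_zero_iff]
    simp only [Multiset.insert_eq_cons, Multiset.mem_cons, Multiset.mem_singleton] at ha
    rcases ha with rfl | rfl
    · linarith [h1.1]
    · linarith [h1.2]

end Listing

lemma rootProd_sum {ι : Type*} (s : Finset ι) (A : ι → Multiset ℂ) (z : ℂ) :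
    rootProd (∑ i ∈ s, A i) z = ∏ i ∈ s, rootProd (A i) z := by
  classical
  induction s using Finset.induction_on with
  | empty => simp [rootProd]
  | insert i s hi ih =>
    rw [Finset.sum_insert hi, Finset.prod_insert hi, ← ih]
    simp [rootProd]

lemma rootProd_pair (a b z : ℂ) : rootProd {a, b} z = (z - a) * (z - b) := by
  simp [rootProd]

/-- A logarithm of `(b - z) / (a - z)` off a convex set containing `a` and `b`. -/
lemma exists_log_div {a b : ℂ} {r : ℝ} (ha : ‖a‖ ≤ r) (hb : ‖b‖ ≤ r) :
    ∃ v : ℂ → ℂ, (∀ z, r < ‖z‖ → DifferentiableAt ℂ v z) ∧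
      (v =O[Bornology.cobounded ℂ] fun z => z⁻¹) ∧
      ∀ z, r < ‖z‖ → Complex.exp (v z) = (b - z) / (a - z) := by
  set G : ℝ → ℂ := fun t => a + t * (b - a) with hG
  have hGc : ContDiffOn ℝ 1 G (Icc 0 1) :=
    (contDiff_const.add (Complex.ofRealCLM.contDiff.mul contDiff_const)).contDiffOn
  have hoff : ∀ z : ℂ, r < ‖z‖ → z ∉ G '' Icc 0 1 := by
    rintro z hz ⟨t, ht, rfl⟩
    have h1 : G t = ((1 - t : ℝ) : ℂ) * a + (t : ℂ) * b := by rw [hG]; push_cast; ring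
    rw [h1] at hz
    have h2 := norm_add_le (((1 - t : ℝ) : ℂ) * a) ((t : ℂ) * b)
    rw [norm_mul, norm_mul, Complex.norm_real, Complex.norm_real, Real.norm_of_nonneg ht.1,
      Real.norm_of_nonneg (by linarith [ht.2] : (0 : ℝ) ≤ 1 - t)] at h2
    nlinarith [ht.1, ht.2, mul_le_mul_of_nonneg_left ha (by linarith [ht.2] : (0 : ℝ) ≤ 1 - t),
      mul_le_mul_of_nonneg_left hb ht.1]
  refine ⟨arcLog G, fun z hz => (hasDerivAt_arcLog hGc (hoff z hz)).differentiableAt,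
    isBigO_arcLog hGc, fun z hz => ?_⟩
  rw [exp_arcLog hGc (hoff z hz)]
  simp [hG]

/-- The function `T` compares the products of linear factors over the listed eigenvalues and over
the zeros of `sin²`. -/
lemma Listing.exists_ratio {φ : Potential} (E : Listing φ) {ε : ℝ} (hε : 0 < ε) (hε' : ε ≤ 1 / 3) :
    ∃ N₂, E.N₀ ≤ N₂ ∧ ∀ N : ℕ, N₂ ≤ N → ∃ T : ℂ → ℂ,
      (∀ w : ℂ, ‖w‖ ≤ (N * Real.pi + Real.pi / 2) / 2 → ‖T w - 1‖ ≤ 6 * ε) ∧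
      ∀ w : ℂ, ‖w‖ ≤ N * Real.pi + Real.pi / 2 →
        charFun φ w * ∏ k ∈ Finset.Icc (-(N : ℤ)) N, (w - k * (Real.pi : ℂ)) ^ 2 =
        -4 * Complex.sin w ^ 2 *
          (∏ k ∈ Finset.Icc (-(N : ℤ)) N, (w - E.lm k) * (w - E.lp k)) * T w := by
  have hπ := Real.pi_pos
  obtain ⟨R, hR⟩ := exists_norm_ratio_sub_one_le φ hε
  obtain ⟨N₂, hN₂⟩ := exists_nat_gt (R / Real.pi)
  rw [div_lt_iff₀ hπ] at hN₂
  refine ⟨max E.N₀ N₂, le_max_left _ _, fun N hN => ?_⟩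
  have hN0 : E.N₀ ≤ N := (le_max_left _ _).trans hN
  have hN2 : (N₂ : ℝ) ≤ N := by exact_mod_cast (le_max_right _ _).trans hN
  set s := Finset.Icc (-(N : ℤ)) N with hs
  set ρ := N * Real.pi + Real.pi / 2 with hρ
  set ρ₁ := N * Real.pi + 5 * Real.pi / 8 with hρ₁
  set ρ₀ := N * Real.pi + Real.pi / 4 with hρ₀
  have hρpos : 0 < ρ := by positivity
  have hnk : ∀ k : ℤ, ‖(k : ℂ) * (Real.pi : ℂ)‖ = |(k : ℝ)| * Real.pi := fun k => by
    rw [norm_mul, Complex.norm_intCast, Complex.norm_real, Real.norm_of_nonneg hπ.le]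
  have hmem : ∀ k : ℤ, k ∈ s ↔ |k| ≤ (N : ℤ) := fun k => by rw [hs, Finset.mem_Icc, abs_le]
  -- the zeros in the disk of radius `ρ₁` are divided out of `Δ² - 4` and of `sin²`
  obtain ⟨g₁, hg₁, hFg, hg₁0⟩ := (E.isZeros hN0 (r := 5 * Real.pi / 8) (by linarith)
    (by linarith)).exists_eq (differentiable_charFun φ)
  obtain ⟨g₂, hg₂, hSg, hg₂0⟩ := (isZeros_sin_sq (K := Metric.closedBall 0 ρ₁) (s := s)
    (fun k => by
      rw [hmem, mem_closedBall_zero_iff, hnk]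
      constructor
      · intro h
        have : |(k : ℝ)| ≤ N := by exact_mod_cast h
        nlinarith
      · intro h
        by_contra! h'
        have : (N : ℝ) + 1 ≤ |(k : ℝ)| := by exact_mod_cast h'
        nlinarith)).exists_eq differentiable_neg_four_mul_sin_sq
  have hA : ∀ z, rootProd (∑ k ∈ s, {E.lm k, E.lp k}) z = ∏ k ∈ s, (z - E.lm k) * (z - E.lp k) :=
    fun z => by
      rw [rootProd_sum]
      exact Finset.prod_congr rfl fun k _ => rootProd_pair _ _ _
  have hB : ∀ z, rootProd (∑ k ∈ s, Multiset.replicate 2 ((k : ℂ) * (Real.pi : ℂ))) z =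
      ∏ k ∈ s, (z - k * (Real.pi : ℂ)) ^ 2 := fun z => by
    rw [rootProd_sum]
    exact Finset.prod_congr rfl fun k _ => by simp [rootProd, sq]
  have hF : ∀ z, charFun φ z = (∏ k ∈ s, (z - E.lm k) * (z - E.lp k)) * g₁ z := fun z => by
    rw [← hA]; exact congrFun hFg z
  have hS : ∀ z : ℂ, -4 * Complex.sin z ^ 2 = (∏ k ∈ s, (z - k * (Real.pi : ℂ)) ^ 2) * g₂ z :=
    fun z => by rw [← hB]; exact congrFun hSg z
  have hid : ∀ w : ℂ, ‖w‖ ≤ ρ₁ →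
      charFun φ w * ∏ k ∈ s, (w - k * (Real.pi : ℂ)) ^ 2 =
        -4 * Complex.sin w ^ 2 * (∏ k ∈ s, (w - E.lm k) * (w - E.lp k)) * (g₁ w / g₂ w) :=
    fun w hw => by
      have := hg₂0 w (mem_closedBall_zero_iff.2 hw)
      rw [hF, hS]
      generalize (∏ k ∈ s, (w - k * (Real.pi : ℂ)) ^ 2) = X
      field_simp
  -- the exterior logarithm
  have hlog : ∀ k : ℤ, ∃ v : ℂ → ℂ, k ∈ s → (∀ z, ρ₀ < ‖z‖ → DifferentiableAt ℂ v z) ∧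
      (v =O[Bornology.cobounded ℂ] fun z => z⁻¹) ∧ ∀ z, ρ₀ < ‖z‖ →
        Complex.exp (v z) = (z - k * (Real.pi : ℂ)) ^ 2 / ((z - E.lm k) * (z - E.lp k)) := fun k => by
    by_cases hk : k ∈ s
    · have hk' := (hmem k).1 hk
      have h1 := E.norm_le hN0 hk'
      have h2 : ‖(k : ℂ) * (Real.pi : ℂ)‖ ≤ ρ₀ := by
        rw [hnk]
        have : |(k : ℝ)| ≤ N := by exact_mod_cast hk'
        nlinarith
      obtain ⟨v₁, hv₁, hv₁O, hv₁e⟩ := exists_log_div h1.1 h2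
      obtain ⟨v₂, hv₂, hv₂O, hv₂e⟩ := exists_log_div h1.2 h2
      refine ⟨fun z => v₁ z + v₂ z, fun _ => ⟨fun z hz => (hv₁ z hz).add (hv₂ z hz),
        hv₁O.add hv₂O, fun z hz => ?_⟩⟩
      rw [Complex.exp_add, hv₁e z hz, hv₂e z hz, ← neg_sub z, ← neg_sub z (E.lm k),
        ← neg_sub z (E.lp k), neg_div_neg_eq, neg_div_neg_eq, div_mul_div_comm, sq]
    · exact ⟨0, fun h => absurd h hk⟩
  choose v hv using hlog
  refine ⟨fun z => g₁ z / g₂ z, fun w hw => ?_, fun w hw => hid w (by linarith)⟩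
  refine norm_sub_one_le_of_circle (T := fun z => g₁ z / g₂ z) (v := fun z => ∑ k ∈ s, v k z) (R₀ := ρ₀) (R₁ := ρ₁) hρpos
    (by linarith) (by linarith) ?_ ?_ ?_ ?_ hε' (fun z hz => ?_) hw
  · exact hg₁.differentiableOn.div hg₂.differentiableOn fun z hz =>
      hg₂0 z (Metric.ball_subset_closedBall hz)
  · exact fun z hz => div_ne_zero (hg₁0 z (Metric.ball_subset_closedBall hz))
      (hg₂0 z (Metric.ball_subset_closedBall hz))
  · exact fun z hz => DifferentiableAt.fun_sum fun k hk => (hv k hk).1 z hz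
  · exact Asymptotics.IsBigO.fun_sum fun k hk => (hv k hk).2.1
  · rw [mem_sphere_zero_iff_norm] at hz
    have hdist := pi_div_four_le_norm_sub (N := N) (r := Real.pi / 2) (by linarith) (by linarith) hz
    have hzR : R ≤ ‖z‖ := by rw [hz]; nlinarith
    have h1 := hR z hzR hdist
    have hz0 : ρ₀ < ‖z‖ := by rw [hz]; linarith
    have hkne : ∏ k ∈ s, (z - k * (Real.pi : ℂ)) ^ 2 ≠ 0 :=
      Finset.prod_ne_zero_iff.2 fun k _ => pow_ne_zero 2 fun h0 => by
        have := hdist k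
        rw [h0, norm_zero] at this
        linarith
    have hsin : -4 * Complex.sin z ^ 2 ≠ 0 := by
      rw [hS]
      exact mul_ne_zero hkne (hg₂0 z (mem_closedBall_zero_iff.2 (by rw [hz]; linarith)))
    have hRne : ∏ k ∈ s, (z - E.lm k) * (z - E.lp k) ≠ 0 :=
      Finset.prod_ne_zero_iff.2 fun k hk => by
        have h2 := E.norm_le hN0 ((hmem k).1 hk)
        refine mul_ne_zero (fun h0 => ?_) fun h0 => ?_ <;> rw [sub_eq_zero] at h0 <;>
          rw [h0] at hz0 <;> linarith [h2.1, h2.2]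
    have he : Complex.exp (∑ k ∈ s, v k z) =
        (∏ k ∈ s, (z - k * (Real.pi : ℂ)) ^ 2) / ∏ k ∈ s, (z - E.lm k) * (z - E.lp k) := by
      rw [Complex.exp_sum, ← Finset.prod_div_distrib]
      exact Finset.prod_congr rfl fun k hk => (hv k hk).2.2 z hz0
    have h2 : g₁ z / g₂ z * Complex.exp (-∑ k ∈ s, v k z) =
        charFun φ z / (-4 * Complex.sin z ^ 2) := by
      rw [Complex.exp_neg, he, inv_div, hF, hS, div_mul_div_comm, mul_comm (g₁ z),
        mul_comm (g₂ z)]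
    rw [h2]
    exact h1

end ZS

namespace ZS

/-! ### Limits of square roots and of bounded holomorphic functions -/

/-- If `v² → 1` and `v (N + 1) / v N → 1`, then `v` stays near one of the square roots `±1`: close
to `1` it cannot jump to `-1`. -/
lemma tendsto_one_or_neg_one {v r : ℕ → ℂ} (hv : Tendsto (fun N => v N ^ 2) atTop (𝓝 1))
    (hr : Tendsto r atTop (𝓝 1)) (hrv : ∀ᶠ N in atTop, v (N + 1) = r N * v N) :
    Tendsto v atTop (𝓝 1) ∨ Tendsto v atTop (𝓝 (-1)) := by
  have hfac : ∀ x : ℂ, ‖x - 1‖ * ‖x + 1‖ = ‖x ^ 2 - 1‖ := fun x => by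
    rw [← norm_mul]; congr 1; ring
  have htri : ∀ x : ℂ, 2 ≤ ‖x - 1‖ + ‖x + 1‖ := fun x => by
    have h := norm_sub_le (x + 1) (x - 1)
    rw [show x + 1 - (x - 1) = 2 by ring, Complex.norm_two] at h
    linarith
  have h0 : Tendsto (fun N => 2 * ‖v N ^ 2 - 1‖) atTop (𝓝 0) := by
    simpa using ((tendsto_iff_norm_sub_tendsto_zero.1 hv).const_mul 2)
  have e1 := (tendsto_iff_norm_sub_tendsto_zero.1 hv).eventually_le_const
    (show (0 : ℝ) < 1 / 4 by norm_num)
  have e2 := (tendsto_iff_norm_sub_tendsto_zero.1 hr).eventually_le_const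
    (show (0 : ℝ) < 1 / 4 by norm_num)
  obtain ⟨N₁, hN₁⟩ := eventually_atTop.1 (e1.and (e2.and hrv))
  by_cases hex : ∃ N, N₁ ≤ N ∧ ‖v N - 1‖ ≤ 1 / 2
  · obtain ⟨N₂, hN₂, hv₂⟩ := hex
    left
    have hall : ∀ N, N₂ ≤ N → ‖v N - 1‖ ≤ 1 / 2 := fun N hN => by
      induction N, hN using Nat.le_induction with
      | base => exact hv₂
      | succ N hN ih =>
        obtain ⟨h1, h2, h3⟩ := hN₁ N (hN₂.trans hN)
        have h4 := hfac (v N)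
        have h5 := htri (v N)
        have h6 : ‖v N - 1‖ ≤ 1 / 6 := by nlinarith [norm_nonneg (v N - 1)]
        have h7 : ‖v (N + 1) - 1‖ ≤ ‖r N - 1‖ * ‖v N‖ + ‖v N - 1‖ := by
          rw [h3, ← norm_mul, show r N * v N - 1 = (r N - 1) * v N + (v N - 1) by ring]
          exact norm_add_le _ _
        have h8 : ‖v N‖ ≤ 1 + ‖v N - 1‖ := by
          have := norm_add_le 1 (v N - 1)
          rwa [add_sub_cancel, norm_one] at this
        nlinarith [norm_nonneg (r N - 1), norm_nonneg (v N)]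
    rw [tendsto_iff_norm_sub_tendsto_zero]
    refine squeeze_zero' (Eventually.of_forall fun _ => norm_nonneg _)
      (eventually_atTop.2 ⟨N₂, fun N hN => ?_⟩) h0
    have h1 := hfac (v N)
    have h2 := htri (v N)
    nlinarith [hall N hN, norm_nonneg (v N - 1)]
  · right
    push Not at hex
    rw [tendsto_iff_norm_sub_tendsto_zero]
    refine squeeze_zero' (Eventually.of_forall fun _ => norm_nonneg _)
      (eventually_atTop.2 ⟨N₁, fun N hN => ?_⟩) h0
    have h1 := hfac (v N)
    rw [sub_neg_eq_add]
    nlinarith [hex N hN, norm_nonneg (v N + 1)]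

/-- A sequence whose squares have a nonzero limit converges if its successive quotients tend
to `1`: the sign of the square root cannot change any more. -/
lemma exists_tendsto_of_sq {u r : ℕ → ℂ} {w : ℂ} (hw : w ≠ 0)
    (hu : Tendsto (fun N => u N ^ 2) atTop (𝓝 w)) (hr : Tendsto r atTop (𝓝 1))
    (hru : ∀ᶠ N in atTop, u (N + 1) = r N * u N) : ∃ l, Tendsto u atTop (𝓝 l) := by
  obtain ⟨s, hs⟩ := IsAlgClosed.exists_pow_nat_eq w two_pos
  have hs0 : s ≠ 0 := fun h => hw (by rw [← hs, h]; ring)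
  have hus : ∀ N, s * (u N / s) = u N := fun N => mul_div_cancel₀ _ hs0
  have h := tendsto_one_or_neg_one (v := fun N => u N / s)
    (by
      have := hu.div_const (s ^ 2)
      rw [← hs, div_self (pow_ne_zero 2 hs0)] at this
      simpa only [div_pow] using this) hr
    (hru.mono fun N hN => by simp only [hN, mul_div_assoc])
  rcases h with h | h
  · exact ⟨_, by simpa only [hus] using h.const_mul s⟩
  · exact ⟨_, by simpa only [hus] using h.const_mul s⟩

/-- Convergence of `y` passes to `x` if `y / x` tends to `1`; `x` may have zeros. -/
lemma tendsto_of_approx_mul {x y : ℕ → ℂ} {y₀ : ℂ} (hy : Tendsto y atTop (𝓝 y₀))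
    (h : ∀ ε : ℝ, 0 < ε → ε ≤ 1 / 2 → ∀ᶠ N in atTop, ∃ T : ℂ, ‖T - 1‖ ≤ ε ∧ y N = x N * T) :
    Tendsto x atTop (𝓝 y₀) := by
  have hxy : Tendsto (fun N => x N - y N) atTop (𝓝 0) := by
    rw [Metric.tendsto_atTop']
    intro δ hδ
    have hM : 0 < ‖y₀‖ + 1 := by positivity
    set ε := min (1 / 2) (δ / (4 * (‖y₀‖ + 1)))
    have hε : 0 < ε := by positivity
    have hε2 : ε ≤ δ / (4 * (‖y₀‖ + 1)) := min_le_right _ _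
    rw [le_div_iff₀ (by positivity)] at hε2
    have e1 := hy.norm.eventually_le_const (show ‖y₀‖ < ‖y₀‖ + 1 by linarith)
    obtain ⟨N₁, hN₁⟩ := eventually_atTop.1 (e1.and (h ε hε (min_le_left _ _)))
    refine ⟨N₁, fun N hN => ?_⟩
    obtain ⟨h1, T, hT, hyT⟩ := hN₁ N hN.le
    have hT2 : ‖T - 1‖ ≤ 1 / 2 := hT.trans (min_le_left _ _)
    have h2 : ‖x N - y N‖ = ‖x N‖ * ‖T - 1‖ := by
      rw [← norm_mul, ← norm_neg, hyT]; congr 1; ring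
    have h3 : ‖x N‖ ≤ ‖y N‖ + ‖x N - y N‖ := by
      have := norm_add_le (y N) (x N - y N)
      rwa [add_sub_cancel] at this
    have h4 : ‖x N‖ ≤ 2 * (‖y₀‖ + 1) := by nlinarith [norm_nonneg (x N)]
    rw [dist_zero_right, h2]
    nlinarith [norm_nonneg (x N), norm_nonneg (T - 1)]
  simpa using hxy.add hy

/-- Convergence and boundedness on a circle carry over to the disk, with holomorphic limit, by
Cauchy's formula and dominated convergence. -/
lemma exists_tendsto_ball {f : ℕ → ℂ → ℂ} (hf : ∀ N, Differentiable ℂ (f N)) {ρ B : ℝ}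
    (hρ : 0 < ρ) (hb : ∀ᶠ N in atTop, ∀ z ∈ Metric.sphere (0 : ℂ) ρ, ‖f N z‖ ≤ B)
    (hc : ∀ z ∈ Metric.sphere (0 : ℂ) ρ, ∃ l, Tendsto (fun N => f N z) atTop (𝓝 l)) :
    ∃ g : ℂ → ℂ, DifferentiableOn ℂ g (Metric.ball 0 ρ) ∧
      ∀ w ∈ Metric.ball (0 : ℂ) ρ, Tendsto (fun N => f N w) atTop (𝓝 (g w)) := by
  lift ρ to NNReal using hρ.le
  choose! h hh using hc
  have hcm : ∀ t, circleMap 0 ρ t ∈ Metric.sphere (0 : ℂ) ρ :=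
    fun t => circleMap_mem_sphere 0 ρ.coe_nonneg t
  have hint : CircleIntegrable h 0 ρ := by
    have hm : AEStronglyMeasurable (fun t => h (circleMap 0 ρ t))
        (volume.restrict (uIoc 0 (2 * Real.pi))) :=
      aestronglyMeasurable_of_tendsto_ae atTop
        (fun N => ((hf N).continuous.comp (continuous_circleMap 0 ρ)).aestronglyMeasurable)
        (Eventually.of_forall fun t => hh _ (hcm t))
    refine (intervalIntegrable_const (c := B)).mono_fun hm (Eventually.of_forall fun t => ?_)
    refine le_trans ?_ (le_abs_self B)
    exact le_of_tendsto (hh _ (hcm t)).norm (hb.mono fun N hN => hN _ (hcm t))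
  have hps := hasFPowerSeriesOn_cauchy_integral hint (NNReal.coe_pos.1 hρ)
  refine ⟨fun w => (2 * Real.pi * Complex.I)⁻¹ • ∮ z in C(0, ρ), (z - w)⁻¹ • h z, ?_,
    fun w hw => ?_⟩
  · have := hps.differentiableOn
    rwa [Metric.eball_coe] at this
  · have hcau : ∀ N, f N w = (2 * Real.pi * Complex.I)⁻¹ • ∮ z in C(0, ρ), (z - w)⁻¹ • f N z :=
      fun N => (Complex.two_pi_I_inv_smul_circleIntegral_sub_inv_smul_of_differentiable_on_off_countable
        countable_empty hw (hf N).continuous.continuousOn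
        fun z _ => (hf N).differentiableAt).symm
    simp only [hcau]
    refine Tendsto.const_smul ?_ _
    have hw' := mem_ball_zero_iff.1 hw
    have hne : ∀ t, ρ - ‖w‖ ≤ ‖circleMap 0 ρ t - w‖ := fun t => by
      have := norm_sub_norm_le (circleMap 0 ρ t) w
      rwa [mem_sphere_zero_iff_norm.1 (hcm t)] at this
    refine intervalIntegral.tendsto_integral_filter_of_dominated_convergence
      (fun _ => (ρ : ℝ) * ((ρ - ‖w‖)⁻¹ * B)) (Eventually.of_forall fun N => ?_)
      (hb.mono fun N hN => Eventually.of_forall fun t _ => ?_) intervalIntegrable_const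
      (Eventually.of_forall fun t _ => ?_)
    · refine Continuous.aestronglyMeasurable ?_
      simp only [deriv_circleMap]
      have h1 : Continuous fun t => circleMap 0 ρ t - w := by fun_prop
      have h2 : Continuous fun t => (circleMap 0 ρ t - w)⁻¹ := h1.inv₀ fun t h0 => by
        have := hne t
        rw [h0, norm_zero] at this
        linarith
      have h3 := (hf N).continuous
      fun_prop
    · rw [norm_smul, norm_smul, deriv_circleMap, norm_mul, Complex.norm_I, mul_one,
        mem_sphere_zero_iff_norm.1 (hcm t), norm_inv]
      have hB := (norm_nonneg _).trans (hN _ (hcm t))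
      have h1 : 0 < ρ - ‖w‖ := by linarith
      gcongr
      · exact hne t
      · exact hN _ (hcm t)
    · exact ((hh _ (hcm t)).const_smul _).const_smul _

/-! ### The product formula for the sine -/

lemma prod_Icc_succ {M : Type*} [CommMonoid M] (f : ℤ → M) (N : ℕ) :
    ∏ k ∈ Finset.Icc (-((N + 1 : ℕ) : ℤ)) ((N + 1 : ℕ) : ℤ), f k =
      f (N + 1) * f (-(N + 1)) * ∏ k ∈ Finset.Icc (-(N : ℤ)) N, f k := by
  have h : Finset.Icc (-((N + 1 : ℕ) : ℤ)) ((N + 1 : ℕ) : ℤ) =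
      insert (N + 1 : ℤ) (insert (-(N + 1) : ℤ) (Finset.Icc (-(N : ℤ)) N)) := by
    ext k
    simp only [Finset.mem_Icc, Finset.mem_insert]
    push_cast
    omega
  rw [h, Finset.prod_insert, Finset.prod_insert, mul_assoc]
  · simp
  · simp only [Finset.mem_insert, Finset.mem_Icc]
    omega

lemma piK_ne_zero (k : ℤ) : piK k ≠ 0 := by
  rw [piK]
  split_ifs with h
  · exact one_ne_zero
  · exact mul_ne_zero (by exact_mod_cast h) (by exact_mod_cast Real.pi_ne_zero)

lemma prod_sq_eq (z : ℂ) (N : ℕ) :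
    ∏ k ∈ Finset.Icc (-(N : ℤ)) N, ((z - k * (Real.pi : ℂ)) ^ 2 / piK k ^ 2) =
      ((Real.pi : ℂ) * (z / Real.pi) *
        ∏ j ∈ Finset.range N, (1 - (z / Real.pi) ^ 2 / ((j : ℂ) + 1) ^ 2)) ^ 2 := by
  have hπ : (Real.pi : ℂ) ≠ 0 := by exact_mod_cast Real.pi_ne_zero
  induction N with
  | zero => simp [piK, mul_div_cancel₀ _ hπ]
  | succ N ih =>
    have hN : ((N : ℂ) + 1) ≠ 0 := by exact_mod_cast N.succ_ne_zero
    have h1 : ((N : ℤ) + 1) ≠ 0 := by omega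
    have h2 : (-((N : ℤ) + 1)) ≠ 0 := by omega
    rw [prod_Icc_succ, ih, Finset.prod_range_succ, piK, piK, if_neg h1, if_neg h2]
    generalize ∏ j ∈ Finset.range N, (1 - (z / Real.pi) ^ 2 / ((j : ℂ) + 1) ^ 2) = X
    push_cast
    field_simp
    ring

lemma tendsto_prod_sq (z : ℂ) :
    Tendsto (fun N : ℕ => ∏ k ∈ Finset.Icc (-(N : ℤ)) N, ((z - k * (Real.pi : ℂ)) ^ 2 / piK k ^ 2))
      atTop (𝓝 (Complex.sin z ^ 2)) := by
  have hπ : (Real.pi : ℂ) ≠ 0 := by exact_mod_cast Real.pi_ne_zero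
  have h := (Complex.tendsto_euler_sin_prod (z / Real.pi)).pow 2
  rw [mul_div_cancel₀ _ hπ] at h
  simpa only [prod_sq_eq, mul_div_cancel₀ _ hπ] using h

/-- On a circle about `0` the partial products of `sin²` are largest at the imaginary axis. -/
lemma exists_norm_prod_sq_le (ρ : ℝ) : ∃ B, ∀ (N : ℕ) (z : ℂ), ‖z‖ = ρ →
    ‖∏ k ∈ Finset.Icc (-(N : ℤ)) N, ((z - k * (Real.pi : ℂ)) ^ 2 / piK k ^ 2)‖ ≤ B := by
  have hb := (tendsto_prod_sq ((ρ : ℂ) * Complex.I)).norm.bddAbove_range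
  obtain ⟨B, hB⟩ := hb
  refine ⟨B, fun N z hz => le_trans ?_ (hB ⟨N, rfl⟩)⟩
  simp only [prod_sq_eq, norm_pow, norm_mul, norm_div, Complex.norm_I, hz, Complex.norm_real,
    norm_prod, mul_one]
  have hρ : 0 ≤ ρ := hz ▸ norm_nonneg z
  rw [Real.norm_of_nonneg hρ]
  gcongr with j hj
  have h1 : (1 : ℂ) - ((ρ : ℂ) * Complex.I / Real.pi) ^ 2 / ((j : ℂ) + 1) ^ 2 =
      ((1 + (ρ / Real.pi) ^ 2 / ((j : ℝ) + 1) ^ 2 : ℝ) : ℂ) := by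
    push_cast
    rw [mul_div_right_comm, mul_pow, Complex.I_sq]
    ring
  rw [h1, Complex.norm_real, Real.norm_of_nonneg (by positivity)]
  refine (norm_sub_le _ _).trans (le_of_eq ?_)
  have h2 : ‖(j : ℂ) + 1‖ = (j : ℝ) + 1 := by
    rw [← Nat.cast_succ, Complex.norm_natCast, Nat.cast_succ]
  rw [norm_one, norm_div, norm_pow, norm_pow, norm_div, hz, Complex.norm_real,
    Real.norm_of_nonneg Real.pi_pos.le, h2]

end ZS

namespace ZS

/-! ### The product over the double eigenvalues -/

lemma eventually_ne_zero_of_differentiable {f : ℂ → ℂ} (hf : Differentiable ℂ f) {w : ℂ}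
    (hw : f w ≠ 0) (z : ℂ) : ∀ᶠ x in 𝓝[≠] z, f x ≠ 0 :=
  ((hf.analyticAt z).eventually_eq_zero_or_eventually_ne_zero).resolve_left fun h =>
    analyticOrderAt_ne_top_of_differentiable hf hw z (analyticOrderAt_eq_top.2 h)

namespace Listing

variable {φ : Potential} (E : Listing φ)

lemma finite_J (hfin : IsFiniteGap φ) : E.J.Finite := by
  refine (hfin.preimage' (f := E.lm) fun z hz => ?_).subset fun k hk => hk.1
  rw [mem_ofPred_eq] at hz
  have h : {k | E.lm k = z}.encard ≤ 1 := by rw [← hz, ← E.mult z]; exact le_self_add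
  exact Set.finite_of_encard_le_coe (k := 1) h

lemma one_le_algMult (k : ℤ) : 1 ≤ algMult φ (E.lm k) := by
  rw [← E.mult]
  exact le_add_right (Set.one_le_encard_iff_nonempty.2 ⟨k, rfl⟩)

lemma algMult_ne_zero_iff {z : ℂ} : algMult φ z ≠ 0 ↔ ∃ k, E.lm k = z ∨ E.lp k = z := by
  rw [← E.mult z, Ne, add_eq_zero, Set.encard_eq_zero, Set.encard_eq_zero]
  constructor
  · intro h
    by_contra! h'
    exact h ⟨eq_empty_of_forall_notMem fun k hk => (h' k).1 hk,
      eq_empty_of_forall_notMem fun k hk => (h' k).2 hk⟩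
  · rintro ⟨k, hk | hk⟩ h
    · exact (h.1 ▸ hk : k ∈ (∅ : Set ℤ))
    · exact (h.2 ▸ hk : k ∈ (∅ : Set ℤ))

lemma charFun_eq_zero_iff {z : ℂ} : charFun φ z = 0 ↔ ∃ k, E.lm k = z ∨ E.lp k = z := by
  rw [← E.algMult_ne_zero_iff, Ne, algMult_eq_zero_iff, not_not]

/-- An eigenvalue in an outer disk is listed at the index of this disk only. -/
lemma ne_of_outer {k j : ℤ} (hk : (E.N₀ : ℤ) < |k|) (hj : j ≠ k) {z : ℂ}
    (hz : ‖z - k * (Real.pi : ℂ)‖ < Real.pi / 4) : E.lm j ≠ z ∧ E.lp j ≠ z := by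
  have hπ := Real.pi_pos
  rcases le_or_gt |j| (E.N₀ : ℤ) with h | h
  · have h1 := E.norm_le le_rfl h
    have hk' : (E.N₀ : ℝ) + 1 ≤ |(k : ℝ)| := by exact_mod_cast hk
    have h3 := norm_sub_norm_le ((k : ℂ) * (Real.pi : ℂ)) z
    rw [norm_mul, Complex.norm_intCast, Complex.norm_real, Real.norm_of_nonneg hπ.le,
      norm_sub_rev] at h3
    refine ⟨fun h0 => ?_, fun h0 => ?_⟩
    · rw [h0] at h1
      nlinarith [h1.1]
    · rw [h0] at h1
      nlinarith [h1.2]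
  · have h1 := E.outer j h
    have h2 := pi_le_norm_sub hj
    have h3 := norm_sub_le_norm_sub_add_norm_sub ((j : ℂ) * (Real.pi : ℂ)) z (k * (Real.pi : ℂ))
    rw [norm_sub_rev _ z] at h3
    refine ⟨fun h0 => ?_, fun h0 => ?_⟩
    · rw [h0] at h1
      linarith [h1.1]
    · rw [h0] at h1
      linarith [h1.2]

/-- A double eigenvalue that is listed at a single index is listed there twice. -/
lemma eq_of_algMult_eq_two {k : ℤ} {z : ℂ} (hz : algMult φ z = 2)
    (h : ∀ j, j ≠ k → E.lm j ≠ z ∧ E.lp j ≠ z) : E.lm k = z ∧ E.lp k = z := by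
  have h1 : ∀ l : ℤ → ℂ, (∀ j, j ≠ k → l j ≠ z) → {j | l j = z}.encard ≤ 1 ∧
      (l k ≠ z → {j | l j = z}.encard = 0) := fun l hl => by
    have hsub : {j | l j = z} ⊆ {k} := fun j hj => by
      by_contra hjk
      exact hl j hjk hj
    refine ⟨(Set.encard_le_encard hsub).trans (Set.encard_singleton k).le, fun hk => ?_⟩
    rw [Set.encard_eq_zero]
    refine eq_empty_of_forall_notMem fun j hj => ?_
    rw [mem_singleton_iff.1 (hsub hj)] at hj
    exact hk hj
  have hm := h1 E.lm fun j hj => (h j hj).1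
  have hp := h1 E.lp fun j hj => (h j hj).2
  rw [← E.mult z] at hz
  constructor
  · by_contra hk
    rw [hm.2 hk, zero_add] at hz
    exact absurd (hz ▸ hp.1) (by decide)
  · by_contra hk
    rw [hp.2 hk, add_zero] at hz
    exact absurd (hz ▸ hm.1) (by decide)

/-- Outside `J` both entries coincide. For outer indices this follows from the count: if one entry
is double, then so is the other, as the disk contains no other entries. -/
lemma lp_eq_lm (hφ : MultAtMostTwo φ) {k : ℤ} (hk : k ∉ E.J) : E.lp k = E.lm k := by
  have hcase : ∀ z, 1 ≤ algMult φ z → algMult φ z = 1 ∨ algMult φ z = 2 := fun z h1 => by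
    have h2 := hφ z
    lift algMult φ z to ℕ using (h2.trans_lt (by decide)).ne with n
    norm_cast at h1 h2 ⊢
    omega
  have hp : 1 ≤ algMult φ (E.lp k) := by
    rw [← E.mult]
    exact le_add_left (Set.one_le_encard_iff_nonempty.2 ⟨k, rfl⟩)
  rcases le_or_gt |k| (E.N₀ : ℤ) with h | h
  · rcases hcase _ (E.one_le_algMult k) with h1 | h1
    · exact absurd ⟨h1, E.simple k h h1⟩ hk
    · exact E.double k h h1
  · rcases hcase _ (E.one_le_algMult k) with h1 | h1
    · rcases hcase _ hp with h2 | h2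
      · exact absurd ⟨h1, h2⟩ hk
      · exact (E.eq_of_algMult_eq_two h2 fun j hj => E.ne_of_outer h hj (E.outer k h).2).1.symm
    · exact (E.eq_of_algMult_eq_two h1 fun j hj => E.ne_of_outer h hj (E.outer k h).1).2

lemma tau_eq (hφ : MultAtMostTwo φ) {k : ℤ} (hk : k ∉ E.J) : E.tau k = E.lm k := by
  rw [tau, E.lp_eq_lm hφ hk]; ring

lemma tendsto_tau_sub_div (l : ℕ → ℤ) (hl : ∀ N, |l N| = N + 1) (z : ℂ) :
    Tendsto (fun N => (E.tau (l N) - z) / piK (l N)) atTop (𝓝 1) := by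
  have hπ := Real.pi_pos
  rw [tendsto_iff_norm_sub_tendsto_zero]
  have h0 : Tendsto (fun N : ℕ => (Real.pi / 4 + ‖z‖) / (((N : ℝ) + 1) * Real.pi)) atTop (𝓝 0) :=
    Tendsto.const_div_atTop ((tendsto_natCast_atTop_atTop.atTop_add
      (tendsto_const_nhds (x := (1 : ℝ)))).atTop_mul_const hπ) _
  refine squeeze_zero' (Eventually.of_forall fun _ => norm_nonneg _)
    (eventually_atTop.2 ⟨E.N₀, fun N hN => ?_⟩) h0
  have hk : (E.N₀ : ℤ) < |l N| := by rw [hl]; omega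
  have h1 := E.outer _ hk
  have hne : l N ≠ 0 := fun h => by
    have := hl N
    rw [h, abs_zero] at this
    omega
  have hn : ‖piK (l N)‖ = ((N : ℝ) + 1) * Real.pi := by
    rw [piK, if_neg hne, norm_mul, Complex.norm_intCast, Complex.norm_real,
      Real.norm_of_nonneg hπ.le]
    congr 1
    exact_mod_cast hl N
  have h2 : E.tau (l N) - z - piK (l N) = ((E.lm (l N) - l N * (Real.pi : ℂ)) +
      (E.lp (l N) - l N * (Real.pi : ℂ))) / 2 - z := by
    rw [piK, if_neg hne, tau]; ring
  rw [div_sub_one (piK_ne_zero _), norm_div, hn, h2]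
  gcongr
  refine (norm_sub_le _ _).trans ?_
  gcongr
  rw [norm_div, Complex.norm_two]
  linarith [norm_add_le (E.lm (l N) - l N * (Real.pi : ℂ)) (E.lp (l N) - l N * (Real.pi : ℂ))]

/-- The product over the double eigenvalues converges to an entire function, and it has the
expected relation to `Δ² - 4`. -/
lemma exists_product (hφ : MultAtMostTwo φ) (D : Finset ℤ) (hD : E.J ⊆ D) :
    ∃ H : ℂ → ℂ, Differentiable ℂ H ∧
      (∀ z, HasProd (fun j : ℤ => if j ∉ D then (E.tau j - z) / piK j else 1) (H z)
        (symmetricIcc ℤ)) ∧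
      ∀ z, charFun φ z = -4 * (∏ k ∈ D, (z - E.lm k) * (z - E.lp k) / piK k ^ 2) * H z ^ 2 := by
  have hπ := Real.pi_pos
  set f : ℂ → ℤ → ℂ := fun z j => if j ∉ D then (E.tau j - z) / piK j else 1 with hf
  set u : ℕ → ℂ → ℂ := fun N z => ∏ k ∈ Finset.Icc (-(N : ℤ)) N, f z k with hu
  set Q : ℂ → ℂ := fun z => ∏ k ∈ D, (z - E.lm k) * (z - E.lp k) / piK k ^ 2 with hQ
  set S : ℕ → ℂ → ℂ := fun N z =>
    ∏ k ∈ Finset.Icc (-(N : ℤ)) N, ((z - k * (Real.pi : ℂ)) ^ 2 / piK k ^ 2) with hS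
  have hfd : ∀ k, Differentiable ℂ fun z => f z k := fun k => by
    by_cases hk : k ∈ D
    · simp only [hf, hk, not_true_eq_false, if_false]
      exact differentiable_const _
    · simp only [hf, hk, not_false_eq_true, if_true]
      fun_prop
  have hud : ∀ N, Differentiable ℂ (u N) := fun N => Differentiable.fun_finsetProd fun k _ => hfd k
  have hQd : Differentiable ℂ Q := Differentiable.fun_finsetProd fun k _ => by fun_prop
  obtain ⟨N₁, hN₁⟩ : ∃ N₁ : ℕ, ∀ k ∈ D, |k| ≤ (N₁ : ℤ) := by
    refine ⟨D.sup fun k => k.natAbs, fun k hk => ?_⟩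
    have h : k.natAbs ≤ D.sup fun k => k.natAbs := Finset.le_sup (f := fun k : ℤ => k.natAbs) hk
    rw [Int.abs_eq_natAbs]
    exact_mod_cast h
  -- the partial products
  have hprod : ∀ N, N₁ ≤ N → ∀ z, ∏ k ∈ Finset.Icc (-(N : ℤ)) N,
      ((z - E.lm k) * (z - E.lp k) / piK k ^ 2) = Q z * u N z ^ 2 := fun N hN z => by
    have hsub : D ⊆ Finset.Icc (-(N : ℤ)) N := fun k hk => by
      have := hN₁ k hk
      rw [Finset.mem_Icc, ← abs_le]
      omega
    rw [hu, hQ]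
    simp only
    rw [← Finset.prod_pow, ← Finset.prod_sdiff hsub, mul_comm, ← Finset.prod_sdiff hsub]
    congr 1
    have h1 : ∏ k ∈ D, f z k ^ 2 = 1 := Finset.prod_eq_one fun k hk => by simp [hf, hk]
    rw [h1, mul_one]
    refine Finset.prod_congr rfl fun k hk => ?_
    have hkD := (Finset.mem_sdiff.1 hk).2
    have hkJ : k ∉ E.J := fun h => hkD (hD h)
    simp only [hf, hkD, not_false_eq_true, if_true]
    rw [E.tau_eq hφ hkJ, E.lp_eq_lm hφ hkJ, div_pow]
    ring
  -- comparison with `sin²`: `S` are the partial products of `sin²` over the zeros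
  have happrox : ∀ ε : ℝ, 0 < ε → ε ≤ 1 / 2 → ∃ N₂, ∀ N : ℕ, N₂ ≤ N → ∀ z : ℂ,
      ‖z‖ ≤ (N * Real.pi + Real.pi / 2) / 2 → ∃ T : ℂ, ‖T - 1‖ ≤ ε ∧
        charFun φ z * S N z = -4 * Complex.sin z ^ 2 * (Q z * u N z ^ 2) * T := fun ε hε hε' => by
    obtain ⟨N₂, -, hN₂⟩ := E.exists_ratio (ε := ε / 6) (by linarith) (by linarith)
    refine ⟨max N₁ N₂, fun N hN z hz => ?_⟩
    obtain ⟨T, hT, hT'⟩ := hN₂ N ((le_max_right _ _).trans hN)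
    refine ⟨T z, (hT z hz).trans (by linarith), ?_⟩
    have h1 := hT' z (hz.trans (by
      have : (0 : ℝ) ≤ N * Real.pi + Real.pi / 2 := by positivity
      linarith))
    rw [← hprod N ((le_max_left _ _).trans hN), hS]
    simp only [Finset.prod_div_distrib]
    rw [mul_div_assoc', h1]
    ring
  have hgrow : ∀ r : ℝ, ∀ᶠ N : ℕ in atTop, r ≤ (N * Real.pi + Real.pi / 2) / 2 := fun r => by
    obtain ⟨M, hM⟩ := exists_nat_gt (2 * r / Real.pi)
    rw [div_lt_iff₀ hπ] at hM
    refine eventually_atTop.2 ⟨M, fun N hN => ?_⟩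
    have : (M : ℝ) ≤ N := by exact_mod_cast hN
    nlinarith
  -- the squares of the partial products converge
  have hlim : ∀ z, Tendsto (fun N => -4 * Complex.sin z ^ 2 * (Q z * u N z ^ 2)) atTop
      (𝓝 (charFun φ z * Complex.sin z ^ 2)) := fun z => by
    refine tendsto_of_approx_mul ((tendsto_prod_sq z).const_mul _) fun ε hε hε' => ?_
    obtain ⟨N₂, hN₂⟩ := happrox ε hε hε'
    filter_upwards [eventually_ge_atTop N₂, hgrow ‖z‖] with N hN hz using hN₂ N hN z hz
  have hlim2 : ∀ z, Complex.sin z ≠ 0 → Q z ≠ 0 → Tendsto (fun N => u N z ^ 2) atTop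
      (𝓝 (charFun φ z / (-4 * Q z))) := fun z hs hq => by
    have h := (hlim z).div_const (-4 * Complex.sin z ^ 2 * Q z)
    convert h using 1
    · funext N; field_simp
    · congr 1; field_simp
  have hratio : ∀ z, ∀ᶠ N : ℕ in atTop, u (N + 1) z =
      ((E.tau (N + 1) - z) / piK (N + 1) * ((E.tau (-(N + 1)) - z) / piK (-(N + 1)))) * u N z :=
    fun z => eventually_atTop.2 ⟨N₁, fun N hN => by
      have h1 : ∀ k : ℤ, |k| = N + 1 → k ∉ D := fun k hk hkD => by
        have := hN₁ k hkD
        omega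
      rw [hu]
      simp only
      rw [prod_Icc_succ]
      congr 1
      simp only [hf]
      rw [if_pos (h1 _ (by rw [abs_of_nonneg (by positivity)])), if_pos (h1 _ (by
        rw [abs_neg, abs_of_nonneg (by positivity)]))]⟩
  have hr1 : ∀ z, Tendsto (fun N : ℕ => (E.tau (N + 1) - z) / piK (N + 1) *
      ((E.tau (-(N + 1)) - z) / piK (-(N + 1)))) atTop (𝓝 1) := fun z => by
    have := (E.tendsto_tau_sub_div (fun N => (N : ℤ) + 1)
      (fun N => abs_of_nonneg (by positivity)) z).mul
      (E.tendsto_tau_sub_div (fun N => -((N : ℤ) + 1))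
      (fun N => by rw [abs_neg, abs_of_nonneg (by positivity)]) z)
    rwa [one_mul] at this
  -- off the zeros the partial products converge, since their successive quotients tend to `1`
  have hconv : ∀ z, Complex.sin z ≠ 0 → Q z ≠ 0 → charFun φ z ≠ 0 →
      ∃ l, Tendsto (fun N => u N z) atTop (𝓝 l) := fun z hs hq hF =>
    exists_tendsto_of_sq (div_ne_zero hF (mul_ne_zero (by norm_num) hq)) (hlim2 z hs hq) (hr1 z)
      (hratio z)
  -- large circles on which nothing vanishes
  have hcirc : ∀ r : ℝ, ∃ ρ, r < ρ ∧ 0 < ρ ∧ ∀ z ∈ Metric.sphere (0 : ℂ) ρ,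
      Complex.sin z ≠ 0 ∧ Q z ≠ 0 ∧ charFun φ z ≠ 0 := fun r => by
    obtain ⟨M, hM⟩ := exists_nat_gt (r / Real.pi)
    rw [div_lt_iff₀ hπ] at hM
    set N := max M (max N₁ E.N₀)
    have hMN : (M : ℝ) ≤ N := by exact_mod_cast le_max_left _ _
    have hN1 : N₁ ≤ N := (le_max_left _ _).trans (le_max_right _ _)
    have hN0 : E.N₀ ≤ N := (le_max_right _ _).trans (le_max_right _ _)
    refine ⟨N * Real.pi + Real.pi / 2, by nlinarith, by positivity, fun z hz => ?_⟩
    rw [mem_sphere_zero_iff_norm] at hz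
    have hne : ∀ k, z ≠ E.lm k ∧ z ≠ E.lp k := fun k => by
      rcases le_or_gt |k| (N : ℤ) with h | h
      · have h1 := E.norm_le hN0 h
        constructor <;> rintro rfl
        · linarith [h1.1]
        · linarith [h1.2]
      · have h1 := E.lt_norm hN0 h
        constructor <;> rintro rfl
        · linarith [h1.1]
        · linarith [h1.2]
    refine ⟨fun h0 => ?_, ?_, fun h0 => ?_⟩
    · obtain ⟨k, hk⟩ := Complex.sin_eq_zero_iff.1 h0
      have := pi_div_four_le_norm_sub (by linarith) (by linarith) hz k
      rw [hk, sub_self, norm_zero] at this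
      linarith
    · exact Finset.prod_ne_zero_iff.2 fun k _ => div_ne_zero (mul_ne_zero
        (sub_ne_zero.2 (hne k).1) (sub_ne_zero.2 (hne k).2)) (pow_ne_zero 2 (piK_ne_zero k))
    · obtain ⟨k, hk | hk⟩ := E.charFun_eq_zero_iff.1 h0
      · exact (hne k).1 hk.symm
      · exact (hne k).2 hk.symm
  -- the partial products are bounded on these circles, so they converge in the disks
  have hball : ∀ r : ℝ, ∃ ρ, r < ρ ∧ ∃ g : ℂ → ℂ, DifferentiableOn ℂ g (Metric.ball 0 ρ) ∧
      ∀ w ∈ Metric.ball (0 : ℂ) ρ, Tendsto (fun N => u N w) atTop (𝓝 (g w)) := fun r => by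
    obtain ⟨ρ, hrρ, hρ, hne⟩ := hcirc r
    refine ⟨ρ, hrρ, ?_⟩
    have hcont : ContinuousOn (fun z => charFun φ z / (-4 * Complex.sin z ^ 2 * Q z))
        (Metric.sphere 0 ρ) := by
      have h1 := (differentiable_charFun φ).continuous
      have h2 := hQd.continuous
      have h3 := Complex.continuous_sin
      refine ContinuousOn.div (by fun_prop) (by fun_prop) fun z hz => ?_
      have := hne z hz
      exact mul_ne_zero (mul_ne_zero (by norm_num) (pow_ne_zero 2 this.1)) this.2.1
    obtain ⟨B₁, hB₁⟩ := (isCompact_sphere (0 : ℂ) ρ).exists_bound_of_continuousOn hcont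
    obtain ⟨B₂, hB₂⟩ := exists_norm_prod_sq_le ρ
    obtain ⟨N₂, hN₂⟩ := happrox (1 / 2) (by norm_num) le_rfl
    refine exists_tendsto_ball hud hρ (B := B₁ * B₂ * 2 + 1) ?_
      fun z hz => hconv z (hne z hz).1 (hne z hz).2.1 (hne z hz).2.2
    filter_upwards [eventually_ge_atTop N₂, hgrow ρ] with N hN hNρ z hz
    have hz' := mem_sphere_zero_iff_norm.1 hz
    obtain ⟨T, hT, hT'⟩ := hN₂ N hN z (by rw [hz']; exact hNρ)
    have hT1 : 1 / 2 ≤ ‖T‖ := by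
      have := norm_sub_norm_le (1 : ℂ) T
      rw [norm_one, norm_sub_rev] at this
      linarith
    have hT0 : T ≠ 0 := fun h => by rw [h, norm_zero] at hT1; linarith
    have hn := hne z hz
    have hs := hn.1
    have hq := hn.2.1
    have husq : u N z ^ 2 = charFun φ z / (-4 * Complex.sin z ^ 2 * Q z) * S N z * T⁻¹ := by
      rw [div_mul_eq_mul_div, hT']
      field_simp
    have h1 : ‖u N z‖ ^ 2 ≤ B₁ * B₂ * 2 := by
      rw [← norm_pow, husq, norm_mul, norm_mul, norm_inv]
      have hB1 := (norm_nonneg _).trans (hB₁ z hz)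
      have hB2 := (norm_nonneg _).trans (hB₂ N z hz')
      have hTi : ‖T‖⁻¹ ≤ 2 := by
        rw [show (2 : ℝ) = (1 / 2)⁻¹ by norm_num]
        exact inv_anti₀ (by norm_num) hT1
      gcongr
      · exact hB₁ z hz
      · exact hB₂ N z hz'
    nlinarith [sq_nonneg (‖u N z‖ - 1)]
  have hex : ∀ w, ∃ l, Tendsto (fun N => u N w) atTop (𝓝 l) := fun w => by
    obtain ⟨ρ, hρ, g, -, hg⟩ := hball ‖w‖
    exact ⟨g w, hg w (by rwa [mem_ball_zero_iff])⟩
  choose H hH using hex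
  have hHd : Differentiable ℂ H := fun w => by
    obtain ⟨ρ, hρ, g, hgd, hg⟩ := hball ‖w‖
    have hw : Metric.ball (0 : ℂ) ρ ∈ 𝓝 w :=
      Metric.isOpen_ball.mem_nhds (by rwa [mem_ball_zero_iff])
    refine (hgd.differentiableAt hw).congr_of_eventuallyEq ?_
    filter_upwards [hw] with x hx using tendsto_nhds_unique (hH x) (hg x hx)
  refine ⟨H, hHd, fun z => hasProd_symmetricIcc_iff.2 (hH z), fun z => ?_⟩
  -- the identity holds off the zeros of `sin` and `Q`, which are isolated
  obtain ⟨ρ, -, hρ, hne⟩ := hcirc 0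
  have hn := hne ρ (by rw [mem_sphere_zero_iff_norm, Complex.norm_real, Real.norm_of_nonneg hρ.le])
  have hev : ∀ᶠ x in 𝓝[≠] z, charFun φ x = -4 * Q x * H x ^ 2 := by
    filter_upwards [eventually_ne_zero_of_differentiable Complex.differentiable_sin hn.1 z,
      eventually_ne_zero_of_differentiable hQd hn.2.1 z] with x hs hq
    have := tendsto_nhds_unique (hlim2 x hs hq) ((hH x).pow 2)
    rw [← this]
    field_simp
  have hc1 := (differentiable_charFun φ).continuous
  have hc2 := hQd.continuous
  have hc3 := hHd.continuous
  have t1 : Tendsto (charFun φ) (𝓝[≠] z) (𝓝 (charFun φ z)) :=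
    (hc1.tendsto z).mono_left nhdsWithin_le_nhds
  have t2 : Tendsto (fun x => -4 * Q x * H x ^ 2) (𝓝[≠] z) (𝓝 (-4 * Q z * H z ^ 2)) :=
    (Continuous.tendsto (by fun_prop) z).mono_left nhdsWithin_le_nhds
  exact tendsto_nhds_unique (t1.congr' hev) t2

end Listing

end ZS

namespace ZS

/-! ### Standard and canonical roots -/

lemma tendsto_div_cobounded (a : ℂ) : Tendsto (fun z => a / z) (Bornology.cobounded ℂ) (𝓝 0) := by
  simpa [div_eq_mul_inv] using (tendsto_inv₀_cobounded (α := ℂ)).const_mul a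

/-- The principal branch in the normalization of the standard root tends to `1` at infinity. -/
lemma tendsto_cpow_half (a b : ℂ) :
    Tendsto (fun z => ((1 - a / z) * (1 - b / z)) ^ (1 / 2 : ℂ)) (Bornology.cobounded ℂ) (𝓝 1) := by
  have h : Tendsto (fun z => (1 - a / z) * (1 - b / z)) (Bornology.cobounded ℂ) (𝓝 1) := by
    simpa using ((tendsto_const_nhds (x := (1 : ℂ))).sub (tendsto_div_cobounded a)).mul
      ((tendsto_const_nhds (x := (1 : ℂ))).sub (tendsto_div_cobounded b))
  simpa using h.cpow (tendsto_const_nhds (x := (1 / 2 : ℂ))) Complex.one_mem_slitPlane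

/-- The standard root exists: it is `-(z - G 0) exp (ℓ / 2)` for a logarithm `ℓ` of
`(z - G 1) / (z - G 0)` that vanishes at infinity. -/
lemma exists_isStandardRoot {G : ℝ → ℂ} (hG : ContDiffOn ℝ 1 G (Icc 0 1)) :
    ∃ y, IsStandardRoot (G 0) (G 1) (G '' Icc 0 1) y := by
  have h0 : ∀ z ∉ G '' Icc 0 1, G 0 - z ≠ 0 := fun z hz h =>
    hz ⟨0, left_mem_Icc.2 zero_le_one, sub_eq_zero.1 h⟩
  set y : ℂ → ℂ := fun z => -((z - G 0) * Complex.exp (arcLog G z / 2)) with hy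
  have hsq : ∀ z ∉ G '' Icc 0 1, y z ^ 2 = (z - G 0) * (z - G 1) := fun z hz => by
    have h1 : Complex.exp (arcLog G z / 2) ^ 2 = (G 1 - z) / (G 0 - z) := by
      rw [← exp_arcLog hG hz, ← Complex.exp_nat_mul]
      congr 1
      push_cast
      ring
    have h2 := h0 z hz
    rw [hy]
    simp only
    rw [neg_sq, mul_pow, h1]
    field_simp
    ring
  refine ⟨y, fun z hz => ?_, hsq, ?_⟩
  · have h1 := (hasDerivAt_arcLog hG hz).differentiableAt
    have h2 : DifferentiableAt ℂ y z := by rw [hy]; fun_prop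
    exact h2.differentiableWithinAt
  · have hlog : Tendsto (arcLog G) (Bornology.cobounded ℂ) (𝓝 0) :=
      (isBigO_arcLog hG).trans_tendsto (tendsto_inv₀_cobounded (α := ℂ))
    have hexp : Tendsto (fun z => Complex.exp (arcLog G z / 2)) (Bornology.cobounded ℂ) (𝓝 1) := by
      have := (Complex.continuous_exp.tendsto _).comp (hlog.div_const 2)
      simpa [Function.comp_def] using this
    have h1 : Tendsto (fun z => (1 - G 0 / z) * Complex.exp (arcLog G z / 2) +
        ((1 - G 0 / z) * (1 - G 1 / z)) ^ (1 / 2 : ℂ)) (Bornology.cobounded ℂ) (𝓝 2) := by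
      have := (((tendsto_const_nhds (x := (1 : ℂ))).sub (tendsto_div_cobounded (G 0))).mul hexp).add
        (tendsto_cpow_half (G 0) (G 1))
      convert this using 2
      norm_num
    have hbd : Bornology.IsBounded (G '' Icc 0 1) :=
      (isCompact_Icc.image_of_continuousOn hG.continuousOn).isBounded
    filter_upwards [h1.eventually_ne two_ne_zero, Bornology.isBounded_def.1 hbd,
      Bornology.eventually_ne_cobounded (0 : ℂ)] with z hne hz hz0
    -- both functions are roots of `(1 - a / z) (1 - b / z)`, and they are not opposite
    have hs := hsq z hz
    have hX : (((1 - G 0 / z) * (1 - G 1 / z)) ^ (1 / 2 : ℂ)) ^ 2 =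
        (1 - G 0 / z) * (1 - G 1 / z) := by
      rw [one_div, ← Nat.cast_ofNat (R := ℂ) (n := 2), Complex.cpow_nat_inv_pow _ two_ne_zero]
    have hY : y z = -z * ((1 - G 0 / z) * Complex.exp (arcLog G z / 2)) := by
      rw [hy]; field_simp
    rw [hY] at hs ⊢
    generalize (1 - G 0 / z) * Complex.exp (arcLog G z / 2) = Y at *
    generalize ((1 - G 0 / z) * (1 - G 1 / z)) ^ (1 / 2 : ℂ) = X at *
    congr 1
    have h2 : z ^ 2 * (Y ^ 2 - X ^ 2) = 0 := by
      rw [hX]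
      have h3 : (z - G 0) * (z - G 1) = z ^ 2 * ((1 - G 0 / z) * (1 - G 1 / z)) := by field_simp
      linear_combination hs + h3
    rcases mul_eq_zero.1 h2 with h3 | h3
    · exact absurd h3 (pow_ne_zero 2 hz0)
    · rw [sq_sub_sq] at h3
      exact sub_eq_zero.1 ((mul_eq_zero.1 h3).resolve_left hne)

lemma IsStandardRoot.tendsto {a b : ℂ} {S : Set ℂ} {y : ℂ → ℂ} (h : IsStandardRoot a b S y) :
    Tendsto (fun z => y z / z) (Bornology.cobounded ℂ) (𝓝 (-1)) := by
  refine (tendsto_cpow_half a b).neg.congr' ?_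
  filter_upwards [h.2.2, Bornology.eventually_ne_cobounded (0 : ℂ)] with z hz hz0
  rw [hz]
  field_simp

/-- If the arc is a point, the standard root is linear. -/
lemma IsStandardRoot.eq_sub {a : ℂ} {y : ℂ → ℂ} (h : IsStandardRoot a a {a} y) {z : ℂ}
    (hz : z ≠ a) : y z = a - z := by
  have hpre : IsPreconnected ({a}ᶜ : Set ℂ) :=
    (isConnected_compl_singleton_of_one_lt_rank
      (by rw [Complex.rank_real_complex]; exact Cardinal.one_lt_two) a).isPreconnected
  have hc : ContinuousOn (fun z : ℂ => a - z) {a}ᶜ := by fun_prop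
  rcases hpre.eq_or_eq_neg_of_sq_eq h.1.continuousOn hc
    (fun x hx => by
      have := h.2.1 x hx
      simp only [Pi.pow_apply]
      rw [this]
      ring)
    (fun {x} hx h0 => hx (sub_eq_zero.1 h0).symm) with h1 | h1
  · exact h1 hz
  · have h2 : Tendsto (fun z => y z / z) (Bornology.cobounded ℂ) (𝓝 1) := by
      have h3 : Tendsto (fun z => 1 - a / z) (Bornology.cobounded ℂ) (𝓝 1) := by
        simpa using (tendsto_const_nhds (x := (1 : ℂ))).sub (tendsto_div_cobounded a)
      refine h3.congr' ?_
      filter_upwards [Bornology.eventually_ne_cobounded a,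
        Bornology.eventually_ne_cobounded (0 : ℂ)] with x hx hx0
      rw [h1 hx, Pi.neg_apply]
      field_simp
      ring
    have := tendsto_nhds_unique h.tendsto h2
    norm_num at this

namespace CurveSystem

variable {φ : Potential} {E : Listing φ} (C : CurveSystem E)

lemma isStandardRoot (k : ℤ) : IsStandardRoot (E.lm k) (E.lp k) (C.arc k)
    (standardRoot (E.lm k) (E.lp k) (C.arc k)) := by
  obtain ⟨y, hy⟩ := exists_isStandardRoot (C.arc_contDiff k)
  rw [C.arc_zero, C.arc_one] at hy
  exact Classical.epsilon_spec (p := IsStandardRoot (E.lm k) (E.lp k) (C.arc k)) ⟨y, hy⟩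

lemma lm_mem_arc (k : ℤ) : E.lm k ∈ C.arc k := ⟨0, left_mem_Icc.2 zero_le_one, C.arc_zero k⟩

lemma lp_mem_arc (k : ℤ) : E.lp k ∈ C.arc k := ⟨1, right_mem_Icc.2 zero_le_one, C.arc_one k⟩

lemma arc_eq_singleton {k : ℤ} (h : E.lm k = E.lp k) : C.arc k = {E.lm k} := by
  refine Subset.antisymm ?_ (singleton_subset_iff.2 (C.lm_mem_arc k))
  rintro z ⟨t, ht, rfl⟩
  exact C.arc_const k h t ht

lemma standardRoot_eq (hφ : MultAtMostTwo φ) {k : ℤ} (hk : k ∉ E.J) {z : ℂ} (hz : z ∉ C.arc k) :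
    standardRoot (E.lm k) (E.lp k) (C.arc k) z = E.tau k - z := by
  have h := C.isStandardRoot k
  rw [E.tau_eq hφ hk]
  rw [C.arc_eq_singleton (E.lp_eq_lm hφ hk).symm] at h hz ⊢
  rw [E.lp_eq_lm hφ hk] at h ⊢
  exact h.eq_sub hz

/-- Outside `D` the standard roots are `τ_k - z`, so the canonical product splits into a finite
product of standard roots and an entire function. -/
lemma hasProd_rootFactor (hφ : MultAtMostTwo φ) {D : Finset ℤ} (hD : E.J ⊆ D) {z p : ℂ}
    (hz : z ∉ ⋃ k, C.arc k)
    (hp : HasProd (fun j : ℤ => if j ∉ D then (E.tau j - z) / piK j else 1) p (symmetricIcc ℤ)) :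
    HasProd (C.rootFactor z) ((∏ k ∈ D, C.rootFactor z k) * p) (symmetricIcc ℤ) := by
  have h1 : HasProd (fun k => if k ∈ D then C.rootFactor z k else 1)
      (∏ k ∈ D, C.rootFactor z k) (symmetricIcc ℤ) := by
    have := hasProd_prod_of_ne_finset_one (L := symmetricIcc ℤ) (s := D)
      (f := fun k => if k ∈ D then C.rootFactor z k else 1) fun k hk => if_neg hk
    rwa [Finset.prod_congr rfl fun k hk => if_pos hk] at this
  convert! h1.mul hp using 1
  funext k
  by_cases hk : k ∈ D
  · simp only [hk, not_true_eq_false, if_true, if_false, mul_one]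
  · simp only [hk, not_false_eq_true, if_true, if_false, one_mul]
    rw [rootFactor, C.standardRoot_eq hφ (fun h => hk (hD h)) fun h => hz (mem_iUnion.2 ⟨k, h⟩)]

lemma charFun_ne_zero {z : ℂ} (hz : z ∉ ⋃ k, C.arc k) : charFun φ z ≠ 0 := fun h => by
  obtain ⟨k, hk | hk⟩ := E.charFun_eq_zero_iff.1 h
  · exact hz (mem_iUnion.2 ⟨k, hk ▸ C.lm_mem_arc k⟩)
  · exact hz (mem_iUnion.2 ⟨k, hk ▸ C.lp_mem_arc k⟩)

lemma arc_subset_inside (k : ℤ) : C.arc k ⊆ inside (C.Γ k) := by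
  rintro _ ⟨t, ht, rfl⟩
  exact C.arc_inside k t ht

lemma disjoint_range_inside (m k : ℤ) : Disjoint (range (C.Γ m)) (inside (C.Γ k)) := by
  rcases eq_or_ne m k with rfl | h
  · exact Set.disjoint_right.2 fun z hz => hz.1
  · exact (C.disjoint m k h).mono subset_union_right subset_union_left

lemma notMem_arc (m : ℤ) (t : ℝ) : C.Γ m t ∉ ⋃ k, C.arc k := by
  rw [mem_iUnion]
  rintro ⟨k, hk⟩
  exact (C.disjoint_range_inside m k).notMem_of_mem_left ⟨t, rfl⟩ (C.arc_subset_inside k hk)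

lemma canonicalRoot_eq (hφ : MultAtMostTwo φ) {D : Finset ℤ} (hD : E.J ⊆ D) {z p : ℂ}
    (hz : z ∉ ⋃ k, C.arc k)
    (hp : HasProd (fun j : ℤ => if j ∉ D then (E.tau j - z) / piK j else 1) p (symmetricIcc ℤ)) :
    C.canonicalRoot z = 2 * Complex.I * ((∏ k ∈ D, C.rootFactor z k) * p) := by
  rw [canonicalRoot, (C.hasProd_rootFactor hφ hD hz hp).tprod_eq]

lemma canonicalRoot_sq (hφ : MultAtMostTwo φ) (hfin : IsFiniteGap φ) {z : ℂ}
    (hz : z ∉ ⋃ k, C.arc k) : C.canonicalRoot z ^ 2 = charFun φ z := by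
  have hD : E.J ⊆ (E.finite_J hfin).toFinset := (E.finite_J hfin).coe_toFinset.ge
  obtain ⟨H, -, hH, hF⟩ := E.exists_product hφ _ hD
  rw [C.canonicalRoot_eq hφ hD hz (hH z), hF]
  have h1 : ∀ k, C.rootFactor z k ^ 2 = (z - E.lm k) * (z - E.lp k) / piK k ^ 2 := fun k => by
    rw [rootFactor, div_pow, (C.isStandardRoot k).2.1 z fun hk => hz (mem_iUnion.2 ⟨k, hk⟩)]
  simp only [← h1, Finset.prod_pow]
  rw [mul_pow, mul_pow, mul_pow, Complex.I_sq]
  ring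

lemma isCutSystem (D : Finset ℤ) : IsCutSystem (fun k : D => C.G k) (fun k : D => inside (C.Γ k))
    (fun k : D => standardRoot (E.lm k) (E.lp k) (C.arc k)) where
  contDiffOn k := C.arc_contDiff k
  isOpen k := isOpen_inside (C.closed_curve k).contDiff.continuous (C.closed_curve k).periodic
  isBounded k := isBounded_inside (C.closed_curve k).contDiff.continuous (C.closed_curve k).periodic
  isPreconnected k :=
    isPreconnected_compl_inside (C.closed_curve k).contDiff.continuous (C.closed_curve k).periodic
  arc_subset k := C.arc_subset_inside k
  disjoint j k hjk := (C.disjoint j k fun h => hjk (Subtype.ext h)).mono subset_union_left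
    subset_union_left
  differentiableOn k := (C.isStandardRoot k).1
  sq_eq k z hz := by
    rw [C.arc_zero, C.arc_one]
    exact (C.isStandardRoot k).2.1 z hz
  tendsto k := (C.isStandardRoot k).tendsto

/-- The curve `Γ m` has winding number one around the points inside, and zero around the points
inside the other curves. -/
lemma winding (m k : ℤ) : ∀ z ∈ inside (C.Γ k),
    (2 * Real.pi * Complex.I)⁻¹ * ∫ t in (0 : ℝ)..1, deriv (C.Γ m) t / (C.Γ m t - z) =
      if m = k then 1 else 0 := fun z hz => by
  split_ifs with h
  · subst h
    exact C.counterclockwise m z hz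
  · rw [integral_deriv_div_sub_eq_zero (C.closed_curve m).contDiff (C.closed_curve m).periodic,
      mul_zero]
    exact fun hz' => (C.disjoint m k h).notMem_of_mem_left hz' (Or.inl hz)

open Classical in
/-- The normalized differentials: the polynomial comes from the hyperelliptic curve over
`D = J ∪ {n}`, as the factors of the canonical root with indices outside `D` cancel. -/
lemma exists_normalized (hφ : MultAtMostTwo φ) (hfin : IsFiniteGap φ) (n : ℤ) :
    ∃ (ζ : ℂ → ℂ) (P : Polynomial ℂ), Differentiable ℂ ζ ∧
      (∀ m : ℤ, 1 / (2 * (Real.pi : ℂ)) * C.cycleIntegral m ζ = if m = n then 1 else 0) ∧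
      P.natDegree = (if n ∈ E.J then E.J.ncard - 1 else E.J.ncard) ∧
      P.leadingCoeff = (-1) ^ P.natDegree ∧
      ∀ z : ℂ, ∃ p : ℂ,
        HasProd (fun j : ℤ => if j ∉ E.J ∧ j ≠ n then (E.tau j - z) / piK j else 1) p
          (symmetricIcc ℤ) ∧
        ζ z = -(2 / piK n) * (∏ᶠ j ∈ E.J \ {n}, piK j)⁻¹ * P.eval z * p := by
  have hJ := E.finite_J hfin
  set D : Finset ℤ := insert n hJ.toFinset with hDdef
  have hmem : ∀ j, j ∈ D ↔ j = n ∨ j ∈ E.J := fun j => by rw [hDdef]; simp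
  have hnD : n ∈ D := (hmem n).2 (Or.inl rfl)
  have hD : E.J ⊆ D := fun j hj => (hmem j).2 (Or.inr hj)
  obtain ⟨H, hHd, hH, hF⟩ := E.exists_product hφ D hD
  obtain ⟨P, hdeg, hlead, hP⟩ := (C.isCutSystem D).exists_normalized_polynomial ⟨n, hnD⟩
  have hprod : ∏ k ∈ D, piK k = piK n * ∏ᶠ j ∈ E.J \ {n}, piK j := by
    have h1 : E.J \ {n} = ((D.erase n : Finset ℤ) : Set ℤ) := by
      ext j
      simp only [Finset.coe_erase, Set.mem_sdiff, mem_singleton_iff, Finset.mem_coe, hmem]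
      tauto
    rw [finprod_mem_congr h1 fun _ _ => rfl, finprod_mem_coe_finset,
      Finset.mul_prod_erase D piK hnD]
  have hprod0 : ∏ k ∈ D, piK k ≠ 0 := Finset.prod_ne_zero_iff.2 fun k _ => piK_ne_zero k
  -- the leading constant is chosen so that `ζ / (canonical root) = i P / ∏ y` on the cycles
  set c := -(2 / piK n) * (∏ᶠ j ∈ E.J \ {n}, piK j)⁻¹ with hc
  have hcD : c * ∏ k ∈ D, piK k = -2 := by
    rw [hprod] at hprod0 ⊢
    have h1 := left_ne_zero_of_mul hprod0
    have h2 := right_ne_zero_of_mul hprod0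
    rw [hc]
    field_simp
  refine ⟨fun z => c * P.eval z * H z, P, ?_, fun m => ?_, ?_, hlead, fun z => ⟨H z, ?_, rfl⟩⟩
  · exact (P.differentiable.const_mul c).mul hHd
  · have hint := hP (C.Γ m) (C.closed_curve m).contDiff (fun k => C.disjoint_range_inside m k)
      (fun k => if m = (k : ℤ) then 1 else 0) fun k => C.winding m k
    have hcyc : C.cycleIntegral m (fun z => c * P.eval z * H z) =
        ∫ t in (0 : ℝ)..1, Complex.I * (P.eval (C.Γ m t) / (∏ k : D,
          standardRoot (E.lm k) (E.lp k) (C.arc k) (C.Γ m t)) * deriv (C.Γ m) t) := by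
      refine intervalIntegral.integral_congr fun t _ => ?_
      have hz := C.notMem_arc m t
      have hne := C.charFun_ne_zero hz
      have hroot := C.canonicalRoot_eq hφ hD hz (hH _)
      have hsq := C.canonicalRoot_sq hφ hfin hz
      have hr0 : C.canonicalRoot (C.Γ m t) ≠ 0 := fun h0 => hne (by rw [← hsq, h0]; ring)
      rw [hroot] at hr0
      have hH0 : H (C.Γ m t) ≠ 0 := fun h0 => hr0 (by rw [h0]; ring)
      have hq : ∏ k ∈ D, C.rootFactor (C.Γ m t) k =
          (∏ k : D, standardRoot (E.lm k) (E.lp k) (C.arc k) (C.Γ m t)) / ∏ k ∈ D, piK k := by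
        simp only [rootFactor]
        rw [Finset.prod_div_distrib, Finset.prod_coe_sort D fun k =>
          standardRoot (E.lm k) (E.lp k) (C.arc k) (C.Γ m t)]
      simp only [cycle]
      rw [← mul_assoc]
      congr 1
      rw [hroot, hq]
      rw [hq] at hr0
      generalize (∏ k : D, standardRoot (E.lm k) (E.lp k) (C.arc k) (C.Γ m t)) = Y at *
      generalize ∏ k ∈ D, piK k = q at *
      have hY : Y ≠ 0 := fun h0 => hr0 (by rw [h0]; simp)
      field_simp
      rw [Complex.I_sq]
      linear_combination P.eval (C.Γ m t) * hcD
    rw [hcyc, intervalIntegral.integral_const_mul, hint]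
    have hπ : (Real.pi : ℂ) ≠ 0 := by exact_mod_cast Real.pi_ne_zero
    simp only
    split_ifs
    · field_simp
      rw [Complex.I_sq]
      norm_num
    · simp
  · rw [hdeg, Fintype.card_coe, Set.ncard_eq_toFinset_card _ hJ, hDdef]
    split_ifs with h
    · rw [Finset.insert_eq_of_mem (hJ.mem_toFinset.2 h)]
    · rw [Finset.card_insert_of_notMem fun h' => h (hJ.mem_toFinset.1 h'), Nat.add_sub_cancel]
  · convert! hH z using 2 with j
    simp only [hmem, not_or, and_comm]

end CurveSystem

end ZS

end

open Classical in
theorem theorem3p1 (φ : ZS.Potential) (hφ : ZS.MultAtMostTwo φ) (hfin : ZS.IsFiniteGap φ) :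
    -- the periodic eigenvalues can be listed as required
    Nonempty (ZS.Listing φ) ∧
    ∀ (E : ZS.Listing φ) (C : ZS.CurveSystem E),
      -- the canonical root is a convergent product, and the canonical sheet lies on the curve
      (∀ z : ℂ, z ∉ ⋃ k, C.arc k → Multipliable (C.rootFactor z) (symmetricIcc ℤ)) ∧
      C.canonicalSheet ⊆ ZS.spectralCurve φ ∧
      (∀ m : ℤ, range (C.cycle m) ⊆ C.canonicalSheet) ∧
      E.J.Finite ∧
      ∀ n : ℤ, ∃ (ζ : ℂ → ℂ) (P : Polynomial ℂ),
        Differentiable ℂ ζ ∧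
        (∀ m : ℤ, 1 / (2 * (Real.pi : ℂ)) * C.cycleIntegral m ζ = if m = n then 1 else 0) ∧
        P.natDegree = (if n ∈ E.J then E.J.ncard - 1 else E.J.ncard) ∧
        P.leadingCoeff = (-1) ^ P.natDegree ∧
        ∀ z : ℂ, ∃ p : ℂ,
          HasProd (fun j : ℤ => if j ∉ E.J ∧ j ≠ n then (E.tau j - z) / ZS.piK j else 1) p
            (symmetricIcc ℤ) ∧
          ζ z = -(2 / ZS.piK n) * (∏ᶠ j ∈ E.J \ {n}, ZS.piK j)⁻¹ * P.eval z * p := by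
  refine ⟨ZS.nonempty_listing φ hφ, fun E C => ⟨fun z hz => ?_, ?_, fun m => ?_,
    E.finite_J hfin, C.exists_normalized hφ hfin⟩⟩
  · have hD : E.J ⊆ (E.finite_J hfin).toFinset := (E.finite_J hfin).coe_toFinset.ge
    obtain ⟨H, -, hH, -⟩ := E.exists_product hφ _ hD
    exact (C.hasProd_rootFactor hφ hD hz (hH z)).multipliable
  · rintro ⟨z, w⟩ ⟨hz, hw⟩
    have := C.canonicalRoot_sq hφ hfin hz
    rwa [← hw] at this
  · rintro _ ⟨t, rfl⟩
    exact ⟨C.notMem_arc m t, rfl⟩
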